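/- Let $k\ge 5$ be a real number. All functions are on $\mathbb R^3$; $|\nabla|$ and $(1-\Delta)^{s/2}$ are the Fourier multipliers with symbols $|\xi|$ and $(1+|\xi|^2)^{s/2}$, $\|f\|_{H^s}=\|(1-\Delta)^{s/2}f\|_{L^2}$, $\|f\|_{W^{s,p}}=\|(1-\Delta)^{s/2}f\|_{L^p}$, and $$\|f\|_Y=\||\nabla|^{-1}f\|_{H^{2k+1}}+\|f\|_{W^{k+\frac{12}5,\frac{10}9}}.$$ For $T\in(0,\infty]$ and a function $\alpha=\alpha(t,x)$ on $[0,T)\times\mathbb R^3$ put $$\|\alpha\|_X=\sup_{0\le t<T}\Big(\big\||\nabla|^{-1}(1-\Delta)^{k+\frac12}\alpha(t)\big\|_{L^2}+(1+t)^{\frac{16}{15}}\big\|(1-\Delta)^{\frac k2}\alpha(t)\big\|_{L^{10}}\Big),$$ $$\|\alpha\|_{H^{-1}\cap H^{2k}}=\sup_{0\le t<T}\Big(\big\||\nabla|^{-1}\alpha(t)\big\|_{L^2}+\|\alpha(t)\|_{H^{2k}}\Big).$$ Consider regular solutions $(n,v)=(1+\rho,v)$, $\rho,v\in C([0,T);H^{2k})\cap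 C^1([0,T)\times\mathbb R^3)$, of the ion Euler–Poisson system (with normalized constants) $$\partial_t n+\nabla\cdot(nv)=0,\qquad n(\partial_t v+v\cdot\nabla v)=-\nabla n-n\nabla\phi,\qquad \Delta\phi=e^{\phi}-n,$$ where $\phi(t,\cdot)$ is of class $C^2$ and tends to $0$ at infinity for each $t$, and where $\operatorname{curl}v(0)=0$. Let $$\alpha_j=\rho+(-1)^j\frac{i}{q(|\nabla|)}\mathcal R^{-1}v,\quad j=1,2,\qquad q(r)=\sqrt{\frac{2+r^2}{1+r^2}},\qquad \mathcal R^{-1}v=-|\nabla|^{-1}\operatorname{div}v$$ (thus $\mathcal R^{-1}v=|\nabla|\psi$ if $v=\nabla\psi$). Proposition. There are constants $\varepsilon>0$ and $C>0$, depending only on $k$, such that for every $T\in(0,\infty]$, every such solution on $[0,T)$ and $\alpha=\alpha_1$ or $\alpha=\alpha_2$: if $\|\alpha\|_X\le\varepsilon$, then $$\|\alpha\|_{H^{-1}\cap H^{2k}}\le C\left(\|\alpha(0)\|_Y+\|\alpha\|_X^{\frac32}\right).$$ -/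

import Mathlib

open MeasureTheory Filter Topology FourierTransform
open scoped ENNReal SchwartzMap Laplacian Gradient

noncomputable section

namespace IonEP

/-- Physical space, and also frequency space. -/
abbrev R3 : Type := EuclideanSpace ℝ (Fin 3)

/-- Complex-valued square-integrable functions on `ℝ³`. -/
abbrev L2 : Type := Lp ℂ 2 (volume : Measure R3)

instance fact_one_le_ten : Fact ((1 : ℝ≥0∞) ≤ 10) := ⟨by norm_num⟩

instance fact_one_le_ten_ninths : Fact ((1 : ℝ≥0∞) ≤ 10 / 9) :=
  ⟨by rw [ENNReal.le_div_iff_mul_le] <;> norm_num⟩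

/-! ### Differential operators -/

/-- The partial derivative in the direction of the `i`-th coordinate. -/
def pd (i : Fin 3) (f : R3 → ℝ) (x : R3) : ℝ :=
  fderiv ℝ f x (EuclideanSpace.single i 1)

/-- The divergence of a vector field. -/
def div (w : R3 → R3) (x : R3) : ℝ := ∑ i, pd i (fun y => w y i) x

/-- The curl of a vector field. -/
def curl (w : R3 → R3) (x : R3) : R3 :=
  !₂[pd 1 (fun y => w y 2) x - pd 2 (fun y => w y 1) x,
     pd 2 (fun y => w y 0) x - pd 0 (fun y => w y 2) x,
     pd 0 (fun y => w y 1) x - pd 1 (fun y => w y 0) x]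

/-! ### Fourier multipliers

Mathlib's Fourier transform uses the character `exp (-2πi x·ξ)`, so that `∂ⱼ` has the symbol
`i (2π ξⱼ)`: the frequency variable of the operators `|∇|` and `1 - Δ` is `2π ξ`. -/

/-- The size of the frequency, that is, the symbol of `|∇|`. -/
def freq (ξ : R3) : ℝ := 2 * Real.pi * ‖ξ‖

/-- `⟨a⟩ = √(1 + a²)` at the frequency: the symbol of `(1 - Δ)^{1/2}`. -/
def jap (ξ : R3) : ℝ := Real.sqrt (1 + freq ξ ^ 2)

open Classical in
/-- The class of a square-integrable function in `L²` (and `0` for other functions). -/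
def toL2 (f : R3 → ℂ) : L2 := if h : MemLp f 2 volume then h.toLp f else 0

/-- The Fourier multiplier with symbol `m`, acting on `L²`. -/
def fourierMul (m : R3 → ℂ) (f : L2) : L2 :=
  𝓕⁻ (toL2 fun ξ => m ξ * (𝓕 f : L2) ξ)

/-- For bounded measurable symbols, `fourierMul` is multiplication on the Fourier side. -/
theorem fourier_fourierMul {m : R3 → ℂ} (hm : Measurable m) {C : ℝ} (hC : ∀ ξ, ‖m ξ‖ ≤ C)
    (f : L2) :
    (𝓕 (fourierMul m f) : L2) =ᵐ[volume] fun ξ => m ξ * (𝓕 f : L2) ξ := by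
  have h : MemLp (fun ξ => m ξ * (𝓕 f : L2) ξ) 2 (volume : Measure R3) := by
    refine MemLp.of_le_mul (c := C) (Lp.memLp (𝓕 f : L2))
      (hm.aestronglyMeasurable.mul (Lp.aestronglyMeasurable _)) (Eventually.of_forall fun ξ => ?_)
    rw [norm_mul]
    exact mul_le_mul_of_nonneg_right (hC ξ) (norm_nonneg _)
  rw [fourierMul, fourier_fourierInv_eq, toL2, dif_pos h]
  exact h.coeFn_toLp

/-- `q(r) = √((2 + r²) / (1 + r²))`, so that `p(r) = r q(r)` is the dispersion relation. -/
def q (r : ℝ) : ℝ := Real.sqrt ((2 + r ^ 2) / (1 + r ^ 2))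

/-- The `j`-th Riesz transform `∂ⱼ |∇|⁻¹`, with symbol `i ξⱼ / |ξ|`. -/
def riesz (j : Fin 3) (f : L2) : L2 :=
  fourierMul (fun ξ => Complex.I * ((ξ j / ‖ξ‖ : ℝ) : ℂ)) f

/-- `q(|∇|)⁻¹`. -/
def qInv (f : L2) : L2 := fourierMul (fun ξ => ((q (freq ξ))⁻¹ : ℝ)) f

/-- `𝓡⁻¹ w`, where `𝓡 = ∇ |∇|⁻¹`: if `w = ∇ψ` then `𝓡⁻¹ w = |∇|ψ = -|∇|⁻¹ div w`. -/
def rieszInv (w : R3 → R3) : L2 :=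
  -∑ j, riesz j (toL2 fun x => ((w x j : ℝ) : ℂ))

/-- The complex unknowns `αⱼ = ρ + (-1)ʲ i q(|∇|)⁻¹ 𝓡⁻¹ v`, `j = 1, 2`, at a fixed time. -/
def alpha (j : ℕ) (ρ : R3 → ℝ) (v : R3 → R3) : L2 :=
  toL2 (fun x => ((ρ x : ℝ) : ℂ)) + ((-1 : ℂ) ^ j * Complex.I) • qInv (rieszInv v)

/-- The symbols in the definition of `alpha` are bounded and measurable. -/
theorem riesz_symbol (j : Fin 3) :
    Measurable (fun ξ : R3 => Complex.I * ((ξ j / ‖ξ‖ : ℝ) : ℂ)) ∧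
      ∀ ξ : R3, ‖Complex.I * ((ξ j / ‖ξ‖ : ℝ) : ℂ)‖ ≤ 1 := by
  refine ⟨by fun_prop, fun ξ => ?_⟩
  rw [norm_mul, Complex.norm_I, one_mul, Complex.norm_real, norm_div, norm_norm]
  exact div_le_one_of_le₀ (PiLp.norm_apply_le ξ j) (norm_nonneg _)

theorem qInv_symbol :
    Measurable (fun ξ : R3 => (((q (freq ξ))⁻¹ : ℝ) : ℂ)) ∧
      ∀ ξ : R3, ‖(((q (freq ξ))⁻¹ : ℝ) : ℂ)‖ ≤ 1 := by
  refine ⟨by unfold q freq; fun_prop, fun ξ => ?_⟩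
  have h : 1 ≤ q (freq ξ) := by
    unfold q
    rw [Real.one_le_sqrt, le_div_iff₀ (by positivity)]
    linarith
  rw [Complex.norm_real, Real.norm_eq_abs, abs_of_nonneg (by positivity)]
  exact inv_le_one_of_one_le₀ h

/-! ### Function spaces -/

/-- `‖f‖_{H^s} = ‖(1 - Δ)^{s/2} f‖_{L²}`, possibly infinite. -/
def normH (s : ℝ) (f : L2) : ℝ≥0∞ :=
  eLpNorm (fun ξ => ((jap ξ ^ s : ℝ) : ℂ) * (𝓕 f : L2) ξ) 2 volume

/-- `‖|∇|⁻¹ f‖_{H^s}`, possibly infinite. -/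
def normHneg (s : ℝ) (f : L2) : ℝ≥0∞ :=
  eLpNorm (fun ξ => (((freq ξ)⁻¹ * jap ξ ^ s : ℝ) : ℂ) * (𝓕 f : L2) ξ) 2 volume

/-- The operator `(1 - Δ)^{s/2}` on tempered distributions. -/
def bessel (s : ℝ) : 𝓢'(R3, ℂ) →L[ℂ] 𝓢'(R3, ℂ) :=
  TemperedDistribution.fourierMultiplierCLM ℂ (fun ξ => ((jap ξ ^ s : ℝ) : ℂ))

/-- The symbol of `bessel s` is admissible for Mathlib's Fourier multipliers. -/
theorem bessel_symbol (s : ℝ) :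
    Function.HasTemperateGrowth (fun ξ : R3 => ((jap ξ ^ s : ℝ) : ℂ)) := by
  have h1 := Function.hasTemperateGrowth_one_add_norm_sq_rpow R3 (s / 2)
  have h2 : Function.HasTemperateGrowth (fun ξ : R3 => (2 * Real.pi) • ξ) :=
    ((2 * Real.pi) • ContinuousLinearMap.id ℝ R3).hasTemperateGrowth
  have h3 := Function.Complex.hasTemperateGrowth_ofReal.comp (h1.comp h2)
  have h4 : (fun ξ : R3 => ((jap ξ ^ s : ℝ) : ℂ)) =
      Complex.ofReal ∘ ((fun x : R3 => (1 + ‖x‖ ^ 2) ^ (s / 2)) ∘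
        fun ξ : R3 => (2 * Real.pi) • ξ) := by
    funext ξ
    have h5 : 1 + freq ξ ^ 2 = 1 + ‖(2 * Real.pi) • ξ‖ ^ 2 := by
      rw [norm_smul, Real.norm_eq_abs, abs_of_pos Real.two_pi_pos, freq]
    simp only [Function.comp, jap]
    rw [h5, Real.sqrt_eq_rpow, ← Real.rpow_mul (by positivity)]
    congr 2
    ring
  rw [h4]
  exact h3

/-- `‖f‖_{W^{s,p}} = ‖(1 - Δ)^{s/2} f‖_{L^p}`: the `L^p` norm of the function that represents the
tempered distribution `(1 - Δ)^{s/2} f`, and `∞` if there is no such function in `L^p`. -/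
def normW (s : ℝ) (p : ℝ≥0∞) [Fact (1 ≤ p)] (f : L2) : ℝ≥0∞ :=
  ⨅ (g : Lp ℂ p (volume : Measure R3))
    (_ : Lp.toTemperedDistribution g = bessel s (Lp.toTemperedDistribution f)), ‖g‖ₑ

/-- `‖u‖_Y = ‖|∇|⁻¹ u‖_{H^{2k+1}} + ‖u‖_{W^{k+12/5,10/9}}`. -/
def normY (k : ℝ) (u : L2) : ℝ≥0∞ :=
  normHneg (2 * k + 1) u + normW (k + 12 / 5) (10 / 9) u

/-- `‖u‖_X = sup_t (‖|∇|⁻¹ (1-Δ)^{k+1/2} u(t)‖_{L²} + (1+t)^{16/15} ‖(1-Δ)^{k/2} u(t)‖_{L¹⁰})`,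
for a function `u` on the time interval `J`. -/
def normX (k : ℝ) (J : Set ℝ) (u : ℝ → L2) : ℝ≥0∞ :=
  ⨆ t ∈ J, (normHneg (2 * k + 1) (u t) +
    ENNReal.ofReal ((1 + t) ^ (16 / 15 : ℝ)) * normW k 10 (u t))

/-- `sup_t ‖u(t)‖_{H^{-1} ∩ H^{2k}}` on the time interval `J`, where `H^{-1}` is homogeneous. -/
def normHinter (k : ℝ) (J : Set ℝ) (u : ℝ → L2) : ℝ≥0∞ :=
  ⨆ t ∈ J, (normHneg 0 (u t) + normH (2 * k) (u t))

/-- `f ∈ C(J; H^s)` for a real-valued function `f(t, x)`. -/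
def ContinuousInH (s : ℝ) (J : Set ℝ) (f : ℝ → R3 → ℝ) : Prop :=
  (∀ t ∈ J, MemLp (f t) 2 volume ∧ normH s (toL2 fun x => (f t x : ℂ)) < ∞) ∧
    ∀ t ∈ J, Tendsto (fun t' => normH s (toL2 fun x => ((f t' x - f t x : ℝ) : ℂ)))
      (𝓝[J] t) (𝓝 0)

/-! ### The ion Euler–Poisson system -/

/-- The time interval `[0, T)`, with `T = ∞` allowed. -/
def timeInterval (T : EReal) : Set ℝ := {t | 0 ≤ t ∧ (t : EReal) < T}

/-- `(n, v) = (1 + ρ, v)`, with the electric potential `φ`, is a regular solution on `J × ℝ³` of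
the ion Euler–Poisson system
`∂ₜ n + div (n v) = 0`, `n (∂ₜ v + v·∇v) = -∇n - n ∇φ`, `Δφ = exp φ - n`
that is irrotational at time `0`. The regularity index is `k`: `ρ, v ∈ C(J; H^{2k})`. -/
structure IsSolution (k : ℝ) (J : Set ℝ) (ρ : ℝ → R3 → ℝ) (v : ℝ → R3 → R3)
    (φ : ℝ → R3 → ℝ) : Prop where
  contDiff_density : ContDiffOn ℝ 1 (Function.uncurry ρ) (J ×ˢ Set.univ)
  contDiff_velocity : ContDiffOn ℝ 1 (Function.uncurry v) (J ×ˢ Set.univ)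
  contDiff_potential : ∀ t ∈ J, ContDiff ℝ 2 (φ t)
  regular_density : ContinuousInH (2 * k) J ρ
  regular_velocity : ∀ i : Fin 3, ContinuousInH (2 * k) J (fun t x => v t x i)
  potential_at_infinity : ∀ t ∈ J, Tendsto (φ t) (cocompact R3) (𝓝 0)
  mass : ∀ t ∈ J, ∀ x,
    derivWithin (fun s => ρ s x) J t + div (fun y => (1 + ρ t y) • v t y) x = 0
  momentum : ∀ t ∈ J, ∀ x,
    (1 + ρ t x) • (derivWithin (fun s => v s x) J t + fderiv ℝ (v t) x (v t x)) =
      -∇ (fun y => 1 + ρ t y) x - (1 + ρ t x) • ∇ (φ t) x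
  poisson : ∀ t ∈ J, ∀ x, Δ (φ t) x = Real.exp (φ t x) - (1 + ρ t x)
  irrotational : ∀ x, curl (v 0) x = 0

end IonEP

end

/-!
The estimate is an energy estimate for the symmetrized system in the unknowns `σ = log (1 + ρ)` and `v`,
`∂ₜσ + v·∇σ + div v = 0`, `∂ₜv + v·∇v + ∇σ + ∇φ = 0`. Its nonlinear terms cost one factor in `W^{1,∞}`, and
the `L¹⁰` part of the `X` norm makes that factor decay like `(1 + t)^{-16/15}`, which is integrable in time.
So each energy grows by at most a constant times `‖α‖_X³`, while it is at most a constant times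
`‖|∇|⁻¹α(0)‖²_{H^{2k+1}}` at time `0`. Square roots give the claim.

*Decay.* `ρ`, `v` and their gradients arise from the real and imaginary parts of `(1 - Δ)^{k/2} α` by
multipliers whose symbols decay like `⟨ξ⟩⁻⁴`. Such symbols have kernels in `L^{10/9}`
(`IsSymbol.kernel_lt_top`), so Hölder's inequality gives the pointwise bounds (`abs_density_le`,
`abs_pd_velocity_le`, …).

*Order `2k`.* As `2k` need not be an integer, the homogeneous norm of order `s = 2k` is replaced by the
equivalent weighted sum of `‖δ_h^M f‖²` over the dyadic steps `h = 2⁻ᵐ eᵢ` (`wsum_diff_le`, `hs_sq_le_wsum`).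
The Leibniz rule for differences yields the product and commutator estimates `hs_mul_le` and
`wsum_comm_le`. For each step, the derivatives in the rate of change of
`‖δσ‖² + ‖δv‖² + ‖(1 - Δ)^{-1/2} δρ‖²` cancel: transport and pressure by integration by parts, the
linear part `(1 - Δ)^{-1} ρ` of `φ` against the last term (`abs_energy_rate_le`). Summation over finite sets
of steps gives `Slice.abs_sum_stepRate_le`; no a priori differentiability of the full norm is needed.

*Order `-1`.* Here the energy is `‖q(|∇|)|∇|⁻¹ρ‖² + ‖|∇|⁻¹v‖²`, cut off at low frequencies. All terms have
to be in divergence form, and `v·∇v = ∇|v|²/2` because `v` stays irrotational (`Flow.leray_eq_zero`: the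
divergence-free part of `v` satisfies a Grönwall inequality). The result is `LowSlice.abs_lowRate_le`.

*Poisson equation.* The maximum principle (`abs_potential_le`), the integrability of `φ²`
(`integrable_of_subsolution`) and elliptic regularity (`IsPotential.hs_rem_le`) show that `φ` is small, lies
in `L²`, and that `e^φ - 1 - φ` is quadratic in `ρ`. Differentiability in time of the energies follows from
the pointwise equations (`hasDerivWithinAt_cl`, `IsSolution.flow`).
-/

noncomputable section

namespace IonEP

open MeasureTheory Filter Topology FourierTransform
open scoped ENNReal SchwartzMap Laplacian Gradient ComplexConjugate Real
open ENNReal (ofReal ofReal_mul ofReal_add ofReal_toReal ofReal_lt_top ofReal_le_ofReal ofReal_le_ofReal_iff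
  ofReal_pow ofReal_ne_top toReal_nonneg)
open Real (norm_eq_abs rpow_nonneg rpow_mul rpow_natCast norm_of_nonneg rpow_add)
open Complex (norm_real I conj_ofReal)
open Finset (sum_le_sum mul_sum sum_congr mem_univ
  sum_add_distrib sum_nonneg single_le_sum sum_mul sum_neg_distrib abs_sum_le_sum_abs)

/-! ### The Fourier transform on `L²` -/

theorem coeFn_toL2 {f : R3 → ℂ} (h : MemLp f 2 volume) : (toL2 f : R3 → ℂ) =ᵐ[volume] f := by
  rw [toL2, dif_pos h]; exact h.coeFn_toLp

theorem toL2_congr {f g : R3 → ℂ} (h : f =ᵐ[volume] g) : toL2 f = toL2 g := by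
  by_cases hf : MemLp f 2 volume
  · have hg : MemLp g 2 volume := (memLp_congr_ae h).1 hf
    rw [toL2, toL2, dif_pos hf, dif_pos hg]
    exact MemLp.toLp_eq_toLp_iff hf hg |>.2 h
  · have hg : ¬ MemLp g 2 volume := fun hg => hf ((memLp_congr_ae h).2 hg)
    rw [toL2, toL2, dif_neg hf, dif_neg hg]

theorem toL2_coeFn (f : L2) : toL2 (f : R3 → ℂ) = f := by
  rw [toL2, dif_pos (Lp.memLp f)]; exact Lp.toLp_coeFn f _

theorem integral_fourier_schwartz_mul (ψ : 𝓢(R3, ℂ)) (u : L2) :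
    ∫ x, (𝓕 ψ : 𝓢(R3, ℂ)) x * u x = ∫ x, ψ x * (𝓕 u : L2) x := by
  have h := congrArg (fun T : 𝓢'(R3, ℂ) => T ψ) (Lp.fourier_toTemperedDistribution_eq u)
  simpa [TemperedDistribution.fourier_apply] using h

theorem L2_ext_schwartz {u : L2} {g : R3 → ℂ} (hg : LocallyIntegrable g volume)
    (h : ∀ ψ : 𝓢(R3, ℂ), ∫ x, ψ x * u x = ∫ x, ψ x * g x) : u =ᵐ[volume] g := by
  refine ae_eq_of_integral_contDiff_smul_eq ((Lp.memLp u).locallyIntegrable (by norm_num)) hg ?_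
  intro φ hφ hc
  have hg₁ : HasCompactSupport (Complex.ofRealCLM ∘ φ) := hc.comp_left rfl
  have hg₂ : ContDiff ℝ ((⊤ : ℕ∞) : WithTop ℕ∞) (Complex.ofRealCLM ∘ φ) :=
    Complex.ofRealCLM.contDiff.comp hφ
  have := h (hg₁.toSchwartzMap hg₂)
  simpa using this

theorem memLp_star (u : L2) : MemLp (fun x => conj (u x)) 2 (volume : Measure R3) :=
  (Lp.memLp u).star

theorem integral_mul_eq_inner (u f : L2) :
    ∫ x, f x * u x = inner ℂ (toL2 fun x => conj (u x)) f := by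
  rw [L2.inner_def]
  apply integral_congr_ae
  filter_upwards [coeFn_toL2 (memLp_star u)] with x hx
  rw [hx]; simp

/-- The multiplication formula, by density of the Schwartz functions. -/
theorem integral_fourier_mul (f u : L2) :
    ∫ x, (𝓕 f : L2) x * u x = ∫ x, f x * (𝓕 u : L2) x := by
  refine DenseRange.induction_on (p := fun f : L2 => ∫ x, (𝓕 f : L2) x * u x = ∫ x, f x * (𝓕 u : L2) x)
    (SchwartzMap.denseRange_toLpCLM (p := 2) ENNReal.ofNat_ne_top) f ?_ ?_
  · simp_rw [integral_mul_eq_inner]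
    apply isClosed_eq
    · exact (innerSL ℂ _).continuous.comp (fourierCLM ℂ L2).continuous
    · exact (innerSL ℂ _).continuous
  · intro ψ
    have e1 : (𝓕 (ψ.toLp 2 volume) : L2) =ᵐ[volume] (𝓕 ψ : 𝓢(R3, ℂ)) := by
      rw [SchwartzMap.toLp_fourier_eq]; exact SchwartzMap.coeFn_toLp _ _ _
    have e2 : (ψ.toLp 2 volume : L2) =ᵐ[volume] ψ := SchwartzMap.coeFn_toLp _ _ _
    have := integral_fourier_schwartz_mul ψ u
    rw [SchwartzMap.toLpCLM_apply]
    calc _ = ∫ x, (𝓕 ψ : 𝓢(R3, ℂ)) x * u x := by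
          apply integral_congr_ae; filter_upwards [e1] with x hx; rw [hx]
      _ = _ := this
      _ = _ := by apply integral_congr_ae; filter_upwards [e2] with x hx; rw [hx]

/-- On `L¹ ∩ L²` the Fourier transform of `L²` is the Fourier integral. -/
theorem fourier_toL2 {m : R3 → ℂ} (h1 : Integrable m) (h2 : MemLp m 2 volume) :
    (𝓕 (toL2 m) : L2) =ᵐ[volume] 𝓕 m := by
  refine L2_ext_schwartz ?_ ?_
  · exact (VectorFourier.fourierIntegral_continuous Real.continuous_fourierChar
      (by exact (innerSL ℝ).continuous₂) h1).locallyIntegrable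
  intro ψ
  rw [← integral_fourier_schwartz_mul]
  have := VectorFourier.integral_fourierIntegral_smul_eq_flip (L := innerₗ R3) (μ := volume)
    (ν := volume) Real.continuous_fourierChar (by exact (innerSL ℝ).continuous₂)
    (ψ.integrable (μ := volume)) h1
  have e : ∫ x, (𝓕 ψ : 𝓢(R3, ℂ)) x * toL2 m x = ∫ x, (𝓕 ψ : 𝓢(R3, ℂ)) x * m x := by
    apply integral_congr_ae; filter_upwards [coeFn_toL2 h2] with x hx; rw [hx]
  rw [e]
  rw [flip_innerₗ] at this
  exact this

theorem fourierInv_toL2 {m : R3 → ℂ} (h1 : Integrable m) (h2 : MemLp m 2 volume) :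
    (𝓕⁻ (toL2 m) : L2) =ᵐ[volume] 𝓕⁻ m := by
  have hc : Continuous (𝓕⁻ m) := by
    have : (𝓕⁻ m) = fun x => 𝓕 m (-x) := by ext x; rw [Real.fourierInv_eq_fourier_neg]
    rw [this]
    exact (VectorFourier.fourierIntegral_continuous Real.continuous_fourierChar
      (by exact (innerSL ℝ).continuous₂) h1).comp continuous_neg
  refine L2_ext_schwartz hc.locallyIntegrable ?_
  intro ψ
  have h0 := integral_fourier_schwartz_mul (𝓕⁻ ψ) (𝓕⁻ (toL2 m))
  rw [FourierTransform.fourier_fourierInv_eq, FourierTransform.fourier_fourierInv_eq] at h0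
  rw [h0]
  have := VectorFourier.integral_fourierIntegral_smul_eq_flip (L := -innerₗ R3) (μ := volume)
    (ν := volume) Real.continuous_fourierChar (by exact ((innerSL ℝ).continuous₂).neg)
    (ψ.integrable (μ := volume)) h1
  have e : ∫ x, (𝓕⁻ ψ : 𝓢(R3, ℂ)) x * toL2 m x = ∫ x, (𝓕⁻ ψ : 𝓢(R3, ℂ)) x * m x := by
    apply integral_congr_ae; filter_upwards [coeFn_toL2 h2] with x hx; rw [hx]
  rw [e]
  have e2 : (-innerₗ R3 : R3 →ₗ[ℝ] R3 →ₗ[ℝ] ℝ).flip = -innerₗ R3 := by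
    ext x y; simp [real_inner_comm]
  rw [e2] at this
  simp_rw [SchwartzMap.fourierInv_coe]
  exact this

/-- The character `ξ ↦ exp (2πi h·ξ)`. -/
def chr (h ξ : R3) : ℂ := Complex.exp ((2 * π * inner ℝ h ξ : ℝ) * I)

theorem norm_chr (h ξ : R3) : ‖chr h ξ‖ = 1 := Complex.norm_exp_ofReal_mul_I _

theorem continuous_chr (h : R3) : Continuous (chr h) := by unfold chr; fun_prop

theorem memLp_chr_mul (h : R3) {f : R3 → ℂ} {p : ℝ≥0∞} (hf : MemLp f p volume) :
    MemLp (fun ξ => chr h ξ * f ξ) p volume := by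
  refine hf.of_le ((continuous_chr h).aestronglyMeasurable.mul hf.1) (.of_forall fun ξ => ?_)
  rw [norm_mul, norm_chr, one_mul]

theorem fourier_chr_mul (h : R3) (f : R3 → ℂ) (x : R3) :
    𝓕 (fun ξ => chr h ξ * f ξ) x = 𝓕 f (x - h) := by
  rw [Real.fourier_eq', Real.fourier_eq']
  congr 1; ext ξ
  simp only [smul_eq_mul, chr]
  rw [← mul_assoc, ← Complex.exp_add, inner_sub_right, real_inner_comm ξ h]
  congr 2; push_cast; ring

theorem fourier_translate (h : R3) {u w : L2} (hw : w =ᵐ[volume] fun x => u (x + h)) :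
    (𝓕 w : L2) =ᵐ[volume] fun ξ => chr h ξ * (𝓕 u : L2) ξ := by
  refine L2_ext_schwartz ((memLp_chr_mul h (Lp.memLp _)).locallyIntegrable (by norm_num)) ?_
  intro ψ
  rw [← integral_fourier_schwartz_mul]
  have h1 : Integrable (fun ξ => chr h ξ * ψ ξ) :=
    memLp_one_iff_integrable.1 (memLp_chr_mul h (ψ.memLp 1 volume))
  have h2 := memLp_chr_mul h (ψ.memLp 2 volume)
  have h3 := integral_fourier_mul (toL2 fun ξ => chr h ξ * ψ ξ) u
  calc _ = ∫ x, (𝓕 ψ : 𝓢(R3, ℂ)) x * u (x + h) := by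
        apply integral_congr_ae; filter_upwards [hw] with x hx; rw [hx]
    _ = ∫ x, (𝓕 ψ : 𝓢(R3, ℂ)) (x - h) * u x := by
        rw [← integral_sub_right_eq_self _ h]; simp
    _ = ∫ x, (𝓕 (toL2 fun ξ => chr h ξ * ψ ξ) : L2) x * u x := by
        apply integral_congr_ae; filter_upwards [fourier_toL2 h1 h2] with x hx
        rw [hx, fourier_chr_mul, SchwartzMap.fourier_coe]
    _ = _ := h3
    _ = _ := by
        apply integral_congr_ae; filter_upwards [coeFn_toL2 h2] with x hx; rw [hx]; ring

/-- The class in `L²` of a real-valued function. -/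
def cl (f : R3 → ℝ) : L2 := toL2 fun x => ((f x : ℝ) : ℂ)

theorem memLp_ofReal {f : R3 → ℝ} {p : ℝ≥0∞} (hf : MemLp f p volume) :
    MemLp (fun x => ((f x : ℝ) : ℂ)) p volume := hf.ofReal

theorem coeFn_cl {f : R3 → ℝ} (hf : MemLp f 2 volume) :
    (cl f : R3 → ℂ) =ᵐ[volume] fun x => ((f x : ℝ) : ℂ) := coeFn_toL2 (memLp_ofReal hf)

theorem cl_congr {f g : R3 → ℝ} (h : f =ᵐ[volume] g) : cl f = cl g :=
  toL2_congr (by filter_upwards [h] with x hx; rw [hx])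

theorem cl_add {f g : R3 → ℝ} (hf : MemLp f 2 volume) (hg : MemLp g 2 volume) :
    cl (fun x => f x + g x) = cl f + cl g := by
  apply Lp.ext
  filter_upwards [coeFn_cl (hf.add hg), coeFn_cl hf, coeFn_cl hg, Lp.coeFn_add (cl f) (cl g)]
    with x h1 h2 h3 h4
  have h1' : (cl (fun x => f x + g x) : R3 → ℂ) x = _ := h1
  rw [h1', h4]; simp [h2, h3]

theorem cl_smul (c : ℝ) {f : R3 → ℝ} (hf : MemLp f 2 volume) :
    cl (fun x => c * f x) = (c : ℂ) • cl f := by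
  apply Lp.ext
  filter_upwards [coeFn_cl (hf.const_mul c), coeFn_cl hf, Lp.coeFn_smul (c : ℂ) (cl f)]
    with x h1 h2 h3
  have h1' : (cl (fun x => c * f x) : R3 → ℂ) x = _ := h1
  rw [h1', h3, Pi.smul_apply, h2, smul_eq_mul]; push_cast; simp

theorem cl_neg {f : R3 → ℝ} (hf : MemLp f 2 volume) : cl (fun x => -f x) = -cl f := by
  have := cl_smul (-1) hf
  simpa using this

theorem cl_sub {f g : R3 → ℝ} (hf : MemLp f 2 volume) (hg : MemLp g 2 volume) :
    cl (fun x => f x - g x) = cl f - cl g := by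
  have := cl_add hf hg.neg
  rw [show (-g) = fun x => -g x from rfl, cl_neg hg] at this
  simpa [sub_eq_add_neg] using this

theorem eLpNorm_coe_cl {f : R3 → ℝ} (hf : MemLp f 2 volume) :
    eLpNorm (cl f) 2 volume = eLpNorm f 2 volume := by
  rw [eLpNorm_congr_ae (coeFn_cl hf)]
  exact eLpNorm_congr_norm_ae (.of_forall fun x => by simp)

theorem eLpNorm_fourier (u : L2) :
    eLpNorm (𝓕 u : L2) 2 volume = eLpNorm u 2 volume := by
  rw [← Lp.enorm_def, ← Lp.enorm_def, ← ofReal_norm, ← ofReal_norm, Lp.norm_fourier_eq]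

theorem L2_ext_of_fourier {u w : L2} (h : (𝓕 u : L2) =ᵐ[volume] (𝓕 w : L2)) : u = w := by
  have h1 : (𝓕 u : L2) = 𝓕 w := Lp.ext h
  have := congrArg (fun z : L2 => (𝓕⁻ z : L2)) h1
  simpa using this

/-- The Fourier transform of a real function is Hermitian. -/
theorem fourier_conj {u w : L2} (h : w =ᵐ[volume] fun x => conj (u x)) :
    (𝓕 w : L2) =ᵐ[volume] fun ξ => conj ((𝓕 u : L2) (-ξ)) := by
  have hneg : MeasurePreserving (fun x : R3 => -x) volume volume := Measure.measurePreserving_neg _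
  have hm : MemLp (fun ξ => conj ((𝓕 u : L2) (-ξ))) 2 (volume : Measure R3) :=
    (memLp_star (𝓕 u)).comp_measurePreserving hneg
  refine L2_ext_schwartz (hm.locallyIntegrable (by norm_num)) ?_
  intro ψ
  rw [← integral_fourier_schwartz_mul]
  -- the function `ξ ↦ conj (ψ (-ξ))` has Fourier transform `conj ∘ 𝓕 ψ`
  set χ : R3 → ℂ := fun ξ => conj (ψ (-ξ)) with hχ
  have hχ1 : MemLp χ 1 volume := (ψ.memLp 1 volume).star.comp_measurePreserving hneg
  have hχ2 : MemLp χ 2 volume := (ψ.memLp 2 volume).star.comp_measurePreserving hneg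
  have hF : ∀ x, 𝓕 χ x = conj (𝓕 (ψ : R3 → ℂ) x) := by
    intro x
    rw [Real.fourier_eq', Real.fourier_eq', ← integral_conj, ← integral_neg_eq_self]
    congr 1; ext ξ
    simp only [hχ, neg_neg, smul_eq_mul, map_mul, ← Complex.exp_conj, conj_ofReal,
      Complex.conj_I, inner_neg_left]
    congr 2; push_cast; ring
  have h3 := integral_fourier_mul (toL2 χ) u
  calc _ = ∫ x, conj ((𝓕 (toL2 χ) : L2) x * u x) := by
        apply integral_congr_ae
        filter_upwards [h, fourier_toL2 (memLp_one_iff_integrable.1 hχ1) hχ2] with x hx hx'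
        rw [hx, hx', hF, SchwartzMap.fourier_coe]; simp
    _ = conj (∫ x, toL2 χ x * (𝓕 u : L2) x) := by rw [integral_conj, h3]
    _ = ∫ x, conj (χ x * (𝓕 u : L2) x) := by
        rw [← integral_conj]
        apply integral_congr_ae; filter_upwards [coeFn_toL2 hχ2] with x hx; rw [hx]
    _ = _ := by
        rw [← integral_neg_eq_self]
        simp [hχ]

theorem ae_neg {p : R3 → Prop} (h : ∀ᵐ x : R3, p x) :
    ∀ᵐ x : R3, p (-x) :=
  (Measure.measurePreserving_neg (volume : Measure R3)).quasiMeasurePreserving.ae h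

theorem fourier_cl_neg {f : R3 → ℝ} (hf : MemLp f 2 volume) :
    ∀ᵐ ξ : R3, (𝓕 (cl f) : L2) (-ξ) = conj ((𝓕 (cl f) : L2) ξ) := by
  have h : (cl f : R3 → ℂ) =ᵐ[volume] fun x => conj ((cl f : L2) x) := by
    filter_upwards [coeFn_cl hf] with x hx; rw [hx]; simp
  filter_upwards [ae_neg (fourier_conj h)] with ξ hξ
  rw [hξ]; simp

theorem ae_eq_re_of_fourier {u : L2}
    (h : ∀ᵐ ξ : R3, (𝓕 u : L2) (-ξ) = conj ((𝓕 u : L2) ξ)) :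
    u = cl fun x => (u x).re := by
  have h1 : u = toL2 fun x => conj (u x) := by
    apply L2_ext_of_fourier
    filter_upwards [ae_neg h, fourier_conj (coeFn_toL2 (memLp_star u))] with ξ h1 h2
    rw [h2, ← h1]; simp
  have h2 := coeFn_toL2 (memLp_star u)
  rw [← h1] at h2
  have hm : MemLp (fun x => (u x).re) 2 (volume : Measure R3) := (Lp.memLp u).re
  apply Lp.ext
  filter_upwards [h2, coeFn_cl hm] with x hx hx'
  rw [hx']
  exact (Complex.conj_eq_iff_re.1 hx.symm).symm

/-! ### Derivatives and the Fourier transform -/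

/-- The `i`-th basis vector. -/
abbrev ee (i : Fin 3) : R3 := EuclideanSpace.single i 1

theorem inner_ee (x : R3) (i : Fin 3) : inner ℝ x (ee i) = x i := by
  simp [ee, EuclideanSpace.inner_single_right]

theorem pd_eq_fderiv_ofReal {f : R3 → ℝ} {x : R3} (hf : DifferentiableAt ℝ f x) (i : Fin 3) :
    fderiv ℝ (fun y => ((f y : ℝ) : ℂ)) x (ee i) = ((pd i f x : ℝ) : ℂ) := by
  have := (Complex.ofRealCLM.hasFDerivAt.comp x hf.hasFDerivAt).fderiv
  have h2 : (fun y => ((f y : ℝ) : ℂ)) = Complex.ofRealCLM ∘ f := rfl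
  rw [h2, this]; simp [pd]

/-- The symbol of `∂ᵢ`. -/
def dsym (i : Fin 3) (ξ : R3) : ℂ := 2 * π * I * ((ξ i : ℝ) : ℂ)

theorem continuous_dsym (i : Fin 3) : Continuous (dsym i) := by unfold dsym; fun_prop

theorem norm_dsym (i : Fin 3) (ξ : R3) : ‖dsym i ξ‖ = 2 * π * |ξ i| := by
  simp [dsym, abs_of_pos Real.pi_pos]

theorem norm_dsym_le (i : Fin 3) (ξ : R3) : ‖dsym i ξ‖ ≤ freq ξ := by
  rw [norm_dsym, freq]
  exact mul_le_mul_of_nonneg_left (PiLp.norm_apply_le ξ i) (by positivity)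

theorem integral_schwartz_mul_dsym (χ : 𝓢(R3, ℂ)) (u : L2) (i : Fin 3) :
    ∫ ξ, χ ξ * (dsym i ξ * (𝓕 u : L2) ξ) =
      -∫ x, fderiv ℝ (𝓕 χ : 𝓢(R3, ℂ)) x (ee i) * u x := by
  have ht : (fun ξ : R3 => inner ℝ ξ (ee i)).HasTemperateGrowth := by fun_prop
  have e := SchwartzMap.lineDerivOp_fourier_eq χ (ee i)
  have h := integral_fourier_schwartz_mul
    ((-(2 * π * I)) • SchwartzMap.smulLeftCLM ℂ (inner ℝ · (ee i)) χ) u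
  rw [← e] at h
  rw [← integral_neg]
  have h1 : ∫ ξ, χ ξ * (dsym i ξ * (𝓕 u : L2) ξ) =
    -∫ (x : R3), (-(2 * π * I) • (SchwartzMap.smulLeftCLM ℂ (inner ℝ · (ee i))) χ) x * (𝓕 u : L2) x := by
    rw [← integral_neg]
    congr 1; ext ξ
    rw [_root_.smul_apply, SchwartzMap.smulLeftCLM_apply_apply ht, inner_ee]
    simp only [dsym, smul_eq_mul, Complex.real_smul]; ring
  rw [h1, ← h, integral_neg]
  rfl

theorem integral_schwartz_mul_pd (χ : 𝓢(R3, ℂ)) {f : R3 → ℝ} (hd : Differentiable ℝ f)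
    (hf : MemLp f 2 volume) (i : Fin 3) (hf' : MemLp (pd i f) 2 volume) :
    ∫ x, χ x * ((pd i f x : ℝ) : ℂ) = -∫ x, fderiv ℝ χ x (ee i) * ((f x : ℝ) : ℂ) := by
  simp_rw [← pd_eq_fderiv_ofReal (hd _)]
  have hdc : Differentiable ℝ (fun y => ((f y : ℝ) : ℂ)) := Complex.ofRealCLM.differentiable.comp hd
  have hχ' : MemLp (fun x => fderiv ℝ χ x (ee i)) 2 (volume : Measure R3) :=
    ((LineDeriv.lineDerivOp (ee i) χ : 𝓢(R3, ℂ)).memLp 2 volume)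
  refine integral_mul_fderiv_eq_neg_fderiv_mul_of_integrable ?_ ?_ ?_ ?_ ?_
  · exact MemLp.integrable_mul hχ' (memLp_ofReal hf)
  · simp_rw [pd_eq_fderiv_ofReal (hd _)]
    exact MemLp.integrable_mul (χ.memLp 2 volume) (memLp_ofReal hf')
  · exact MemLp.integrable_mul (χ.memLp 2 volume) (memLp_ofReal hf)
  · exact fun x _ => χ.differentiableAt
  · exact fun x _ => hdc x

theorem fourier_pd {f : R3 → ℝ} (hd : Differentiable ℝ f) (hf : MemLp f 2 volume) {i : Fin 3}
    (hf' : MemLp (pd i f) 2 volume) :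
    (𝓕 (cl (pd i f)) : L2) =ᵐ[volume] fun ξ => dsym i ξ * (𝓕 (cl f) : L2) ξ := by
  refine L2_ext_schwartz ?_ ?_
  · have : LocallyIntegrable (𝓕 (cl f) : L2) (volume : Measure R3) :=
      (Lp.memLp _).locallyIntegrable (by norm_num)
    rw [← locallyIntegrableOn_univ] at this ⊢
    exact this.continuousOn_mul (continuous_dsym i).continuousOn isOpen_univ.isLocallyClosed
  intro ψ
  rw [← integral_fourier_schwartz_mul, integral_schwartz_mul_dsym]
  have := integral_schwartz_mul_pd (𝓕 ψ) hd hf i hf'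
  calc _ = ∫ x, (𝓕 ψ : 𝓢(R3, ℂ)) x * ((pd i f x : ℝ) : ℂ) := by
        apply integral_congr_ae; filter_upwards [coeFn_cl hf'] with x hx; rw [hx]
    _ = _ := this
    _ = _ := by
        congr 1
        apply integral_congr_ae; filter_upwards [coeFn_cl hf] with x hx; rw [hx]

/-- The classical derivative is square-integrable if its Fourier transform should be: it represents the
distributional derivative. -/
theorem memLp_pd {f : R3 → ℝ} (hd : ContDiff ℝ 1 f) (hf : MemLp f 2 volume) {i : Fin 3}
    (hf' : MemLp (fun ξ => dsym i ξ * (𝓕 (cl f) : L2) ξ) 2 volume) :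
    MemLp (pd i f) 2 volume := by
  set G : L2 := 𝓕⁻ (toL2 fun ξ => dsym i ξ * (𝓕 (cl f) : L2) ξ) with hG
  have hGF : (𝓕 G : L2) =ᵐ[volume] fun ξ => dsym i ξ * (𝓕 (cl f) : L2) ξ := by
    rw [hG, fourier_fourierInv_eq]; exact coeFn_toL2 hf'
  have hcont : Continuous (fun x => ((pd i f x : ℝ) : ℂ)) := by
    refine Complex.continuous_ofReal.comp ?_
    exact (hd.continuous_fderiv (by norm_num)).clm_apply continuous_const
  have hdd : Differentiable ℝ f := hd.differentiable (by norm_num)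
  have hdc : Differentiable ℝ (fun y => ((f y : ℝ) : ℂ)) := Complex.ofRealCLM.differentiable.comp hdd
  have key : (G : R3 → ℂ) =ᵐ[volume] fun x => ((pd i f x : ℝ) : ℂ) := by
    refine ae_eq_of_integral_contDiff_smul_eq ((Lp.memLp G).locallyIntegrable (by norm_num))
      hcont.locallyIntegrable ?_
    intro φ hφ hc
    have hg₁ : HasCompactSupport (Complex.ofRealCLM ∘ φ) := hc.comp_left rfl
    have hg₂ : ContDiff ℝ ((⊤ : ℕ∞) : WithTop ℕ∞) (Complex.ofRealCLM ∘ φ) :=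
      Complex.ofRealCLM.contDiff.comp hφ
    set ψ := hg₁.toSchwartzMap hg₂ with hψ
    have hψφ : ∀ x, ψ x = φ x := fun x => rfl
    have e1 : ∫ x, ψ x * G x = -∫ x, fderiv ℝ ψ x (ee i) * (cl f : L2) x := by
      have h1 := integral_fourier_schwartz_mul (𝓕⁻ ψ) G
      have h2 := integral_schwartz_mul_dsym (𝓕⁻ ψ) (cl f) i
      rw [FourierTransform.fourier_fourierInv_eq] at h1 h2
      rw [h1, ← h2]
      apply integral_congr_ae; filter_upwards [hGF] with x hx; rw [hx]
    have e2 : ∫ x, ψ x * ((pd i f x : ℝ) : ℂ) = -∫ x, fderiv ℝ ψ x (ee i) * ((f x : ℝ) : ℂ) := by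
      have hcs : HasCompactSupport (fun x => fderiv ℝ ψ x (ee i)) := hg₁.fderiv_apply (𝕜 := ℝ) _
      have hcf' : Continuous (fun x => fderiv ℝ ψ x (ee i)) :=
        ((ψ.smooth 1).continuous_fderiv (by norm_num)).clm_apply continuous_const
      simp_rw [← pd_eq_fderiv_ofReal (hdd _)]
      refine integral_mul_fderiv_eq_neg_fderiv_mul_of_integrable ?_ ?_ ?_ ?_ ?_
      · exact (hcf'.mul hdc.continuous).integrable_of_hasCompactSupport hcs.mul_right
      · simp_rw [pd_eq_fderiv_ofReal (hdd _)]
        exact (ψ.continuous.mul hcont).integrable_of_hasCompactSupport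
          (HasCompactSupport.mul_right hg₁)
      · exact (ψ.continuous.mul hdc.continuous).integrable_of_hasCompactSupport
          (HasCompactSupport.mul_right hg₁)
      · exact fun x _ => ψ.differentiableAt
      · exact fun x _ => hdc x
    have e3 : ∫ x, fderiv ℝ ψ x (ee i) * (cl f : L2) x =
        ∫ x, fderiv ℝ ψ x (ee i) * ((f x : ℝ) : ℂ) := by
      apply integral_congr_ae; filter_upwards [coeFn_cl hf] with x hx; rw [hx]
    simp only [hψφ] at e1 e2
    simp only [Complex.real_smul]
    rw [e1, e2, e3]
  have h2 : MemLp (fun x => ((pd i f x : ℝ) : ℂ)) 2 volume := (memLp_congr_ae key).1 (Lp.memLp G)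
  simpa using h2.re

/-! ### Weights -/

theorem freq_nonneg (ξ : R3) : 0 ≤ freq ξ := by unfold freq; positivity

theorem one_le_jap (ξ : R3) : 1 ≤ jap ξ := by
  rw [jap, Real.one_le_sqrt]; nlinarith [sq_nonneg (freq ξ)]

theorem jap_pos (ξ : R3) : 0 < jap ξ := lt_of_lt_of_le one_pos (one_le_jap ξ)

theorem jap_sq (ξ : R3) : jap ξ ^ 2 = 1 + freq ξ ^ 2 := Real.sq_sqrt (by positivity)

theorem freq_le_jap (ξ : R3) : freq ξ ≤ jap ξ :=
  Real.le_sqrt_of_sq_le (by linarith)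

theorem norm_le_freq (ξ : R3) : ‖ξ‖ ≤ freq ξ := by
  unfold freq; nlinarith [Real.pi_gt_three, norm_nonneg ξ]

theorem continuous_freq : Continuous freq := by unfold freq; fun_prop

theorem continuous_jap : Continuous jap := by unfold jap; have := continuous_freq; fun_prop

theorem continuous_jap_rpow (s : ℝ) : Continuous fun ξ => jap ξ ^ s :=
  continuous_jap.rpow_const fun ξ => Or.inl (jap_pos ξ).ne'

/-- `‖a(∇) u‖_{L²}` for a real weight `a` on the frequency side, possibly infinite. -/
def wnorm (a : R3 → ℝ) (u : L2) : ℝ≥0∞ :=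
  eLpNorm (fun ξ => ((a ξ : ℝ) : ℂ) * (𝓕 u : L2) ξ) 2 volume

theorem wnorm_le {a b : R3 → ℝ} {C : ℝ} (h : ∀ ξ, |a ξ| ≤ C * |b ξ|) (u : L2) :
    wnorm a u ≤ ofReal C * wnorm b u := by
  refine eLpNorm_le_mul_eLpNorm_of_ae_le_mul (.of_forall fun ξ => ?_) 2
  simp only [norm_mul, norm_real, norm_eq_abs]
  rw [← mul_assoc]
  exact mul_le_mul_of_nonneg_right (h ξ) (norm_nonneg _)

theorem wnorm_mono {a b : R3 → ℝ} (h : ∀ ξ, |a ξ| ≤ |b ξ|) (u : L2) : wnorm a u ≤ wnorm b u := by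
  simpa using wnorm_le (C := 1) (by simpa using h) u

theorem wnorm_one (u : L2) : wnorm (fun _ => 1) u = eLpNorm u 2 volume := by
  simp only [wnorm, Complex.ofReal_one, one_mul]; exact eLpNorm_fourier u

theorem aestronglyMeasurable_weight {a : R3 → ℝ} (ha : Measurable a) (u : L2) :
    AEStronglyMeasurable (fun ξ => ((a ξ : ℝ) : ℂ) * (𝓕 u : L2) ξ) volume :=
  (Complex.measurable_ofReal.comp ha).aestronglyMeasurable.mul (Lp.aestronglyMeasurable _)

theorem wnorm_add_le {a : R3 → ℝ} (ha : Measurable a) (u w : L2) :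
    wnorm a (u + w) ≤ wnorm a u + wnorm a w := by
  have : wnorm a (u + w) = eLpNorm ((fun ξ => ((a ξ : ℝ) : ℂ) * (𝓕 u : L2) ξ) +
      fun ξ => ((a ξ : ℝ) : ℂ) * (𝓕 w : L2) ξ) 2 volume := by
    apply eLpNorm_congr_ae
    have hF : (𝓕 (u + w) : L2) = 𝓕 u + 𝓕 w := FourierTransform.fourier_add u w
    rw [hF]
    filter_upwards [Lp.coeFn_add (𝓕 u : L2) (𝓕 w)] with ξ hξ
    rw [hξ]; simp only [Pi.add_apply]; ring
  rw [this]
  exact eLpNorm_add_le (aestronglyMeasurable_weight ha u) (aestronglyMeasurable_weight ha w)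
    (by norm_num)

theorem wnorm_smul (a : R3 → ℝ) (c : ℂ) (u : L2) : wnorm a (c • u) = ‖c‖ₑ * wnorm a u := by
  have hF : (𝓕 (c • u) : L2) = c • 𝓕 u := FourierTransform.fourier_smul c u
  rw [wnorm, wnorm, hF, ← eLpNorm_const_smul]
  apply eLpNorm_congr_ae
  filter_upwards [Lp.coeFn_smul c (𝓕 u : L2)] with ξ hξ
  rw [hξ]; simp only [Pi.smul_apply, smul_eq_mul]; ring

theorem wnorm_neg (a : R3 → ℝ) (u : L2) : wnorm a (-u) = wnorm a u := by
  have := wnorm_smul a (-1) u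
  simpa using this

theorem wnorm_add_weight_le {a b : R3 → ℝ} (ha : Measurable a) (hb : Measurable b) (u : L2) :
    wnorm (fun ξ => a ξ + b ξ) u ≤ wnorm a u + wnorm b u := by
  refine le_trans (le_of_eq ?_) (eLpNorm_add_le (aestronglyMeasurable_weight ha u)
    (aestronglyMeasurable_weight hb u) (by norm_num))
  apply eLpNorm_congr_ae (.of_forall fun ξ => ?_)
  simp only [Pi.add_apply]; push_cast; ring

theorem integrable_jap_rpow {r : ℝ} (hr : 3 < r) : Integrable fun ξ => jap ξ ^ (-r) := by
  have h := integrable_rpow_neg_one_add_norm_sq (E := R3) (μ := volume) (r := r)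
    (by simpa using hr)
  refine h.mono' (continuous_jap_rpow _).aestronglyMeasurable (.of_forall fun ξ => ?_)
  rw [norm_eq_abs, abs_of_nonneg (rpow_nonneg (jap_pos ξ).le _), jap,
    Real.sqrt_eq_rpow, ← rpow_mul (by positivity)]
  rw [show (1 / 2 : ℝ) * -r = -r / 2 by ring]
  refine Real.rpow_le_rpow_of_nonpos (by positivity) ?_ (by linarith)
  have := norm_le_freq ξ
  nlinarith [norm_nonneg ξ]

theorem memLp_jap_rpow {r : ℝ} (hr : 3 < 2 * r) :
    MemLp (fun ξ => ((jap ξ ^ (-r) : ℝ) : ℂ)) 2 (volume : Measure R3) := by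
  refine memLp_ofReal ((memLp_two_iff_integrable_sq
    (continuous_jap_rpow _).aestronglyMeasurable).2 ?_)
  refine (integrable_jap_rpow hr).congr (.of_forall fun ξ => ?_)
  simp only
  rw [← rpow_natCast, ← rpow_mul (jap_pos ξ).le]; congr 1; push_cast; ring

/-- The constant of the embedding `H² ⊂ 𝓕 L¹`. -/
def sobC : ℝ≥0∞ := eLpNorm (fun ξ => ((jap ξ ^ (-2 : ℝ) : ℝ) : ℂ)) 2 (volume : Measure R3)

theorem sobC_lt_top : sobC < ∞ := (memLp_jap_rpow (by norm_num)).2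

theorem eLpNorm_one_fourier_le {a : R3 → ℝ} (ha : Measurable a) (u : L2) :
    eLpNorm (fun ξ => ((a ξ : ℝ) : ℂ) * (𝓕 u : L2) ξ) 1 volume ≤
      sobC * wnorm (fun ξ => jap ξ ^ (2 : ℝ) * a ξ) u := by
  have hm : Measurable fun ξ => jap ξ ^ (2 : ℝ) * a ξ :=
    (continuous_jap_rpow 2).measurable.mul ha
  have h := eLpNorm_smul_le_mul_eLpNorm (p := 2) (q := 2) (r := 1)
    (aestronglyMeasurable_weight hm u) (memLp_jap_rpow (r := 2) (by norm_num)).1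
  refine le_trans (le_of_eq ?_) h
  apply eLpNorm_congr_ae (.of_forall fun ξ => ?_)
  simp only [Pi.smul_apply', smul_eq_mul]
  rw [← mul_assoc, ← Complex.ofReal_mul, ← mul_assoc, ← rpow_add (jap_pos ξ)]
  norm_num

theorem integrable_weight {a : R3 → ℝ} (ha : Measurable a) {u : L2}
    (h : wnorm (fun ξ => jap ξ ^ (2 : ℝ) * a ξ) u < ∞) :
    Integrable (fun ξ => ((a ξ : ℝ) : ℂ) * (𝓕 u : L2) ξ) :=
  memLp_one_iff_integrable.1 ⟨aestronglyMeasurable_weight ha u,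
    (eLpNorm_one_fourier_le ha u).trans_lt (ENNReal.mul_lt_top sobC_lt_top h)⟩

theorem continuous_fourierInv {m : R3 → ℂ} (h1 : Integrable m) : Continuous (𝓕⁻ m) := by
  have : (𝓕⁻ m) = fun x => 𝓕 m (-x) := by ext x; rw [Real.fourierInv_eq_fourier_neg]
  rw [this]
  exact (VectorFourier.fourierIntegral_continuous Real.continuous_fourierChar
    (by exact (innerSL ℝ).continuous₂) h1).comp continuous_neg

theorem coeFn_eq_fourierInv {u : L2} (h : Integrable (𝓕 u : L2)) :
    (u : R3 → ℂ) =ᵐ[volume] 𝓕⁻ ((𝓕 u : L2) : R3 → ℂ) := by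
  have := fourierInv_toL2 h (Lp.memLp _)
  rwa [toL2_coeFn, fourierInv_fourier_eq] at this

/-- Fourier inversion for continuous functions with integrable Fourier transform. -/
theorem eq_fourierInv {f : R3 → ℝ} (hc : Continuous f) (hf : MemLp f 2 volume)
    (h : Integrable (𝓕 (cl f) : L2)) (x : R3) :
    ((f x : ℝ) : ℂ) = 𝓕⁻ ((𝓕 (cl f) : L2) : R3 → ℂ) x := by
  have h1 : (fun x => ((f x : ℝ) : ℂ)) =ᵐ[volume] 𝓕⁻ ((𝓕 (cl f) : L2) : R3 → ℂ) :=
    (coeFn_cl hf).symm.trans (coeFn_eq_fourierInv h)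
  have h2 := (Continuous.ae_eq_iff_eq volume (by fun_prop) (continuous_fourierInv h)).1 h1
  exact congrFun h2 x

theorem abs_le_of_wnorm {f : R3 → ℝ} (hc : Continuous f) (hf : MemLp f 2 volume) (x : R3) :
    ‖f x‖ₑ ≤ sobC * wnorm (fun ξ => jap ξ ^ (2 : ℝ)) (cl f) := by
  have hle := eLpNorm_one_fourier_le (a := fun _ => 1) measurable_const (cl f)
  simp only [Complex.ofReal_one, one_mul, mul_one] at hle
  by_cases htop : sobC * wnorm (fun ξ => jap ξ ^ (2 : ℝ)) (cl f) = ∞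
  · rw [htop]; exact le_top
  have hi : Integrable (𝓕 (cl f) : L2) :=
    memLp_one_iff_integrable.1 ⟨Lp.aestronglyMeasurable _, hle.trans_lt (lt_top_iff_ne_top.2 htop)⟩
  have h1 := eq_fourierInv hc hf hi x
  have h2 : ‖f x‖ₑ = ‖((f x : ℝ) : ℂ)‖ₑ := by simp [enorm_eq_nnnorm]
  rw [h2, h1, Real.fourierInv_eq]
  refine (enorm_integral_le_lintegral_enorm _).trans (le_trans (le_of_eq ?_) hle)
  rw [eLpNorm_one_eq_lintegral_enorm]
  congr 1; ext ξ
  rw [← ofReal_norm, ← ofReal_norm, Circle.norm_smul]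

/-- A real element of `L²` with enough decay in frequency has a representative of class `C¹`. -/
theorem exists_contDiff_repr {u : L2} (hu : u = cl fun x => (u x).re)
    (h1 : Integrable (𝓕 u : L2)) (h2 : Integrable fun ξ => ‖ξ‖ * ‖(𝓕 u : L2) ξ‖) :
    ∃ g : R3 → ℝ, ContDiff ℝ 1 g ∧ MemLp g 2 volume ∧ cl g = u := by
  set F : R3 → ℂ := 𝓕⁻ ((𝓕 u : L2) : R3 → ℂ) with hF
  have hFd : ContDiff ℝ 1 F := by
    have : F = fun x => 𝓕 ((𝓕 u : L2) : R3 → ℂ) (-x) := by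
      ext x; rw [hF, Real.fourierInv_eq_fourier_neg]
    rw [this]
    refine ContDiff.comp (g := 𝓕 ((𝓕 u : L2) : R3 → ℂ)) ?_ contDiff_neg
    refine Real.contDiff_fourier (N := 1) ?_
    intro n hn
    have hn' : n ≤ 1 := by exact_mod_cast hn
    interval_cases n
    · simpa using h1.norm
    · simpa using h2
  have hae := coeFn_eq_fourierInv h1
  have hm : MemLp (fun x => (u x).re) 2 (volume : Measure R3) := (Lp.memLp u).re
  have hre : (fun x => (F x).re) =ᵐ[volume] fun x => (u x).re := by
    filter_upwards [hae] with x hx; rw [hx]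
  refine ⟨fun x => (F x).re, Complex.reCLM.contDiff.comp hFd, (memLp_congr_ae hre).2 hm, ?_⟩
  rw [cl_congr hre, ← hu]

/-! ### Iterated differences and homogeneous Sobolev norms -/

theorem eLpNorm_two_sq {F : Type*} [NormedAddCommGroup F] (f : R3 → F) :
    eLpNorm f 2 (volume : Measure R3) ^ 2 = ∫⁻ x, ‖f x‖ₑ ^ 2 := by
  have := eLpNorm_nnreal_pow_eq_lintegral (f := f) (μ := (volume : Measure R3)) (p := 2) (by norm_num)
  simpa using this

theorem memLp_fwdDiff {f : R3 → ℝ} {p : ℝ≥0∞} (hf : MemLp f p volume) (h : R3) :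
    MemLp (fwdDiff h f) p volume :=
  (hf.comp_measurePreserving (measurePreserving_add_right volume h)).sub hf

theorem memLp_fwdDiff_iter {f : R3 → ℝ} {p : ℝ≥0∞} (hf : MemLp f p volume) (h : R3) (j : ℕ) :
    MemLp ((fwdDiff h)^[j] f) p volume := by
  induction j generalizing f with
  | zero => exact hf
  | succ j ih => exact ih (memLp_fwdDiff hf h)

theorem fourier_fwdDiff {f : R3 → ℝ} (hf : MemLp f 2 volume) (h : R3) :
    (𝓕 (cl (fwdDiff h f)) : L2) =ᵐ[volume] fun ξ => (chr h ξ - 1) * (𝓕 (cl f) : L2) ξ := by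
  have hmp := measurePreserving_add_right (volume : Measure R3) h
  have hf' : MemLp (fun x => f (x + h)) 2 volume := hf.comp_measurePreserving hmp
  have e : cl (fwdDiff h f) = cl (fun x => f (x + h)) - cl f := cl_sub hf' hf
  have ht : (cl (fun x => f (x + h)) : R3 → ℂ) =ᵐ[volume] fun x => (cl f : L2) (x + h) := by
    filter_upwards [coeFn_cl hf', hmp.quasiMeasurePreserving.ae (coeFn_cl hf)] with x h1 h2
    rw [h1, h2]
  have hF : (𝓕 (cl (fwdDiff h f)) : L2) = 𝓕 (cl fun x => f (x + h)) - 𝓕 (cl f) := by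
    rw [e]; exact map_sub (fourierCLM ℂ L2) _ _
  rw [hF]
  filter_upwards [Lp.coeFn_sub (𝓕 (cl fun x => f (x + h)) : L2) (𝓕 (cl f)),
    fourier_translate h ht] with ξ h1 h2
  rw [h1, Pi.sub_apply, h2]; ring

theorem fourier_fwdDiff_iter {f : R3 → ℝ} (hf : MemLp f 2 volume) (h : R3) (j : ℕ) :
    (𝓕 (cl ((fwdDiff h)^[j] f)) : L2) =ᵐ[volume]
      fun ξ => (chr h ξ - 1) ^ j * (𝓕 (cl f) : L2) ξ := by
  induction j generalizing f with
  | zero => simp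
  | succ j ih =>
    filter_upwards [ih (memLp_fwdDiff hf h), fourier_fwdDiff hf h] with ξ h1 h2
    rw [Function.iterate_succ_apply, h1, h2]; ring

/-- The dyadic step `2⁻ᵐ eᵢ`. -/
def stp (p : ℤ × Fin 3) : R3 := ((2 : ℝ) ^ (-p.1)) • ee p.2

/-- The weight `2^{2sm}` that belongs to the step `2⁻ᵐ eᵢ`. -/
def wt (s : ℝ) (p : ℤ × Fin 3) : ℝ≥0∞ := ofReal ((2 : ℝ) ^ (2 * s * p.1))

/-- The weighted sum of the squared `L²` norms of a family of functions indexed by the steps. -/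
def wsum (s : ℝ) (G : ℤ × Fin 3 → R3 → ℝ) : ℝ≥0∞ :=
  ∑' p, wt s p * eLpNorm (G p) 2 volume ^ 2

/-- The homogeneous Sobolev norm `‖|∇|^s f‖_{L²}` of a real function. -/
def hs (s : ℝ) (f : R3 → ℝ) : ℝ≥0∞ := wnorm (fun ξ => freq ξ ^ s) (cl f)

theorem inner_stp (p : ℤ × Fin 3) (ξ : R3) : inner ℝ (stp p) ξ = (2 : ℝ) ^ (-p.1) * ξ p.2 := by
  rw [stp, real_inner_smul_left, real_inner_comm, inner_ee]

theorem norm_chr_sub_one_sq (h ξ : R3) :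
    ‖chr h ξ - 1‖ ^ 2 = 2 - 2 * Real.cos (2 * π * inner ℝ h ξ) := by
  rw [chr, Complex.exp_mul_I, ← Complex.normSq_eq_norm_sq, Complex.normSq_apply]
  have := Real.sin_sq_add_cos_sq (2 * π * inner ℝ h ξ)
  rw [← Complex.ofReal_cos, ← Complex.ofReal_sin]
  simp only [Complex.sub_re, Complex.add_re, Complex.mul_re, Complex.ofReal_re, Complex.ofReal_im,
    Complex.I_re, Complex.I_im, Complex.one_re, Complex.sub_im, Complex.add_im, Complex.mul_im,
    Complex.one_im]
  nlinarith

theorem norm_chr_sub_one_le (h ξ : R3) :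
    ‖chr h ξ - 1‖ ≤ min 2 (2 * π * |inner ℝ h ξ|) := by
  refine le_min ?_ ?_
  · calc _ ≤ ‖chr h ξ‖ + ‖(1 : ℂ)‖ := norm_sub_le _ _
      _ = 2 := by rw [norm_chr]; norm_num
  · have := Real.norm_exp_I_mul_ofReal_sub_one_le (x := 2 * π * inner ℝ h ξ)
    rw [chr, mul_comm]
    refine this.trans (le_of_eq ?_)
    rw [norm_eq_abs, abs_mul, abs_of_pos Real.two_pi_pos]

/-- The dyadic sum `∑ₘ 2^{2sm} min(2, 4π 2⁻ᵐ)^{2j}`: after rescaling by a power of two it bounds the weighted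
sum over the steps of the symbol of a difference of order `j`. -/
def dyC (s : ℝ) (j : ℕ) : ℝ≥0∞ :=
  ∑' m : ℤ, ofReal ((2 : ℝ) ^ (2 * s * m) * min 2 (2 * π * (2 * (2 : ℝ) ^ (-m))) ^ (2 * j))

theorem dyC_lt_top {s : ℝ} {j : ℕ} (hs : 0 < s) (hj : s < j) : dyC s j < ∞ := by
  have key : Summable fun m : ℤ =>
      (2 : ℝ) ^ (2 * s * m) * min 2 (2 * π * (2 * (2 : ℝ) ^ (-m))) ^ (2 * j) := by
    have hmin : ∀ m : ℤ, 0 ≤ min 2 (2 * π * (2 * (2 : ℝ) ^ (-m))) := fun m =>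
      le_min (by norm_num) (by positivity)
    refine Summable.of_nat_of_neg ?_ ?_
    · have hr : Summable fun n : ℕ => (4 * π) ^ (2 * j) * ((2 : ℝ) ^ (2 * s - 2 * j)) ^ n := by
        refine (summable_geometric_of_lt_one (by positivity) ?_).mul_left _
        exact Real.rpow_lt_one_of_one_lt_of_neg (by norm_num) (by linarith)
      refine Summable.of_nonneg_of_le (fun n => mul_nonneg (by positivity) (pow_nonneg (hmin _) _))
        (fun n => ?_) hr
      calc _ ≤ (2 : ℝ) ^ (2 * s * n) * (2 * π * (2 * (2 : ℝ) ^ (-(n : ℤ)))) ^ (2 * j) := by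
            push_cast
            gcongr
            exact min_le_right _ _
        _ = _ := by
            rw [show 2 * π * (2 * (2 : ℝ) ^ (-(n : ℤ))) = (4 * π) * (2 : ℝ) ^ (-(n : ℤ)) by ring,
              mul_pow, mul_left_comm]
            congr 1
            rw [← Real.rpow_intCast, ← rpow_natCast, ← rpow_natCast,
              ← rpow_mul (by norm_num), ← rpow_mul (by norm_num),
              ← rpow_add (by norm_num)]
            congr 1; push_cast; ring
    · have hr : Summable fun n : ℕ => (2 : ℝ) ^ (2 * j) * ((2 : ℝ) ^ (-(2 * s))) ^ n := by
        refine (summable_geometric_of_lt_one (by positivity) ?_).mul_left _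
        exact Real.rpow_lt_one_of_one_lt_of_neg (by norm_num) (by linarith)
      refine Summable.of_nonneg_of_le (fun n => mul_nonneg (by positivity) (pow_nonneg (hmin _) _))
        (fun n => ?_) hr
      calc _ ≤ (2 : ℝ) ^ (2 * s * (-(n : ℤ) : ℤ)) * 2 ^ (2 * j) := by
            gcongr
            exact min_le_left _ _
        _ = _ := by
            rw [mul_comm]; congr 1
            rw [← rpow_natCast, ← rpow_mul (by norm_num)]
            congr 1; push_cast; ring
  rw [dyC, ← ENNReal.ofReal_tsum_of_nonneg _ key]
  · exact ofReal_lt_top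
  · exact fun m => mul_nonneg (by positivity) (pow_nonneg (le_min (by norm_num) (by positivity)) _)

/-- Rescaling by the power of two next to `τ` reduces the dyadic sum to `dyC`. -/
theorem tsum_dyadic_le {s : ℝ} (hs : 0 < s) {j : ℕ} (hj : 0 < j) {τ : ℝ} (hτ : 0 ≤ τ) :
    ∑' m : ℤ, ofReal ((2 : ℝ) ^ (2 * s * m) *
      min 2 (2 * π * ((2 : ℝ) ^ (-m) * τ)) ^ (2 * j)) ≤
      dyC s j * ofReal (τ ^ (2 * s)) := by
  rcases hτ.eq_or_lt with rfl | hτ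
  · have : ∀ m : ℤ, ofReal ((2 : ℝ) ^ (2 * s * m) *
      min 2 (2 * π * ((2 : ℝ) ^ (-m) * 0)) ^ (2 * j)) = 0 := by
      intro m; simp [hj.ne']
    rw [ENNReal.tsum_eq_zero.2 this]
    exact zero_le
  obtain ⟨n, hn1, hn2⟩ := exists_mem_Ico_zpow hτ (by norm_num : (1 : ℝ) < 2)
  rw [← (Equiv.addRight n).tsum_eq, dyC, ← ENNReal.tsum_mul_right]
  refine ENNReal.tsum_le_tsum fun m => ?_
  rw [← ofReal_mul (mul_nonneg (by positivity)
    (pow_nonneg (le_min (by norm_num) (by positivity)) _))]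
  refine ofReal_le_ofReal ?_
  have e1 : (2 : ℝ) ^ (2 * s * ((Equiv.addRight n) m : ℤ)) =
      (2 : ℝ) ^ (2 * s * m) * ((2 : ℝ) ^ n) ^ (2 * s) := by
    rw [← Real.rpow_intCast, ← rpow_mul (by norm_num), ← rpow_add (by norm_num)]
    congr 1; simp; ring
  have e2 : (2 : ℝ) ^ (-((Equiv.addRight n) m)) * τ ≤ 2 * (2 : ℝ) ^ (-m) := by
    have : (2 : ℝ) ^ (-((Equiv.addRight n) m)) = (2 : ℝ) ^ (-m) * (2 : ℝ) ^ (-n) := by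
      rw [← zpow_add₀ (by norm_num)]; congr 1; simp; ring
    rw [this, mul_assoc, mul_comm (2 : ℝ)]
    refine mul_le_mul_of_nonneg_left ?_ (by positivity)
    rw [zpow_neg, inv_mul_le_iff₀ (by positivity)]
    rw [zpow_add_one₀ (by norm_num)] at hn2
    exact hn2.le
  rw [e1]
  calc _ ≤ (2 : ℝ) ^ (2 * s * m) * τ ^ (2 * s) *
        min 2 (2 * π * (2 * (2 : ℝ) ^ (-m))) ^ (2 * j) := by
        gcongr
    _ = _ := by ring

/-- The single step `2⁻ᵐ` with `|2⁻ᵐ y|` between `1/4` and `1/2` gives the lower bound. -/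
theorem le_tsum_dyadic {s : ℝ} (hs : 0 < s) {j : ℕ} {y : ℝ} (hy : 0 < |y|) {i : Fin 3} {ξ : R3}
    (hξ : ξ i = y) :
    ofReal (|y| ^ (2 * s)) ≤
      ∑' m : ℤ, wt s (m, i) * ofReal (‖chr (stp (m, i)) ξ - 1‖ ^ (2 * j)) := by
  obtain ⟨n, hn1, hn2⟩ := exists_mem_Ico_zpow hy (by norm_num : (1 : ℝ) < 2)
  refine le_trans ?_ (ENNReal.le_tsum (n + 2))
  rw [wt, ← ofReal_mul (by positivity)]
  refine ofReal_le_ofReal ?_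
  have h2n : (0 : ℝ) < 2 ^ n := by positivity
  -- the phase lies in `[π/2, π]` in absolute value, where the cosine is not positive
  have h1 : 1 ≤ ‖chr (stp (n + 2, i)) ξ - 1‖ := by
    have := norm_chr_sub_one_sq (stp (n + 2, i)) ξ
    rw [inner_stp, hξ, ← Real.cos_abs, abs_mul, abs_of_pos Real.two_pi_pos, abs_mul,
      abs_of_pos (by positivity : (0 : ℝ) < 2 ^ (-(n + 2)))] at this
    have e : (2 : ℝ) ^ (-(n + 2)) = (2 ^ n)⁻¹ / 4 := by
      rw [neg_add, zpow_add₀ (by norm_num), zpow_neg]; norm_num; ring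
    have h3 : 1 ≤ (2 ^ n)⁻¹ * |y| := by rw [inv_mul_eq_div, le_div_iff₀ h2n]; linarith
    have h4 : (2 ^ n)⁻¹ * |y| ≤ 2 := by
      rw [zpow_add_one₀ (by norm_num)] at hn2
      rw [inv_mul_eq_div, div_le_iff₀ h2n]; linarith
    have hc : Real.cos (2 * π * (2 ^ (-(n + 2)) * |y|)) ≤ 0 := by
      rw [e]
      apply Real.cos_nonpos_of_pi_div_two_le_of_le
      · nlinarith [Real.pi_pos]
      · nlinarith [Real.pi_pos]
    nlinarith [norm_nonneg (chr (stp (n + 2, i)) ξ - 1)]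
  calc |y| ^ (2 * s) ≤ ((2 : ℝ) ^ (n + 2)) ^ (2 * s) := by
        refine Real.rpow_le_rpow hy.le ?_ (by linarith)
        rw [zpow_add_one₀ (by norm_num)] at hn2
        rw [zpow_add₀ (by norm_num)]
        norm_num; linarith
    _ = (2 : ℝ) ^ (2 * s * ((n + 2 : ℤ) : ℝ)) * 1 := by
        rw [← Real.rpow_intCast, ← rpow_mul (by norm_num), mul_one, mul_comm]
    _ ≤ _ := by
        refine mul_le_mul_of_nonneg_left (one_le_pow₀ h1) (by positivity)

theorem hs_sq (s : ℝ) (f : R3 → ℝ) :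
    hs s f ^ 2 = ∫⁻ ξ, ofReal (freq ξ ^ (2 * s)) * ‖(𝓕 (cl f) : L2) ξ‖ₑ ^ 2 := by
  rw [hs, wnorm, eLpNorm_two_sq]
  congr 1; ext ξ
  rw [enorm_mul, mul_pow]
  congr 1
  rw [← ofReal_norm, ← ofReal_pow (norm_nonneg _), norm_real, norm_eq_abs,
    sq_abs, ← rpow_natCast, ← rpow_mul (freq_nonneg ξ)]
  congr 2; push_cast; ring

/-- Plancherel's theorem for the weighted sum of differences. -/
theorem wsum_diff_eq (s : ℝ) (j : ℕ) {f : R3 → ℝ} (hf : MemLp f 2 volume) :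
    wsum s (fun p => (fwdDiff (stp p))^[j] f) = ∫⁻ ξ, (∑' p : ℤ × Fin 3,
      wt s p * ofReal (‖chr (stp p) ξ - 1‖ ^ (2 * j))) * ‖(𝓕 (cl f) : L2) ξ‖ₑ ^ 2 := by
  simp_rw [← ENNReal.tsum_mul_right]
  rw [wsum, lintegral_tsum]
  · congr 1; ext p
    simp_rw [mul_assoc]
    rw [lintegral_const_mul']
    · congr 1
      rw [← eLpNorm_coe_cl (memLp_fwdDiff_iter hf _ _), ← eLpNorm_fourier, eLpNorm_two_sq]
      apply lintegral_congr_ae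
      filter_upwards [fourier_fwdDiff_iter hf (stp p) j] with ξ hξ
      rw [hξ, enorm_mul, mul_pow]
      congr 1
      rw [← ofReal_norm, ← ofReal_pow (norm_nonneg _), norm_pow, ← pow_mul, mul_comm 2]
    · exact ofReal_ne_top
  · intro p
    have hc : Continuous fun ξ => ‖chr (stp p) ξ - 1‖ ^ (2 * j) :=
      (((continuous_chr _).sub continuous_const).norm).pow _
    exact ((measurable_const.mul hc.measurable.ennreal_ofReal).aemeasurable).mul
      ((Lp.aestronglyMeasurable _).enorm.pow_const 2)

/-- The homogeneous norm of order `s` bounds the weighted sum of differences of order `j > s`, as the constant is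
finite then (`dyC_lt_top`). -/
theorem wsum_diff_le {s : ℝ} (hs0 : 0 < s) {j : ℕ} (hj : 0 < j) {f : R3 → ℝ}
    (hf : MemLp f 2 volume) :
    wsum s (fun p => (fwdDiff (stp p))^[j] f) ≤ 3 * dyC s j * hs s f ^ 2 := by
  rw [wsum_diff_eq s j hf, hs_sq, ← lintegral_const_mul'']
  · refine lintegral_mono fun ξ => ?_
    rw [← mul_assoc]
    refine mul_le_mul_left ?_ _
    rw [ENNReal.tsum_prod']
    have hcomm : ∑' (a : ℤ) (b : Fin 3), wt s (a, b) *
        ofReal (‖chr (stp (a, b)) ξ - 1‖ ^ (2 * j)) =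
        ∑ b : Fin 3, ∑' a : ℤ, wt s (a, b) *
        ofReal (‖chr (stp (a, b)) ξ - 1‖ ^ (2 * j)) := by
      rw [ENNReal.tsum_comm, tsum_fintype]
    rw [hcomm]
    calc _ ≤ ∑ b : Fin 3, dyC s j * ofReal (freq ξ ^ (2 * s)) := by
          refine sum_le_sum fun b _ => ?_
          refine le_trans ?_ ((tsum_dyadic_le hs0 hj (abs_nonneg (ξ b))).trans ?_)
          · refine ENNReal.tsum_le_tsum fun m => ?_
            rw [wt, ← ofReal_mul (by positivity)]
            refine ofReal_le_ofReal ?_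
            have h := norm_chr_sub_one_le (stp (m, b)) ξ
            rw [inner_stp, abs_mul, abs_of_pos (by positivity : (0 : ℝ) < 2 ^ (-(m, b).1))] at h
            gcongr
          · gcongr
            exact (PiLp.norm_apply_le ξ b).trans (norm_le_freq ξ)
      _ = _ := by simp; ring
  · exact ((continuous_freq.rpow_const fun ξ => Or.inr (by linarith)).measurable.ennreal_ofReal.aemeasurable).mul
      ((Lp.aestronglyMeasurable _).enorm.pow_const 2)

/-- The constant in the bound of a homogeneous Sobolev norm by differences. -/
def lowC (s : ℝ) : ℝ≥0∞ := ofReal ((2 * π) ^ (2 * s) * 3 ^ s)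

/-- The converse of `wsum_diff_le`: at each frequency the largest coordinate suffices. -/
theorem hs_sq_le_wsum {s : ℝ} (hs0 : 0 < s) (j : ℕ) {f : R3 → ℝ} (hf : MemLp f 2 volume) :
    hs s f ^ 2 ≤ lowC s * wsum s (fun p => (fwdDiff (stp p))^[j] f) := by
  rw [wsum_diff_eq s j hf, hs_sq, ← lintegral_const_mul' (lowC s) _ ofReal_ne_top]
  refine lintegral_mono fun ξ => ?_
  rw [← mul_assoc]
  refine mul_le_mul_left ?_ _
  obtain ⟨i, -, hi⟩ := Finset.exists_max_image Finset.univ (fun i : Fin 3 => |ξ i|) ⟨0, mem_univ _⟩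
  have hn : ‖ξ‖ ^ 2 ≤ 3 * |ξ i| ^ 2 := by
    rw [EuclideanSpace.norm_sq_eq, Fin.sum_univ_three]
    have h0 := hi 0 (mem_univ _)
    have h1 := hi 1 (mem_univ _)
    have h2 := hi 2 (mem_univ _)
    simp only [norm_eq_abs]
    have := pow_le_pow_left₀ (abs_nonneg (ξ 0)) h0 2
    have := pow_le_pow_left₀ (abs_nonneg (ξ 1)) h1 2
    have := pow_le_pow_left₀ (abs_nonneg (ξ 2)) h2 2
    linarith
  have hle : freq ξ ^ (2 * s) ≤ (2 * π) ^ (2 * s) * 3 ^ s * |ξ i| ^ (2 * s) := by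
    rw [freq, Real.mul_rpow (by positivity) (norm_nonneg _), mul_assoc]
    gcongr
    rw [rpow_mul (norm_nonneg _), rpow_mul (abs_nonneg _), ← Real.mul_rpow (by norm_num) (by positivity)]
    refine Real.rpow_le_rpow (by positivity) ?_ hs0.le
    simpa using hn
  refine (ofReal_le_ofReal hle).trans ?_
  rw [ofReal_mul (by positivity), lowC]
  gcongr
  rcases (abs_nonneg (ξ i)).eq_or_lt with h0 | h0
  · rw [← h0, Real.zero_rpow (by linarith)]; simp
  refine (le_tsum_dyadic hs0 (j := j) h0 rfl).trans ?_
  exact ENNReal.tsum_comp_le_tsum_of_injective (f := fun m : ℤ => (m, i))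
    (fun a b h => by simpa using h) _

/-! ### The Leibniz rule for differences; product and commutator estimates -/

/-- The Leibniz rule for iterated differences; the second factor is translated. -/
theorem fwdDiff_iter_mul (h : R3) (M : ℕ) (f g : R3 → ℝ) (x : R3) :
    (fwdDiff h)^[M] (fun y => f y * g y) x = ∑ q ∈ Finset.HasAntidiagonal.antidiagonal M,
      (M.choose q.1 : ℝ) * ((fwdDiff h)^[q.1] f x * (fwdDiff h)^[q.2] g (x + q.1 • h)) := by
  induction M generalizing f g x with
  | zero => simp
  | succ M ih =>
    have e : fwdDiff h (fun y => f y * g y) =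
        (fun y => f y * fwdDiff h g y) + fun y => fwdDiff h f y * g (y + h) := by
      ext y; simp only [fwdDiff, Pi.add_apply]; ring
    rw [Function.iterate_succ_apply, e, fwdDiff_iter_add, Pi.add_apply, ih, ih,
      Finset.sum_antidiagonal_choose_succ_mul
        (fun a b => (fwdDiff h)^[a] f x * (fwdDiff h)^[b] g (x + a • h))]
    congr 1
    refine sum_congr rfl fun q hq => ?_
    rw [← Finset.HasAntidiagonal.mem_antidiagonal.1 hq, Nat.choose_symm_add]
    have h1 := fwdDiff_iter_comp_add h g h q.2 (x + q.1 • h)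
    rw [h1, Function.iterate_succ_apply, add_assoc, ← succ_nsmul]

theorem abs_fwdDiff_iter_le (h : R3) {f : R3 → ℝ} {B : ℝ} (hB : ∀ x, |f x| ≤ B) (j : ℕ) (x : R3) :
    |(fwdDiff h)^[j] f x| ≤ 2 ^ j * B := by
  induction j generalizing f B x with
  | zero => simpa using hB x
  | succ j ih =>
    have h1 : ∀ y, |fwdDiff h f y| ≤ 2 * B := fun y => by
      rw [fwdDiff]
      have := abs_sub (f (y + h)) (f y)
      linarith [hB y, hB (y + h)]
    rw [Function.iterate_succ_apply]
    refine (ih h1 x).trans (le_of_eq (by ring))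

theorem eLpNorm_mul_le_sup {f g : R3 → ℝ} {B : ℝ} (hf : ∀ x, |f x| ≤ B) :
    eLpNorm (fun x => f x * g x) 2 (volume : Measure R3) ≤
      ofReal B * eLpNorm g 2 volume := by
  refine eLpNorm_le_mul_eLpNorm_of_ae_le_mul (.of_forall fun x => ?_) 2
  rw [norm_mul]
  exact mul_le_mul_of_nonneg_right (hf x) (norm_nonneg _)

theorem eLpNorm_add_right {g : R3 → ℝ} (hg : AEStronglyMeasurable g volume) (h : R3) :
    eLpNorm (fun x => g (x + h)) 2 (volume : Measure R3) = eLpNorm g 2 volume :=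
  eLpNorm_comp_measurePreserving hg (measurePreserving_add_right volume h)

theorem sq_sum_le {ι : Type*} (A : Finset ι) (f : ι → ℝ≥0∞) :
    (∑ a ∈ A, f a) ^ 2 ≤ (A.card : ℝ≥0∞) * ∑ a ∈ A, f a ^ 2 := by
  have := ENNReal.rpow_sum_le_const_mul_sum_rpow A f (p := 2) (by norm_num)
  norm_num at this
  exact_mod_cast this

/-- A family bounded in `L²` by a finite sum of families, in weighted square sums. -/
theorem wsum_le_sum {ι : Type*} (A : Finset ι) (s : ℝ) {G : ℤ × Fin 3 → R3 → ℝ}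
    {K : ι → ℤ × Fin 3 → ℝ≥0∞} {b : ι → ℝ≥0∞}
    (h : ∀ p, eLpNorm (G p) 2 volume ≤ ∑ a ∈ A, K a p)
    (hb : ∀ a ∈ A, ∑' p, wt s p * K a p ^ 2 ≤ b a) :
    wsum s G ≤ (A.card : ℝ≥0∞) * ∑ a ∈ A, b a := by
  calc wsum s G ≤ ∑' p, wt s p * ((A.card : ℝ≥0∞) * ∑ a ∈ A, K a p ^ 2) := by
        refine ENNReal.tsum_le_tsum fun p => ?_
        gcongr
        exact (pow_le_pow_left' (h p) 2).trans (sq_sum_le A _)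
    _ = (A.card : ℝ≥0∞) * ∑ a ∈ A, ∑' p, wt s p * K a p ^ 2 := by
        rw [← Summable.tsum_finsetSum (fun _ _ => ENNReal.summable), ← ENNReal.tsum_mul_left]
        congr 1; ext p
        rw [mul_left_comm, mul_sum]
    _ ≤ _ := by gcongr with a ha; exact hb a ha

theorem tsum_const_mul_sq (s : ℝ) (c : ℝ≥0∞) (G : ℤ × Fin 3 → R3 → ℝ) :
    ∑' p, wt s p * (c * eLpNorm (G p) 2 volume) ^ 2 = c ^ 2 * wsum s G := by
  rw [wsum, ← ENNReal.tsum_mul_left]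
  congr 1; ext p; ring

/-- A bound for the constants `dyC s j` with `j ≤ M`, `2j ≥ M`. -/
def dyCmax (s : ℝ) (M : ℕ) : ℝ≥0∞ := ∑ j ∈ (Finset.range (M + 1)).filter fun j => M ≤ 2 * j, dyC s j

theorem dyC_le_max {s : ℝ} {M j : ℕ} (h1 : j ≤ M) (h2 : M ≤ 2 * j) : dyC s j ≤ dyCmax s M :=
  single_le_sum (f := fun j => dyC s j) (fun _ _ => zero_le) (by simp; omega)

theorem dyCmax_lt_top {s : ℝ} {M : ℕ} (hs0 : 0 < s) (hM : 2 * s < M) : dyCmax s M < ∞ := by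
  refine ENNReal.sum_lt_top.2 fun j hj => dyC_lt_top hs0 ?_
  simp at hj
  have : (M : ℝ) ≤ 2 * j := by exact_mod_cast hj.2
  linarith

/-- The order of the differences used at regularity `s`. It exceeds `2s`, so that in each term of the Leibniz
rule one of the factors is a difference of order above `s`. -/
def ord (s : ℝ) : ℕ := 2 * (⌈s⌉₊ + 1)

theorem two_mul_lt_ord (s : ℝ) : 2 * s < ord s := by
  have := Nat.le_ceil s
  unfold ord; push_cast; linarith

theorem norm_stp (p : ℤ × Fin 3) : ‖stp p‖ = (2 : ℝ) ^ (-p.1) := by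
  rw [stp, norm_smul]; simp

theorem ofReal_choose_mul_le (M : ℕ) (j : ℕ) (B : ℝ) (hj : j ≤ M) (hB : 0 ≤ B) :
    ofReal ((M.choose j : ℝ) * (2 ^ j * B)) ≤ 4 ^ M * ofReal B := by
  have h4 : (4 : ℝ≥0∞) ^ M = ofReal (4 ^ M) := by
    rw [ofReal_pow (by norm_num)]; norm_num
  rw [h4, ← ofReal_mul (by positivity)]
  refine ofReal_le_ofReal ?_
  have h1 : (M.choose j : ℝ) ≤ 2 ^ M := by exact_mod_cast Nat.choose_le_two_pow M j
  have h2 : (2 : ℝ) ^ j ≤ 2 ^ M := pow_le_pow_right₀ (by norm_num) hj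
  calc _ ≤ 2 ^ M * (2 ^ M * B) := by gcongr
    _ = _ := by rw [← mul_assoc, ← mul_pow]; norm_num

theorem eLpNorm_sum_le' {ι : Type*} (A : Finset ι) (F : ι → R3 → ℝ)
    (hF : ∀ a ∈ A, AEStronglyMeasurable (F a) volume) :
    eLpNorm (fun x => ∑ a ∈ A, F a x) 2 (volume : Measure R3) ≤ ∑ a ∈ A, eLpNorm (F a) 2 volume := by
  have : (fun x => ∑ a ∈ A, F a x) = ∑ a ∈ A, F a := by ext x; simp
  rw [this]
  exact eLpNorm_sum_le hF (by norm_num)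

theorem eLpNorm_leibniz_left {f g : R3 → ℝ} (c : ℝ) (hc : 0 ≤ c) {B : ℝ} (hB : ∀ x, |f x| ≤ B)
    (hg : AEStronglyMeasurable g volume) (h : R3) :
    eLpNorm (fun x => c * (f x * g (x + h))) 2 (volume : Measure R3) ≤
      ofReal (c * B) * eLpNorm g 2 volume := by
  have := eLpNorm_mul_le_sup (f := fun x => c * f x) (g := fun x => g (x + h)) (B := c * B)
    (fun x => by rw [abs_mul, abs_of_nonneg hc]; exact mul_le_mul_of_nonneg_left (hB x) hc)
  rw [eLpNorm_add_right hg] at this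
  simpa [mul_assoc] using this

theorem eLpNorm_leibniz_right {f g : R3 → ℝ} (c : ℝ) (hc : 0 ≤ c) {B : ℝ} (hB : ∀ x, |g x| ≤ B)
    (h : R3) :
    eLpNorm (fun x => c * (f x * g (x + h))) 2 (volume : Measure R3) ≤
      ofReal (c * B) * eLpNorm f 2 volume := by
  have := eLpNorm_mul_le_sup (f := fun x => c * g (x + h)) (g := f) (B := c * B)
    (fun x => by rw [abs_mul, abs_of_nonneg hc]; exact mul_le_mul_of_nonneg_left (hB _) hc)
  refine le_trans (le_of_eq ?_) this
  congr 1; ext x; ring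

/-- The square of the constant in the product estimate. -/
def prodCsq (s : ℝ) : ℝ≥0∞ :=
  lowC s * ((ord s + 1 : ℕ) * ((ord s + 1 : ℕ) * ((4 ^ ord s) ^ 2 * (3 * dyCmax s (ord s)))))

theorem prodCsq_lt_top {s : ℝ} (hs0 : 0 < s) : prodCsq s < ∞ := by
  have := dyCmax_lt_top hs0 (two_mul_lt_ord s)
  unfold prodCsq lowC
  finiteness

theorem wsum_mul_le {s : ℝ} (hs0 : 0 < s) {f g : R3 → ℝ} {Bf Bg : ℝ} (hf : MemLp f 2 volume)
    (hg : MemLp g 2 volume) (hBf : ∀ x, |f x| ≤ Bf) (hBg : ∀ x, |g x| ≤ Bg) :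
    lowC s * wsum s (fun p => (fwdDiff (stp p))^[ord s] (fun x => f x * g x)) ≤
      prodCsq s * (ofReal Bf ^ 2 * hs s g ^ 2 + ofReal Bg ^ 2 * hs s f ^ 2) := by
  set M := ord s with hM
  have hBf0 : 0 ≤ Bf := (abs_nonneg _).trans (hBf 0)
  have hBg0 : 0 ≤ Bg := (abs_nonneg _).trans (hBg 0)
  have hMs := two_mul_lt_ord s
  -- the difference of lower order is taken in `L^∞`
  set K : ℕ × ℕ → ℤ × Fin 3 → ℝ≥0∞ := fun q p =>
    if q.1 ≤ q.2 then ofReal ((M.choose q.1 : ℝ) * (2 ^ q.1 * Bf)) *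
        eLpNorm ((fwdDiff (stp p))^[q.2] g) 2 volume
      else ofReal ((M.choose q.1 : ℝ) * (2 ^ q.2 * Bg)) *
        eLpNorm ((fwdDiff (stp p))^[q.1] f) 2 volume with hK
  have h := wsum_le_sum (Finset.HasAntidiagonal.antidiagonal M) s
    (G := fun p => (fwdDiff (stp p))^[M] (fun x => f x * g x)) (K := K)
    (b := fun _ => (4 ^ M) ^ 2 * (3 * dyCmax s M) *
      (ofReal Bf ^ 2 * hs s g ^ 2 + ofReal Bg ^ 2 * hs s f ^ 2)) ?_ ?_
  · rw [Finset.sum_const, Finset.Nat.card_antidiagonal] at h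
    calc _ ≤ _ := mul_le_mul_right h (lowC s)
      _ = _ := by rw [prodCsq, nsmul_eq_mul]; ring
  · intro p
    have e : (fwdDiff (stp p))^[M] (fun x => f x * g x) = fun x => ∑ q ∈ Finset.HasAntidiagonal.antidiagonal M,
        (M.choose q.1 : ℝ) * ((fwdDiff (stp p))^[q.1] f x * (fwdDiff (stp p))^[q.2] g (x + q.1 • stp p)) := by
      ext x; exact fwdDiff_iter_mul _ _ _ _ _
    rw [e]
    refine (eLpNorm_sum_le' _ _ fun q _ => ?_).trans (sum_le_sum fun q _ => ?_)
    · refine AEStronglyMeasurable.const_mul ?_ _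
      exact (memLp_fwdDiff_iter hf _ _).1.mul
        ((memLp_fwdDiff_iter hg _ _).comp_measurePreserving (measurePreserving_add_right volume _)).1
    · simp only [hK]
      split_ifs with hq
      · exact eLpNorm_leibniz_left _ (by positivity) (abs_fwdDiff_iter_le _ hBf _)
          (memLp_fwdDiff_iter hg _ _).1 _
      · exact eLpNorm_leibniz_right _ (by positivity) (abs_fwdDiff_iter_le _ hBg _) _
  · intro q hq
    have hq' := Finset.HasAntidiagonal.mem_antidiagonal.1 hq
    simp only [hK]
    have hord : 0 < M := by rw [hM]; unfold ord; omega
    split_ifs with hle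
    · rw [tsum_const_mul_sq s _ (fun p => (fwdDiff (stp p))^[q.2] g)]
      calc _ ≤ (4 ^ M * ofReal Bf) ^ 2 * (3 * dyCmax s M * hs s g ^ 2) := by
            gcongr
            · exact ofReal_choose_mul_le M _ _ (by omega) hBf0
            · refine (wsum_diff_le hs0 (by omega) hg).trans ?_
              gcongr
              exact dyC_le_max (by omega) (by omega)
        _ = (4 ^ M) ^ 2 * (3 * dyCmax s M) * (ofReal Bf ^ 2 * hs s g ^ 2) := by ring
        _ ≤ _ := by gcongr; exact le_self_add
    · rw [tsum_const_mul_sq s _ (fun p => (fwdDiff (stp p))^[q.1] f)]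
      have hch : M.choose q.1 = M.choose q.2 := by
        rw [← hq', Nat.choose_symm_add]
      rw [hch]
      calc _ ≤ (4 ^ M * ofReal Bg) ^ 2 * (3 * dyCmax s M * hs s f ^ 2) := by
            gcongr
            · exact ofReal_choose_mul_le M _ _ (by omega) hBg0
            · refine (wsum_diff_le hs0 (by omega) hf).trans ?_
              gcongr
              exact dyC_le_max (by omega) (by omega)
        _ = (4 ^ M) ^ 2 * (3 * dyCmax s M) * (ofReal Bg ^ 2 * hs s f ^ 2) := by ring
        _ ≤ _ := by gcongr; exact le_add_self

/-- The constant in the product estimate. -/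
def prodC (s : ℝ) : ℝ≥0∞ := prodCsq s ^ (1 / 2 : ℝ) + 1

theorem prodC_lt_top {s : ℝ} (hs0 : 0 < s) : prodC s < ∞ := by
  have := prodCsq_lt_top hs0
  unfold prodC
  exact ENNReal.add_lt_top.2 ⟨ENNReal.rpow_lt_top_of_nonneg (by norm_num) this.ne, by simp⟩

theorem le_of_sq_le_mul_sq_add {a c x y : ℝ≥0∞} (h : a ^ 2 ≤ c * (x ^ 2 + y ^ 2)) :
    a ≤ (c ^ (1 / 2 : ℝ) + 1) * (x + y) := by
  have h1 : a ^ 2 ≤ ((c ^ (1 / 2 : ℝ)) * (x + y)) ^ 2 := by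
    rw [mul_pow, ← ENNReal.rpow_natCast (c ^ (1 / 2 : ℝ)), ← ENNReal.rpow_mul]
    norm_num
    refine h.trans (mul_le_mul_right ?_ c)
    calc x ^ 2 + y ^ 2 ≤ x ^ 2 + y ^ 2 + 2 * (x * y) := le_self_add
      _ = _ := by ring
  have h2 : a ≤ (c ^ (1 / 2 : ℝ)) * (x + y) :=
    (ENNReal.pow_le_pow_left_iff two_ne_zero).1 h1
  exact h2.trans (by gcongr; exact le_self_add)

/-- The tame product estimate. In each term of the Leibniz rule the factor with the difference of lower order
is bounded in `L^∞`, the other one in `L²`. -/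
theorem hs_mul_le {s : ℝ} (hs0 : 0 < s) {f g : R3 → ℝ} {Bf Bg : ℝ} (hf : MemLp f 2 volume)
    (hg : MemLp g 2 volume) (hBf : ∀ x, |f x| ≤ Bf) (hBg : ∀ x, |g x| ≤ Bg) :
    hs s (fun x => f x * g x) ≤
      prodC s * (ofReal Bf * hs s g + ofReal Bg * hs s f) := by
  have hfg : MemLp (fun x => f x * g x) 2 volume := by
    refine hg.of_le_mul (c := Bf) (hf.1.mul hg.1) (.of_forall fun x => ?_)
    rw [norm_mul]; exact mul_le_mul_of_nonneg_right (hBf x) (norm_nonneg _)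
  refine le_of_sq_le_mul_sq_add ?_
  rw [mul_pow, mul_pow]
  exact (hs_sq_le_wsum hs0 (ord s) hfg).trans (wsum_mul_le hs0 hf hg hBf hBg)

/-- The constant in the commutator estimate. -/
def commC (s : ℝ) : ℝ≥0∞ :=
  (ord s + 1 : ℕ) * ((ord s + 1 : ℕ) * ((4 ^ ord s) ^ 2 * (3 * (dyCmax s (ord s) + dyCmax (s - 1) (ord s)))))

theorem commC_lt_top {s : ℝ} (hs0 : 1 < s) : commC s < ∞ := by
  have h1 := dyCmax_lt_top (by linarith) (two_mul_lt_ord s)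
  have h2 := dyCmax_lt_top (s := s - 1) (M := ord s) (by linarith)
    (by have := two_mul_lt_ord s; linarith)
  unfold commC
  finiteness

theorem wt_shift (s : ℝ) (p : ℤ × Fin 3) (c L : ℝ) (hc : 0 ≤ c) (hL : 0 ≤ L) (X : ℝ≥0∞) :
    wt s p * (ofReal (c * ((2 : ℝ) ^ (-p.1) * L)) * X) ^ 2 =
      wt (s - 1) p * (ofReal (c * L) * X) ^ 2 := by
  rw [mul_pow (ofReal (c * (2 ^ (-p.1) * L))), mul_pow (ofReal (c * L)),
    ← mul_assoc (wt s p), ← mul_assoc (wt (s - 1) p)]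
  congr 1
  rw [wt, wt, ← ofReal_pow (by positivity), ← ofReal_pow (by positivity),
    ← ofReal_mul (by positivity), ← ofReal_mul (by positivity)]
  congr 1
  have : (2 : ℝ) ^ (2 * s * (p.1 : ℝ)) = 2 ^ (2 * (s - 1) * (p.1 : ℝ)) * (2 ^ p.1) ^ 2 := by
    rw [← Real.rpow_intCast, ← rpow_natCast, ← rpow_mul (by norm_num),
      ← rpow_add (by norm_num)]
    congr 1; push_cast; ring
  rw [this, zpow_neg]
  have h2 : (2 : ℝ) ^ p.1 ≠ 0 := by positivity
  field_simp

/-- The commutator estimate: `δᴹ(a g) - a δᴹ g` costs one derivative of `a` in `L^∞` and gains one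
derivative on `g`. -/
theorem wsum_comm_le {s : ℝ} (hs1 : 1 < s) {a g : R3 → ℝ} {L B : ℝ} (ha : MemLp a 2 volume)
    (hg : MemLp g 2 volume) (hL : ∀ x h, |a (x + h) - a x| ≤ ‖h‖ * L) (hB : ∀ x, |g x| ≤ B) :
    wsum s (fun p x => (fwdDiff (stp p))^[ord s] (fun y => a y * g y) x -
        a x * (fwdDiff (stp p))^[ord s] g x) ≤
      commC s * (ofReal L ^ 2 * hs (s - 1) g ^ 2 + ofReal B ^ 2 * hs s a ^ 2) := by
  set M := ord s with hM
  have hL0 : 0 ≤ L := by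
    have := (abs_nonneg _).trans (hL 0 (ee 0))
    simpa using this
  have hB0 : 0 ≤ B := (abs_nonneg _).trans (hB 0)
  have hMs := two_mul_lt_ord s
  -- the term without a difference of `a` is the one that the commutator removes
  set A := (Finset.HasAntidiagonal.antidiagonal M).erase (0, M) with hA
  set K : ℕ × ℕ → ℤ × Fin 3 → ℝ≥0∞ := fun q p =>
    if q.1 ≤ q.2 then ofReal (((M.choose q.1 : ℝ) * 2 ^ (q.1 - 1)) * ((2 : ℝ) ^ (-p.1) * L)) *
        eLpNorm ((fwdDiff (stp p))^[q.2] g) 2 volume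
      else ofReal ((M.choose q.1 : ℝ) * (2 ^ q.2 * B)) *
        eLpNorm ((fwdDiff (stp p))^[q.1] a) 2 volume with hK
  have hcard : (A.card : ℝ≥0∞) ≤ (M + 1 : ℕ) := by
    have := Finset.card_erase_le (s := Finset.HasAntidiagonal.antidiagonal M) (a := (0, M))
    rw [Finset.Nat.card_antidiagonal] at this
    exact_mod_cast this
  have h := wsum_le_sum A s
    (G := fun p x => (fwdDiff (stp p))^[M] (fun y => a y * g y) x -
        a x * (fwdDiff (stp p))^[M] g x) (K := K)
    (b := fun _ => (4 ^ M) ^ 2 * (3 * (dyCmax s M + dyCmax (s - 1) M)) *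
      (ofReal L ^ 2 * hs (s - 1) g ^ 2 + ofReal B ^ 2 * hs s a ^ 2)) ?_ ?_
  · rw [Finset.sum_const, nsmul_eq_mul] at h
    refine h.trans ?_
    rw [commC, ← hM]
    calc _ ≤ ((M + 1 : ℕ) : ℝ≥0∞) * (((M + 1 : ℕ) : ℝ≥0∞) * ((4 ^ M) ^ 2 * (3 * (dyCmax s M + dyCmax (s - 1) M)) *
      (ofReal L ^ 2 * hs (s - 1) g ^ 2 + ofReal B ^ 2 * hs s a ^ 2))) := by gcongr
      _ = _ := by ring
  · intro p
    have e : (fun x => (fwdDiff (stp p))^[M] (fun x => a x * g x) x - a x * (fwdDiff (stp p))^[M] g x) =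
        fun x => ∑ q ∈ A,
        (M.choose q.1 : ℝ) * ((fwdDiff (stp p))^[q.1] a x * (fwdDiff (stp p))^[q.2] g (x + q.1 • stp p)) := by
      ext x
      have h0 := Finset.add_sum_erase _ (fun q : ℕ × ℕ => (M.choose q.1 : ℝ) *
        ((fwdDiff (stp p))^[q.1] a x * (fwdDiff (stp p))^[q.2] g (x + q.1 • stp p)))
        (show (0, M) ∈ Finset.HasAntidiagonal.antidiagonal M by simp)
      simp only [Nat.choose_zero_right, Nat.cast_one, one_mul, Function.iterate_zero, id_eq,
        zero_smul, add_zero] at h0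
      rw [fwdDiff_iter_mul, ← h0, add_sub_cancel_left]
    rw [e]
    refine (eLpNorm_sum_le' _ _ fun q _ => ?_).trans (sum_le_sum fun q hq => ?_)
    · refine AEStronglyMeasurable.const_mul ?_ _
      exact (memLp_fwdDiff_iter ha _ _).1.mul
        ((memLp_fwdDiff_iter hg _ _).comp_measurePreserving (measurePreserving_add_right volume _)).1
    · have hq0 : q.1 ≠ 0 := by
        rintro h0
        have h1 := Finset.mem_erase.1 hq
        have h2 := Finset.HasAntidiagonal.mem_antidiagonal.1 h1.2
        exact h1.1 (Prod.ext h0 (by simp; omega))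
      simp only [hK]
      split_ifs with hle
      · obtain ⟨j, hj⟩ := Nat.exists_eq_succ_of_ne_zero hq0
        have hb : ∀ x, |(fwdDiff (stp p))^[q.1] a x| ≤ 2 ^ (q.1 - 1) * ((2 : ℝ) ^ (-p.1) * L) := by
          intro x
          rw [hj, Function.iterate_succ_apply]
          refine abs_fwdDiff_iter_le _ (fun y => ?_) _ _
          have := hL y (stp p)
          rwa [norm_stp] at this
        rw [mul_assoc]
        exact eLpNorm_leibniz_left _ (by positivity) hb (memLp_fwdDiff_iter hg _ _).1 _
      · exact eLpNorm_leibniz_right _ (by positivity) (abs_fwdDiff_iter_le _ hB _) _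
  · intro q hq
    have hq' := Finset.HasAntidiagonal.mem_antidiagonal.1 (Finset.mem_of_mem_erase hq)
    have hord : 0 < M := by rw [hM]; unfold ord; omega
    simp only [hK]
    split_ifs with hle
    · simp_rw [wt_shift s _ _ L (by positivity : (0 : ℝ) ≤ (M.choose q.1 : ℝ) * 2 ^ (q.1 - 1)) hL0]
      rw [tsum_const_mul_sq (s - 1) _ (fun p => (fwdDiff (stp p))^[q.2] g)]
      have hc : ofReal ((M.choose q.1 : ℝ) * 2 ^ (q.1 - 1) * L) ≤ 4 ^ M * ofReal L := by
        refine le_trans (ofReal_le_ofReal ?_) (ofReal_choose_mul_le M q.1 L (by omega) hL0)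
        rw [mul_assoc]
        gcongr
        · norm_num
        · omega
      calc _ ≤ (4 ^ M * ofReal L) ^ 2 * (3 * (dyCmax s M + dyCmax (s - 1) M) * hs (s - 1) g ^ 2) := by
            gcongr
            refine (wsum_diff_le (by linarith) (by omega) hg).trans ?_
            gcongr
            exact (dyC_le_max (by omega) (by omega)).trans le_add_self
        _ = (4 ^ M) ^ 2 * (3 * (dyCmax s M + dyCmax (s - 1) M)) * (ofReal L ^ 2 * hs (s - 1) g ^ 2) := by ring
        _ ≤ _ := by gcongr; exact le_self_add
    · rw [tsum_const_mul_sq s _ (fun p => (fwdDiff (stp p))^[q.1] a)]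
      have hch : M.choose q.1 = M.choose q.2 := by
        rw [← hq', Nat.choose_symm_add]
      rw [hch]
      calc _ ≤ (4 ^ M * ofReal B) ^ 2 * (3 * (dyCmax s M + dyCmax (s - 1) M) * hs s a ^ 2) := by
            gcongr
            · exact ofReal_choose_mul_le M _ _ (by omega) hB0
            · refine (wsum_diff_le (by linarith) (by omega) ha).trans ?_
              gcongr
              exact (dyC_le_max (by omega) (by omega)).trans le_self_add
        _ = (4 ^ M) ^ 2 * (3 * (dyCmax s M + dyCmax (s - 1) M)) * (ofReal B ^ 2 * hs s a ^ 2) := by ring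
        _ ≤ _ := by gcongr; exact le_add_self

/-! ### Composition with power series -/

theorem measurable_freq_rpow (s : ℝ) : Measurable fun ξ => freq ξ ^ s := by
  have := continuous_freq.measurable; fun_prop

theorem hs_add_le (s : ℝ) {f g : R3 → ℝ} (hf : MemLp f 2 volume) (hg : MemLp g 2 volume) :
    hs s (fun x => f x + g x) ≤ hs s f + hs s g := by
  rw [hs, cl_add hf hg]; exact wnorm_add_le (measurable_freq_rpow s) _ _

theorem hs_const_mul (s c : ℝ) {f : R3 → ℝ} (hf : MemLp f 2 volume) :
    hs s (fun x => c * f x) = ofReal |c| * hs s f := by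
  rw [hs, cl_smul c hf, wnorm_smul, hs]
  congr 1
  rw [← ofReal_norm, norm_real, norm_eq_abs]

theorem hs_neg (s : ℝ) {f : R3 → ℝ} (hf : MemLp f 2 volume) : hs s (fun x => -f x) = hs s f := by
  rw [hs, cl_neg hf, wnorm_neg, hs]

theorem hs_sub_le (s : ℝ) {f g : R3 → ℝ} (hf : MemLp f 2 volume) (hg : MemLp g 2 volume) :
    hs s (fun x => f x - g x) ≤ hs s f + hs s g := by
  have := hs_add_le s hf hg.neg
  rw [show hs s (-g) = hs s g from hs_neg s hg] at this
  simpa [sub_eq_add_neg] using this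

theorem memLp_of_abs_le {f g : R3 → ℝ} {C : ℝ} (hg : MemLp g 2 (volume : Measure R3))
    (hf : AEStronglyMeasurable f volume) (h : ∀ x, |f x| ≤ C * |g x|) : MemLp f 2 volume :=
  hg.of_le_mul hf (Eventually.of_forall h)

theorem memLp_mul {f g : R3 → ℝ} {B : ℝ} (hf : AEStronglyMeasurable f (volume : Measure R3))
    (hg : MemLp g 2 (volume : Measure R3))
    (hB : ∀ x, |f x| ≤ B) : MemLp (fun x => f x * g x) 2 volume :=
  memLp_of_abs_le hg (hf.mul hg.1) fun x => by
    rw [abs_mul]; exact mul_le_mul_of_nonneg_right (hB x) (abs_nonneg _)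

theorem memLp_pow_succ {f : R3 → ℝ} {B : ℝ} (hf : MemLp f 2 (volume : Measure R3))
    (hB : ∀ x, |f x| ≤ B) (n : ℕ) : MemLp (fun x => f x ^ (n + 1)) 2 volume := by
  refine memLp_of_abs_le (C := B ^ n) hf (hf.1.pow _) fun x => ?_
  rw [abs_pow, pow_succ]
  exact mul_le_mul_of_nonneg_right (pow_le_pow_left₀ (abs_nonneg _) (hB x) n) (abs_nonneg _)

theorem hs_pow_succ_le {s : ℝ} (hs0 : 0 < s) {f : R3 → ℝ} {B : ℝ} (hf : MemLp f 2 volume)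
    (hB : ∀ x, |f x| ≤ B) (n : ℕ) :
    hs s (fun x => f x ^ (n + 1)) ≤ (2 * prodC s * ofReal B) ^ n * hs s f := by
  induction n with
  | zero => simp
  | succ n ih =>
    have h0 : 0 ≤ B := (abs_nonneg _).trans (hB 0)
    have hBn : ∀ x, |f x ^ (n + 1)| ≤ B ^ (n + 1) := fun x => by
      rw [abs_pow]; exact pow_le_pow_left₀ (abs_nonneg _) (hB x) _
    have h := hs_mul_le hs0 hf (memLp_pow_succ hf hB n) hB hBn
    have e : (fun x => f x ^ (n + 1 + 1)) = fun x => f x * f x ^ (n + 1) := by ext x; ring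
    rw [e]
    refine h.trans ?_
    have h1 : (1 : ℝ≥0∞) ≤ 2 * prodC s := by
      unfold prodC
      calc (1 : ℝ≥0∞) ≤ 2 * 1 := by norm_num
        _ ≤ _ := by gcongr; exact le_add_self
    calc _ ≤ prodC s * (ofReal B * ((2 * prodC s * ofReal B) ^ n * hs s f) +
          ofReal B * ((2 * prodC s * ofReal B) ^ n * hs s f)) := by
          refine mul_le_mul_right (add_le_add (mul_le_mul_right ih _) ?_) _
          rw [ofReal_pow h0, pow_succ', mul_assoc]
          refine mul_le_mul_right (mul_le_mul_left (pow_le_pow_left' ?_ n) _) _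
          calc ofReal B = 1 * ofReal B := (one_mul _).symm
            _ ≤ _ := by gcongr
      _ = _ := by ring

theorem wnorm_le_of_tendsto {a : R3 → ℝ} (ha : Measurable a) {u : ℕ → L2} {w : L2}
    (h : Tendsto u atTop (𝓝 w)) {B : ℝ≥0∞} (hB : ∀ n, wnorm a (u n) ≤ B) : wnorm a w ≤ B := by
  have hF : Tendsto (fun n => (𝓕 (u n) : L2)) atTop (𝓝 (𝓕 w)) :=
    ((fourierCLM ℂ L2).continuous.tendsto w).comp h
  obtain ⟨ns, -, hns⟩ := (tendstoInMeasure_of_tendsto_Lp hF).exists_seq_tendsto_ae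
  refine (Lp.eLpNorm_lim_le_liminf_eLpNorm (f := fun n ξ => ((a ξ : ℝ) : ℂ) * (𝓕 (u (ns n)) : L2) ξ)
    (fun n => aestronglyMeasurable_weight ha _) _ ?_).trans ?_
  · filter_upwards [hns] with ξ hξ
    exact hξ.const_mul _
  · refine (liminf_le_limsup).trans ?_
    exact limsup_le_of_le (by isBoundedDefault) (.of_forall fun n => hB (ns n))

/-- Composition with a power series without constant term, by summing the product estimate. -/
theorem hs_comp_le {s : ℝ} (hs0 : 0 < s) {f : R3 → ℝ} {B : ℝ} (hf : MemLp f 2 volume)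
    (hB : ∀ x, |f x| ≤ B) {a : ℕ → ℝ} {F : ℝ → ℝ}
    (hF : ∀ x, |x| ≤ B → HasSum (fun n => a n * x ^ (n + 1)) (F x))
    (ha : Summable fun n => |a n| * B ^ n) (hFm : MemLp (fun x => F (f x)) 2 volume) :
    hs s (fun x => F (f x)) ≤
      (∑' n, ofReal |a n| * (2 * prodC s * ofReal B) ^ n) * hs s f := by
  have hB0 : 0 ≤ B := (abs_nonneg _).trans (hB 0)
  have hmem : ∀ n, MemLp (fun x => a n * f x ^ (n + 1)) 2 (volume : Measure R3) := fun n =>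
    (memLp_pow_succ hf hB n).const_mul _
  have hP : ∀ N, MemLp (fun x => ∑ n ∈ Finset.range N, a n * f x ^ (n + 1)) 2 (volume : Measure R3) :=
    fun N => memLp_finsetSum _ fun n _ => hmem n
  have hbound : ∀ N, hs s (fun x => ∑ n ∈ Finset.range N, a n * f x ^ (n + 1)) ≤
      ∑ n ∈ Finset.range N, ofReal |a n| * (2 * prodC s * ofReal B) ^ n * hs s f := by
    intro N
    induction N with
    | zero =>
      have : hs s (fun _ => (0 : ℝ)) = 0 := by
        have := hs_const_mul s 0 (f := f) hf
        simpa using this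
      simp [this]
    | succ N ih =>
      simp_rw [Finset.sum_range_succ]
      refine (hs_add_le s (hP N) (hmem N)).trans ?_
      gcongr
      rw [hs_const_mul s (a N) (memLp_pow_succ hf hB N), mul_assoc]
      gcongr
      exact hs_pow_succ_le hs0 hf hB N
  have hlim : Tendsto (fun N => cl fun x => ∑ n ∈ Finset.range N, a n * f x ^ (n + 1)) atTop
      (𝓝 (cl fun x => F (f x))) := by
    rw [tendsto_iff_norm_sub_tendsto_zero]
    have ht := tendsto_sum_nat_add fun n => |a n| * B ^ n
    have ht2 := ht.mul_const ‖cl f‖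
    rw [zero_mul] at ht2
    refine squeeze_zero (fun _ => norm_nonneg _) (fun N => ?_) ht2
    rw [← cl_sub (hP N) hFm]
    refine Lp.norm_le_mul_norm_of_ae_le_mul ?_
    filter_upwards [coeFn_cl ((hP N).sub hFm), coeFn_cl hf] with x h1 h2
    have h1' : (cl (fun x => ∑ n ∈ Finset.range N, a n * f x ^ (n + 1) - F (f x)) : R3 → ℂ) x = _ := h1
    rw [h1', h2, norm_real, norm_real]
    simp only [Pi.sub_apply]
    have hsum := hF (f x) (hB x)
    have hs2 : ∑ n ∈ Finset.range N, a n * f x ^ (n + 1) - F (f x) =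
        -∑' n, a (n + N) * f x ^ (n + N + 1) := by
      rw [← hsum.tsum_eq, ← hsum.summable.sum_add_tsum_nat_add N]; ring
    rw [hs2, norm_neg, ← tsum_mul_right]
    have hterm : ∀ n, ‖a (n + N) * f x ^ (n + N + 1)‖ ≤ |a (n + N)| * B ^ (n + N) * ‖f x‖ := by
      intro n
      rw [norm_mul, norm_pow, pow_succ, ← mul_assoc]
      simp only [norm_eq_abs]
      gcongr
      exact hB x
    have hsm : Summable fun n => |a (n + N)| * B ^ (n + N) * ‖f x‖ :=
      ((summable_nat_add_iff N).2 ha).mul_right _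
    exact tsum_of_norm_bounded hsm.hasSum hterm
  refine wnorm_le_of_tendsto (measurable_freq_rpow s) hlim fun N => (hbound N).trans ?_
  rw [← sum_mul]
  gcongr
  exact ENNReal.sum_le_tsum _

/-! ### Symbols and their kernels -/

/-- Symbols of Mikhlin type with weight `W`: each derivative up to second order in a coordinate
direction costs a factor `‖ξ‖⁻¹`, away from the origin. -/
def IsSymbol (W m : R3 → ℝ) : Prop :=
  ∀ i : Fin 3, ∃ C : ℝ, 0 ≤ C ∧ ∃ m₁ m₂ : R3 → ℝ, ∀ ξ ≠ 0,
    HasDerivAt (fun t : ℝ => m (ξ + t • ee i)) (m₁ ξ) 0 ∧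
    HasDerivAt (fun t : ℝ => m₁ (ξ + t • ee i)) (m₂ ξ) 0 ∧
    |m ξ| ≤ C * W ξ ∧ |m₁ ξ| * ‖ξ‖ ≤ C * W ξ ∧ |m₂ ξ| * ‖ξ‖ ^ 2 ≤ C * W ξ

theorem IsSymbol.mono {W W' m : R3 → ℝ} (h : IsSymbol W m) (hW : ∀ ξ ≠ 0, W ξ ≤ W' ξ) :
    IsSymbol W' m := by
  intro i
  obtain ⟨C, hC, m₁, m₂, H⟩ := h i
  refine ⟨C, hC, m₁, m₂, fun ξ hξ => ?_⟩
  obtain ⟨h1, h2, h3, h4, h5⟩ := H ξ hξ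
  have := mul_le_mul_of_nonneg_left (hW ξ hξ) hC
  exact ⟨h1, h2, h3.trans this, h4.trans this, h5.trans this⟩

theorem IsSymbol.mul {W W' m m' : R3 → ℝ} (h : IsSymbol W m) (h' : IsSymbol W' m') :
    IsSymbol (fun ξ => W ξ * W' ξ) (fun ξ => m ξ * m' ξ) := by
  intro i
  obtain ⟨C, hC, m₁, m₂, H⟩ := h i
  obtain ⟨C', hC', m₁', m₂', H'⟩ := h' i
  refine ⟨4 * (C * C'), by positivity, fun ξ => m₁ ξ * m' ξ + m ξ * m₁' ξ,
    fun ξ => (m₂ ξ * m' ξ + m₁ ξ * m₁' ξ) + (m₁ ξ * m₁' ξ + m ξ * m₂' ξ), fun ξ hξ => ?_⟩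
  obtain ⟨h1, h2, h3, h4, h5⟩ := H ξ hξ
  obtain ⟨h1', h2', h3', h4', h5'⟩ := H' ξ hξ
  have hn : 0 < ‖ξ‖ := norm_pos_iff.2 hξ
  have a0 := mul_le_mul h3 h3' (abs_nonneg _) ((abs_nonneg _).trans h3)
  have a1 := mul_le_mul h4 h3' (abs_nonneg _) ((by positivity : 0 ≤ |m₁ ξ| * ‖ξ‖).trans h4)
  have a2 := mul_le_mul h3 h4' (by positivity) ((abs_nonneg _).trans h3)
  have a3 := mul_le_mul h5 h3' (abs_nonneg _) ((by positivity : 0 ≤ |m₂ ξ| * ‖ξ‖ ^ 2).trans h5)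
  have a4 := mul_le_mul h4 h4' (by positivity) ((by positivity : 0 ≤ |m₁ ξ| * ‖ξ‖).trans h4)
  have a5 := mul_le_mul h3 h5' (by positivity) ((abs_nonneg _).trans h3)
  refine ⟨?_, ?_, ?_, ?_, ?_⟩
  · have := h1.mul h1'
    simp only [zero_smul, add_zero] at this
    exact this
  · have := (h2.mul h1').add (h1.mul h2')
    simp only [zero_smul, add_zero] at this
    exact this
  · rw [abs_mul]; nlinarith [abs_nonneg (m ξ), abs_nonneg (m' ξ)]
  · have := abs_add_le (m₁ ξ * m' ξ) (m ξ * m₁' ξ)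
    rw [abs_mul, abs_mul] at this
    have := mul_le_mul_of_nonneg_right this hn.le
    nlinarith [abs_nonneg (m ξ), abs_nonneg (m' ξ)]
  · have b1 := abs_add_le (m₂ ξ * m' ξ + m₁ ξ * m₁' ξ) (m₁ ξ * m₁' ξ + m ξ * m₂' ξ)
    have b2 := abs_add_le (m₂ ξ * m' ξ) (m₁ ξ * m₁' ξ)
    have b3 := abs_add_le (m₁ ξ * m₁' ξ) (m ξ * m₂' ξ)
    rw [abs_mul, abs_mul] at b2 b3
    have := mul_le_mul_of_nonneg_right (b1.trans (add_le_add b2 b3)) (sq_nonneg ‖ξ‖)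
    nlinarith [abs_nonneg (m ξ), abs_nonneg (m' ξ)]

theorem isSymbol_coord (j : Fin 3) : IsSymbol (fun ξ => ‖ξ‖) (fun ξ => ξ j) := by
  intro i
  refine ⟨1, zero_le_one, fun _ => (ee i) j, fun _ => 0, fun ξ hξ => ⟨?_, ?_, ?_, ?_, ?_⟩⟩
  · have : (fun t : ℝ => (ξ + t • ee i) j) = fun t => ξ j + t * (ee i) j := by
      ext t; simp
    rw [this]
    simpa using ((hasDerivAt_id (0 : ℝ)).mul_const ((ee i) j)).const_add (ξ j)
  · exact hasDerivAt_const _ _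
  · rw [one_mul]; exact PiLp.norm_apply_le ξ j
  · have h : |(ee i) j| ≤ 1 := by
      have := PiLp.norm_apply_le (ee i) j
      simpa using this
    nlinarith [norm_nonneg ξ]
  · simp

theorem norm_add_smul_ee_sq (ξ : R3) (t : ℝ) (i : Fin 3) :
    ‖ξ + t • ee i‖ ^ 2 = ‖ξ‖ ^ 2 + 2 * t * ξ i + t ^ 2 := by
  rw [norm_add_sq_real, real_inner_smul_right, inner_ee, norm_smul]
  simp; ring

/-- Powers of `c + |2πξ|²`, `c ≥ 0`, are symbols; for `c = 0` this needs the restriction `ξ ≠ 0`. -/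
theorem isSymbol_rpow {c : ℝ} (hc : 0 ≤ c) (e : ℝ) :
    IsSymbol (fun ξ => (c + freq ξ ^ 2) ^ e) (fun ξ => (c + freq ξ ^ 2) ^ e) := by
  intro i
  set P : R3 → ℝ := fun ξ => c + freq ξ ^ 2 with hP
  set κ : ℝ := (2 * π) ^ 2 with hκ
  have hκ0 : 0 < κ := by positivity
  have hPd : ∀ ξ, HasDerivAt (fun t : ℝ => P (ξ + t • ee i)) (2 * κ * ξ i) 0 := by
    intro ξ
    have e1 : (fun t : ℝ => P (ξ + t • ee i)) =
        fun t => c + κ * (‖ξ‖ ^ 2 + 2 * t * ξ i + t ^ 2) := by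
      ext t; simp only [hP, freq, mul_pow, norm_add_smul_ee_sq, hκ]
    rw [e1]
    have h1 : HasDerivAt (fun t : ℝ => ‖ξ‖ ^ 2 + 2 * t * ξ i + t ^ 2) (2 * ξ i) 0 := by
      have a := (((hasDerivAt_id (0 : ℝ)).const_mul 2).mul_const (ξ i)).const_add (‖ξ‖ ^ 2)
      have b := (hasDerivAt_id (0 : ℝ)).pow 2
      have := a.add b
      simp at this
      exact this
    have := (h1.const_mul κ).const_add c
    rwa [show κ * (2 * ξ i) = 2 * κ * ξ i by ring] at this
  have hcd : ∀ ξ : R3, HasDerivAt (fun t : ℝ => (ξ + t • ee i) i) 1 0 := by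
    intro ξ
    have : (fun t : ℝ => (ξ + t • ee i) i) = fun t => ξ i + t := by ext t; simp
    rw [this]; exact (hasDerivAt_id (0 : ℝ)).const_add _
  have hPpos : ∀ ξ ≠ 0, 0 < P ξ := fun ξ hξ => by
    have : 0 < ‖ξ‖ := norm_pos_iff.2 hξ
    simp only [hP, freq]; positivity
  have hPle : ∀ ξ, κ * ‖ξ‖ ^ 2 ≤ P ξ := fun ξ => by
    simp only [hP, freq, mul_pow, hκ]; linarith
  have hrd : ∀ r : ℝ, ∀ ξ ≠ 0, HasDerivAt (fun t : ℝ => P (ξ + t • ee i) ^ r)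
      (2 * κ * ξ i * r * P ξ ^ (r - 1)) 0 := by
    intro r ξ hξ
    have := (hPd ξ).rpow_const (p := r) (Or.inl (by simpa using (hPpos ξ hξ).ne'))
    simpa using this
  refine ⟨4 * (|e| + |e * (e - 1)| + 1), by positivity, fun ξ => 2 * κ * ξ i * e * P ξ ^ (e - 1),
    fun ξ => 2 * κ * e * (P ξ ^ (e - 1) + ξ i * (2 * κ * ξ i * (e - 1) * P ξ ^ (e - 1 - 1))), fun ξ hξ => ?_⟩
  have hp := hPpos ξ hξ
  have hn : 0 < ‖ξ‖ := norm_pos_iff.2 hξ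
  have hpe : 0 < P ξ ^ e := Real.rpow_pos_of_pos hp _
  have hxi : |ξ i| ≤ ‖ξ‖ := PiLp.norm_apply_le ξ i
  have r1 : P ξ ^ (e - 1) * (κ * ‖ξ‖ ^ 2) ≤ P ξ ^ e := by
    rw [Real.rpow_sub_one hp.ne', div_mul_eq_mul_div, div_le_iff₀ hp]
    exact mul_le_mul_of_nonneg_left (hPle ξ) hpe.le
  have r2 : P ξ ^ (e - 1 - 1) * (κ * ‖ξ‖ ^ 2) ^ 2 ≤ P ξ ^ e := by
    rw [Real.rpow_sub_one hp.ne', Real.rpow_sub_one hp.ne', div_div, div_mul_eq_mul_div,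
      div_le_iff₀ (by positivity)]
    have : (κ * ‖ξ‖ ^ 2) ^ 2 ≤ P ξ * P ξ := by
      rw [sq]; exact mul_le_mul (hPle ξ) (hPle ξ) (by positivity) hp.le
    exact mul_le_mul_of_nonneg_left this hpe.le
  have hp1 : 0 < P ξ ^ (e - 1) := Real.rpow_pos_of_pos hp _
  have hp2 : 0 < P ξ ^ (e - 1 - 1) := Real.rpow_pos_of_pos hp _
  have hA := abs_nonneg e
  have hB := abs_nonneg (e * (e - 1))
  refine ⟨hrd e ξ hξ, ?_, ?_, ?_, ?_⟩
  · have a := (((hcd ξ).mul (hrd (e - 1) ξ hξ)).const_mul (2 * κ * e))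
    have e1 : (fun t : ℝ => 2 * κ * ((ξ + t • ee i) i) * e * P (ξ + t • ee i) ^ (e - 1)) =
        fun t => 2 * κ * e * (((ξ + t • ee i) i) * P (ξ + t • ee i) ^ (e - 1)) := by
      ext t; ring
    rw [e1]
    simpa using a
  · rw [abs_of_pos hpe]; nlinarith
  · rw [abs_mul, abs_mul, abs_mul, abs_of_pos hp1, abs_of_pos (by positivity : 0 < 2 * κ)]
    calc _ ≤ 2 * κ * ‖ξ‖ * |e| * P ξ ^ (e - 1) * ‖ξ‖ := by gcongr
      _ = 2 * |e| * (P ξ ^ (e - 1) * (κ * ‖ξ‖ ^ 2)) := by ring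
      _ ≤ 2 * |e| * P ξ ^ e := by gcongr
      _ ≤ _ := mul_le_mul_of_nonneg_right (by linarith) hpe.le
  · have t1 : |2 * κ * e * (P ξ ^ (e - 1) + ξ i * (2 * κ * ξ i * (e - 1) * P ξ ^ (e - 1 - 1)))| ≤
        2 * κ * |e| * P ξ ^ (e - 1) + 4 * κ ^ 2 * |e * (e - 1)| * ‖ξ‖ ^ 2 * P ξ ^ (e - 1 - 1) := by
      have : 2 * κ * e * (P ξ ^ (e - 1) + ξ i * (2 * κ * ξ i * (e - 1) * P ξ ^ (e - 1 - 1))) =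
        2 * κ * e * P ξ ^ (e - 1) + 4 * κ ^ 2 * (e * (e - 1)) * (ξ i) ^ 2 * P ξ ^ (e - 1 - 1) := by ring
      rw [this]
      refine (abs_add_le _ _).trans (add_le_add (le_of_eq ?_) ?_)
      · rw [abs_mul, abs_mul, abs_of_pos hp1, abs_of_pos (by positivity : 0 < 2 * κ)]
      · rw [abs_mul, abs_mul, abs_mul, abs_of_pos hp2, abs_of_pos (by positivity : 0 < 4 * κ ^ 2),
          abs_pow]
        gcongr
    calc _ ≤ _ := mul_le_mul_of_nonneg_right t1 (by positivity)
      _ = 2 * |e| * (P ξ ^ (e - 1) * (κ * ‖ξ‖ ^ 2)) +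
          4 * |e * (e - 1)| * (P ξ ^ (e - 1 - 1) * (κ * ‖ξ‖ ^ 2) ^ 2) := by ring
      _ ≤ 2 * |e| * P ξ ^ e + 4 * |e * (e - 1)| * P ξ ^ e := by gcongr
      _ ≤ _ := by nlinarith

/-- The second difference of a function with bounded second derivative. -/
theorem abs_second_diff_le {f f₁ f₂ : ℝ → ℝ} {h B : ℝ} (hh : 0 ≤ h)
    (h1 : ∀ t ∈ Set.Icc (-h) h, HasDerivAt f (f₁ t) t)
    (h2 : ∀ t ∈ Set.Icc (-h) h, HasDerivAt f₁ (f₂ t) t)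
    (hB : ∀ t ∈ Set.Icc (-h) h, |f₂ t| ≤ B) : |f h - 2 * f 0 + f (-h)| ≤ 2 * B * h ^ 2 := by
  have hB0 : 0 ≤ B := (abs_nonneg _).trans (hB 0 ⟨by linarith, hh⟩)
  have hlip : ∀ t ∈ Set.Icc 0 h, |f₁ t - f₁ (-t)| ≤ 2 * B * h := by
    intro t ht
    have := (convex_Icc (-h) h).norm_image_sub_le_of_norm_hasDerivWithin_le
      (fun x hx => (h2 x hx).hasDerivWithinAt) hB (x := -t) (y := t)
      ⟨by linarith [ht.2], by linarith [ht.1]⟩ ⟨by linarith [ht.1], ht.2⟩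
    rw [norm_eq_abs, norm_eq_abs, show t - -t = 2 * t by ring,
      abs_of_nonneg (by linarith [ht.1] : 0 ≤ 2 * t)] at this
    nlinarith [ht.2]
  have := (convex_Icc 0 h).norm_image_sub_le_of_norm_hasDerivWithin_le
    (f := fun t => f t + f (-t)) (f' := fun t => f₁ t - f₁ (-t)) (C := 2 * B * h)
    (fun x hx => by
      have a := h1 x ⟨by linarith [hx.1], hx.2⟩
      have b := (h1 (-x) ⟨by linarith [hx.2], by linarith [hx.1]⟩).comp x (hasDerivAt_neg x)
      have := a.add b
      simp only [mul_neg, mul_one, ← sub_eq_add_neg] at this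
      exact this.hasDerivWithinAt) hlip (x := 0) (y := h) ⟨le_rfl, hh⟩ ⟨hh, le_rfl⟩
  simp only [norm_eq_abs, neg_zero, sub_zero] at this
  rw [abs_of_nonneg hh] at this
  calc _ = |f h + f (-h) - (f 0 + f 0)| := by congr 1; ring
    _ ≤ _ := this
    _ = _ := by ring

theorem jap_zero : jap 0 = 1 := by simp [jap, freq]

theorem IsSymbol.abs_le_jap {m : R3 → ℝ} {b : ℝ} (h : IsSymbol (fun ξ => jap ξ ^ b) m) :
    ∃ C, 0 ≤ C ∧ ∀ ξ, |m ξ| ≤ C * jap ξ ^ b := by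
  obtain ⟨C, hC, m₁, m₂, H⟩ := h 0
  refine ⟨max C |m 0|, le_max_of_le_left hC, fun ξ => ?_⟩
  by_cases hξ : ξ = 0
  · rw [hξ, jap_zero, Real.one_rpow, mul_one]; exact le_max_right _ _
  · refine (H ξ hξ).2.2.1.trans ?_
    have := jap_pos ξ
    gcongr; exact le_max_left _ _

/-- The second differences of a bounded symbol are small away from the origin. -/
theorem IsSymbol.abs_fwdDiff_two_le {m : R3 → ℝ} {b : ℝ} (hb : b ≤ 0)
    (hm : IsSymbol (fun ξ => jap ξ ^ b) m) (i : Fin 3) :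
    ∃ C, 0 ≤ C ∧ ∀ h : ℝ, 0 < h → ∀ ξ, |(fwdDiff (h • ee i))^[2] m ξ| ≤
      C * (1 + ‖h⁻¹ • (ξ + h • ee i)‖ ^ 2)⁻¹ := by
  obtain ⟨C₀, hC₀, H₀⟩ := IsSymbol.abs_le_jap hm
  have H₀' : ∀ ξ, |m ξ| ≤ C₀ := fun ξ => (H₀ ξ).trans
    (mul_le_of_le_one_right hC₀ (Real.rpow_le_one_of_one_le_of_nonpos (one_le_jap ξ) hb))
  obtain ⟨C, hC, m₁, m₂, H⟩ := hm i
  refine ⟨20 * C₀ + 16 * C, by positivity, fun h hh ξ => ?_⟩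
  set η := ξ + h • ee i with hη
  have hy : ‖h⁻¹ • η‖ = ‖η‖ / h := by
    rw [norm_smul, norm_inv, norm_eq_abs, abs_of_pos hh]; field_simp
  have e1 : (fwdDiff (h • ee i))^[2] m ξ = m (η + h • ee i) - 2 * m (η + (0 : ℝ) • ee i) + m (η + (-h) • ee i) := by
    simp only [Function.iterate_succ, Function.iterate_zero, Function.comp, fwdDiff, id, hη]
    rw [show ξ + h • ee i + (-h) • ee i = ξ by simp]
    rw [zero_smul, add_zero]; ring
  rw [hy]
  have hpos : 0 < 1 + (‖η‖ / h) ^ 2 := by positivity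
  rw [← div_eq_mul_inv, le_div_iff₀ hpos]
  -- near the origin there is nothing to gain; elsewhere the second derivative is bounded by `C ‖η‖⁻²`
  by_cases hcase : ‖η‖ ≤ 2 * h
  · have h1 : |(fwdDiff (h • ee i))^[2] m ξ| ≤ 4 * C₀ := by
      have := abs_fwdDiff_iter_le (h • ee i) H₀' 2 ξ
      linarith
    have h2 : (‖η‖ / h) ^ 2 ≤ 4 := by
      have : ‖η‖ / h ≤ 2 := by rwa [div_le_iff₀ hh]
      nlinarith [div_nonneg (norm_nonneg η) hh.le]
    have h3 := abs_nonneg ((fwdDiff (h • ee i))^[2] m ξ)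
    nlinarith
  · push Not at hcase
    have hge : ∀ t ∈ Set.Icc (-h) h, ‖η‖ / 2 ≤ ‖η + t • ee i‖ := by
      intro t ht
      have a := norm_sub_le (η + t • ee i) (t • ee i)
      have b : ‖t • ee i‖ ≤ h := by
        rw [norm_smul]; simpa using abs_le.2 ht
      rw [add_sub_cancel_right] at a
      linarith
    have hηpos : 0 < ‖η‖ := by linarith
    have hne : ∀ t ∈ Set.Icc (-h) h, η + t • ee i ≠ 0 := fun t ht h0 => by
      have := hge t ht; rw [h0, norm_zero] at this; linarith
    have shift : ∀ (g g' : R3 → ℝ) (t : ℝ), HasDerivAt (fun r : ℝ => g (η + t • ee i + r • ee i)) (g' (η + t • ee i)) 0 →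
        HasDerivAt (fun r : ℝ => g (η + r • ee i)) (g' (η + t • ee i)) t := by
      intro g g' t ht
      have := HasDerivAt.comp_sub_const t t (f := fun r : ℝ => g (η + t • ee i + r • ee i))
        (f' := g' (η + t • ee i)) (by simpa using ht)
      refine this.congr_of_eventuallyEq (.of_forall fun r => ?_)
      have e : η + t • ee i + (r - t) • ee i = η + r • ee i := by module
      simp only [e]
    have key := abs_second_diff_le (f := fun t => m (η + t • ee i)) (f₁ := fun t => m₁ (η + t • ee i))
      (f₂ := fun t => m₂ (η + t • ee i)) (B := C * 4 / ‖η‖ ^ 2) hh.le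
      (fun t ht => shift m m₁ t (H _ (hne t ht)).1)
      (fun t ht => shift m₁ m₂ t (H _ (hne t ht)).2.1)
      (fun t ht => by
        have h5 := (H _ (hne t ht)).2.2.2.2
        have h6 : C * jap (η + t • ee i) ^ b ≤ C :=
          mul_le_of_le_one_right hC (Real.rpow_le_one_of_one_le_of_nonpos (one_le_jap _) hb)
        rw [le_div_iff₀ (by positivity)]
        have h7 : ‖η‖ ^ 2 ≤ 4 * ‖η + t • ee i‖ ^ 2 := by
          have := hge t ht; nlinarith
        nlinarith [abs_nonneg (m₂ (η + t • ee i))])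
    rw [e1]
    have hr : 1 ≤ (‖η‖ / h) ^ 2 := by
      have : 1 ≤ ‖η‖ / h := by rw [le_div_iff₀ hh]; linarith
      nlinarith
    calc _ ≤ (2 * (C * 4 / ‖η‖ ^ 2) * h ^ 2) * (2 * (‖η‖ / h) ^ 2) := by
          refine mul_le_mul key (by linarith) hpos.le (by positivity)
      _ = 16 * C := by field_simp; ring
      _ ≤ _ := by linarith

theorem integrable_decay : Integrable (fun y : R3 => ((1 + ‖y‖ ^ 2)⁻¹) ^ 2) := by
  have h := integrable_rpow_neg_one_add_norm_sq (E := R3) (μ := volume) (r := 4) (by simp; norm_num)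
  refine h.congr (.of_forall fun y => ?_)
  have : (0 : ℝ) < 1 + ‖y‖ ^ 2 := by positivity
  simp only
  rw [show (-4 / 2 : ℝ) = -((2 : ℕ) : ℝ) by norm_num, Real.rpow_neg this.le, rpow_natCast, inv_pow]

theorem eLpNorm_sq_decay_le {C h : ℝ} (hh : 0 < h) (i : Fin 3) {F : R3 → ℝ}
    (hF : ∀ ξ, |F ξ| ≤ C * (1 + ‖h⁻¹ • (ξ + h • ee i)‖ ^ 2)⁻¹) :
    eLpNorm F 2 (volume : Measure R3) ^ 2 ≤
      ofReal (C ^ 2 * (h ^ 3 * ∫ y : R3, ((1 + ‖y‖ ^ 2)⁻¹) ^ 2)) := by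
  set g : R3 → ℝ := fun y => ((1 + ‖y‖ ^ 2)⁻¹) ^ 2 with hg
  have hgi : Integrable g := integrable_decay
  have h1 : Integrable (fun ξ => C ^ 2 * g (h⁻¹ • (ξ + h • ee i))) := by
    refine Integrable.const_mul ?_ _
    exact ((integrable_comp_smul_iff volume g (inv_ne_zero hh.ne')).2 hgi).comp_add_right (h • ee i)
  have h2 : ∫ ξ, C ^ 2 * g (h⁻¹ • (ξ + h • ee i)) = C ^ 2 * (h ^ 3 * ∫ y, g y) := by
    rw [integral_const_mul]
    congr 1
    rw [integral_add_right_eq_self (fun ξ => g (h⁻¹ • ξ)), Measure.integral_comp_inv_smul]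
    simp [abs_of_pos hh]
  rw [eLpNorm_two_sq, ← h2, ofReal_integral_eq_lintegral_ofReal h1
    (.of_forall fun ξ => by positivity)]
  refine lintegral_mono fun ξ => ?_
  rw [← ofReal_norm, ← ofReal_pow (norm_nonneg _)]
  refine ofReal_le_ofReal ?_
  rw [norm_eq_abs, hg]
  simp only
  rw [← mul_pow]
  exact pow_le_pow_left₀ (abs_nonneg _) (hF ξ) 2

/-- A symbol with integrable decay lies in `H^a`, as a function of the frequency, for all `a < 3/2`; the proof
of `IsSymbol.kernel_lt_top` needs some `a > 6/5`, and `a = 7/5` is used. -/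
theorem IsSymbol.hs_lt_top {m : R3 → ℝ} (hm : IsSymbol (fun ξ => jap ξ ^ (-4 : ℝ)) m)
    (h2 : MemLp m 2 volume) : hs (7 / 5) m < ∞ := by
  have key : wsum (7 / 5) (fun p => (fwdDiff (stp p))^[2] m) < ∞ := by
    choose C hC H using fun i => hm.abs_fwdDiff_two_le (by norm_num) i
    set I : ℝ := ∫ y : R3, ((1 + ‖y‖ ^ 2)⁻¹) ^ 2 with hI
    have hI0 : 0 ≤ I := integral_nonneg fun y => by positivity
    set E : ℝ := (eLpNorm m 2 volume).toReal with hE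
    have hEe : eLpNorm m 2 volume = ofReal E := (ofReal_toReal h2.2.ne).symm
    have hE0 : 0 ≤ E := toReal_nonneg
    have hd : ∀ h : R3, eLpNorm ((fwdDiff h)^[2] m) 2 volume ≤ ofReal (4 * E) := by
      have h1 : ∀ (f : R3 → ℝ) (h : R3), MemLp f 2 volume →
          eLpNorm (fwdDiff h f) 2 volume ≤ 2 * eLpNorm f 2 volume := by
        intro f h hf
        have := eLpNorm_sub_le (f := fun x => f (x + h)) (g := f) (p := 2) (μ := (volume : Measure R3))
          (hf.comp_measurePreserving (measurePreserving_add_right volume h)).1 hf.1 (by norm_num)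
        rw [eLpNorm_add_right hf.1] at this
        rw [two_mul]; exact this
      intro h
      refine (h1 _ h (memLp_fwdDiff h2 h)).trans ?_
      calc _ ≤ 2 * (2 * eLpNorm m 2 volume) := by gcongr; exact h1 m h h2
        _ = _ := by
          rw [hEe, ofReal_mul (by norm_num), ← mul_assoc]; norm_num
    rw [wsum, ENNReal.tsum_prod', ENNReal.tsum_comm, tsum_fintype]
    refine ENNReal.sum_lt_top.2 fun i _ => ?_
    set b : ℤ → ℝ := fun n => (2 : ℝ) ^ (2 * (7 / 5 : ℝ) * n) *
      min ((4 * E) ^ 2) (C i ^ 2 * (((2 : ℝ) ^ (-n)) ^ 3 * I)) with hb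
    have hmin : ∀ n : ℤ, 0 ≤ min ((4 * E) ^ 2) (C i ^ 2 * (((2 : ℝ) ^ (-n)) ^ 3 * I)) := fun n =>
      le_min (by positivity) (by positivity)
    have hb0 : ∀ n, 0 ≤ b n := fun n => mul_nonneg (by positivity) (hmin n)
    have hbs : Summable b := by
      refine Summable.of_nat_of_neg ?_ ?_
      · have hr : Summable fun n : ℕ => (C i ^ 2 * I) * ((2 : ℝ) ^ (-(1 / 5) : ℝ)) ^ n := by
          refine (summable_geometric_of_lt_one (by positivity) ?_).mul_left _
          exact Real.rpow_lt_one_of_one_lt_of_neg (by norm_num) (by norm_num)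
        refine Summable.of_nonneg_of_le (fun n => hb0 _) (fun n => ?_) hr
        calc b n ≤ (2 : ℝ) ^ (2 * (7 / 5 : ℝ) * n) * (C i ^ 2 * (((2 : ℝ) ^ (-(n : ℤ))) ^ 3 * I)) := by
              simp only [hb]; push_cast
              gcongr
              exact min_le_right _ _
          _ = (C i ^ 2 * I) * ((2 : ℝ) ^ (2 * (7 / 5 : ℝ) * n) * ((2 : ℝ) ^ (-(n : ℤ))) ^ 3) := by ring
          _ = _ := by
            congr 1
            rw [← Real.rpow_intCast, ← rpow_natCast, ← rpow_natCast,
              ← rpow_mul (by norm_num), ← rpow_mul (by norm_num),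
              ← rpow_add (by norm_num)]
            congr 1; push_cast; ring
      · have hr : Summable fun n : ℕ => (4 * E) ^ 2 * ((2 : ℝ) ^ (-(14 / 5) : ℝ)) ^ n := by
          refine (summable_geometric_of_lt_one (by positivity) ?_).mul_left _
          exact Real.rpow_lt_one_of_one_lt_of_neg (by norm_num) (by norm_num)
        refine Summable.of_nonneg_of_le (fun n => hb0 _) (fun n => ?_) hr
        calc b (-n) ≤ (2 : ℝ) ^ (2 * (7 / 5 : ℝ) * (-(n : ℤ) : ℤ)) * (4 * E) ^ 2 := by
              simp only [hb]
              gcongr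
              exact min_le_left _ _
          _ = _ := by
            rw [mul_comm]; congr 1
            rw [← rpow_natCast, ← rpow_mul (by norm_num)]
            congr 1; push_cast; ring
    refine lt_of_le_of_lt (ENNReal.tsum_le_tsum (g := fun n => ofReal (b n)) fun n => ?_) ?_
    · rw [wt, hb]
      simp only
      rw [ofReal_mul (by positivity)]
      gcongr
      rw [ENNReal.ofReal_min]
      refine le_min ?_ ?_
      · rw [ofReal_pow (by positivity)]
        exact pow_le_pow_left' (hd _) 2
      · exact eLpNorm_sq_decay_le (by positivity) i (H i _ (by positivity))
    · rw [← ENNReal.ofReal_tsum_of_nonneg hb0 hbs]; exact ofReal_lt_top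
  have h3 := hs_sq_le_wsum (s := 7 / 5) (by norm_num) 2 h2
  have h4 : hs (7 / 5) m ^ 2 < ∞ := h3.trans_lt (ENNReal.mul_lt_top ofReal_lt_top key)
  by_contra hcon
  rw [not_lt, top_le_iff] at hcon
  rw [hcon] at h4
  simp at h4

theorem IsSymbol.memLp {m : R3 → ℝ} (hm : IsSymbol (fun ξ => jap ξ ^ (-4 : ℝ)) m)
    (hmeas : Measurable m) : MemLp m 2 volume ∧ Integrable m := by
  obtain ⟨C, hC, H⟩ := IsSymbol.abs_le_jap hm
  have hb : ∀ ξ, ‖m ξ‖ ≤ C * ‖((jap ξ ^ (-4 : ℝ) : ℝ) : ℂ)‖ := fun ξ => by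
    rw [norm_real, norm_eq_abs, norm_eq_abs, abs_of_nonneg (rpow_nonneg (jap_pos ξ).le _)]
    exact H ξ
  refine ⟨(memLp_jap_rpow (r := 4) (by norm_num)).of_le_mul hmeas.aestronglyMeasurable
    (Eventually.of_forall hb), ?_⟩
  refine ((integrable_jap_rpow (r := 4) (by norm_num)).const_mul C).mono' hmeas.aestronglyMeasurable
    (Eventually.of_forall H)

/-- `9/10 = 2/5 + 1/2`: splits the `L^{10/9}` norm of a kernel into a weight and the weighted `L²` norm. -/
instance holderTriple_ten_ninths : ENNReal.HolderTriple (5 / 2) 2 (10 / 9) := by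
  constructor
  rw [ENNReal.inv_div (by simp) (by simp), ENNReal.inv_div (by simp) (by simp)]
  have h1 : (2 / 5 : ℝ≥0∞) = ofReal (2 / 5) := by
    rw [ENNReal.ofReal_div_of_pos (by norm_num)]; norm_num
  have h2 : (2⁻¹ : ℝ≥0∞) = ofReal (1 / 2) := by
    rw [ENNReal.ofReal_div_of_pos (by norm_num)]; norm_num
  have h3 : (9 / 10 : ℝ≥0∞) = ofReal (9 / 10) := by
    rw [ENNReal.ofReal_div_of_pos (by norm_num)]; norm_num
  rw [h1, h2, h3, ← ofReal_add (by norm_num) (by norm_num)]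
  norm_num

/-- `1 = 9/10 + 1/10`: the kernel in `L^{10/9}` acts on `L^{10}`. -/
instance holderTriple_one : ENNReal.HolderTriple (10 / 9) 10 1 := by
  constructor
  rw [ENNReal.inv_div (by simp) (by simp)]
  have h1 : (9 / 10 : ℝ≥0∞) = ofReal (9 / 10) := by
    rw [ENNReal.ofReal_div_of_pos (by norm_num)]; norm_num
  have h2 : (10⁻¹ : ℝ≥0∞) = ofReal (1 / 10) := by
    rw [ENNReal.ofReal_div_of_pos (by norm_num)]; norm_num
  rw [h1, h2, ← ofReal_add (by norm_num) (by norm_num)]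
  norm_num

/-- The kernel of a symbol with integrable decay lies in `L^{10/9}`. -/
theorem IsSymbol.kernel_lt_top {m : R3 → ℝ} (hm : IsSymbol (fun ξ => jap ξ ^ (-4 : ℝ)) m)
    (hmeas : Measurable m) :
    eLpNorm (𝓕 fun ξ => ((m ξ : ℝ) : ℂ)) (10 / 9) volume < ∞ := by
  obtain ⟨h2, h1⟩ := hm.memLp hmeas
  have hK : (𝓕 (cl m) : L2) =ᵐ[volume] 𝓕 fun ξ => ((m ξ : ℝ) : ℂ) :=
    fourier_toL2 h1.ofReal (memLp_ofReal h2)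
  rw [← eLpNorm_congr_ae hK]
  have ha : wnorm (fun ξ => 1 + freq ξ ^ (7 / 5 : ℝ)) (cl m) < ∞ := by
    refine (wnorm_add_weight_le measurable_const (measurable_freq_rpow _) _).trans_lt ?_
    rw [wnorm_one]
    exact ENNReal.add_lt_top.2 ⟨(Lp.memLp _).2, hm.hs_lt_top h2⟩
  have hpos : ∀ ξ, 0 < 1 + freq ξ ^ (7 / 5 : ℝ) := fun ξ => by
    have := rpow_nonneg (freq_nonneg ξ) (7 / 5); linarith
  have hw : MemLp (fun ξ => (((1 + freq ξ ^ (7 / 5 : ℝ))⁻¹ : ℝ) : ℂ)) (5 / 2) (volume : Measure R3) := by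
    have hjap : MemLp (fun ξ => jap ξ ^ (-(7 / 5) : ℝ)) (5 / 2) (volume : Measure R3) := by
      refine (integrable_norm_rpow_iff (continuous_jap_rpow _).aestronglyMeasurable
        (by simp) (ENNReal.div_ne_top (by simp) (by simp))).1 ?_
      refine (integrable_jap_rpow (r := 7 / 2) (by norm_num)).congr (.of_forall fun ξ => ?_)
      simp only [norm_eq_abs]
      rw [abs_of_nonneg (rpow_nonneg (jap_pos ξ).le _), ← rpow_mul (jap_pos ξ).le]
      congr 1; rw [ENNReal.toReal_div]; norm_num
    refine memLp_ofReal (hjap.of_le_mul (c := 2 ^ (7 / 5 : ℝ)) ?_ (.of_forall fun ξ => ?_))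
    · exact (measurable_const.add (measurable_freq_rpow _)).inv.aestronglyMeasurable
    · rw [norm_eq_abs, norm_eq_abs, abs_of_pos (inv_pos.2 (hpos ξ)),
        abs_of_nonneg (rpow_nonneg (jap_pos ξ).le _), Real.rpow_neg (jap_pos ξ).le,
        ← div_eq_mul_inv, inv_le_comm₀ (hpos ξ) (by have := jap_pos ξ; positivity), inv_div,
        div_le_iff₀ (by positivity)]
      have hj2 : jap ξ ≤ 2 * max 1 (freq ξ) := by
        have h1 := jap_sq ξ
        have h2 := le_max_left 1 (freq ξ)
        have h3 := le_max_right 1 (freq ξ)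
        have h4 := freq_nonneg ξ
        nlinarith [jap_pos ξ]
      calc jap ξ ^ (7 / 5 : ℝ) ≤ (2 * max 1 (freq ξ)) ^ (7 / 5 : ℝ) :=
            Real.rpow_le_rpow (jap_pos ξ).le hj2 (by norm_num)
        _ = max 1 (freq ξ) ^ (7 / 5 : ℝ) * 2 ^ (7 / 5 : ℝ) := by
            rw [Real.mul_rpow (by norm_num) (le_max_of_le_left zero_le_one), mul_comm]
        _ ≤ _ := by
            gcongr
            rcases le_total 1 (freq ξ) with h | h
            · rw [max_eq_right h]; linarith
            · rw [max_eq_left h, Real.one_rpow]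
              have := rpow_nonneg (freq_nonneg ξ) (7 / 5); linarith
  have h := eLpNorm_smul_le_mul_eLpNorm (p := 5 / 2) (q := 2) (r := 10 / 9)
    (aestronglyMeasurable_weight (a := fun ξ => 1 + freq ξ ^ (7 / 5 : ℝ))
      (measurable_const.add (measurable_freq_rpow (7 / 5))) (cl m)) hw.1
  refine lt_of_le_of_lt (le_of_eq ?_) (h.trans_lt (ENNReal.mul_lt_top hw.2 ha))
  apply eLpNorm_congr_ae (.of_forall fun ξ => ?_)
  simp only [Pi.smul_apply', smul_eq_mul]
  rw [← mul_assoc, ← Complex.ofReal_mul, inv_mul_cancel₀ (hpos ξ).ne', Complex.ofReal_one, one_mul]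

/-- A multiplier with integrable decay maps `L^{10}` to `L^∞`. -/
theorem IsSymbol.enorm_le {m : R3 → ℝ} (hm : IsSymbol (fun ξ => jap ξ ^ (-4 : ℝ)) m)
    (hmeas : Measurable m) {f : R3 → ℝ} (hc : Continuous f) (hf : MemLp f 2 volume) {G : L2} {c : ℂ}
    (hcn : ‖c‖ = 1)
    (hfG : (𝓕 (cl f) : L2) =ᵐ[volume] fun ξ => c * (((m ξ : ℝ) : ℂ) * (𝓕 G : L2) ξ)) (x : R3) :
    ‖f x‖ₑ ≤ eLpNorm (𝓕 fun ξ => ((m ξ : ℝ) : ℂ)) (10 / 9) volume * eLpNorm G 10 volume := by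
  obtain ⟨h2, h1⟩ := hm.memLp hmeas
  have hi : Integrable (𝓕 (cl f) : L2) :=
    ((MemLp.integrable_mul (memLp_ofReal h2) (Lp.memLp (𝓕 G : L2))).const_mul c).congr hfG.symm
  have hx := eq_fourierInv hc hf hi x
  have hr1 : Integrable (fun ξ => chr x ξ * ((m ξ : ℝ) : ℂ)) :=
    memLp_one_iff_integrable.1 (memLp_chr_mul x (memLp_one_iff_integrable.2 h1.ofReal))
  have hr2 := memLp_chr_mul x (memLp_ofReal h2)
  set K : R3 → ℂ := 𝓕 fun ξ => ((m ξ : ℝ) : ℂ) with hK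
  have hKc : Continuous K := VectorFourier.fourierIntegral_continuous Real.continuous_fourierChar
      (by exact (innerSL ℝ).continuous₂) h1.ofReal
  have e : ((f x : ℝ) : ℂ) = c * ∫ y, K (y - x) * G y := by
    rw [hx, Real.fourierInv_eq', ← integral_const_mul]
    have h3 := integral_fourier_mul (toL2 fun ξ => chr x ξ * ((m ξ : ℝ) : ℂ)) G
    calc _ = ∫ ξ, c * (toL2 (fun ξ => chr x ξ * ((m ξ : ℝ) : ℂ)) ξ * (𝓕 G : L2) ξ) := by
          apply integral_congr_ae
          filter_upwards [hfG, coeFn_toL2 hr2] with ξ a b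
          rw [a, b, chr, real_inner_comm ξ x, smul_eq_mul]; ring
      _ = c * ∫ y, (𝓕 (toL2 fun ξ => chr x ξ * ((m ξ : ℝ) : ℂ)) : L2) y * G y := by
          rw [integral_const_mul, h3]
      _ = _ := by
          rw [← integral_const_mul]
          apply integral_congr_ae
          filter_upwards [fourier_toL2 hr1 hr2] with y a
          rw [a, fourier_chr_mul]
  have h4 : ‖f x‖ₑ = ‖((f x : ℝ) : ℂ)‖ₑ := by simp [enorm_eq_nnnorm]
  have hcc : ‖c‖ₑ = 1 := by rw [← ofReal_norm, hcn, ENNReal.ofReal_one]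
  rw [h4, e, enorm_mul, hcc, one_mul]
  refine (enorm_integral_le_lintegral_enorm _).trans ?_
  have hKs : eLpNorm (fun y => K (y - x)) (10 / 9) (volume : Measure R3) = eLpNorm K (10 / 9) volume :=
    eLpNorm_comp_measurePreserving hKc.aestronglyMeasurable (measurePreserving_sub_right volume x)
  have h5 := eLpNorm_smul_le_mul_eLpNorm (p := 10 / 9) (q := 10) (r := 1) (μ := (volume : Measure R3))
    (Lp.aestronglyMeasurable G) (φ := fun y => K (y - x)) (by fun_prop)
  rw [hKs, eLpNorm_one_eq_lintegral_enorm] at h5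
  exact h5

/-! ### Calculus of partial derivatives -/

theorem pd_mul {f g : R3 → ℝ} {x : R3} (hf : DifferentiableAt ℝ f x) (hg : DifferentiableAt ℝ g x)
    (i : Fin 3) : pd i (fun y => f y * g y) x = pd i f x * g x + f x * pd i g x := by
  have : (fun y => f y * g y) = f * g := rfl
  rw [pd, this, fderiv_mul hf hg]; simp [pd]; ring

theorem pd_add {f g : R3 → ℝ} {x : R3} (hf : DifferentiableAt ℝ f x) (hg : DifferentiableAt ℝ g x)
    (i : Fin 3) : pd i (fun y => f y + g y) x = pd i f x + pd i g x := by
  rw [pd, fderiv_fun_add hf hg]; simp [pd]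

theorem pd_sub {f g : R3 → ℝ} {x : R3} (hf : DifferentiableAt ℝ f x) (hg : DifferentiableAt ℝ g x)
    (i : Fin 3) : pd i (fun y => f y - g y) x = pd i f x - pd i g x := by
  rw [pd, fderiv_fun_sub hf hg]; simp [pd]

theorem pd_comp {F : ℝ → ℝ} {F' : ℝ} {f : R3 → ℝ} {x : R3} (hF : HasDerivAt F F' (f x))
    (hf : DifferentiableAt ℝ f x) (i : Fin 3) : pd i (fun y => F (f y)) x = F' * pd i f x := by
  have := (hF.comp_hasFDerivAt x hf.hasFDerivAt).fderiv
  have e : (fun y => F (f y)) = F ∘ f := rfl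
  rw [pd, e, this]; simp [pd]

theorem contDiff_pd {f : R3 → ℝ} {n : ℕ} (hf : ContDiff ℝ ((n + 1 : ℕ) : WithTop ℕ∞) f) (i : Fin 3) :
    ContDiff ℝ (n : WithTop ℕ∞) (pd i f) :=
  (hf.fderiv_right (m := (n : WithTop ℕ∞)) (by norm_cast)).clm_apply contDiff_const

theorem continuous_pd {f : R3 → ℝ} (hf : ContDiff ℝ 1 f) (i : Fin 3) : Continuous (pd i f) :=
  (hf.continuous_fderiv (by norm_num)).clm_apply continuous_const

theorem hasDerivAt_line {f : R3 → ℝ} (hf : Differentiable ℝ f) (i : Fin 3) (x : R3) (t : ℝ) :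
    HasDerivAt (fun r : ℝ => f (x + r • ee i)) (pd i f (x + t • ee i)) t := by
  have h1 : HasDerivAt (fun r : ℝ => x + r • ee i) (ee i) t := by
    simpa using ((hasDerivAt_id t).smul_const (ee i)).const_add x
  exact (hf (x + t • ee i)).hasFDerivAt.comp_hasDerivAt t h1

theorem laplacian_eq_sum_pd {f : R3 → ℝ} (hf : ContDiff ℝ 2 f) (x : R3) :
    Δ f x = ∑ i, pd i (pd i f) x := by
  rw [InnerProductSpace.laplacian_eq_iteratedFDeriv_orthonormalBasis f
    (EuclideanSpace.basisFun (Fin 3) ℝ)]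
  refine sum_congr rfl fun i _ => ?_
  rw [iteratedFDeriv_two_apply]
  have hd : DifferentiableAt ℝ (fderiv ℝ f) x :=
    ((hf.fderiv_right (m := 1) (by norm_num)).differentiable (by norm_num)) x
  have e : pd i f = fun y => (fderiv ℝ f y) (ee i) := rfl
  rw [pd, e, fderiv_clm_apply hd (differentiableAt_const _)]
  simp [EuclideanSpace.basisFun_apply]

theorem integral_mul_pd {f g : R3 → ℝ} (hf : Differentiable ℝ f) (hg : Differentiable ℝ g)
    (i : Fin 3) (h1 : Integrable fun x => pd i f x * g x) (h2 : Integrable fun x => f x * pd i g x)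
    (h3 : Integrable fun x => f x * g x) :
    ∫ x, f x * pd i g x = -∫ x, pd i f x * g x :=
  integral_mul_fderiv_eq_neg_fderiv_mul_of_integrable h1 h2 h3 (fun x _ => hf x) (fun x _ => hg x)

theorem hasCompactSupport_pd {f : R3 → ℝ} (hf : HasCompactSupport f) (i : Fin 3) :
    HasCompactSupport (pd i f) := hf.fderiv_apply (𝕜 := ℝ) _

theorem integral_mul_pd_of_hasCompactSupport {f g : R3 → ℝ} (hf : ContDiff ℝ 1 f)
    (hg : ContDiff ℝ 1 g) (i : Fin 3) (hc : HasCompactSupport f) :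
    ∫ x, f x * pd i g x = -∫ x, pd i f x * g x := by
  refine integral_mul_pd (hf.differentiable (by norm_num)) (hg.differentiable (by norm_num)) i ?_ ?_ ?_
  · exact ((continuous_pd hf i).mul hg.continuous).integrable_of_hasCompactSupport
      (hasCompactSupport_pd hc i).mul_right
  · exact (hf.continuous.mul (continuous_pd hg i)).integrable_of_hasCompactSupport hc.mul_right
  · exact (hf.continuous.mul hg.continuous).integrable_of_hasCompactSupport hc.mul_right

theorem integral_mul_pd_of_memLp {f g : R3 → ℝ} (hf : Differentiable ℝ f) (hg : Differentiable ℝ g)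
    (i : Fin 3) (h1 : MemLp f 2 volume) (h2 : MemLp g 2 volume) (h3 : MemLp (pd i f) 2 volume)
    (h4 : MemLp (pd i g) 2 volume) : ∫ x, f x * pd i g x = -∫ x, pd i f x * g x :=
  integral_mul_pd hf hg i (MemLp.integrable_mul h3 h2) (MemLp.integrable_mul h1 h4)
    (MemLp.integrable_mul h1 h2)

/-! ### Cutoffs -/

/-- A smooth bump, equal to one on the unit ball and supported in the ball of radius two. -/
def bump : ContDiffBump (0 : R3) := ⟨1, 2, one_pos, one_lt_two⟩

/-- The bump at scale `R`. -/
def cut (R : ℝ) (x : R3) : ℝ := bump (R⁻¹ • x)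

theorem contDiff_cut (R : ℝ) {n : ℕ∞} : ContDiff ℝ n (cut R) :=
  bump.contDiff.comp (contDiff_const_smul _)

theorem cut_nonneg (R : ℝ) (x : R3) : 0 ≤ cut R x := bump.nonneg

theorem cut_le_one (R : ℝ) (x : R3) : cut R x ≤ 1 := bump.le_one

theorem abs_cut_le (R : ℝ) (x : R3) : |cut R x| ≤ 1 := by
  rw [abs_of_nonneg (cut_nonneg R x)]; exact cut_le_one R x

theorem cut_eq_one {R : ℝ} (hR : 0 < R) {x : R3} (hx : ‖x‖ ≤ R) : cut R x = 1 := by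
  refine bump.one_of_mem_closedBall ?_
  rw [mem_closedBall_zero_iff, norm_smul, norm_inv, norm_eq_abs, abs_of_pos hR,
    inv_mul_le_iff₀ hR]
  simpa [bump] using hx

theorem hasCompactSupport_cut {R : ℝ} (hR : 0 < R) : HasCompactSupport (cut R) :=
  bump.hasCompactSupport.comp_smul (inv_ne_zero hR.ne')

theorem pd_comp_smul {f : R3 → ℝ} (hf : Differentiable ℝ f) (c : ℝ) (i : Fin 3) (x : R3) :
    pd i (fun y => f (c • y)) x = c * pd i f (c • x) := by
  have h1 : HasFDerivAt (fun y : R3 => c • y) (c • ContinuousLinearMap.id ℝ R3) x :=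
    (hasFDerivAt_id x).const_smul c
  have := ((hf (c • x)).hasFDerivAt.comp x h1).fderiv
  have e : (fun y => f (c • y)) = f ∘ fun y => c • y := rfl
  rw [pd, e, this]; simp [pd]

theorem pd_cut (R : ℝ) (i : Fin 3) : pd i (cut R) = fun x => R⁻¹ * pd i bump (R⁻¹ • x) := by
  ext x
  exact pd_comp_smul (bump.contDiff (n := 1).differentiable (by norm_num)) _ i x

theorem pd_pd_cut (R : ℝ) (i : Fin 3) :
    pd i (pd i (cut R)) = fun x => R⁻¹ ^ 2 * pd i (pd i bump) (R⁻¹ • x) := by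
  ext x
  have hb : ContDiff ℝ 1 (pd i bump) := contDiff_pd (n := 1) bump.contDiff i
  have hd : Differentiable ℝ (pd i bump) := hb.differentiable (by norm_num)
  rw [pd_cut]
  have e1 := pd_comp_smul hd R⁻¹ i x
  have e2 := pd_mul (f := fun _ => R⁻¹) (g := fun y => pd i bump (R⁻¹ • y)) (x := x)
    (differentiableAt_const _) ((hd _).comp x (by fun_prop)) i
  rw [e2, e1]
  simp [pd]; ring

theorem exists_abs_pd_cut_le : ∃ C, 0 ≤ C ∧ ∀ R, 0 < R → ∀ i x, |pd i (cut R) x| ≤ C * R⁻¹ := by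
  have h : ∀ i, ∃ C, ∀ x, |pd i bump x| ≤ C := fun i =>
    (continuous_pd bump.contDiff i).bounded_above_of_compact_support
      (hasCompactSupport_pd bump.hasCompactSupport i)
  choose C hC using h
  have h0 : ∀ i, 0 ≤ C i := fun i => (abs_nonneg _).trans (hC i 0)
  refine ⟨∑ i, C i, sum_nonneg fun i _ => h0 i, fun R hR i x => ?_⟩
  rw [pd_cut, abs_mul, abs_of_pos (inv_pos.2 hR), mul_comm]
  gcongr
  exact (hC i _).trans (single_le_sum (fun i _ => h0 i) (mem_univ i))

theorem exists_lap_cut_le : ∃ C, 0 ≤ C ∧ ∀ R, 0 < R → ∀ x, |∑ i, pd i (pd i (cut R)) x| ≤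
    C * R⁻¹ ^ 2 * (Metric.closedBall (0 : R3) (2 * R)).indicator 1 x := by
  have hcs : ∀ i, HasCompactSupport (pd i (pd i bump)) := fun i =>
    hasCompactSupport_pd (hasCompactSupport_pd bump.hasCompactSupport i) i
  have hb : ∀ i, ContDiff ℝ 1 (pd i bump) := fun i => contDiff_pd (n := 1) bump.contDiff i
  have h : ∀ i, ∃ C, ∀ x, |pd i (pd i bump) x| ≤ C := fun i =>
    (continuous_pd (hb i) i).bounded_above_of_compact_support (hcs i)
  choose C hC using h
  have h0 : ∀ i, 0 ≤ C i := fun i => (abs_nonneg _).trans (hC i 0)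
  refine ⟨∑ i, C i, sum_nonneg fun i _ => h0 i, fun R hR x => ?_⟩
  by_cases hx : x ∈ Metric.closedBall (0 : R3) (2 * R)
  · rw [Set.indicator_of_mem hx, Pi.one_apply, mul_one, sum_mul]
    refine (abs_sum_le_sum_abs _ _).trans (sum_le_sum fun i _ => ?_)
    rw [pd_pd_cut, abs_mul, abs_of_nonneg (by positivity), mul_comm]
    gcongr
    exact hC i _
  · rw [Set.indicator_of_notMem hx, mul_zero]
    have hz : ∀ i, pd i (pd i (cut R)) x = 0 := by
      intro i
      have hsub : tsupport (cut R) ⊆ Metric.closedBall (0 : R3) (2 * R) := by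
        refine closure_minimal (fun y hy => ?_) Metric.isClosed_closedBall
        by_contra hcon
        refine hy ?_
        refine bump.zero_of_le_dist ?_
        rw [mem_closedBall_zero_iff, not_le] at hcon
        rw [dist_zero_right, norm_smul, norm_inv, norm_eq_abs, abs_of_pos hR,
          inv_mul_eq_div, le_div_iff₀ hR]
        simpa [bump] using hcon.le
      have h1 : tsupport (pd i (cut R)) ⊆ tsupport (cut R) := tsupport_fderiv_apply_subset ℝ _
      have h2 : tsupport (pd i (pd i (cut R))) ⊆ tsupport (pd i (cut R)) :=
        tsupport_fderiv_apply_subset ℝ _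
      exact image_eq_zero_of_notMem_tsupport fun hm => hx (hsub (h1 (h2 hm)))
    simp [hz]

theorem tendsto_cut (x : R3) : Tendsto (fun n : ℕ => cut (n + 1) x) atTop (𝓝 1) := by
  refine tendsto_const_nhds.congr' ?_
  filter_upwards [eventually_ge_atTop ⌈‖x‖⌉₊] with n hn
  rw [cut_eq_one (by positivity)]
  have := Nat.le_ceil ‖x‖
  have : (⌈‖x‖⌉₊ : ℝ) ≤ n := by exact_mod_cast hn
  linarith

/-! ### The divergence of a square-integrable vector field -/

/-- Integration by parts for a `C¹` field in `L²` with divergence in `L²`. The single derivatives need not lie in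
`L²`, hence the cutoffs. -/
theorem integral_schwartz_mul_div {V : Fin 3 → R3 → ℝ} (hV : ∀ i, ContDiff ℝ 1 (V i))
    (hV2 : ∀ i, MemLp (V i) 2 volume) (hD : MemLp (fun x => ∑ i, pd i (V i) x) 2 volume)
    (ψ : 𝓢(R3, ℂ)) :
    ∫ x, ψ x * ((∑ i, pd i (V i) x : ℝ) : ℂ) =
      -∑ i, ∫ x, fderiv ℝ ψ x (ee i) * ((V i x : ℝ) : ℂ) := by
  obtain ⟨C, hC, hcut⟩ := exists_abs_pd_cut_le
  have hψ' : ∀ i, MemLp (fun x => fderiv ℝ ψ x (ee i)) 2 (volume : Measure R3) := fun i =>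
    ((LineDeriv.lineDerivOp (ee i) ψ : 𝓢(R3, ℂ)).memLp 2 volume)
  have hψc : ∀ i, Continuous fun x => fderiv ℝ ψ x (ee i) := fun i =>
    ((ψ.smooth 1).continuous_fderiv (by norm_num)).clm_apply continuous_const
  have hdV : ∀ i, Differentiable ℝ (V i) := fun i => (hV i).differentiable (by norm_num)
  -- the identity with a cutoff
  have hn : ∀ n : ℕ, ∫ x, ((cut (n + 1) x : ℝ) : ℂ) * (ψ x * ((∑ i, pd i (V i) x : ℝ) : ℂ)) =
      -∑ i, ∫ x, (((pd i (cut (n + 1)) x : ℝ) : ℂ) * (ψ x * ((V i x : ℝ) : ℂ)) +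
        ((cut (n + 1) x : ℝ) : ℂ) * (fderiv ℝ ψ x (ee i) * ((V i x : ℝ) : ℂ))) := by
    intro n
    set R : ℝ := n + 1 with hR
    have hR0 : 0 < R := by positivity
    have hcs : HasCompactSupport fun x => ((cut R x : ℝ) : ℂ) := (hasCompactSupport_cut hR0).comp_left (g := Complex.ofReal) Complex.ofReal_zero
    have hcd : Differentiable ℝ (cut R) := (contDiff_cut R (n := 1)).differentiable (by norm_num)
    have hcc : Differentiable ℝ fun x => ((cut R x : ℝ) : ℂ) := Complex.ofRealCLM.differentiable.comp hcd
    have hW : ∀ i x, fderiv ℝ (fun y => ((cut R y : ℝ) : ℂ) * ψ y) x (ee i) =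
        ((pd i (cut R) x : ℝ) : ℂ) * ψ x + ((cut R x : ℝ) : ℂ) * fderiv ℝ ψ x (ee i) := by
      intro i x
      have e : (fun y => ((cut R y : ℝ) : ℂ) * ψ y) = (fun y => ((cut R y : ℝ) : ℂ)) * ψ := rfl
      rw [e, fderiv_mul (hcc x) ψ.differentiableAt]
      simp only [add_apply, smul_apply, smul_eq_mul]
      rw [pd_eq_fderiv_ofReal (hcd x)]; ring
    have hi : ∀ i, ∫ x, (((cut R x : ℝ) : ℂ) * ψ x) * ((pd i (V i) x : ℝ) : ℂ) =
        -∫ x, (((pd i (cut R) x : ℝ) : ℂ) * (ψ x * ((V i x : ℝ) : ℂ)) +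
        ((cut R x : ℝ) : ℂ) * (fderiv ℝ ψ x (ee i) * ((V i x : ℝ) : ℂ))) := by
      intro i
      have hVc : Differentiable ℝ fun x => ((V i x : ℝ) : ℂ) :=
        Complex.ofRealCLM.differentiable.comp (hdV i)
      have hpc : Continuous fun x => ((pd i (V i) x : ℝ) : ℂ) :=
        Complex.continuous_ofReal.comp (continuous_pd (hV i) i)
      have hcsp : HasCompactSupport fun x => ((pd i (cut R) x : ℝ) : ℂ) :=
        (hasCompactSupport_pd (hasCompactSupport_cut hR0) i).comp_left (g := Complex.ofReal) Complex.ofReal_zero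
      have hpcc : Continuous fun x => ((pd i (cut R) x : ℝ) : ℂ) :=
        Complex.continuous_ofReal.comp (continuous_pd (contDiff_cut R (n := 1)) i)
      have := integral_mul_fderiv_eq_neg_fderiv_mul_of_integrable (μ := (volume : Measure R3)) (v := ee i)
        (f := fun x => ((cut R x : ℝ) : ℂ) * ψ x) (g := fun x => ((V i x : ℝ) : ℂ)) ?_ ?_ ?_
        (fun x _ => (hcc x).mul ψ.differentiableAt) (fun x _ => hVc x)
      · simp_rw [pd_eq_fderiv_ofReal (hdV i _), hW] at this
        rw [this]
        congr 1; congr 1; ext x; ring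
      · simp_rw [hW, add_mul]
        refine Integrable.add ?_ ?_
        · exact ((hpcc.mul ψ.continuous).mul hVc.continuous).integrable_of_hasCompactSupport
            (hcsp.mul_right.mul_right)
        · exact ((hcc.continuous.mul (hψc i)).mul hVc.continuous).integrable_of_hasCompactSupport
            (hcs.mul_right.mul_right)
      · simp_rw [pd_eq_fderiv_ofReal (hdV i _)]
        exact ((hcc.continuous.mul ψ.continuous).mul hpc).integrable_of_hasCompactSupport
            (hcs.mul_right.mul_right)
      · exact ((hcc.continuous.mul ψ.continuous).mul hVc.continuous).integrable_of_hasCompactSupport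
            (hcs.mul_right.mul_right)
    rw [← sum_neg_distrib]
    simp_rw [← hi]
    rw [← integral_finsetSum]
    · congr 1; ext x; push_cast; rw [mul_sum, mul_sum]
      exact sum_congr rfl fun i _ => by ring
    · intro i _
      have hpc : Continuous fun x => ((pd i (V i) x : ℝ) : ℂ) :=
        Complex.continuous_ofReal.comp (continuous_pd (hV i) i)
      exact ((hcc.continuous.mul ψ.continuous).mul hpc).integrable_of_hasCompactSupport
            (hcs.mul_right.mul_right)
  have hcutn : ∀ (n : ℕ) x, ‖((cut (n + 1) x : ℝ) : ℂ)‖ ≤ 1 := fun n x => by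
    rw [norm_real]; exact abs_cut_le _ x
  have hcutc : ∀ n : ℕ, Continuous fun x => ((cut (n + 1) x : ℝ) : ℂ) := fun n =>
    Complex.continuous_ofReal.comp (contDiff_cut _ (n := 0)).continuous
  have hlimc : ∀ x, Tendsto (fun n : ℕ => ((cut (n + 1) x : ℝ) : ℂ)) atTop (𝓝 1) := fun x => by
    have := (Complex.continuous_ofReal.tendsto 1).comp (tendsto_cut x)
    simpa [Function.comp_def] using this
  have hL : Tendsto (fun n : ℕ => ∫ x, ((cut (n + 1) x : ℝ) : ℂ) * (ψ x * ((∑ i, pd i (V i) x : ℝ) : ℂ)))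
      atTop (𝓝 (∫ x, ψ x * ((∑ i, pd i (V i) x : ℝ) : ℂ))) := by
    have hint : Integrable fun x => ψ x * ((∑ i, pd i (V i) x : ℝ) : ℂ) :=
      MemLp.integrable_mul (ψ.memLp 2 volume) (memLp_ofReal hD)
    refine tendsto_integral_of_dominated_convergence _ (fun n => ?_) hint.norm (fun n => ?_) ?_
    · exact (hcutc n).aestronglyMeasurable.mul hint.1
    · refine .of_forall fun x => ?_
      rw [norm_mul]
      exact mul_le_of_le_one_left (norm_nonneg _) (hcutn n x)
    · refine .of_forall fun x => ?_
      simpa using (hlimc x).mul_const (ψ x * ((∑ i, pd i (V i) x : ℝ) : ℂ))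
  have hRt : Tendsto (fun n : ℕ => -∑ i, ∫ x, (((pd i (cut (n + 1)) x : ℝ) : ℂ) * (ψ x * ((V i x : ℝ) : ℂ)) +
        ((cut (n + 1) x : ℝ) : ℂ) * (fderiv ℝ ψ x (ee i) * ((V i x : ℝ) : ℂ)))) atTop
      (𝓝 (-∑ i, ∫ x, fderiv ℝ ψ x (ee i) * ((V i x : ℝ) : ℂ))) := by
    refine (tendsto_finsetSum _ fun i _ => ?_).neg
    have hint1 : Integrable fun x => ψ x * ((V i x : ℝ) : ℂ) :=
      MemLp.integrable_mul (ψ.memLp 2 volume) (memLp_ofReal (hV2 i))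
    have hint2 : Integrable fun x => fderiv ℝ ψ x (ee i) * ((V i x : ℝ) : ℂ) :=
      MemLp.integrable_mul (hψ' i) (memLp_ofReal (hV2 i))
    have hb : ∀ (n : ℕ) x, ‖((pd i (cut (n + 1)) x : ℝ) : ℂ)‖ ≤ C * ((n : ℝ) + 1)⁻¹ := fun n x => by
      rw [norm_real]; exact hcut (n + 1) (by positivity) i x
    refine tendsto_integral_of_dominated_convergence
      (fun x => C * ‖ψ x * ((V i x : ℝ) : ℂ)‖ + ‖fderiv ℝ ψ x (ee i) * ((V i x : ℝ) : ℂ)‖)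
      (fun n => ?_) ((hint1.norm.const_mul C).add hint2.norm) (fun n => ?_) ?_
    · refine AEStronglyMeasurable.add ?_ ((hcutc n).aestronglyMeasurable.mul hint2.1)
      exact (Complex.continuous_ofReal.comp
        (continuous_pd (contDiff_cut _ (n := 1)) i)).aestronglyMeasurable.mul hint1.1
    · refine .of_forall fun x => (norm_add_le _ _).trans (add_le_add ?_ ?_)
      · rw [norm_mul]
        refine mul_le_mul_of_nonneg_right ((hb n x).trans ?_) (norm_nonneg _)
        refine mul_le_of_le_one_right hC (inv_le_one_of_one_le₀ ?_)
        have : (0 : ℝ) ≤ n := Nat.cast_nonneg n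
        linarith
      · rw [norm_mul]; exact mul_le_of_le_one_left (norm_nonneg _) (hcutn n x)
    · refine .of_forall fun x => ?_
      have h1 : Tendsto (fun n : ℕ => ((pd i (cut (n + 1)) x : ℝ) : ℂ)) atTop (𝓝 0) := by
        refine squeeze_zero_norm (hb · x) ?_
        have := (tendsto_one_div_add_atTop_nhds_zero_nat (𝕜 := ℝ)).const_mul C
        simpa using this
      have := (h1.mul_const (ψ x * ((V i x : ℝ) : ℂ))).add
        ((hlimc x).mul_const (fderiv ℝ ψ x (ee i) * ((V i x : ℝ) : ℂ)))
      simpa using this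
  exact tendsto_nhds_unique (hL.congr hn) hRt

theorem fourier_div {V : Fin 3 → R3 → ℝ} (hV : ∀ i, ContDiff ℝ 1 (V i))
    (hV2 : ∀ i, MemLp (V i) 2 volume) (hD : MemLp (fun x => ∑ i, pd i (V i) x) 2 volume) :
    (𝓕 (cl fun x => ∑ i, pd i (V i) x) : L2) =ᵐ[volume]
      fun ξ => ∑ i, dsym i ξ * (𝓕 (cl (V i)) : L2) ξ := by
  have hloc : ∀ i, LocallyIntegrable (fun ξ => dsym i ξ * (𝓕 (cl (V i)) : L2) ξ) (volume : Measure R3) := by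
    intro i
    have : LocallyIntegrable (𝓕 (cl (V i)) : L2) (volume : Measure R3) :=
      (Lp.memLp _).locallyIntegrable (by norm_num)
    rw [← locallyIntegrableOn_univ] at this ⊢
    exact this.continuousOn_mul (continuous_dsym i).continuousOn isOpen_univ.isLocallyClosed
  refine L2_ext_schwartz ?_ ?_
  · have := locallyIntegrable_finsetSum Finset.univ fun i _ => hloc i
    exact this
  intro ψ
  rw [← integral_fourier_schwartz_mul]
  have hint : ∀ i, Integrable fun ξ => ψ ξ * (dsym i ξ * (𝓕 (cl (V i)) : L2) ξ) := by
    intro i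
    have ht : (dsym i).HasTemperateGrowth := by
      have : (fun ξ : R3 => inner ℝ ξ (ee i)).HasTemperateGrowth := by fun_prop
      have h2 := Function.Complex.hasTemperateGrowth_ofReal.comp this
      have h3 := (Function.HasTemperateGrowth.const (E := R3) (2 * π * I : ℂ)).mul h2
      have e : dsym i = (fun _ : R3 => (2 * π * I : ℂ)) * (Complex.ofReal ∘ fun ξ : R3 => inner ℝ ξ (ee i)) := by
        ext ξ; simp [dsym]; exact (inner_ee ξ i).symm
      rw [e]; exact h3
    have := MemLp.integrable_mul ((SchwartzMap.smulLeftCLM ℂ (dsym i) ψ).memLp 2 volume)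
      (Lp.memLp (𝓕 (cl (V i)) : L2))
    refine this.congr (.of_forall fun ξ => ?_)
    simp only [Pi.mul_apply, SchwartzMap.smulLeftCLM_apply_apply ht, smul_eq_mul]; ring
  simp_rw [mul_sum]
  rw [integral_finsetSum _ fun i _ => hint i]
  simp_rw [integral_schwartz_mul_dsym]
  rw [sum_neg_distrib]
  calc _ = ∫ x, (𝓕 ψ : 𝓢(R3, ℂ)) x * ((∑ i, pd i (V i) x : ℝ) : ℂ) := by
        apply integral_congr_ae; filter_upwards [coeFn_cl hD] with x hx; rw [hx]
    _ = _ := integral_schwartz_mul_div hV hV2 hD _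
    _ = _ := by
        congr 1
        refine sum_congr rfl fun i _ => ?_
        apply integral_congr_ae; filter_upwards [coeFn_cl (hV2 i)] with x hx; rw [hx]

/-! ### The Poisson equation: maximum principle and square integrability -/

theorem pd_pd_nonneg_of_min {f : R3 → ℝ} (hf : ContDiff ℝ 2 f) {x : R3} (hx : ∀ y, f x ≤ f y)
    (i : Fin 3) : 0 ≤ pd i (pd i f) x := by
  by_contra! hneg
  have hd : Differentiable ℝ f := hf.differentiable (by norm_num)
  have hd' : Differentiable ℝ (pd i f) :=
    (contDiff_pd (n := 1) hf i).differentiable (by norm_num)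
  set g : ℝ → ℝ := fun r => f (x + r • ee i) with hg
  have h1 : deriv g = fun r => pd i f (x + r • ee i) := funext fun r => (hasDerivAt_line hd i x r).deriv
  have h2 : deriv (deriv g) 0 = pd i (pd i f) x := by
    rw [h1, (hasDerivAt_line hd' i x 0).deriv]; simp
  have hmin : IsLocalMin g 0 := .of_forall fun r => by simpa [hg] using hx (x + r • ee i)
  have hmax : IsLocalMax g 0 := isLocalMax_of_deriv_deriv_neg (h2 ▸ hneg) hmin.deriv_eq_zero
    (hasDerivAt_line hd i x 0).continuousAt
  have hc : g =ᶠ[𝓝 0] fun _ => g 0 := by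
    filter_upwards [hmin, hmax] with r h3 h4 using le_antisymm h4 h3
  have h3 : deriv g =ᶠ[𝓝 0] fun _ => 0 := by
    have := hc.deriv
    simpa using this
  have h4 : deriv (deriv g) 0 = 0 := by rw [h3.deriv_eq]; simp
  rw [h2] at h4
  exact hneg.ne h4

theorem laplacian_nonneg_of_min {f : R3 → ℝ} (hf : ContDiff ℝ 2 f) {x : R3} (hx : ∀ y, f x ≤ f y) :
    0 ≤ Δ f x := by
  rw [laplacian_eq_sum_pd hf]
  exact sum_nonneg fun i _ => pd_pd_nonneg_of_min hf hx i

/-- The maximum principle for `Δφ = exp φ - (1 + ρ)`. -/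
theorem abs_potential_le {φ ρ : R3 → ℝ} (hφ : ContDiff ℝ 2 φ)
    (h0 : Tendsto φ (cocompact R3) (𝓝 0)) (hP : ∀ x, Δ φ x = Real.exp (φ x) - (1 + ρ x))
    {b : ℝ} (hb : b ≤ 1 / 4) (hρ : ∀ x, |ρ x| ≤ b) (x : R3) : |φ x| ≤ 2 * b := by
  have hb0 : 0 ≤ b := (abs_nonneg _).trans (hρ 0)
  rw [abs_le]
  constructor
  · by_contra! hlt
    have hx0 : φ x < 0 := by linarith
    obtain ⟨y, hy⟩ := hφ.continuous.exists_forall_le' x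
      ((h0.eventually (lt_mem_nhds hx0)).mono fun y hy => hy.le)
    have h1 := laplacian_nonneg_of_min hφ hy
    rw [hP] at h1
    have h2 := (abs_le.1 (hρ y)).1
    have h3 : Real.exp (φ y) < Real.exp (-(2 * b)) := Real.exp_lt_exp.2 ((hy x).trans_lt hlt |>.trans_eq (by ring))
    have h4 : Real.exp (-(2 * b)) * (1 + 2 * b) ≤ 1 := by
      have := Real.add_one_le_exp (2 * b)
      have h5 := Real.exp_pos (-(2 * b))
      calc _ ≤ Real.exp (-(2 * b)) * Real.exp (2 * b) := by gcongr; linarith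
        _ = 1 := by rw [← Real.exp_add]; simp
    nlinarith
  · by_contra! hlt
    have hx0 : 0 < φ x := by linarith
    obtain ⟨y, hy⟩ := hφ.continuous.exists_forall_ge' x
      ((h0.eventually (gt_mem_nhds hx0)).mono fun y hy => hy.le)
    have h1 := laplacian_nonneg_of_min hφ.neg (x := y) (fun z => by simpa using hy z)
    have h6 : Δ (fun y => -φ y) y = -Δ φ y := congrFun InnerProductSpace.laplacian_neg y
    rw [h6, hP] at h1
    have h2 := (abs_le.1 (hρ y)).2
    have h3 := Real.add_one_le_exp (φ y)
    have := hy x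
    linarith

theorem integral_cut {R : ℝ} (hR : 0 < R) :
    ∫ x, cut R x = R ^ 3 * ∫ x : R3, bump x := by
  have := Measure.integral_comp_inv_smul (volume : Measure R3) (fun x => bump x) R
  simp only [finrank_euclideanSpace, Fintype.card_fin, smul_eq_mul] at this
  rw [abs_of_nonneg (by positivity)] at this
  exact this

theorem integrable_cut_mul {R : ℝ} (hR : 0 < R) {f : R3 → ℝ} (hf : Continuous f) :
    Integrable fun x => cut R x * f x :=
  ((contDiff_cut R (n := 0)).continuous.mul hf).integrable_of_hasCompactSupport
    (hasCompactSupport_cut hR).mul_right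

theorem integral_cut_mul_lap {R : ℝ} (hR : 0 < R) {z : R3 → ℝ} (hz : ContDiff ℝ 2 z) :
    ∫ x, cut R x * ∑ i, pd i (pd i z) x = ∫ x, (∑ i, pd i (pd i (cut R)) x) * z x := by
  have hzi : ∀ i, ContDiff ℝ 1 (pd i z) := fun i => contDiff_pd (n := 1) hz i
  have hci : ∀ i, ContDiff ℝ 1 (pd i (cut R)) := fun i =>
    contDiff_pd (n := 1) (contDiff_cut R (n := 2)) i
  have hcs := hasCompactSupport_cut hR
  simp_rw [mul_sum, sum_mul]
  rw [integral_finsetSum, integral_finsetSum]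
  · refine sum_congr rfl fun i _ => ?_
    rw [integral_mul_pd_of_hasCompactSupport (contDiff_cut R (n := 1)) (hzi i) i hcs,
      integral_mul_pd_of_hasCompactSupport (hci i) (hz.of_le (by norm_num)) i
        (hasCompactSupport_pd hcs i), neg_neg]
  · intro i _
    exact ((continuous_pd (hci i) i).mul hz.continuous).integrable_of_hasCompactSupport
      (hasCompactSupport_pd (hasCompactSupport_pd hcs i) i).mul_right
  · intro i _
    exact integrable_cut_mul hR (continuous_pd (hzi i) i)

theorem integrable_of_tendsto_cut {f : R3 → ℝ} (hf : Continuous f) (h0 : ∀ x, 0 ≤ f x) {K : ℝ}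
    (hK : ∀ R, 1 ≤ R → ∫ x, cut R x * f x ≤ K) : Integrable f := by
  refine ⟨hf.aestronglyMeasurable, ?_⟩
  have hb : ∀ n : ℕ, ∫⁻ x, ‖cut (n + 1) x * f x‖ₑ ≤ ofReal K := by
    intro n
    have h1 : (1 : ℝ) ≤ n + 1 := by simp
    rw [← ofReal_integral_norm_eq_lintegral_enorm (integrable_cut_mul (by positivity) hf)]
    refine ofReal_le_ofReal (le_trans (le_of_eq ?_) (hK (n + 1) h1))
    refine integral_congr_ae (.of_forall fun x => ?_)
    exact norm_of_nonneg (mul_nonneg (cut_nonneg _ _) (h0 x))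
  have hl : ∀ x, Tendsto (fun n : ℕ => ‖cut (n + 1) x * f x‖ₑ) atTop (𝓝 ‖f x‖ₑ) := fun x => by
    have := ((tendsto_cut x).mul_const (f x)).enorm
    simpa using this
  have := lintegral_liminf_le' (u := atTop) (μ := (volume : Measure R3)) (f := fun (n : ℕ) x => ‖cut (n + 1) x * f x‖ₑ)
    fun n => ((contDiff_cut _ (n := 0)).continuous.mul hf).aestronglyMeasurable.enorm
  rw [hasFiniteIntegral_iff_enorm]
  calc _ = ∫⁻ x, liminf (fun n : ℕ => ‖cut (n + 1) x * f x‖ₑ) atTop := by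
        congr 1; ext x; exact (hl x).liminf_eq.symm
    _ ≤ _ := this
    _ ≤ ofReal K := by
        refine liminf_le_of_frequently_le' (Frequently.of_forall hb)
    _ < ∞ := ofReal_lt_top

/-- A bounded nonnegative subsolution of `z - Δz ≤ g` with integrable `g` is integrable: test with
cutoffs at scale `R`, and iterate the resulting bound of the mass at scale `R` by `R⁻²` times the
mass at scale `2R` until it beats the trivial bound by `R³`. -/
theorem integrable_of_subsolution {z w g : R3 → ℝ} (hz : ContDiff ℝ 2 z) (hz0 : ∀ x, 0 ≤ z x)
    {M : ℝ} (hzM : ∀ x, z x ≤ M) (hw : Continuous w) (hw0 : ∀ x, 0 ≤ w x) (hgc : Continuous g)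
    (hg : Integrable g) (hg0 : ∀ x, 0 ≤ g x)
    (h : ∀ x, z x + w x ≤ g x + ∑ i, pd i (pd i z) x) : Integrable fun x => z x + w x := by
  obtain ⟨C, hC, hlap⟩ := exists_lap_cut_le
  have hzc := hz.continuous
  have hLc : Continuous fun x => ∑ i, pd i (pd i z) x :=
    continuous_finsetSum _ fun i _ => continuous_pd (contDiff_pd (n := 1) hz i) i
  set G := ∫ x, g x
  set b0 := ∫ x : R3, bump x
  have hb0 : 0 ≤ b0 := integral_nonneg fun x => bump.nonneg
  have hM : 0 ≤ M := (hz0 0).trans (hzM 0)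
  have hG : 0 ≤ G := integral_nonneg hg0
  have hK : ∀ R, 0 < R → ∫ x, cut R x * (z x + w x) ≤ G + C * R⁻¹ ^ 2 * ∫ x, cut (2 * R) x * z x := by
    intro R hR
    have h1 : ∫ x, cut R x * (z x + w x) ≤ ∫ x, (cut R x * g x + cut R x * ∑ i, pd i (pd i z) x) := by
      refine integral_mono (integrable_cut_mul hR (hzc.add hw))
        ((integrable_cut_mul hR hgc).add (integrable_cut_mul hR hLc)) fun x => ?_
      show cut R x * (z x + w x) ≤ cut R x * g x + cut R x * ∑ i, pd i (pd i z) x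
      rw [← mul_add]
      exact mul_le_mul_of_nonneg_left (h x) (cut_nonneg _ _)
    rw [integral_add (integrable_cut_mul hR hgc) (integrable_cut_mul hR hLc)] at h1
    refine h1.trans (add_le_add ?_ ?_)
    · exact integral_mono (integrable_cut_mul hR hgc) hg fun x =>
        mul_le_of_le_one_left (hg0 x) (cut_le_one _ _)
    · rw [integral_cut_mul_lap hR hz, ← integral_const_mul]
      have hci : ∀ i, ContDiff ℝ 1 (pd i (cut R)) := fun i =>
        contDiff_pd (n := 1) (contDiff_cut R (n := 2)) i
      refine integral_mono ?_ ((integrable_cut_mul (by positivity) hzc).const_mul _) fun x => ?_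
      · simp_rw [sum_mul]
        refine integrable_finsetSum _ fun i _ => ?_
        exact ((continuous_pd (hci i) i).mul hzc).integrable_of_hasCompactSupport
          (hasCompactSupport_pd (hasCompactSupport_pd (hasCompactSupport_cut hR) i) i).mul_right
      · show (∑ i, pd i (pd i (cut R)) x) * z x ≤ C * R⁻¹ ^ 2 * (cut (2 * R) x * z x)
        rw [← mul_assoc]
        refine mul_le_mul_of_nonneg_right ((le_abs_self _).trans ((hlap R hR x).trans ?_)) (hz0 x)
        refine mul_le_mul_of_nonneg_left (Set.indicator_le' (fun y hy => ?_) (fun y _ => cut_nonneg _ y) x)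
          (by positivity)
        rw [cut_eq_one (by positivity) (mem_closedBall_zero_iff.1 hy), Pi.one_apply]
  have hI0 : ∀ R, 0 < R → ∫ x, cut R x * z x ≤ M * (R ^ 3 * b0) := by
    intro R hR
    rw [← integral_cut hR, ← integral_const_mul]
    refine integral_mono (integrable_cut_mul hR hzc) ?_ fun x => ?_
    · simpa [mul_comm] using integrable_cut_mul hR (f := fun _ => M) continuous_const
    · show cut R x * z x ≤ M * cut R x
      rw [mul_comm]; exact mul_le_mul_of_nonneg_right (hzM x) (cut_nonneg _ _)
  have hI1 : ∀ R, 0 < R → ∫ x, cut R x * z x ≤ ∫ x, cut R x * (z x + w x) := fun R hR =>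
    integral_mono (integrable_cut_mul hR hzc) (integrable_cut_mul hR (hzc.add hw)) fun x =>
      mul_le_mul_of_nonneg_left (by linarith [hw0 x]) (cut_nonneg _ _)
  refine integrable_of_tendsto_cut (hzc.add hw) (fun x => add_nonneg (hz0 x) (hw0 x))
    (K := G + C * (G + 16 * C * (M * b0))) fun R hR => ?_
  have hR0 : 0 < R := by linarith
  have hinv : R⁻¹ ≤ 1 := inv_le_one_of_one_le₀ hR
  have hinv0 : 0 < R⁻¹ := inv_pos.2 hR0
  have h2 : ∫ x, cut (2 * R) x * z x ≤ G + 16 * C * (M * b0) * R := by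
    refine ((hI1 _ (by positivity)).trans (hK (2 * R) (by positivity))).trans ?_
    have := hI0 (2 * (2 * R)) (by positivity)
    have h3 : C * (2 * R)⁻¹ ^ 2 * ∫ x, cut (2 * (2 * R)) x * z x ≤ C * (2 * R)⁻¹ ^ 2 * (M * ((2 * (2 * R)) ^ 3 * b0)) := by
      gcongr
    refine add_le_add le_rfl (h3.trans (le_of_eq ?_))
    field_simp; ring
  refine (hK R hR0).trans (add_le_add le_rfl ?_)
  calc C * R⁻¹ ^ 2 * ∫ x, cut (2 * R) x * z x ≤ C * R⁻¹ ^ 2 * (G + 16 * C * (M * b0) * R) := by gcongr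
    _ = C * (R⁻¹ ^ 2 * G + 16 * C * (M * b0) * R⁻¹) := by field_simp
    _ ≤ C * (1 * G + 16 * C * (M * b0) * 1) := by
      gcongr
      exact pow_le_one₀ hinv0.le hinv
    _ = _ := by ring

theorem pd_sq {f : R3 → ℝ} (hf : Differentiable ℝ f) (i : Fin 3) :
    pd i (fun y => f y ^ 2) = fun x => 2 * (f x * pd i f x) := by
  ext x
  have : (fun y => f y ^ 2) = fun y => f y * f y := by ext y; ring
  rw [this, pd_mul (hf x) (hf x)]; ring

theorem pd_pd_sq {f : R3 → ℝ} (hf : ContDiff ℝ 2 f) (i : Fin 3) (x : R3) :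
    pd i (pd i (fun y => f y ^ 2)) x = 2 * (pd i f x ^ 2 + f x * pd i (pd i f) x) := by
  have hd : Differentiable ℝ f := hf.differentiable (by norm_num)
  have hd' : Differentiable ℝ (pd i f) := (contDiff_pd (n := 1) hf i).differentiable (by norm_num)
  rw [pd_sq hd, pd_mul (f := fun _ => 2) (g := fun x => f x * pd i f x) (differentiableAt_const _)
    ((hd x).mul (hd' x)), pd_mul (hd x) (hd' x)]
  simp [pd]; ring

theorem mul_exp_sub_one_ge {x : ℝ} (hx : |x| ≤ 1 / 2) : 3 / 4 * x ^ 2 ≤ x * (Real.exp x - 1) := by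
  have h := Real.abs_exp_sub_one_sub_id_le (x := x) (by linarith)
  rw [abs_le] at h hx
  rcases le_total 0 x with h0 | h0
  · nlinarith [Real.add_one_le_exp x]
  · have h1 := Real.quadratic_le_exp_of_nonneg (neg_nonneg.2 h0)
    have h2 : Real.exp x * Real.exp (-x) = 1 := by rw [← Real.exp_add]; simp
    have h3 := Real.exp_pos x
    have h4 : Real.exp x * (1 - x + x ^ 2 / 2) ≤ 1 := by nlinarith
    have h5 : Real.exp x - 1 ≤ 3 / 4 * x := by
      by_contra! hc
      have h6 : (1 + 3 / 4 * x) * (1 - x + x ^ 2 / 2) < Real.exp x * (1 - x + x ^ 2 / 2) :=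
        mul_lt_mul_of_pos_right (by linarith) (by nlinarith)
      have h7 : 0 ≤ x * (-1 / 4 - x / 4 + 3 / 8 * x ^ 2) :=
        mul_nonneg_of_nonpos_of_nonpos h0 (by nlinarith)
      nlinarith
    nlinarith

/-- `z = φ²` is a subsolution, as `Δφ² = 2|∇φ|² + 2φΔφ` and `φ (e^φ - 1) ≥ 3/4 φ²` for `|φ| ≤ 1/2`. -/
theorem integrable_potential_sq {φ ρ : R3 → ℝ} {b : ℝ} (hφ : ContDiff ℝ 2 φ)
    (h0 : Tendsto φ (cocompact R3) (𝓝 0)) (hP : ∀ x, Δ φ x = Real.exp (φ x) - (1 + ρ x))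
    (hb : b ≤ 1 / 4) (hρ : ∀ x, |ρ x| ≤ b) (hρc : Continuous ρ) (hρ2 : MemLp ρ 2 volume) :
    Integrable fun x => φ x ^ 2 + 2 * ∑ i, pd i φ x ^ 2 := by
  have hφb := abs_potential_le hφ h0 hP hb hρ
  have hφb' : ∀ x, |φ x| ≤ 1 / 2 := fun x => (hφb x).trans (by linarith)
  have hpc : ∀ i, Continuous (pd i φ) := fun i => continuous_pd (hφ.of_le (by norm_num)) i
  refine integrable_of_subsolution (g := fun x => 2 * ρ x ^ 2) (M := 1) (hφ.pow 2)
    (fun x => sq_nonneg _) (fun x => ?_)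
    (by fun_prop) (fun x => by positivity) (by fun_prop) (hρ2.integrable_sq.const_mul 2)
    (fun x => by positivity) fun x => ?_
  · have := hφb' x
    rw [abs_le] at this
    nlinarith
  · simp_rw [pd_pd_sq hφ, ← mul_sum, sum_add_distrib, ← mul_sum]
    rw [← laplacian_eq_sum_pd hφ, hP]
    have := mul_exp_sub_one_ge (hφb' x)
    nlinarith [sq_nonneg (φ x - 2 * ρ x)]

/-- The potential and its gradient are square-integrable, although only decay at infinity is assumed. -/
theorem memLp_potential {φ ρ : R3 → ℝ} {b : ℝ} (hφ : ContDiff ℝ 2 φ)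
    (h0 : Tendsto φ (cocompact R3) (𝓝 0)) (hP : ∀ x, Δ φ x = Real.exp (φ x) - (1 + ρ x))
    (hb : b ≤ 1 / 4) (hρ : ∀ x, |ρ x| ≤ b) (hρc : Continuous ρ) (hρ2 : MemLp ρ 2 volume) :
    MemLp φ 2 volume ∧ ∀ i, MemLp (pd i φ) 2 volume := by
  have h := integrable_potential_sq hφ h0 hP hb hρ hρc hρ2
  have hpc : ∀ i, Continuous (pd i φ) := fun i => continuous_pd (hφ.of_le (by norm_num)) i
  refine ⟨?_, fun i => ?_⟩
  · rw [memLp_two_iff_integrable_sq hφ.continuous.aestronglyMeasurable]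
    refine h.mono' (hφ.continuous.pow 2).aestronglyMeasurable (.of_forall fun x => ?_)
    rw [norm_of_nonneg (sq_nonneg _)]
    have : 0 ≤ ∑ i, pd i φ x ^ 2 := sum_nonneg fun i _ => sq_nonneg _
    linarith
  · rw [memLp_two_iff_integrable_sq (hpc i).aestronglyMeasurable]
    refine h.mono' ((hpc i).pow 2).aestronglyMeasurable (.of_forall fun x => ?_)
    rw [norm_of_nonneg (sq_nonneg _)]
    have := single_le_sum (f := fun i => pd i φ x ^ 2) (fun i _ => sq_nonneg _) (mem_univ i)
    have h3 := sq_nonneg (φ x)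
    have h4 := sq_nonneg (pd i φ x)
    linarith

/-! ### The Poisson equation: Sobolev bounds -/

/-- The quadratic part `eˣ - 1 - x` of the exponential. -/
def expRem (x : ℝ) : ℝ := Real.exp x - 1 - x

/-- `φ` is the potential of the small square-integrable density perturbation `ρ`. -/
structure IsPotential (b : ℝ) (ρ φ : R3 → ℝ) : Prop where
  contDiff : ContDiff ℝ 2 φ
  tendsto : Tendsto φ (cocompact R3) (𝓝 0)
  poisson : ∀ x, Δ φ x = Real.exp (φ x) - (1 + ρ x)
  le : b ≤ 1 / 4
  bound : ∀ x, |ρ x| ≤ b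
  continuous : Continuous ρ
  memLp_density : MemLp ρ 2 volume

theorem abs_expRem_sub_le {x y : ℝ} (hx : |x| ≤ 1 / 2) (hy : |y| ≤ 1 / 2) :
    |expRem x - expRem y| ≤ 3 / 4 * |x - y| := by
  have hd : ∀ z ∈ Metric.closedBall (0 : ℝ) (1 / 2), HasDerivWithinAt expRem (Real.exp z - 1)
      (Metric.closedBall (0 : ℝ) (1 / 2)) z := fun z _ =>
    (((Real.hasDerivAt_exp z).sub_const 1).sub (hasDerivAt_id z)).hasDerivWithinAt
  have hb : ∀ z ∈ Metric.closedBall (0 : ℝ) (1 / 2), ‖Real.exp z - 1‖ ≤ 3 / 4 := by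
    intro z hz
    rw [mem_closedBall_zero_iff, norm_eq_abs] at hz
    have h := Real.abs_exp_sub_one_sub_id_le (x := z) (by linarith)
    rw [norm_eq_abs]
    rw [abs_le] at *
    constructor <;> nlinarith
  have := (convex_closedBall (0 : ℝ) (1 / 2)).norm_image_sub_le_of_norm_hasDerivWithin_le hd hb
    (x := y) (y := x) (by simpa using hy) (by simpa using hx)
  simpa using this

theorem abs_expRem_le {x : ℝ} (hx : |x| ≤ 1) : |expRem x| ≤ |x| * |x| := by
  have := Real.abs_exp_sub_one_sub_id_le hx
  rwa [← sq_abs, sq] at this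

theorem sum_dsym_sq (ξ : R3) : ∑ i, dsym i ξ * dsym i ξ = -((freq ξ ^ 2 : ℝ) : ℂ) := by
  have h : freq ξ ^ 2 = ∑ i, (2 * π) ^ 2 * ξ i ^ 2 := by
    rw [freq, mul_pow, EuclideanSpace.norm_sq_eq, mul_sum]
    simp
  rw [h]; push_cast
  rw [← sum_neg_distrib]
  refine sum_congr rfl fun i _ => ?_
  simp only [dsym]
  ring_nf
  rw [Complex.I_sq]; ring

theorem continuous_expRem : Continuous expRem := by unfold expRem; fun_prop

/-- Composition with a function that vanishes to second order at `0` gains a small factor. -/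
theorem hs_comp_quadratic_le {s : ℝ} (hs0 : 0 < s) {f : R3 → ℝ} {B : ℝ} (hf : MemLp f 2 volume)
    (hB : ∀ x, |f x| ≤ B) (hB1 : B ≤ 1 / 2) (hsmall : 4 * prodC s * ofReal B ≤ 1)
    {c : ℕ → ℝ} (hc : ∀ n, |c n| ≤ 1) {F : ℝ → ℝ}
    (hF : ∀ x, |x| ≤ B → HasSum (fun n => c n * x ^ (n + 1)) (c 0 * x + F x))
    (hFm : MemLp (fun x => F (f x)) 2 volume) :
    hs s (fun x => F (f x)) ≤ 4 * prodC s * ofReal B * hs s f := by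
  have hB0 : 0 ≤ B := (abs_nonneg _).trans (hB 0)
  set a : ℕ → ℝ := fun n => if n = 0 then 0 else c n with ha
  have ha1 : ∀ n, |a n| ≤ 1 := fun n => by
    by_cases hn : n = 0
    · simp [ha, hn]
    · simpa [ha, hn] using hc n
  refine (hs_comp_le hs0 hf hB (a := a) (F := F) (fun x hx => ?_) ?_ hFm).trans ?_
  · have h1 := (hF x hx).sub (hasSum_ite_eq 0 (c 0 * x))
    rw [add_sub_cancel_left] at h1
    refine h1.congr_fun fun n => ?_
    by_cases hn : n = 0 <;> simp [ha, hn]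
  · refine Summable.of_nonneg_of_le (fun n => by positivity) (fun n => ?_)
      (summable_geometric_of_lt_one hB0 (by linarith : B < 1))
    exact mul_le_of_le_one_left (by positivity) (ha1 n)
  · set y := 2 * prodC s * ofReal B with hy
    have hy2 : 2 * y = 4 * prodC s * ofReal B := by rw [hy]; ring
    have hy1 : y ≤ 2⁻¹ := by
      rw [ENNReal.le_inv_iff_mul_le, mul_comm, hy2]; exact hsmall
    rw [← hy2]
    gcongr
    rw [tsum_eq_zero_add' ENNReal.summable]
    have h0 : a 0 = 0 := by simp [ha]
    rw [h0, abs_zero, ENNReal.ofReal_zero, zero_mul, zero_add]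
    calc ∑' n, ofReal |a (n + 1)| * y ^ (n + 1) ≤ ∑' n : ℕ, y * y ^ n := by
          refine ENNReal.tsum_le_tsum fun n => ?_
          rw [pow_succ']
          refine (mul_le_mul_left (ENNReal.ofReal_le_one.2 (ha1 _)) _).trans ?_
          rw [one_mul]
      _ = y * (1 - y)⁻¹ := by rw [ENNReal.tsum_mul_left, ENNReal.tsum_geometric]
      _ ≤ y * 2 := by
          gcongr
          rw [ENNReal.inv_le_iff_inv_le]
          refine ENNReal.le_sub_of_add_le_right (ne_top_of_le_ne_top (by simp) hy1) ?_
          calc (2 : ℝ≥0∞)⁻¹ + y ≤ 2⁻¹ + 2⁻¹ := by gcongr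
            _ = 1 := ENNReal.inv_two_add_inv_two
      _ = 2 * y := mul_comm _ _

theorem hasSum_expRem (x : ℝ) :
    HasSum (fun n : ℕ => ((n + 1).factorial : ℝ)⁻¹ * x ^ (n + 1))
      (((0 + 1).factorial : ℝ)⁻¹ * x + expRem x) := by
  have h := NormedSpace.expSeries_div_hasSum_exp x
  rw [← Real.exp_eq_exp_ℝ] at h
  have h2 := (hasSum_nat_add_iff' 1).2 h
  have e : Real.exp x - ∑ i ∈ Finset.range 1, x ^ i / (i.factorial : ℝ) =
      ((0 + 1).factorial : ℝ)⁻¹ * x + expRem x := by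
    simp [expRem]
  rw [e] at h2
  refine h2.congr_fun fun n => ?_
  rw [div_eq_mul_inv, mul_comm]

theorem hasSum_logRem {x : ℝ} (hx : |x| < 1) :
    HasSum (fun n : ℕ => (-1) ^ n / ((n : ℝ) + 1) * x ^ (n + 1))
      ((-1) ^ 0 / (((0 : ℕ) : ℝ) + 1) * x + (Real.log (1 + x) - x)) := by
  have h := (Real.hasSum_pow_div_log_of_abs_lt_one (x := -x) (by rwa [abs_neg])).neg
  simp only [neg_neg, sub_neg_eq_add] at h
  have e : (-1 : ℝ) ^ 0 / (((0 : ℕ) : ℝ) + 1) * x + (Real.log (1 + x) - x) = Real.log (1 + x) := by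
    simp
  rw [e]
  refine h.congr_fun fun n => ?_
  rw [neg_pow x (n + 1), pow_succ (-1 : ℝ) n]
  ring

theorem hs_expRem_le {s : ℝ} (hs0 : 0 < s) {f : R3 → ℝ} {B : ℝ} (hf : MemLp f 2 volume)
    (hB : ∀ x, |f x| ≤ B) (hB1 : B ≤ 1 / 2) (hsmall : 4 * prodC s * ofReal B ≤ 1) :
    hs s (fun x => expRem (f x)) ≤ 4 * prodC s * ofReal B * hs s f := by
  refine hs_comp_quadratic_le hs0 hf hB hB1 hsmall (fun n => ?_) (fun x _ => hasSum_expRem x) ?_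
  · rw [abs_of_nonneg (by positivity)]
    exact inv_le_one_of_one_le₀ (by exact_mod_cast Nat.one_le_iff_ne_zero.2 (Nat.factorial_ne_zero _))
  · refine memLp_of_abs_le (C := 1) hf
      (continuous_expRem.comp_aestronglyMeasurable hf.1) fun x => ?_
    have := hB x
    refine (abs_expRem_le (by linarith)).trans ?_
    exact mul_le_mul_of_nonneg_right (by linarith) (abs_nonneg _)

theorem hs_logRem_le {s : ℝ} (hs0 : 0 < s) {f : R3 → ℝ} {B : ℝ} (hf : MemLp f 2 volume)
    (hB : ∀ x, |f x| ≤ B) (hB1 : B ≤ 1 / 2) (hsmall : 4 * prodC s * ofReal B ≤ 1)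
    (hm : MemLp (fun x => Real.log (1 + f x) - f x) 2 volume) :
    hs s (fun x => Real.log (1 + f x) - f x) ≤ 4 * prodC s * ofReal B * hs s f := by
  refine hs_comp_quadratic_le hs0 (F := fun x => Real.log (1 + x) - x) hf hB hB1 hsmall (fun n => ?_)
    (fun x hx => hasSum_logRem (by linarith)) hm
  rw [abs_div, abs_pow, abs_neg, abs_one, one_pow]
  rw [abs_of_pos (by positivity)]
  exact div_le_one_of_le₀ (by linarith [n.cast_nonneg (α := ℝ)]) (by positivity)

theorem hs_expRem_lt_top {s : ℝ} (hs0 : 0 < s) {f : R3 → ℝ} {B : ℝ} (hf : MemLp f 2 volume)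
    (hB : ∀ x, |f x| ≤ B) (hm : MemLp (fun x => expRem (f x)) 2 volume) (hfin : hs s f < ∞) :
    hs s (fun x => expRem (f x)) < ∞ := by
  have hB0 : 0 ≤ B := (abs_nonneg _).trans (hB 0)
  have hfac : ∀ n : ℕ, ((n + 1).factorial : ℝ)⁻¹ ≤ (n.factorial : ℝ)⁻¹ := fun n => by
    gcongr; exact n.le_succ
  set a : ℕ → ℝ := fun n => if n = 0 then 0 else ((n + 1).factorial : ℝ)⁻¹ with ha
  have ha1 : ∀ n, |a n| ≤ (n.factorial : ℝ)⁻¹ := fun n => by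
    by_cases hn : n = 0
    · simp [ha, hn]
    · simp only [ha, hn, if_false]
      rw [abs_of_nonneg (by positivity)]; exact hfac n
  have hsum : ∀ y : ℝ, 0 ≤ y → Summable fun n => |a n| * y ^ n := fun y hy => by
    refine Summable.of_nonneg_of_le (fun n => by positivity) (fun n => ?_)
      (Real.summable_pow_div_factorial y)
    rw [div_eq_inv_mul]
    exact mul_le_mul_of_nonneg_right (ha1 n) (by positivity)
  refine (hs_comp_le hs0 hf hB (a := a) (F := expRem) (fun x _ => ?_) (hsum B hB0) hm).trans_lt ?_
  · have h1 := (hasSum_expRem x).sub (hasSum_ite_eq 0 (((0 + 1).factorial : ℝ)⁻¹ * x))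
    rw [add_sub_cancel_left] at h1
    refine h1.congr_fun fun n => ?_
    by_cases hn : n = 0 <;> simp [ha, hn]
  · refine ENNReal.mul_lt_top ?_ hfin
    set y := 2 * prodC s * ofReal B
    have hy : y ≠ ∞ := ENNReal.mul_ne_top (ENNReal.mul_ne_top (by simp) (prodC_lt_top hs0).ne) (by simp)
    have h2 := (hsum y.toReal toReal_nonneg).tsum_ofReal_lt_top
    refine lt_of_le_of_lt (le_of_eq ?_) h2
    refine tsum_congr fun n => ?_
    rw [ofReal_mul (abs_nonneg _), ofReal_pow toReal_nonneg, ofReal_toReal hy]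

namespace IsPotential

variable {b : ℝ} {ρ φ : R3 → ℝ} (h : IsPotential b ρ φ)
include h

theorem abs_le (x : R3) : |φ x| ≤ 2 * b :=
  abs_potential_le h.contDiff h.tendsto h.poisson h.le h.bound x

theorem abs_le_half (x : R3) : |φ x| ≤ 1 / 2 := (h.abs_le x).trans (by linarith [h.le])

theorem memLp : MemLp φ 2 volume :=
  (memLp_potential h.contDiff h.tendsto h.poisson h.le h.bound h.continuous h.memLp_density).1

theorem memLp_pd (i : Fin 3) : MemLp (pd i φ) 2 volume :=
  (memLp_potential h.contDiff h.tendsto h.poisson h.le h.bound h.continuous h.memLp_density).2 i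

theorem memLp_rem : MemLp (fun x => expRem (φ x)) 2 volume := by
  refine memLp_of_abs_le (C := 1) h.memLp
    (continuous_expRem.comp_aestronglyMeasurable h.memLp.1) fun x => ?_
  have := h.abs_le_half x
  refine (abs_expRem_le (by linarith)).trans ?_
  exact mul_le_mul_of_nonneg_right (by linarith) (abs_nonneg _)

theorem memLp_source : MemLp (fun x => ρ x - expRem (φ x)) 2 volume :=
  h.memLp_density.sub h.memLp_rem

theorem fourier : (fun ξ => ((jap ξ ^ 2 : ℝ) : ℂ) * (𝓕 (cl φ) : L2) ξ) =ᵐ[volume]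
    (𝓕 (cl fun x => ρ x - expRem (φ x)) : L2) := by
  have hd : Differentiable ℝ φ := h.contDiff.differentiable (by norm_num)
  have e : (fun x => ∑ i, pd i (pd i φ) x) = fun x => φ x - (ρ x - expRem (φ x)) := by
    ext x
    rw [← laplacian_eq_sum_pd h.contDiff, h.poisson, expRem]; ring
  have hm : MemLp (fun x => φ x - (ρ x - expRem (φ x))) 2 volume := h.memLp.sub h.memLp_source
  have h1 := fourier_div (V := fun i => pd i φ) (fun i => contDiff_pd (n := 1) h.contDiff i)
    h.memLp_pd (by rw [e]; exact hm)
  rw [e, cl_sub h.memLp h.memLp_source] at h1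
  have h2 : (𝓕 (cl φ - cl fun x => ρ x - expRem (φ x)) : L2) =
    𝓕 (cl φ) - 𝓕 (cl fun x => ρ x - expRem (φ x)) := map_sub (fourierCLM ℂ L2) _ _
  rw [h2] at h1
  have h3 : ∀ᵐ ξ : R3, ∀ i, (𝓕 (cl (pd i φ)) : L2) ξ = dsym i ξ * (𝓕 (cl φ) : L2) ξ :=
    ae_all_iff.2 fun i => fourier_pd hd h.memLp (h.memLp_pd i)
  filter_upwards [h1, h3, Lp.coeFn_sub (𝓕 (cl φ) : L2) (𝓕 (cl fun x => ρ x - expRem (φ x)))]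
    with ξ h4 h5 h6
  rw [h6] at h4
  simp only [Pi.sub_apply, h5, ← mul_assoc, ← sum_mul, sum_dsym_sq] at h4
  rw [jap_sq]
  push_cast at h4 ⊢
  linear_combination h4

theorem wnorm_le {a c : R3 → ℝ} (hac : ∀ ξ, |a ξ| ≤ |c ξ| * jap ξ ^ 2) :
    wnorm a (cl φ) ≤ wnorm c (cl fun x => ρ x - expRem (φ x)) := by
  refine eLpNorm_mono_ae ?_
  filter_upwards [h.fourier] with ξ hξ
  rw [← hξ]
  simp only [norm_mul, norm_real, norm_eq_abs]
  rw [abs_of_nonneg (sq_nonneg (jap ξ)), ← mul_assoc]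
  exact mul_le_mul_of_nonneg_right (hac ξ) (norm_nonneg _)

theorem hs_le_two {r : ℝ} (hr : 0 ≤ r) (hr2 : r ≤ 2) :
    hs r φ ≤ eLpNorm (fun x => ρ x - expRem (φ x)) 2 volume := by
  rw [← eLpNorm_coe_cl h.memLp_source, ← wnorm_one]
  refine h.wnorm_le fun ξ => ?_
  rw [abs_of_nonneg (rpow_nonneg (freq_nonneg ξ) _), abs_one, one_mul, ← rpow_natCast]
  exact (Real.rpow_le_rpow (freq_nonneg ξ) (freq_le_jap ξ) hr).trans
    (Real.rpow_le_rpow_of_exponent_le (one_le_jap ξ) (by simpa using hr2))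

theorem hs_le_sub_two {r : ℝ} (hr2 : 2 ≤ r) :
    hs r φ ≤ hs (r - 2) (fun x => ρ x - expRem (φ x)) := by
  refine h.wnorm_le fun ξ => ?_
  rw [abs_of_nonneg (rpow_nonneg (freq_nonneg ξ) _),
    abs_of_nonneg (rpow_nonneg (freq_nonneg ξ) _)]
  rcases eq_or_lt_of_le (freq_nonneg ξ) with h0 | h0
  · rw [← h0, Real.zero_rpow (by linarith)]
    exact mul_nonneg (rpow_nonneg le_rfl _) (sq_nonneg _)
  · calc freq ξ ^ r = freq ξ ^ (r - 2) * freq ξ ^ 2 := by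
          rw [← rpow_natCast (freq ξ) 2, ← rpow_add h0]; congr 1; push_cast; ring
      _ ≤ _ := by gcongr; exact freq_le_jap ξ

theorem hs_le_source {r : ℝ} : hs r φ ≤ hs r (fun x => ρ x - expRem (φ x)) := by
  refine h.wnorm_le fun ξ => ?_
  refine le_mul_of_one_le_right (abs_nonneg _) ?_
  exact one_le_pow₀ (one_le_jap ξ)

/-- Elliptic regularity: the potential is as regular as the density. -/
theorem hs_lt_top {s : ℝ} (hfin : hs s ρ < ∞) {r : ℝ} (hr : 0 < r) (hrs : r ≤ s) : hs r φ < ∞ := by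
  -- each use of the equation gains two derivatives
  have key : ∀ n : ℕ, ∀ r : ℝ, 0 < r → r ≤ 2 * n + 2 → r ≤ s → hs r φ < ∞ := by
    intro n
    induction n with
    | zero =>
      intro r hr hr2 _
      exact (h.hs_le_two hr.le (by simpa using hr2)).trans_lt h.memLp_source.2
    | succ n ih =>
      intro r hr hr2 hrs
      push_cast at hr2
      rcases le_or_gt r 2 with h2 | h2
      · exact (h.hs_le_two hr.le h2).trans_lt h.memLp_source.2
      · refine (h.hs_le_sub_two h2.le).trans_lt ((hs_sub_le _ h.memLp_density h.memLp_rem).trans_lt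
          (ENNReal.add_lt_top.2 ⟨?_, ?_⟩))
        · have : hs (r - 2) ρ ≤ wnorm (fun ξ => 1 + freq ξ ^ s) (cl ρ) := by
            refine wnorm_mono (fun ξ => ?_) _
            rw [abs_of_nonneg (rpow_nonneg (freq_nonneg ξ) _),
              abs_of_nonneg (by have := rpow_nonneg (freq_nonneg ξ) s; positivity)]
            rcases le_or_gt (freq ξ) 1 with h3 | h3
            · have := Real.rpow_le_one (freq_nonneg ξ) h3 (by linarith : 0 ≤ r - 2)
              have := rpow_nonneg (freq_nonneg ξ) s
              linarith
            · have := Real.rpow_le_rpow_of_exponent_le h3.le (by linarith : r - 2 ≤ s)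
              linarith
          refine this.trans_lt ((wnorm_add_weight_le (a := fun _ => 1) measurable_const
            (measurable_freq_rpow s) _).trans_lt (ENNReal.add_lt_top.2 ⟨?_, hfin⟩))
          rw [wnorm_one]
          exact Lp.eLpNorm_lt_top _
        · exact hs_expRem_lt_top (by linarith) h.memLp h.abs_le h.memLp_rem
            (ih _ (by linarith) (by linarith) (by linarith))
  obtain ⟨n, hn⟩ := exists_nat_ge r
  exact key n r hr (by linarith [n.cast_nonneg (α := ℝ)]) hrs

theorem hs_rem_le {s : ℝ} (hs0 : 0 < s) (hfin : hs s ρ < ∞)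
    (hsmall : 8 * prodC s * ofReal (2 * b) ≤ 1) :
    hs s (fun x => expRem (φ x)) ≤ 8 * prodC s * ofReal (2 * b) * hs s ρ := by
  set y := 4 * prodC s * ofReal (2 * b) with hy
  have hy2 : 2 * y = 8 * prodC s * ofReal (2 * b) := by rw [hy]; ring
  have hy1 : 2 * y ≤ 1 := hy2.trans_le hsmall
  have h1 : hs s (fun x => expRem (φ x)) ≤ y * hs s φ :=
    hs_expRem_le hs0 h.memLp h.abs_le (by linarith [h.le])
      ((le_mul_of_one_le_left (by positivity) (by norm_num)).trans hy1)
  have hfφ := h.hs_lt_top hfin hs0 le_rfl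
  have h2 : hs s φ ≤ hs s ρ + y * hs s φ :=
    h.hs_le_source.trans ((hs_sub_le _ h.memLp_density h.memLp_rem).trans (by gcongr))
  have h3 : hs s φ ≤ 2 * hs s ρ := by
    have h4 : hs s φ + hs s φ ≤ 2 * hs s ρ + hs s φ := by
      calc hs s φ + hs s φ = 2 * hs s φ := (two_mul _).symm
        _ ≤ 2 * (hs s ρ + y * hs s φ) := by gcongr
        _ = 2 * hs s ρ + (2 * y) * hs s φ := by ring
        _ ≤ 2 * hs s ρ + 1 * hs s φ := by gcongr
        _ = _ := by rw [one_mul]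
    exact (ENNReal.add_le_add_iff_right hfφ.ne).1 h4
  calc _ ≤ y * (2 * hs s ρ) := h1.trans (by gcongr)
    _ = _ := by rw [← hy2]; ring

end IsPotential

theorem IsPotential.eLpNorm_sub_source_le {b b' : ℝ} {ρ φ ρ' φ' : R3 → ℝ} (h : IsPotential b ρ φ)
    (h' : IsPotential b' ρ' φ') {a : R3 → ℝ} (ha : ∀ ξ, |a ξ| ≤ jap ξ ^ 2) :
    wnorm a (cl φ - cl φ') ≤
      eLpNorm (fun x => (ρ x - expRem (φ x)) - (ρ' x - expRem (φ' x))) 2 volume := by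
  rw [← eLpNorm_coe_cl (f := fun x => (ρ x - expRem (φ x)) - (ρ' x - expRem (φ' x)))
    (h.memLp_source.sub h'.memLp_source), ← eLpNorm_fourier, cl_sub h.memLp_source h'.memLp_source]
  have h2 : ∀ u w : L2, (𝓕 (u - w) : L2) = 𝓕 u - 𝓕 w := fun u w => map_sub (fourierCLM ℂ L2) _ _
  refine eLpNorm_mono_ae ?_
  rw [h2, h2]
  filter_upwards [h.fourier, h'.fourier, Lp.coeFn_sub (𝓕 (cl φ) : L2) (𝓕 (cl φ')),
    Lp.coeFn_sub (𝓕 (cl fun x => ρ x - expRem (φ x)) : L2) (𝓕 (cl fun x => ρ' x - expRem (φ' x)))]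
    with ξ h3 h4 h5 h6
  rw [h5, h6, Pi.sub_apply, Pi.sub_apply, ← h3, ← h4, ← mul_sub, norm_mul, norm_mul,
    norm_real, norm_real, norm_eq_abs, norm_eq_abs,
    abs_of_nonneg (sq_nonneg (jap ξ))]
  exact mul_le_mul_of_nonneg_right (ha ξ) (norm_nonneg _)

/-- Absorption: the nonlinear part of the source has Lipschitz constant `3/4` in `φ`. -/
theorem IsPotential.eLpNorm_sub_source_le_density {b b' : ℝ} {ρ φ ρ' φ' : R3 → ℝ}
    (h : IsPotential b ρ φ) (h' : IsPotential b' ρ' φ') :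
    eLpNorm (fun x => (ρ x - expRem (φ x)) - (ρ' x - expRem (φ' x))) 2 volume ≤
      4 * eLpNorm (fun x => ρ x - ρ' x) 2 volume := by
  set N := eLpNorm (fun x => (ρ x - expRem (φ x)) - (ρ' x - expRem (φ' x))) 2 (volume : Measure R3)
  have hN : N < ∞ := (h.memLp_source.sub h'.memLp_source).2
  have hφ : eLpNorm (fun x => φ x - φ' x) 2 volume ≤ N := by
    have h1 := h.eLpNorm_sub_source_le h' (a := fun _ => 1) fun ξ => by
      rw [abs_one]; exact one_le_pow₀ (one_le_jap ξ)
    rw [wnorm_one, ← cl_sub h.memLp h'.memLp, eLpNorm_coe_cl (f := fun x => φ x - φ' x) (h.memLp.sub h'.memLp)] at h1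
    exact h1
  have hr : eLpNorm (fun x => expRem (φ' x) - expRem (φ x)) 2 volume ≤ ofReal (3 / 4) * N := by
    refine (eLpNorm_le_mul_eLpNorm_of_ae_le_mul (.of_forall fun x => ?_) 2).trans
      (mul_le_mul_right hφ _)
    have := abs_expRem_sub_le (h'.abs_le_half x) (h.abs_le_half x)
    rwa [abs_sub_comm (φ' x)] at this
  have hsum : N ≤ eLpNorm (fun x => ρ x - ρ' x) 2 volume + ofReal (3 / 4) * N := by
    have e : (fun x => (ρ x - expRem (φ x)) - (ρ' x - expRem (φ' x))) =
      (fun x => ρ x - ρ' x) + fun x => expRem (φ' x) - expRem (φ x) := by ext x; simp; ring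
    simp only [N, e]
    refine (eLpNorm_add_le (h.memLp_density.sub h'.memLp_density).1
          (h'.memLp_rem.sub h.memLp_rem).1 (by norm_num)).trans ?_
    rw [← e]
    exact add_le_add le_rfl hr
  have h4 : (4 : ℝ≥0∞) * ofReal (3 / 4) = 3 := by
    rw [show (4 : ℝ≥0∞) = ofReal 4 by simp, ← ofReal_mul (by norm_num)]
    norm_num
  have h5 : N + 3 * N ≤ 4 * eLpNorm (fun x => ρ x - ρ' x) 2 volume + 3 * N := by
    calc N + 3 * N = 4 * N := by ring
      _ ≤ 4 * (eLpNorm (fun x => ρ x - ρ' x) 2 volume + ofReal (3 / 4) * N) := by gcongr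
      _ = _ := by rw [mul_add, ← mul_assoc, h4]
  exact (ENNReal.add_le_add_iff_right (ENNReal.mul_ne_top (by simp) hN.ne)).1 h5

/-- The potential depends on the density in a Lipschitz way, in `L²`. -/
theorem IsPotential.eLpNorm_sub_le {b b' : ℝ} {ρ φ ρ' φ' : R3 → ℝ}
    (h : IsPotential b ρ φ) (h' : IsPotential b' ρ' φ') :
    eLpNorm (fun x => φ x - φ' x) 2 volume ≤ 4 * eLpNorm (fun x => ρ x - ρ' x) 2 volume := by
  have h1 := h.eLpNorm_sub_source_le h' (a := fun _ => 1) fun ξ => by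
      rw [abs_one]; exact one_le_pow₀ (one_le_jap ξ)
  rw [wnorm_one, ← cl_sub h.memLp h'.memLp, eLpNorm_coe_cl (f := fun x => φ x - φ' x) (h.memLp.sub h'.memLp)] at h1
  exact h1.trans (h.eLpNorm_sub_source_le_density h')

theorem IsPotential.eLpNorm_pd_sub_le {b b' : ℝ} {ρ φ ρ' φ' : R3 → ℝ}
    (h : IsPotential b ρ φ) (h' : IsPotential b' ρ' φ') (i : Fin 3) :
    eLpNorm (fun x => pd i φ x - pd i φ' x) 2 volume ≤ 4 * eLpNorm (fun x => ρ x - ρ' x) 2 volume := by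
  have hd : Differentiable ℝ φ := h.contDiff.differentiable (by norm_num)
  have hd' : Differentiable ℝ φ' := h'.contDiff.differentiable (by norm_num)
  refine le_trans ?_ ((h.eLpNorm_sub_source_le h' (a := freq) fun ξ => ?_).trans
    (h.eLpNorm_sub_source_le_density h'))
  · have h2 : ∀ u w : L2, (𝓕 (u - w) : L2) = 𝓕 u - 𝓕 w := fun u w => map_sub (fourierCLM ℂ L2) _ _
    rw [← eLpNorm_coe_cl (f := fun x => pd i φ x - pd i φ' x) ((h.memLp_pd i).sub (h'.memLp_pd i)),
      ← eLpNorm_fourier, cl_sub (h.memLp_pd i) (h'.memLp_pd i)]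
    refine eLpNorm_mono_ae ?_
    rw [h2, h2]
    filter_upwards [fourier_pd hd h.memLp (h.memLp_pd i), fourier_pd hd' h'.memLp (h'.memLp_pd i),
      Lp.coeFn_sub (𝓕 (cl φ) : L2) (𝓕 (cl φ')),
      Lp.coeFn_sub (𝓕 (cl (pd i φ)) : L2) (𝓕 (cl (pd i φ')))] with ξ h3 h4 h5 h6
    rw [h5, h6, Pi.sub_apply, Pi.sub_apply, h3, h4, ← mul_sub, norm_mul, norm_mul,
      norm_real, norm_eq_abs, abs_of_nonneg (freq_nonneg ξ)]
    exact mul_le_mul_of_nonneg_right (norm_dsym_le i ξ) (norm_nonneg _)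
  · rw [abs_of_nonneg (freq_nonneg ξ)]
    have := freq_le_jap ξ
    have := one_le_jap ξ
    nlinarith

/-! ### Differentiation in time of square-integrable functions -/

theorem lintegral_sq_le_measure_mul {α : Type*} [MeasurableSpace α] (μ : Measure α) {h : α → ℝ≥0∞}
    (hh : AEMeasurable h μ) : (∫⁻ a, h a ∂μ) ^ 2 ≤ μ Set.univ * ∫⁻ a, h a ^ 2 ∂μ := by
  have := ENNReal.lintegral_mul_le_Lp_mul_Lq μ Real.HolderConjugate.two_two
    (aemeasurable_const (b := (1 : ℝ≥0∞))) hh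
  simp only [Pi.mul_apply, one_mul, ENNReal.one_rpow, lintegral_one] at this
  calc (∫⁻ a, h a ∂μ) ^ 2 ≤ (μ Set.univ ^ (1 / 2 : ℝ) * (∫⁻ a, h a ^ (2 : ℝ) ∂μ) ^ (1 / 2 : ℝ)) ^ 2 := by
        gcongr
    _ = _ := by
        rw [mul_pow, ← ENNReal.rpow_natCast, ← ENNReal.rpow_natCast, ← ENNReal.rpow_mul,
          ← ENNReal.rpow_mul]
        norm_num

/-- Minkowski's inequality for the remainder in the fundamental theorem of calculus. -/
theorem eLpNorm_sub_sub_le {J : Set ℝ} (hJ : J.OrdConnected) {f g : ℝ → R3 → ℝ}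
    (hf : ∀ x, ∀ t ∈ J, HasDerivWithinAt (fun s => f s x) (g t x) J t)
    (hg : ContinuousOn (Function.uncurry g) (J ×ˢ Set.univ)) {t₀ t : ℝ} (h0 : t₀ ∈ J) (ht : t ∈ J)
    {S : ℝ≥0∞} (hS : ∀ s ∈ Set.uIcc t₀ t, eLpNorm (fun x => g s x - g t₀ x) 2 volume ≤ S) :
    eLpNorm (fun x => f t x - f t₀ x - (t - t₀) * g t₀ x) 2 volume ≤ ofReal |t - t₀| * S := by
  have hsub : Set.uIcc t₀ t ⊆ J := hJ.uIcc_subset h0 ht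
  have hsub' : Set.uIoc t₀ t ⊆ Set.uIcc t₀ t := Set.uIoc_subset_uIcc
  have hgx : ∀ x, ContinuousOn (fun s => g s x) J := fun x =>
    hg.comp (f := fun s => (s, x)) (by fun_prop) fun s hs => ⟨hs, trivial⟩
  set k : ℝ × R3 → ℝ := fun p => g p.1 p.2 - g t₀ p.2 with hk
  have hkc : ContinuousOn k (Set.uIoc t₀ t ×ˢ Set.univ) := by
    refine ContinuousOn.sub (hg.mono ?_) ?_
    · exact Set.prod_mono (hsub'.trans hsub) le_rfl
    · exact hg.comp (f := fun p : ℝ × R3 => (t₀, p.2)) (by fun_prop) fun s hs => ⟨h0, trivial⟩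
  have hkm : AEMeasurable k (((volume : Measure ℝ).restrict (Set.uIoc t₀ t)).prod (volume : Measure R3)) := by
    have := hkc.aemeasurable (μ := (volume : Measure ℝ).prod (volume : Measure R3))
      (measurableSet_uIoc.prod MeasurableSet.univ)
    rwa [← Measure.prod_restrict, Measure.restrict_univ] at this
  have hpt : ∀ x, f t x - f t₀ x - (t - t₀) * g t₀ x = ∫ s in t₀..t, k (s, x) := by
    intro x
    have hint : IntervalIntegrable (fun s => g s x) volume t₀ t :=
      ((hgx x).mono hsub).intervalIntegrable
    have h1 := intervalIntegral.integral_eq_sub_of_hasDeriv_right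
      (f := fun s => f s x) (f' := fun s => g s x) (a := t₀) (b := t)
      (fun s hs => ((hf x s (hsub hs)).continuousWithinAt).mono hsub)
      (fun s hs => ((hf x s (hsub (Set.Ioo_subset_Icc_self hs))).hasDerivAt
        (mem_of_superset (Ioo_mem_nhds hs.1 hs.2)
          (Set.Ioo_subset_Icc_self.trans hsub))).hasDerivWithinAt) hint
    simp only [hk]
    rw [intervalIntegral.integral_sub hint (by simp), h1]
    simp
  have hpt2 : ∀ x, ‖f t x - f t₀ x - (t - t₀) * g t₀ x‖ₑ ≤ ∫⁻ s in Set.uIoc t₀ t, ‖k (s, x)‖ₑ := by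
    intro x
    rw [hpt]
    rcases intervalIntegral.intervalIntegral_eq_integral_uIoc (fun s => k (s, x)) t₀ t volume with h
    rw [h, enorm_smul]
    have : ‖(if t₀ ≤ t then (1 : ℝ) else -1)‖ₑ = 1 := by split_ifs <;> simp
    rw [this, one_mul]
    exact enorm_integral_le_lintegral_enorm _
  have hvol : (volume : Measure ℝ).restrict (Set.uIoc t₀ t) Set.univ = ofReal |t - t₀| := by
    rw [Measure.restrict_apply_univ, Set.uIoc, Real.volume_Ioc, max_sub_min_eq_abs]
  have hsq : eLpNorm (fun x => f t x - f t₀ x - (t - t₀) * g t₀ x) 2 volume ^ 2 ≤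
      (ofReal |t - t₀| * S) ^ 2 := by
    rw [eLpNorm_two_sq]
    calc _ ≤ ∫⁻ x, ofReal |t - t₀| * ∫⁻ s in Set.uIoc t₀ t, ‖k (s, x)‖ₑ ^ 2 := by
          refine lintegral_mono fun x => (pow_le_pow_left' (hpt2 x) 2).trans ?_
          rw [← hvol]
          refine lintegral_sq_le_measure_mul _ (AEMeasurable.enorm ?_)
          exact (hkc.comp (f := fun s => (s, x)) (by fun_prop)
            fun s hs => ⟨hs, trivial⟩).aemeasurable measurableSet_uIoc
      _ = ofReal |t - t₀| * ∫⁻ x, ∫⁻ s in Set.uIoc t₀ t, ‖k (s, x)‖ₑ ^ 2 := by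
          rw [lintegral_const_mul' _ _ ofReal_ne_top]
      _ = ofReal |t - t₀| * ∫⁻ s in Set.uIoc t₀ t, ∫⁻ x, ‖k (s, x)‖ₑ ^ 2 := by
          rw [lintegral_lintegral_swap (f := fun x s => ‖k (s, x)‖ₑ ^ 2)]
          exact (hkm.comp_quasiMeasurePreserving
            (Measure.measurePreserving_swap (μ := (volume : Measure R3))).quasiMeasurePreserving).enorm.pow_const 2
      _ ≤ ofReal |t - t₀| * ∫⁻ s in Set.uIoc t₀ t, S ^ 2 := by
          refine mul_le_mul_right ?_ _
          refine setLIntegral_mono' measurableSet_uIoc fun s hs => ?_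
          rw [← eLpNorm_two_sq]
          exact pow_le_pow_left' (hS s (hsub' hs)) 2
      _ = _ := by
          rw [lintegral_const, hvol]; ring
  exact (ENNReal.pow_le_pow_left_iff (by norm_num)).1 hsq

/-- Pointwise time derivatives that are continuous in time with values in `L²` are derivatives in
`L²`. -/
theorem hasDerivWithinAt_cl {J : Set ℝ} (hJ : J.OrdConnected) {f g : ℝ → R3 → ℝ}
    (hf : ∀ x, ∀ t ∈ J, HasDerivWithinAt (fun s => f s x) (g t x) J t)
    (hg : ContinuousOn (Function.uncurry g) (J ×ˢ Set.univ))
    (hf2 : ∀ t ∈ J, MemLp (f t) 2 volume) (hg2 : ∀ t ∈ J, MemLp (g t) 2 volume)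
    (hc : ContinuousOn (fun t => cl (g t)) J) {t₀ : ℝ} (h0 : t₀ ∈ J) :
    HasDerivWithinAt (fun t => cl (f t)) (cl (g t₀)) J t₀ := by
  rw [hasDerivWithinAt_iff_isLittleO, Asymptotics.isLittleO_iff]
  intro c hcpos
  have h1 := Metric.continuousWithinAt_iff.1 (hc t₀ h0) c hcpos
  obtain ⟨δ, hδ, h2⟩ := h1
  filter_upwards [self_mem_nhdsWithin, mem_nhdsWithin_of_mem_nhds (Metric.ball_mem_nhds t₀ hδ)]
    with t ht htb
  have hsub : Set.uIcc t₀ t ⊆ J := hJ.uIcc_subset h0 ht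
  have h3 := eLpNorm_sub_sub_le hJ hf hg h0 ht (S := ofReal c) fun s hs => by
    have hsb : dist s t₀ < δ := lt_of_le_of_lt (by
      rw [dist_comm, Real.dist_eq, dist_comm t t₀, Real.dist_eq, abs_sub_comm t₀ s, abs_sub_comm t₀ t]
      exact Set.abs_sub_left_of_mem_uIcc hs) htb
    have h4 := (h2 (hsub hs) hsb).le
    rw [dist_eq_norm, ← cl_sub (hg2 s (hsub hs)) (hg2 t₀ h0), Lp.norm_def,
      eLpNorm_coe_cl (f := fun x => g s x - g t₀ x) ((hg2 s (hsub hs)).sub (hg2 t₀ h0))] at h4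
    exact (ENNReal.le_ofReal_iff_toReal_le ((hg2 s (hsub hs)).sub (hg2 t₀ h0)).2.ne hcpos.le).2 h4
  have hm : MemLp (fun x => f t x - f t₀ x - (t - t₀) * g t₀ x) 2 (volume : Measure R3) :=
    ((hf2 t ht).sub (hf2 t₀ h0)).sub ((hg2 t₀ h0).const_mul _)
  have e : cl (f t) - cl (f t₀) - (t - t₀) • cl (g t₀) = cl fun x => f t x - f t₀ x - (t - t₀) * g t₀ x := by
    rw [cl_sub (f := fun x => f t x - f t₀ x) (g := fun x => (t - t₀) * g t₀ x)
      ((hf2 t ht).sub (hf2 t₀ h0)) ((hg2 t₀ h0).const_mul _), cl_sub (hf2 t ht) (hf2 t₀ h0),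
      cl_smul _ (hg2 t₀ h0)]
    rfl
  rw [e, Lp.norm_def, eLpNorm_coe_cl hm]
  refine ENNReal.toReal_le_of_le_ofReal (by positivity) (h3.trans (le_of_eq ?_))
  rw [← ofReal_mul (abs_nonneg _), norm_eq_abs, mul_comm]

/-! ### Regularity in time -/

/-- `f ∈ C(J; L²)`. -/
structure L2Reg (J : Set ℝ) (f : ℝ → R3 → ℝ) : Prop where
  memLp : ∀ t ∈ J, MemLp (f t) 2 volume
  tendsto : ∀ t ∈ J, Tendsto (fun t' => eLpNorm (fun x => f t' x - f t x) 2 volume) (𝓝[J] t) (𝓝 0)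

/-- `f ∈ C(J; L^∞)`. -/
structure SupReg (J : Set ℝ) (f : ℝ → R3 → ℝ) : Prop where
  bdd : ∀ t ∈ J, ∃ B, ∀ x, |f t x| ≤ B
  unif : ∀ t ∈ J, TendstoUniformly f (f t) (𝓝[J] t)

namespace L2Reg

variable {J : Set ℝ} {f g : ℝ → R3 → ℝ}

theorem continuousOn (h : L2Reg J f) : ContinuousOn (fun t => cl (f t)) J := by
  intro t ht
  rw [ContinuousWithinAt, tendsto_iff_norm_sub_tendsto_zero]
  have h1 := (ENNReal.tendsto_toReal ENNReal.zero_ne_top).comp (h.tendsto t ht)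
  refine (h1.congr' ?_)
  filter_upwards [self_mem_nhdsWithin] with t' ht'
  rw [← cl_sub (h.memLp t' ht') (h.memLp t ht), Lp.norm_def,
    eLpNorm_coe_cl (f := fun x => f t' x - f t x) ((h.memLp t' ht').sub (h.memLp t ht))]
  rfl

theorem of_le (hf : L2Reg J f) {C : ℝ≥0∞} (hC : C ≠ ∞) (hg : ∀ t ∈ J, MemLp (g t) 2 volume)
    (h : ∀ t ∈ J, ∀ t' ∈ J, eLpNorm (fun x => g t' x - g t x) 2 volume ≤
      C * eLpNorm (fun x => f t' x - f t x) 2 volume) : L2Reg J g := by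
  refine ⟨hg, fun t ht => ?_⟩
  have h1 := ENNReal.Tendsto.const_mul (hf.tendsto t ht) (Or.inr hC)
  rw [mul_zero] at h1
  refine tendsto_of_tendsto_of_tendsto_of_le_of_le' tendsto_const_nhds h1
    (.of_forall fun _ => zero_le) ?_
  filter_upwards [self_mem_nhdsWithin] with t' ht' using h t ht t' ht'

theorem congr (hf : L2Reg J f) (h : ∀ t ∈ J, f t = g t) : L2Reg J g := by
  refine hf.of_le (C := 1) (by simp) (fun t ht => h t ht ▸ hf.memLp t ht) fun t ht t' ht' => ?_
  rw [h t ht, h t' ht', one_mul]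

theorem add (hf : L2Reg J f) (hg : L2Reg J g) : L2Reg J fun t x => f t x + g t x := by
  refine ⟨fun t ht => (hf.memLp t ht).add (hg.memLp t ht), fun t ht => ?_⟩
  have h1 := (hf.tendsto t ht).add (hg.tendsto t ht)
  rw [add_zero] at h1
  refine tendsto_of_tendsto_of_tendsto_of_le_of_le' tendsto_const_nhds h1
    (.of_forall fun _ => zero_le) ?_
  filter_upwards [self_mem_nhdsWithin] with t' ht'
  have e : (fun x => f t' x + g t' x - (f t x + g t x)) =
      (fun x => f t' x - f t x) + fun x => g t' x - g t x := by ext x; simp; ring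
  rw [e]
  exact eLpNorm_add_le ((hf.memLp t' ht').sub (hf.memLp t ht)).1
    ((hg.memLp t' ht').sub (hg.memLp t ht)).1 (by norm_num)

theorem neg (hf : L2Reg J f) : L2Reg J fun t x => -f t x := by
  refine hf.of_le (C := 1) (by simp) (fun t ht => (hf.memLp t ht).neg) fun t ht t' ht' => ?_
  have e : (fun x => -f t' x - -f t x) = -fun x => f t' x - f t x := by ext x; simp; ring
  rw [e, eLpNorm_neg, one_mul]

theorem sum {ι : Type*} (A : Finset ι) {F : ι → ℝ → R3 → ℝ} (h : ∀ i ∈ A, L2Reg J (F i)) :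
    L2Reg J fun t x => ∑ i ∈ A, F i t x := by
  classical
  induction A using Finset.induction_on with
  | empty => exact ⟨fun t _ => by simp, fun t _ => by simpa using tendsto_const_nhds⟩
  | insert a A ha ih =>
    have := (h a (Finset.mem_insert_self _ _)).add (ih fun i hi => h i (Finset.mem_insert_of_mem hi))
    exact this.congr fun t _ => by ext x; rw [Finset.sum_insert ha]

theorem fwdDiff (hf : L2Reg J f) (h : R3) : L2Reg J fun t => _root_.fwdDiff h (f t) := by
  refine hf.of_le (C := 2) (by simp) (fun t ht => memLp_fwdDiff (hf.memLp t ht) h) fun t ht t' ht' => ?_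
  have hm := (hf.memLp t' ht').sub (hf.memLp t ht)
  have e : (fun x => _root_.fwdDiff h (f t') x - _root_.fwdDiff h (f t) x) =
      (fun x => (fun y => f t' y - f t y) (x + h)) - fun x => f t' x - f t x := by
    ext x; simp [_root_.fwdDiff]; ring
  rw [e]
  refine (eLpNorm_sub_le ?_ hm.1 (by norm_num)).trans ?_
  · exact hm.1.comp_measurePreserving (measurePreserving_add_right volume h)
  · rw [eLpNorm_add_right (g := fun y => f t' y - f t y) hm.1, two_mul]
    exact le_rfl

theorem fwdDiff_iter (hf : L2Reg J f) (h : R3) (n : ℕ) :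
    L2Reg J fun t => (_root_.fwdDiff h)^[n] (f t) := by
  induction n with
  | zero => exact hf
  | succ n ih =>
    simp only [Function.iterate_succ_apply']
    exact ih.fwdDiff h

theorem comp_lipschitz (hf : L2Reg J f) {F : ℝ → ℝ} (hF : Measurable F) {C b : ℝ}
    (h0 : F 0 = 0) (hb : ∀ t ∈ J, ∀ x, |f t x| ≤ b)
    (hlip : ∀ x y, |x| ≤ b → |y| ≤ b → |F x - F y| ≤ C * |x - y|) :
    L2Reg J fun t x => F (f t x) := by
  refine hf.of_le (C := ofReal C) (by simp) (fun t ht => ?_) fun t ht t' ht' => ?_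
  · refine memLp_of_abs_le (C := C) (hf.memLp t ht)
      (hF.comp_aemeasurable (hf.memLp t ht).1.aemeasurable).aestronglyMeasurable fun x => ?_
    have := hlip (f t x) 0 (hb t ht x) (by simpa using (abs_nonneg _).trans (hb t ht x))
    simpa [h0] using this
  · exact eLpNorm_le_mul_eLpNorm_of_ae_le_mul (.of_forall fun x =>
      hlip _ _ (hb t' ht' x) (hb t ht x)) 2

end L2Reg

namespace SupReg

variable {J : Set ℝ} {f g : ℝ → R3 → ℝ}

theorem mul_l2 (hf : SupReg J f) (hg : L2Reg J g) (hfm : ∀ t ∈ J, Continuous (f t)) :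
    L2Reg J fun t x => f t x * g t x := by
  have hm : ∀ t ∈ J, ∀ t' ∈ J, MemLp (fun x => f t x * g t' x) 2 (volume : Measure R3) := fun t ht t' ht' => by
    obtain ⟨B, hB⟩ := hf.bdd t ht
    exact memLp_mul (hfm t ht).aestronglyMeasurable (hg.memLp t' ht') hB
  refine ⟨fun t ht => hm t ht t ht, fun t ht => ?_⟩
  obtain ⟨B, hB⟩ := hf.bdd t ht
  have hB0 : 0 ≤ B := (abs_nonneg _).trans (hB 0)
  rw [ENNReal.tendsto_nhds_zero]
  intro ε hε
  have hε2 : 0 < ε / 2 := ENNReal.half_pos hε.ne'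
  obtain ⟨δ, hδ, hδε⟩ := ENNReal.exists_nnreal_pos_mul_lt
    (a := eLpNorm (g t) 2 volume + 1) (ENNReal.add_ne_top.2 ⟨(hg.memLp t ht).2.ne, by simp⟩) hε2.ne'
  have h2 := ENNReal.Tendsto.const_mul (hg.tendsto t ht) (Or.inr (ofReal_ne_top (r := B)))
  rw [mul_zero] at h2
  filter_upwards [Metric.tendstoUniformly_iff.1 (hf.unif t ht) δ hδ, self_mem_nhdsWithin,
    ENNReal.tendsto_nhds_zero.1 (hg.tendsto t ht) 1 one_pos, ENNReal.tendsto_nhds_zero.1 h2 _ hε2]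
    with t' h3 ht' h4 h5
  have e : (fun x => f t' x * g t' x - f t x * g t x) =
      (fun x => (f t' x - f t x) * g t' x) + fun x => f t x * (g t' x - g t x) := by
    ext x; simp; ring
  have hg' : eLpNorm (g t') 2 volume ≤ eLpNorm (g t) 2 volume + 1 := by
    have e' : g t' = g t + fun x => g t' x - g t x := by ext x; simp
    calc _ = eLpNorm (g t + fun x => g t' x - g t x) 2 volume := by rw [← e']
      _ ≤ _ := eLpNorm_add_le (hg.memLp t ht).1 ((hg.memLp t' ht').sub (hg.memLp t ht)).1 (by norm_num)
      _ ≤ _ := by gcongr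
  have hδ' : ofReal (δ : ℝ) = δ := ENNReal.ofReal_coe_nnreal
  rw [e, ← ENNReal.add_halves ε]
  refine (eLpNorm_add_le (((hfm t' ht').sub (hfm t ht)).aestronglyMeasurable.mul (hg.memLp t' ht').1)
    ((hfm t ht).aestronglyMeasurable.mul ((hg.memLp t' ht').1.sub (hg.memLp t ht).1))
    (by norm_num)).trans (add_le_add ?_ ?_)
  · refine (eLpNorm_mul_le_sup (B := δ) fun x => ?_).trans ?_
    · have := h3 x
      rw [Real.dist_eq, abs_sub_comm] at this
      exact this.le
    · rw [hδ']
      exact (mul_le_mul_right hg' _).trans hδε.le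
  · exact (eLpNorm_mul_le_sup hB).trans h5

theorem comp_lipschitz (hf : SupReg J f) {F : ℝ → ℝ} {C b : ℝ} (hC : 0 < C)
    (hb : ∀ t ∈ J, ∀ x, |f t x| ≤ b)
    (hlip : ∀ x y, |x| ≤ b → |y| ≤ b → |F x - F y| ≤ C * |x - y|) :
    SupReg J fun t x => F (f t x) := by
  refine ⟨fun t ht => ⟨C * (b + b) + |F (f t 0)|, fun x => ?_⟩, fun t ht => ?_⟩
  · have h1 := hlip _ _ (hb t ht x) (hb t ht 0)
    have h2 : |f t x - f t 0| ≤ b + b := (abs_sub _ _).trans (add_le_add (hb t ht x) (hb t ht 0))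
    have h3 : |F (f t x)| ≤ |F (f t x) - F (f t 0)| + |F (f t 0)| := by
      simpa using abs_add_le (F (f t x) - F (f t 0)) (F (f t 0))
    have : C * |f t x - f t 0| ≤ C * (b + b) := by gcongr
    linarith
  · rw [Metric.tendstoUniformly_iff]
    intro ε hε
    filter_upwards [Metric.tendstoUniformly_iff.1 (hf.unif t ht) (ε / C) (by positivity),
      self_mem_nhdsWithin] with t' h1 ht' x
    have h2 := h1 x
    rw [Real.dist_eq, lt_div_iff₀ hC] at h2
    rw [Real.dist_eq]
    refine (hlip _ _ (hb t ht x) (hb t' ht' x)).trans_lt ?_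
    linarith

/-- Local uniform bounds on compact time intervals. -/
theorem bdd_on_compact (hf : SupReg J f) {K : Set ℝ} (hK : IsCompact K) (hKJ : K ⊆ J) :
    ∃ B, ∀ t ∈ K, ∀ x, |f t x| ≤ B := by
  refine hK.induction_on (p := fun S => ∃ B, ∀ t ∈ S, ∀ x, |f t x| ≤ B) ⟨0, by simp⟩ ?_ ?_ ?_
  · rintro s t hst ⟨B, hB⟩
    exact ⟨B, fun r hr => hB r (hst hr)⟩
  · rintro s t ⟨B, hB⟩ ⟨B', hB'⟩
    refine ⟨max B B', fun r hr x => ?_⟩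
    rcases hr with hr | hr
    · exact (hB r hr x).trans (le_max_left _ _)
    · exact (hB' r hr x).trans (le_max_right _ _)
  · intro t ht
    obtain ⟨B, hB⟩ := hf.bdd t (hKJ ht)
    have h1 := Metric.tendstoUniformly_iff.1 (hf.unif t (hKJ ht)) 1 one_pos
    refine ⟨_, nhdsWithin_mono t hKJ h1, B + 1, fun t' h2 x => ?_⟩
    have h3 := h2 x
    rw [Real.dist_eq] at h3
    have := hB x
    have h4 : |f t' x| ≤ |f t x| + |f t x - f t' x| := by
      have := abs_sub (f t x) (f t x - f t' x)
      simpa using this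
    linarith

end SupReg

/-! ### Regularity of solutions -/

theorem ordConnected_timeInterval (T : EReal) : (timeInterval T).OrdConnected := by
  refine ⟨fun x hx y hy z hz => ⟨hx.1.trans hz.1, lt_of_le_of_lt ?_ hy.2⟩⟩
  exact_mod_cast hz.2

theorem zero_mem_timeInterval {T : EReal} (hT : 0 < T) : (0 : ℝ) ∈ timeInterval T :=
  ⟨le_rfl, by simpa using hT⟩

theorem uniqueDiffOn_timeInterval {T : EReal} (hT : 0 < T) : UniqueDiffOn ℝ (timeInterval T) := by
  obtain ⟨r, hr0, hr⟩ := EReal.lt_iff_exists_real_btwn.1 hT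
  have hr0' : 0 < r := by exact_mod_cast hr0
  refine uniqueDiffOn_convex (ordConnected_timeInterval T).convex ⟨r / 2, ?_⟩
  rw [mem_interior]
  refine ⟨Set.Ioo 0 r, fun x hx => ⟨hx.1.le, lt_trans ?_ hr⟩, isOpen_Ioo, by constructor <;> linarith⟩
  exact_mod_cast hx.2

theorem wnorm_pd_le {f : R3 → ℝ} (hd : Differentiable ℝ f) (hf : MemLp f 2 volume) {i : Fin 3}
    (hf' : MemLp (pd i f) 2 volume) (a : R3 → ℝ) :
    wnorm a (cl (pd i f)) ≤ wnorm (fun ξ => a ξ * freq ξ) (cl f) := by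
  refine eLpNorm_mono_ae ?_
  filter_upwards [fourier_pd hd hf hf'] with ξ h1
  rw [h1, norm_mul, norm_mul, norm_mul, norm_real, norm_real, norm_mul, mul_assoc]
  gcongr
  rw [norm_of_nonneg (freq_nonneg ξ)]
  exact norm_dsym_le i ξ

theorem rpow_weight_le {a s : ℝ} (h : a ≤ s) (ξ : R3) : |jap ξ ^ a| ≤ |jap ξ ^ s| := by
  rw [abs_of_nonneg (rpow_nonneg (jap_pos ξ).le _), abs_of_nonneg (rpow_nonneg (jap_pos ξ).le _)]
  exact Real.rpow_le_rpow_of_exponent_le (one_le_jap ξ) h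

theorem rpow_mul_freq_le {a s : ℝ} (h : a + 1 ≤ s) (ξ : R3) : |jap ξ ^ a * freq ξ| ≤ |jap ξ ^ s| := by
  refine le_trans ?_ (rpow_weight_le h ξ)
  rw [abs_mul, rpow_add (jap_pos ξ), abs_mul, Real.rpow_one]
  refine mul_le_mul_of_nonneg_left ?_ (abs_nonneg _)
  rw [abs_of_nonneg (freq_nonneg ξ), abs_of_pos (jap_pos ξ)]
  exact freq_le_jap ξ

theorem memLp_pd_of_wnorm {s : ℝ} (hs : 1 ≤ s) {f : R3 → ℝ} (hd : ContDiff ℝ 1 f)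
    (hf : MemLp f 2 volume) (hfin : wnorm (fun ξ => jap ξ ^ s) (cl f) < ∞) (i : Fin 3) :
    MemLp (pd i f) 2 volume := by
  refine memLp_pd hd hf ⟨(continuous_dsym i).aestronglyMeasurable.mul (Lp.aestronglyMeasurable _), ?_⟩
  refine lt_of_le_of_lt (eLpNorm_mono fun ξ => ?_) hfin
  rw [norm_mul, norm_mul, norm_real]
  gcongr
  refine (norm_dsym_le i ξ).trans ?_
  have := rpow_mul_freq_le (a := 0) (by linarith : (0 : ℝ) + 1 ≤ s) ξ
  simpa [abs_of_nonneg (freq_nonneg ξ)] using this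

theorem abs_le_of_wnorm_toReal {f : R3 → ℝ} (hc : Continuous f) (hf : MemLp f 2 volume) {W : ℝ≥0∞}
    (hW : wnorm (fun ξ => jap ξ ^ (2 : ℝ)) (cl f) ≤ W) (hfin : W < ∞) (x : R3) :
    |f x| ≤ (sobC * W).toReal := by
  have h := (abs_le_of_wnorm hc hf x).trans (mul_le_mul_right hW _)
  have := ENNReal.toReal_mono (ENNReal.mul_lt_top sobC_lt_top hfin).ne h
  simpa using this

section ContinuousInH

variable {J : Set ℝ} {s : ℝ} {f : ℝ → R3 → ℝ}

theorem ContinuousInH.wnorm_sub_lt_top (h : ContinuousInH s J f) {t t' : ℝ} (ht : t ∈ J) (ht' : t' ∈ J) :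
    wnorm (fun ξ => jap ξ ^ s) (cl fun x => f t' x - f t x) < ∞ := by
  have h1 := h.1 t ht
  have h2 := h.1 t' ht'
  rw [cl_sub h2.1 h1.1, sub_eq_add_neg]
  refine (wnorm_add_le (continuous_jap_rpow s).measurable _ _).trans_lt ?_
  rw [wnorm_neg]
  exact ENNReal.add_lt_top.2 ⟨h2.2, h1.2⟩

theorem ContinuousInH.l2Reg (h : ContinuousInH s J f) (hs : 0 ≤ s) : L2Reg J f := by
  refine ⟨fun t ht => (h.1 t ht).1, fun t ht => ?_⟩
  refine tendsto_of_tendsto_of_tendsto_of_le_of_le' tendsto_const_nhds (h.2 t ht)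
    (.of_forall fun _ => zero_le) ?_
  filter_upwards [self_mem_nhdsWithin] with t' ht'
  rw [← eLpNorm_coe_cl (f := fun x => f t' x - f t x) ((h.1 t' ht').1.sub (h.1 t ht).1), ← wnorm_one]
  refine wnorm_mono (fun ξ => ?_) _
  simpa using rpow_weight_le hs ξ

theorem supReg_of_tendsto (hc : ∀ t ∈ J, Continuous (f t)) (hf : ∀ t ∈ J, MemLp (f t) 2 volume)
    (h0 : ∀ t ∈ J, wnorm (fun ξ => jap ξ ^ (2 : ℝ)) (cl (f t)) < ∞)
    (h : ∀ t ∈ J, Tendsto (fun t' => wnorm (fun ξ => jap ξ ^ (2 : ℝ)) (cl fun x => f t' x - f t x))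
      (𝓝[J] t) (𝓝 0)) : SupReg J f := by
  refine ⟨fun t ht => ⟨_, abs_le_of_wnorm_toReal (hc t ht) (hf t ht) le_rfl (h0 t ht)⟩, fun t ht => ?_⟩
  rw [Metric.tendstoUniformly_iff]
  intro ε hε
  have h1 := ENNReal.Tendsto.const_mul (h t ht) (Or.inr sobC_lt_top.ne)
  rw [mul_zero] at h1
  filter_upwards [self_mem_nhdsWithin, h1.eventually (gt_mem_nhds (ENNReal.ofReal_pos.2 hε))]
    with t' ht' h2 x
  have h3 := (abs_le_of_wnorm (f := fun x => f t' x - f t x) ((hc t' ht').sub (hc t ht))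
    ((hf t' ht').sub (hf t ht)) x).trans_lt h2
  rw [Real.enorm_eq_ofReal_abs, ENNReal.ofReal_lt_ofReal_iff hε] at h3
  rwa [Real.dist_eq, abs_sub_comm]

theorem ContinuousInH.supReg (h : ContinuousInH s J f) (hs : 2 ≤ s) (hc : ∀ t ∈ J, Continuous (f t)) :
    SupReg J f := by
  refine supReg_of_tendsto hc (fun t ht => (h.1 t ht).1)
    (fun t ht => (wnorm_mono (rpow_weight_le hs) _).trans_lt (h.1 t ht).2) fun t ht => ?_
  exact tendsto_of_tendsto_of_tendsto_of_le_of_le tendsto_const_nhds (h.2 t ht) (fun _ => zero_le)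
    fun t' => wnorm_mono (rpow_weight_le hs) _

theorem ContinuousInH.memLp_pd (h : ContinuousInH s J f) (hs : 1 ≤ s) (hc : ∀ t ∈ J, ContDiff ℝ 1 (f t))
    (i : Fin 3) {t : ℝ} (ht : t ∈ J) : MemLp (pd i (f t)) 2 volume :=
  memLp_pd_of_wnorm hs (hc t ht) (h.1 t ht).1 (h.1 t ht).2 i

theorem ContinuousInH.wnorm_pd_sub_le (h : ContinuousInH s J f) (hs : 1 ≤ s)
    (hc : ∀ t ∈ J, ContDiff ℝ 1 (f t)) (i : Fin 3) {t t' : ℝ} (ht : t ∈ J) (ht' : t' ∈ J) {a : ℝ}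
    (ha : a + 1 ≤ s) :
    wnorm (fun ξ => jap ξ ^ a) (cl fun x => pd i (f t') x - pd i (f t) x) ≤
      wnorm (fun ξ => jap ξ ^ s) (cl fun x => f t' x - f t x) := by
  have hd : ContDiff ℝ 1 fun x => f t' x - f t x := (hc t' ht').sub (hc t ht)
  have hm : MemLp (fun x => f t' x - f t x) 2 volume := (h.1 t' ht').1.sub (h.1 t ht).1
  have e : (fun x => pd i (f t') x - pd i (f t) x) = pd i fun x => f t' x - f t x := by
    ext x
    rw [pd_sub ((hc t' ht').differentiable (by norm_num) x) ((hc t ht).differentiable (by norm_num) x)]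
  rw [e]
  exact (wnorm_pd_le (hd.differentiable (by norm_num)) hm
    (memLp_pd_of_wnorm hs hd hm (h.wnorm_sub_lt_top ht ht') i) _).trans
    (wnorm_mono (rpow_mul_freq_le ha) _)

theorem ContinuousInH.l2Reg_pd (h : ContinuousInH s J f) (hs : 1 ≤ s)
    (hc : ∀ t ∈ J, ContDiff ℝ 1 (f t)) (i : Fin 3) : L2Reg J fun t => pd i (f t) := by
  refine ⟨fun t ht => h.memLp_pd hs hc i ht, fun t ht => ?_⟩
  refine tendsto_of_tendsto_of_tendsto_of_le_of_le' tendsto_const_nhds (h.2 t ht)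
    (.of_forall fun _ => zero_le) ?_
  filter_upwards [self_mem_nhdsWithin] with t' ht'
  rw [← eLpNorm_coe_cl (f := fun x => pd i (f t') x - pd i (f t) x)
    ((h.memLp_pd hs hc i ht').sub (h.memLp_pd hs hc i ht)), ← wnorm_one]
  have := h.wnorm_pd_sub_le hs hc i ht ht' (a := 0) (by linarith)
  simp only [Real.rpow_zero] at this
  exact this

theorem ContinuousInH.supReg_pd (h : ContinuousInH s J f) (hs : 3 ≤ s)
    (hc : ∀ t ∈ J, ContDiff ℝ 1 (f t)) (i : Fin 3) : SupReg J fun t => pd i (f t) := by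
  refine supReg_of_tendsto (fun t ht => continuous_pd (hc t ht) i)
    (fun t ht => h.memLp_pd (by linarith) hc i ht) (fun t ht => ?_) fun t ht => ?_
  · exact (wnorm_pd_le ((hc t ht).differentiable (by norm_num)) (h.1 t ht).1
      (h.memLp_pd (by linarith) hc i ht) _).trans_lt
      ((wnorm_mono (rpow_mul_freq_le (by linarith)) _).trans_lt (h.1 t ht).2)
  · refine tendsto_of_tendsto_of_tendsto_of_le_of_le' tendsto_const_nhds (h.2 t ht)
      (.of_forall fun _ => zero_le) ?_
    filter_upwards [self_mem_nhdsWithin] with t' ht'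
    exact h.wnorm_pd_sub_le (by linarith) hc i ht ht' (by linarith)

end ContinuousInH

/-- `f` is differentiable in time with derivative `g`, both pointwise and in `L²`. -/
structure TimeDiff (J : Set ℝ) (f g : ℝ → R3 → ℝ) : Prop where
  deriv : ∀ x, ∀ t ∈ J, HasDerivWithinAt (fun s => f s x) (g t x) J t
  cont : ContinuousOn (Function.uncurry g) (J ×ˢ Set.univ)
  reg : L2Reg J f
  reg' : L2Reg J g

theorem TimeDiff.hasDerivWithinAt {J : Set ℝ} (hJ : J.OrdConnected) {f g : ℝ → R3 → ℝ}
    (h : TimeDiff J f g) {t : ℝ} (ht : t ∈ J) :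
    HasDerivWithinAt (fun t => cl (f t)) (cl (g t)) J t :=
  hasDerivWithinAt_cl hJ h.deriv h.cont h.reg.memLp h.reg'.memLp h.reg'.continuousOn ht

theorem TimeDiff.fwdDiff_iter {J : Set ℝ} {f g : ℝ → R3 → ℝ} (h : TimeDiff J f g) (a : R3) (n : ℕ) :
    TimeDiff J (fun t => (fwdDiff a)^[n] (f t)) (fun t => (fwdDiff a)^[n] (g t)) := by
  refine ⟨?_, ?_, h.reg.fwdDiff_iter a n, h.reg'.fwdDiff_iter a n⟩
  · induction n with
    | zero => exact h.deriv
    | succ n ih =>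
      intro x t ht
      simp only [Function.iterate_succ_apply', fwdDiff]
      exact (ih (x + a) t ht).sub (ih x t ht)
  · induction n with
    | zero => exact h.cont
    | succ n ih =>
      have e : (Function.uncurry fun t => (fwdDiff a)^[n + 1] (g t)) = fun p : ℝ × R3 =>
          (Function.uncurry fun t => (fwdDiff a)^[n] (g t)) (p.1, p.2 + a) -
          (Function.uncurry fun t => (fwdDiff a)^[n] (g t)) p := by
        ext p
        simp only [Function.uncurry, Function.iterate_succ_apply', fwdDiff]
      rw [e]
      refine ContinuousOn.sub (ih.comp (f := fun p : ℝ × R3 => (p.1, p.2 + a)) (by fun_prop) ?_) ih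
      exact fun p hp => ⟨(Set.mem_prod.1 hp).1, trivial⟩

/-! #### The equations in components -/

theorem contDiff_slice {E : Type*} [NormedAddCommGroup E] [NormedSpace ℝ E] {J : Set ℝ} {f : ℝ → R3 → E}
    (h : ContDiffOn ℝ 1 (Function.uncurry f) (J ×ˢ Set.univ)) {t : ℝ} (ht : t ∈ J) : ContDiff ℝ 1 (f t) := by
  have h1 : ContDiff ℝ 1 fun x : R3 => (t, x) := by fun_prop
  have := h.comp_contDiff h1 fun x => ⟨ht, trivial⟩
  exact this

theorem hasDerivWithinAt_slice {J : Set ℝ} {f : ℝ → R3 → ℝ}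
    (h : ContDiffOn ℝ 1 (Function.uncurry f) (J ×ˢ Set.univ)) (x : R3) {t : ℝ} (ht : t ∈ J) :
    HasDerivWithinAt (fun s => f s x)
      (fderivWithin ℝ (Function.uncurry f) (J ×ˢ Set.univ) (t, x) (1, 0)) J t := by
  have h1 := (h.differentiableOn (by norm_num) (t, x) ⟨ht, trivial⟩).hasFDerivWithinAt
  have h2 : HasDerivWithinAt (fun s : ℝ => (s, x)) ((1 : ℝ), (0 : R3)) J t :=
    ((hasDerivAt_id t).prodMk (hasDerivAt_const t x)).hasDerivWithinAt
  exact h1.comp_hasDerivWithinAt t h2 fun s hs => Set.mk_mem_prod hs (Set.mem_univ x)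

theorem continuousOn_derivWithin {J : Set ℝ} (hJ : UniqueDiffOn ℝ J) {f : ℝ → R3 → ℝ}
    (h : ContDiffOn ℝ 1 (Function.uncurry f) (J ×ˢ Set.univ)) :
    ContinuousOn (Function.uncurry fun t x => derivWithin (fun s => f s x) J t) (J ×ˢ Set.univ) := by
  have h1 := h.continuousOn_fderivWithin (hJ.prod uniqueDiffOn_univ) le_rfl
  refine (h1.clm_apply (continuousOn_const (c := ((1 : ℝ), (0 : R3))))).congr fun p hp => ?_
  exact (hasDerivWithinAt_slice h p.2 (Set.mem_prod.1 hp).1).derivWithin (hJ p.1 (Set.mem_prod.1 hp).1)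

theorem gradient_apply (f : R3 → ℝ) (x : R3) (i : Fin 3) :
    (∇ f x) i = pd i f x := by
  rw [← inner_ee, pd, gradient]
  exact InnerProductSpace.toDual_symm_apply

theorem fderiv_apply_component {w : R3 → R3} (hw : Differentiable ℝ w) (x y : R3) (i : Fin 3) :
    (fderiv ℝ w x y) i = ∑ j, y j * pd j (fun z => w z i) x := by
  have h1 : HasFDerivAt (fun z => w z i) ((EuclideanSpace.proj i : R3 →L[ℝ] ℝ).comp (fderiv ℝ w x)) x :=
    (EuclideanSpace.proj i : R3 →L[ℝ] ℝ).hasFDerivAt.comp x (hw x).hasFDerivAt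
  have h2 : ∀ j, pd j (fun z => w z i) x = (fderiv ℝ w x (ee j)) i := fun j => by
    rw [pd, h1.fderiv]; rfl
  simp_rw [h2]
  have h3 : y = ∑ j, y j • ee j := by
    ext l
    simp [Finset.sum_apply, Pi.single_apply]
  conv_lhs => rw [h3, map_sum]
  simp

/-- The logarithm of the density `1 + ρ`. -/
def logDen (ρ : R3 → ℝ) (x : R3) : ℝ := Real.log (1 + ρ x)

theorem abs_log_sub_le {x y : ℝ} (hx : |x| ≤ 1 / 4) (hy : |y| ≤ 1 / 4) :
    |Real.log (1 + x) - Real.log (1 + y)| ≤ 2 * |x - y| := by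
  have hpos : ∀ z ∈ Metric.closedBall (0 : ℝ) (1 / 4), 3 / 4 ≤ 1 + z := fun z hz => by
    rw [mem_closedBall_zero_iff, norm_eq_abs, abs_le] at hz
    linarith
  have hd : ∀ z ∈ Metric.closedBall (0 : ℝ) (1 / 4), HasDerivWithinAt (fun z => Real.log (1 + z))
      (1 / (1 + z)) (Metric.closedBall (0 : ℝ) (1 / 4)) z := fun z hz =>
    (((hasDerivAt_id z).const_add 1).log (by have := hpos z hz; simp; linarith)).hasDerivWithinAt
  have hb : ∀ z ∈ Metric.closedBall (0 : ℝ) (1 / 4), ‖1 / (1 + z)‖ ≤ 2 := by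
    intro z hz
    have := hpos z hz
    rw [norm_of_nonneg (by positivity), div_le_iff₀ (by linarith)]
    linarith
  have := (convex_closedBall (0 : ℝ) (1 / 4)).norm_image_sub_le_of_norm_hasDerivWithin_le hd hb
    (x := y) (y := x) (by simpa using hy) (by simpa using hx)
  simpa using this

theorem abs_inv_one_add_sub_le {x y : ℝ} (hx : |x| ≤ 1 / 4) (hy : |y| ≤ 1 / 4) :
    |(1 + x)⁻¹ - (1 + y)⁻¹| ≤ 2 * |x - y| := by
  rw [abs_le] at hx hy
  have h1 : 3 / 4 ≤ 1 + x := by linarith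
  have h2 : 3 / 4 ≤ 1 + y := by linarith
  rw [inv_sub_inv (by linarith) (by linarith), abs_div, div_le_iff₀ (by positivity)]
  have e : 1 + y - (1 + x) = -(x - y) := by ring
  rw [e, abs_neg, abs_of_pos (by positivity : 0 < (1 + x) * (1 + y))]
  have : 1 ≤ 2 * ((1 + x) * (1 + y)) := by nlinarith
  have := abs_nonneg (x - y)
  nlinarith

/-- A small solution in components, with the regularity in time that it has in `L²`. The equation of the density
is kept next to that of its logarithm, as the energies involve both. -/
structure Flow (s b : ℝ) (J : Set ℝ) (ρ : ℝ → R3 → ℝ) (v : Fin 3 → ℝ → R3 → ℝ) (φ : ℝ → R3 → ℝ) :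
    Prop where
  ordConnected : J.OrdConnected
  zero_mem : (0 : ℝ) ∈ J
  nonneg : ∀ t ∈ J, 0 ≤ t
  contDiff_density : ∀ t ∈ J, ContDiff ℝ 1 (ρ t)
  contDiff_velocity : ∀ i, ∀ t ∈ J, ContDiff ℝ 1 (v i t)
  contH_density : ContinuousInH s J ρ
  contH_velocity : ∀ i, ContinuousInH s J (v i)
  potential : ∀ t ∈ J, IsPotential b (ρ t) (φ t)
  diff_density : TimeDiff J ρ fun t x =>
    -(∑ i, pd i (v i t) x + ∑ i, pd i (fun y => ρ t y * v i t y) x)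
  diff_log : TimeDiff J (fun t => logDen (ρ t)) fun t x =>
    -(∑ i, v i t x * pd i (logDen (ρ t)) x + ∑ i, pd i (v i t) x)
  diff_velocity : ∀ l, TimeDiff J (v l) fun t x =>
    -(∑ i, v i t x * pd i (v l t) x + pd l (logDen (ρ t)) x + pd l (φ t) x)

theorem contDiff_logDen {ρ : R3 → ℝ} (hρ : ContDiff ℝ 1 ρ) (hb : ∀ x, |ρ x| ≤ 1 / 4) :
    ContDiff ℝ 1 (logDen ρ) := by
  refine (contDiff_const.add hρ).log fun x => ?_
  have := (abs_le.1 (hb x)).1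
  linarith

theorem pd_logDen {ρ : R3 → ℝ} (hρ : Differentiable ℝ ρ) (hb : ∀ x, |ρ x| ≤ 1 / 4) (i : Fin 3) (x : R3) :
    pd i (logDen ρ) x = (1 + ρ x)⁻¹ * pd i ρ x := by
  have h0 : 1 + ρ x ≠ 0 := by
    have := (abs_le.1 (hb x)).1
    linarith
  have h1 : HasDerivAt (fun y => Real.log (1 + y)) (1 + ρ x)⁻¹ (ρ x) := by
    simpa using ((hasDerivAt_id (ρ x)).const_add 1).log h0
  exact pd_comp h1 (hρ x) i

/-- The equations of a solution hold in the symmetrized form, and in `L²`. -/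
theorem IsSolution.flow {k : ℝ} (hk : 5 ≤ k) {T : EReal} (hT : 0 < T) {ρ : ℝ → R3 → ℝ}
    {v : ℝ → R3 → R3} {φ : ℝ → R3 → ℝ} (h : IsSolution k (timeInterval T) ρ v φ) {b : ℝ}
    (hb : b ≤ 1 / 4) (hρb : ∀ t ∈ timeInterval T, ∀ x, |ρ t x| ≤ b) :
    Flow (2 * k) b (timeInterval T) ρ (fun i t x => v t x i) φ := by
  set J := timeInterval T
  have hJ : UniqueDiffOn ℝ J := uniqueDiffOn_timeInterval hT
  have hρ4 : ∀ t ∈ J, ∀ x, |ρ t x| ≤ 1 / 4 := fun t ht x => (hρb t ht x).trans hb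
  have hne : ∀ t ∈ J, ∀ x, 1 + ρ t x ≠ 0 := fun t ht x => by
    have := (abs_le.1 (hρ4 t ht x)).1
    linarith
  have hcρ : ∀ t ∈ J, ContDiff ℝ 1 (ρ t) := fun t ht => contDiff_slice h.contDiff_density ht
  have hvi : ∀ i, ContDiffOn ℝ 1 (Function.uncurry fun t x => v t x i) (J ×ˢ Set.univ) := fun i =>
    (EuclideanSpace.proj i : R3 →L[ℝ] ℝ).contDiff.comp_contDiffOn h.contDiff_velocity
  have hcv' : ∀ t ∈ J, ContDiff ℝ 1 (v t) := fun t ht => contDiff_slice h.contDiff_velocity ht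
  have hcv : ∀ i, ∀ t ∈ J, ContDiff ℝ 1 fun x => v t x i := fun i t ht =>
    contDiff_slice (hvi i) ht
  have hdρ : ∀ t ∈ J, Differentiable ℝ (ρ t) := fun t ht => (hcρ t ht).differentiable (by norm_num)
  have hdv : ∀ i, ∀ t ∈ J, Differentiable ℝ fun x => v t x i := fun i t ht =>
    (hcv i t ht).differentiable (by norm_num)
  have hpot : ∀ t ∈ J, IsPotential b (ρ t) (φ t) := fun t ht =>
    ⟨h.contDiff_potential t ht, h.potential_at_infinity t ht, h.poisson t ht, hb, hρb t ht,
      (hcρ t ht).continuous, (h.regular_density.1 t ht).1⟩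
  -- regularity of the unknowns and of their derivatives
  have rρ : L2Reg J ρ := h.regular_density.l2Reg (by linarith)
  have rv : ∀ i, L2Reg J fun t x => v t x i := fun i => (h.regular_velocity i).l2Reg (by linarith)
  have uρ : SupReg J ρ := h.regular_density.supReg (by linarith) fun t ht => (hcρ t ht).continuous
  have uv : ∀ i, SupReg J fun t x => v t x i := fun i =>
    (h.regular_velocity i).supReg (by linarith) fun t ht => (hcv i t ht).continuous
  have rdρ : ∀ i, L2Reg J fun t => pd i (ρ t) := fun i => h.regular_density.l2Reg_pd (by linarith) hcρ i
  have rdv : ∀ i l, L2Reg J fun t => pd i fun x => v t x l := fun i l =>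
    (h.regular_velocity l).l2Reg_pd (by linarith) (hcv l) i
  have uinv : SupReg J fun t x => (1 + ρ t x)⁻¹ :=
    uρ.comp_lipschitz (F := fun x => (1 + x)⁻¹) two_pos hρ4 fun x y hx hy => abs_inv_one_add_sub_le hx hy
  have rlog : L2Reg J fun t => logDen (ρ t) :=
    rρ.comp_lipschitz (F := fun x => Real.log (1 + x)) (by fun_prop) (by simp) hρ4
      fun x y hx hy => abs_log_sub_le hx hy
  have rdlog : ∀ i, L2Reg J fun t => pd i (logDen (ρ t)) := fun i =>
    (uinv.mul_l2 (rdρ i) fun t ht => (continuous_const.add (hcρ t ht).continuous).inv₀ (hne t ht)).congr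
      fun t ht => funext fun x => (pd_logDen (hdρ t ht) (hρ4 t ht) i x).symm
  have rφ : ∀ i, L2Reg J fun t => pd i (φ t) := fun i =>
    rρ.of_le (C := 4) (by simp) (fun t ht => (hpot t ht).memLp_pd i) fun t ht t' ht' =>
      (hpot t' ht').eLpNorm_pd_sub_le (hpot t ht) i
  have rdiv : L2Reg J fun t x => ∑ i, pd i (fun y => v t y i) x := L2Reg.sum _ fun i _ => rdv i i
  have cv : ∀ i, ∀ t ∈ J, Continuous fun x => v t x i := fun i t ht => (hcv i t ht).continuous
  have rflux : L2Reg J fun t x => ∑ i, pd i (fun y => ρ t y * v t y i) x := by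
    refine L2Reg.sum _ fun i _ => ?_
    refine (((uv i).mul_l2 (rdρ i) (cv i)).add
      (uρ.mul_l2 (rdv i i) fun t ht => (hcρ t ht).continuous)).congr fun t ht => funext fun x => ?_
    rw [pd_mul (hdρ t ht x) (hdv i t ht x)]; ring
  -- the equations
  have eρ : ∀ t ∈ J, ∀ x, derivWithin (fun s => ρ s x) J t =
      -(∑ i, pd i (fun y => v t y i) x + ∑ i, pd i (fun y => ρ t y * v t y i) x) := by
    intro t ht x
    have h1 := h.mass t ht x
    have h2 : div (fun y => (1 + ρ t y) • v t y) x =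
        ∑ i, pd i (fun y => v t y i) x + ∑ i, pd i (fun y => ρ t y * v t y i) x := by
      rw [div, ← sum_add_distrib]
      refine sum_congr rfl fun i _ => ?_
      rw [← pd_add (g := fun y => ρ t y * v t y i) (hdv i t ht x) ((hdρ t ht x).mul (hdv i t ht x))]
      congr 1; ext y; simp; ring
    rw [h2] at h1
    linarith
  have dρ : ∀ x, ∀ t ∈ J, HasDerivWithinAt (fun s => ρ s x) (derivWithin (fun s => ρ s x) J t) J t :=
    fun x t ht => (hasDerivWithinAt_slice h.contDiff_density x ht).differentiableWithinAt.hasDerivWithinAt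
  have dv : ∀ l x, ∀ t ∈ J, HasDerivWithinAt (fun s => v s x l) (derivWithin (fun s => v s x l) J t) J t :=
    fun l x t ht => (hasDerivWithinAt_slice (hvi l) x ht).differentiableWithinAt.hasDerivWithinAt
  have eσ : ∀ t ∈ J, ∀ x, derivWithin (fun s => ρ s x) J t / (1 + ρ t x) =
      -(∑ i, v t x i * pd i (logDen (ρ t)) x + ∑ i, pd i (fun y => v t y i) x) := by
    intro t ht x
    rw [eρ t ht x, div_eq_iff (hne t ht x)]
    simp_rw [pd_logDen (hdρ t ht) (hρ4 t ht), pd_mul (hdρ t ht x) (hdv _ t ht x), sum_add_distrib]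
    rw [← mul_sum]
    have h3 : (∑ i, v t x i * ((1 + ρ t x)⁻¹ * pd i (ρ t) x)) * (1 + ρ t x) =
        ∑ i, pd i (ρ t) x * v t x i := by
      rw [sum_mul]
      refine sum_congr rfl fun i _ => ?_
      have := hne t ht x
      field_simp
    linear_combination h3
  have ev : ∀ l, ∀ t ∈ J, ∀ x, derivWithin (fun s => v s x l) J t =
      -(∑ i, v t x i * pd i (fun y => v t y l) x + pd l (logDen (ρ t)) x + pd l (φ t) x) := by
    intro l t ht x
    have h1 := congrArg (fun w : R3 => w l) (h.momentum t ht x)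
    have hdw : HasDerivWithinAt (fun s => v s x) (derivWithin (fun s => v s x) J t) J t := by
      have h5 := (h.contDiff_velocity.differentiableOn (by norm_num) (t, x) ⟨ht, trivial⟩).hasFDerivWithinAt
      have h6 : HasDerivWithinAt (fun s : ℝ => (s, x)) ((1 : ℝ), (0 : R3)) J t :=
        ((hasDerivAt_id t).prodMk (hasDerivAt_const t x)).hasDerivWithinAt
      exact (h5.comp_hasDerivWithinAt t h6 fun s hs => Set.mk_mem_prod hs (Set.mem_univ x)).differentiableWithinAt.hasDerivWithinAt
    have h2 : (derivWithin (fun s => v s x) J t) l = derivWithin (fun s => v s x l) J t :=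
      (((EuclideanSpace.proj l : R3 →L[ℝ] ℝ).hasFDerivAt.comp_hasDerivWithinAt t hdw).derivWithin
        (hJ t ht)).symm
    have h3 : pd l (fun y => 1 + ρ t y) x = pd l (ρ t) x := by
      rw [pd_add (differentiableAt_const 1) (hdρ t ht x)]; simp [pd]
    simp only [PiLp.smul_apply, PiLp.add_apply, PiLp.sub_apply, PiLp.neg_apply, smul_eq_mul,
      gradient_apply, h2, h3, fderiv_apply_component ((hcv' t ht).differentiable (by norm_num))] at h1
    rw [pd_logDen (hdρ t ht) (hρ4 t ht)]
    have := hne t ht x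
    field_simp
    linear_combination h1
  have ccont : ∀ {f : ℝ → R3 → ℝ} {g : ℝ → R3 → ℝ},
      ContDiffOn ℝ 1 (Function.uncurry f) (J ×ˢ Set.univ) →
      (∀ t ∈ J, ∀ x, derivWithin (fun s => f s x) J t = g t x) →
      ContinuousOn (Function.uncurry g) (J ×ˢ Set.univ) := fun hf hg =>
    (continuousOn_derivWithin hJ hf).congr fun p hp => (hg p.1 (Set.mem_prod.1 hp).1 p.2).symm
  refine ⟨ordConnected_timeInterval T, zero_mem_timeInterval hT, fun t ht => ht.1, hcρ, hcv,
    h.regular_density, h.regular_velocity, hpot, ⟨fun x t ht => ?_, ccont h.contDiff_density eρ, rρ,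
      (rdiv.add rflux).neg⟩, ⟨fun x t ht => ?_, ?_, rlog, ?_⟩, fun l => ⟨fun x t ht => ?_, ccont (hvi l) (ev l), rv l, ?_⟩⟩
  · rw [← eρ t ht x]; exact dρ x t ht
  · rw [← eσ t ht x]
    exact ((dρ x t ht).const_add 1).log (hne t ht x)
  · refine ContinuousOn.congr (f := fun p : ℝ × R3 => derivWithin (fun s => ρ s p.2) J p.1 / (1 + ρ p.1 p.2)) ?_
      fun p hp => (eσ p.1 (Set.mem_prod.1 hp).1 p.2).symm
    exact (continuousOn_derivWithin hJ h.contDiff_density).div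
      (continuousOn_const.add h.contDiff_density.continuousOn)
      fun p hp => hne p.1 (Set.mem_prod.1 hp).1 p.2
  · exact ((L2Reg.sum _ fun i _ => (uv i).mul_l2 (rdlog i) (cv i)).add rdiv).neg
  · rw [← ev l t ht x]; exact dv l x t ht
  · exact (((L2Reg.sum _ fun i _ => (uv i).mul_l2 (rdv i l) (cv i)).add (rdlog l)).add (rφ l)).neg

/-! ### The complex unknowns at a fixed time -/

theorem ae_ne_zero : ∀ᵐ ξ : R3, ξ ≠ 0 :=
  compl_mem_ae_iff.2 (measure_singleton (0 : R3))

theorem freq_pos {ξ : R3} (h : ξ ≠ 0) : 0 < freq ξ := by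
  have := norm_pos_iff.2 h
  unfold freq; positivity

theorem freq_neg (ξ : R3) : freq (-ξ) = freq ξ := by simp [freq]

theorem jap_neg (ξ : R3) : jap (-ξ) = jap ξ := by simp [jap, freq_neg]

theorem wnorm_le_ae {a b : R3 → ℝ} {C : ℝ} (h : ∀ ξ ≠ 0, |a ξ| ≤ C * |b ξ|) (u : L2) :
    wnorm a u ≤ ofReal C * wnorm b u := by
  refine eLpNorm_le_mul_eLpNorm_of_ae_le_mul ?_ 2
  filter_upwards [ae_ne_zero] with ξ hξ
  rw [norm_mul, norm_mul, norm_real, norm_real, ← mul_assoc]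
  exact mul_le_mul_of_nonneg_right (h ξ hξ) (norm_nonneg _)

theorem wnorm_mono_ae {a b : R3 → ℝ} (h : ∀ ξ ≠ 0, |a ξ| ≤ |b ξ|) (u : L2) : wnorm a u ≤ wnorm b u := by
  have := wnorm_le_ae (a := a) (b := b) (C := 1) (fun ξ hξ => by simpa using h ξ hξ) u
  simpa using this

/-- The weight of the first part of the `X` norm dominates every power of order at most `s`. -/
theorem rpow_le_freq_inv_mul {a s : ℝ} (h : a ≤ s) {ξ : R3} (hξ : ξ ≠ 0) :
    |jap ξ ^ a| ≤ |(freq ξ)⁻¹ * jap ξ ^ (s + 1)| := by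
  have h0 := freq_pos hξ
  rw [abs_of_nonneg (rpow_nonneg (jap_pos ξ).le _),
    abs_of_nonneg (mul_nonneg (inv_pos.2 h0).le (rpow_nonneg (jap_pos ξ).le _)),
    rpow_add (jap_pos ξ), Real.rpow_one]
  calc jap ξ ^ a ≤ jap ξ ^ s := Real.rpow_le_rpow_of_exponent_le (one_le_jap ξ) h
    _ = (freq ξ)⁻¹ * (jap ξ ^ s * freq ξ) := by field_simp
    _ ≤ _ := mul_le_mul_of_nonneg_left (mul_le_mul_of_nonneg_left (freq_le_jap ξ)
        (rpow_nonneg (jap_pos ξ).le _)) (inv_pos.2 h0).le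

theorem one_le_q (r : ℝ) : 1 ≤ q r := by
  unfold q
  rw [Real.one_le_sqrt, le_div_iff₀ (by positivity)]
  linarith

theorem q_le_two (r : ℝ) : q r ≤ 2 := by
  unfold q
  rw [Real.sqrt_le_left (by norm_num), div_le_iff₀ (by positivity)]
  nlinarith [sq_nonneg r]

theorem q_sq (r : ℝ) : q r ^ 2 = (2 + r ^ 2) / (1 + r ^ 2) := Real.sq_sqrt (by positivity)

theorem measurable_q_freq : Measurable fun ξ => q (freq ξ) := by unfold q freq; fun_prop

theorem fourier_add (u w : L2) : (𝓕 (u + w) : L2) = 𝓕 u + 𝓕 w := map_add (fourierCLM ℂ L2) _ _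

theorem fourier_smul (c : ℂ) (u : L2) : (𝓕 (c • u) : L2) = c • 𝓕 u := map_smul (fourierCLM ℂ L2) _ _

theorem fourier_neg (u : L2) : (𝓕 (-u) : L2) = -𝓕 u := map_neg (fourierCLM ℂ L2) _

theorem fourier_sub (u w : L2) : (𝓕 (u - w) : L2) = 𝓕 u - 𝓕 w := map_sub (fourierCLM ℂ L2) _ _

theorem fourier_rieszInv (w : R3 → R3) : (𝓕 (rieszInv w) : L2) =ᵐ[volume]
    fun ξ => -∑ j, I * ((ξ j / ‖ξ‖ : ℝ) : ℂ) * (𝓕 (cl fun x => w x j) : L2) ξ := by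
  have h : ∀ j, (𝓕 (riesz j (cl fun x => w x j)) : L2) =ᵐ[volume] fun ξ =>
      I * ((ξ j / ‖ξ‖ : ℝ) : ℂ) * (𝓕 (cl fun x => w x j) : L2) ξ := fun j =>
    fourier_fourierMul (riesz_symbol j).1 (riesz_symbol j).2 _
  have e : (𝓕 (rieszInv w) : L2) = -(𝓕 (riesz 0 (cl fun x => w x 0)) + 𝓕 (riesz 1 (cl fun x => w x 1)) +
      𝓕 (riesz 2 (cl fun x => w x 2))) := by
    rw [rieszInv, fourier_neg, Fin.sum_univ_three, fourier_add, fourier_add]; rfl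
  rw [e]
  filter_upwards [h 0, h 1, h 2, Lp.coeFn_neg (𝓕 (riesz 0 (cl fun x => w x 0)) +
      𝓕 (riesz 1 (cl fun x => w x 1)) + 𝓕 (riesz 2 (cl fun x => w x 2)) : L2),
    Lp.coeFn_add (𝓕 (riesz 0 (cl fun x => w x 0)) + 𝓕 (riesz 1 (cl fun x => w x 1)) : L2)
      (𝓕 (riesz 2 (cl fun x => w x 2))),
    Lp.coeFn_add (𝓕 (riesz 0 (cl fun x => w x 0)) : L2) (𝓕 (riesz 1 (cl fun x => w x 1)))]
    with ξ h0 h1 h2 h3 h4 h5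
  rw [h3, Pi.neg_apply, h4, Pi.add_apply, h5, Pi.add_apply, h0, h1, h2, Fin.sum_univ_three]

theorem fourier_alpha (j : ℕ) (ρ : R3 → ℝ) (v : R3 → R3) :
    (𝓕 (alpha j ρ v) : L2) =ᵐ[volume] fun ξ => (𝓕 (cl ρ) : L2) ξ +
      ((-1 : ℂ) ^ j * I) * ((((q (freq ξ))⁻¹ : ℝ) : ℂ) * (𝓕 (rieszInv v) : L2) ξ) := by
  have e : (𝓕 (alpha j ρ v) : L2) = 𝓕 (cl ρ) + ((-1 : ℂ) ^ j * I) • 𝓕 (qInv (rieszInv v)) := by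
    rw [alpha, fourier_add, fourier_smul]; rfl
  rw [e]
  filter_upwards [fourier_fourierMul qInv_symbol.1 qInv_symbol.2 (rieszInv v),
    Lp.coeFn_add (𝓕 (cl ρ) : L2) (((-1 : ℂ) ^ j * I) • 𝓕 (qInv (rieszInv v))),
    Lp.coeFn_smul ((-1 : ℂ) ^ j * I) (𝓕 (qInv (rieszInv v)) : L2)] with ξ h1 h2 h3
  have h1' : (𝓕 (qInv (rieszInv v)) : L2) ξ = _ := h1
  rw [h2, Pi.add_apply, h3, Pi.smul_apply, h1', smul_eq_mul]

theorem norm_phase (j : ℕ) : ‖(-1 : ℂ) ^ j * I‖ = 1 := by simp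

/-- `𝓡⁻¹ v` is real-valued, that is, its Fourier transform is Hermitian. -/
theorem fourier_rieszInv_neg {v : R3 → R3} (hv : ∀ i, MemLp (fun x => v x i) 2 volume) :
    ∀ᵐ ξ : R3,
      (𝓕 (rieszInv v) : L2) (-ξ) = conj ((𝓕 (rieszInv v) : L2) ξ) := by
  filter_upwards [fourier_rieszInv v, ae_neg (fourier_rieszInv v), fourier_cl_neg (hv 0),
    fourier_cl_neg (hv 1), fourier_cl_neg (hv 2)] with ξ h1 h2 h3 h4 h5
  rw [h1, h2]
  simp only [Fin.sum_univ_three, h3, h4, h5, norm_neg, PiLp.neg_apply, map_neg, map_add, map_mul,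
    Complex.conj_I, conj_ofReal]
  push_cast
  ring

theorem exists_fourier_eq {a : R3 → ℝ} (ha : Measurable a) {u : L2} (h : wnorm a u < ∞) :
    ∃ G : L2, (𝓕 G : L2) =ᵐ[volume] fun ξ => ((a ξ : ℝ) : ℂ) * (𝓕 u : L2) ξ := by
  refine ⟨𝓕⁻ (toL2 fun ξ => ((a ξ : ℝ) : ℂ) * (𝓕 u : L2) ξ), ?_⟩
  rw [fourier_fourierInv_eq]
  exact coeFn_toL2 ⟨aestronglyMeasurable_weight ha u, h⟩

/-- A multiplier with an even symbol that is applied to `α` splits into the parts that come from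
`ρ` and from `v`; both are the real and the imaginary part, up to a factor of modulus one. -/
theorem exists_parts {j : ℕ} {ρ : R3 → ℝ} {v : R3 → R3} (hρ : MemLp ρ 2 volume)
    (hv : ∀ i, MemLp (fun x => v x i) 2 volume) {a : R3 → ℝ} (heven : ∀ ξ, a (-ξ) = a ξ) {G : L2}
    (hG : (𝓕 G : L2) =ᵐ[volume] fun ξ => ((a ξ : ℝ) : ℂ) * (𝓕 (alpha j ρ v) : L2) ξ) :
    ∃ G₁ G₂ : L2, ((𝓕 G₁ : L2) =ᵐ[volume] fun ξ => ((a ξ : ℝ) : ℂ) * (𝓕 (cl ρ) : L2) ξ) ∧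
      ((𝓕 G₂ : L2) =ᵐ[volume] fun ξ => ((-1 : ℂ) ^ j * I) *
        (((a ξ * (q (freq ξ))⁻¹ : ℝ) : ℂ) * (𝓕 (rieszInv v) : L2) ξ)) ∧
      (∀ᵐ x : R3, ‖G₁ x‖ ≤ ‖G x‖) ∧ ∀ᵐ x : R3, ‖G₂ x‖ ≤ ‖G x‖ := by
  set Gc : L2 := toL2 fun x => conj (G x)
  have hGc : Gc =ᵐ[volume] fun x => conj (G x) := coeFn_toL2 (memLp_star G)
  have hF := fourier_conj hGc
  have hkey : ∀ᵐ ξ : R3, conj ((𝓕 G : L2) (-ξ)) =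
      ((a ξ : ℝ) : ℂ) * ((𝓕 (cl ρ) : L2) ξ - ((-1 : ℂ) ^ j * I) *
        ((((q (freq ξ))⁻¹ : ℝ) : ℂ) * (𝓕 (rieszInv v) : L2) ξ)) := by
    filter_upwards [ae_neg hG, ae_neg (fourier_alpha j ρ v), fourier_cl_neg hρ,
      fourier_rieszInv_neg hv] with ξ h1 h2 h3 h4
    rw [h1, h2, h3, h4, heven, freq_neg]
    simp only [map_mul, map_add, conj_ofReal, Complex.conj_conj, map_pow, map_neg, map_one,
      Complex.conj_I]
    ring
  refine ⟨(2⁻¹ : ℂ) • (G + Gc), (2⁻¹ : ℂ) • (G - Gc), ?_, ?_, ?_, ?_⟩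
  · rw [fourier_smul, fourier_add]
    filter_upwards [Lp.coeFn_smul (2⁻¹ : ℂ) (𝓕 G + 𝓕 Gc : L2), Lp.coeFn_add (𝓕 G : L2) (𝓕 Gc), hF, hkey,
      hG, fourier_alpha j ρ v] with ξ h1 h2 h3 h4 h5 h6
    rw [h1, Pi.smul_apply, h2, Pi.add_apply, h3, h4, h5, h6, smul_eq_mul]; ring
  · rw [fourier_smul, fourier_sub]
    filter_upwards [Lp.coeFn_smul (2⁻¹ : ℂ) (𝓕 G - 𝓕 Gc : L2), Lp.coeFn_sub (𝓕 G : L2) (𝓕 Gc), hF, hkey,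
      hG, fourier_alpha j ρ v] with ξ h1 h2 h3 h4 h5 h6
    rw [h1, Pi.smul_apply, h2, Pi.sub_apply, h3, h4, h5, h6, smul_eq_mul]; push_cast; ring
  · filter_upwards [Lp.coeFn_smul (2⁻¹ : ℂ) (G + Gc : L2), Lp.coeFn_add (G : L2) Gc, hGc] with x h1 h2 h3
    rw [h1, Pi.smul_apply, h2, Pi.add_apply, h3, norm_smul]
    have := norm_add_le (G x) (conj (G x))
    rw [RCLike.norm_conj] at this
    simp only [norm_inv, Complex.norm_ofNat]; linarith
  · filter_upwards [Lp.coeFn_smul (2⁻¹ : ℂ) (G - Gc : L2), Lp.coeFn_sub (G : L2) Gc, hGc] with x h1 h2 h3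
    rw [h1, Pi.smul_apply, h2, Pi.sub_apply, h3, norm_smul]
    have := norm_sub_le (G x) (conj (G x))
    rw [RCLike.norm_conj] at this
    simp only [norm_inv, Complex.norm_ofNat]; linarith

theorem wnorm_density_le {j : ℕ} {ρ : R3 → ℝ} {v : R3 → R3} (hρ : MemLp ρ 2 volume)
    (hv : ∀ i, MemLp (fun x => v x i) 2 volume) {a : R3 → ℝ} (ha : Measurable a)
    (heven : ∀ ξ, a (-ξ) = a ξ) :
    wnorm a (cl ρ) ≤ wnorm a (alpha j ρ v) ∧
      wnorm (fun ξ => a ξ * (q (freq ξ))⁻¹) (rieszInv v) ≤ wnorm a (alpha j ρ v) := by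
  rcases eq_or_lt_of_le (le_top (a := wnorm a (alpha j ρ v))) with h | h
  · rw [h]; exact ⟨le_top, le_top⟩
  obtain ⟨G, hG⟩ := exists_fourier_eq ha h
  obtain ⟨G₁, G₂, h1, h2, h3, h4⟩ := exists_parts hρ hv heven hG
  have e0 : wnorm a (alpha j ρ v) = eLpNorm G 2 volume := by
    rw [← eLpNorm_fourier, wnorm, eLpNorm_congr_ae hG]
  rw [e0]
  constructor
  · calc _ = eLpNorm G₁ 2 volume := by rw [← eLpNorm_fourier, wnorm, eLpNorm_congr_ae h1]
      _ ≤ _ := eLpNorm_mono_ae h3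
  · calc _ = eLpNorm (𝓕 G₂ : L2) 2 volume := by
          rw [wnorm, eLpNorm_congr_ae h2]
          refine eLpNorm_congr_norm_ae (.of_forall fun ξ => ?_)
          rw [norm_mul _ (_ * _), norm_phase, one_mul]
      _ = eLpNorm G₂ 2 volume := eLpNorm_fourier _
      _ ≤ _ := eLpNorm_mono_ae h4

theorem wnorm_rieszInv_le {j : ℕ} {ρ : R3 → ℝ} {v : R3 → R3} (hρ : MemLp ρ 2 volume)
    (hv : ∀ i, MemLp (fun x => v x i) 2 volume) {a : R3 → ℝ} (ha : Measurable a)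
    (heven : ∀ ξ, a (-ξ) = a ξ) :
    wnorm a (rieszInv v) ≤ 2 * wnorm a (alpha j ρ v) := by
  have h1 : wnorm a (rieszInv v) ≤ ofReal 2 * wnorm (fun ξ => a ξ * (q (freq ξ))⁻¹) (rieszInv v) := by
    refine wnorm_le (fun ξ => ?_) _
    have h3 := q_le_two (freq ξ)
    have h4 := one_le_q (freq ξ)
    have h5 : 2⁻¹ ≤ (q (freq ξ))⁻¹ := inv_anti₀ (by linarith) h3
    rw [abs_mul, abs_of_pos (by linarith : 0 < (q (freq ξ))⁻¹)]
    nlinarith [abs_nonneg (a ξ)]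
  refine h1.trans ?_
  simp only [ENNReal.ofReal_ofNat]
  gcongr
  exact (wnorm_density_le hρ hv ha heven).2

/-- A velocity field is a gradient if its Fourier transform is parallel to the frequency. -/
def IsGradient (v : R3 → R3) : Prop :=
  ∀ l, (𝓕 (cl fun x => v x l) : L2) =ᵐ[volume]
    fun ξ => I * ((ξ l / ‖ξ‖ : ℝ) : ℂ) * (𝓕 (rieszInv v) : L2) ξ

theorem abs_div_norm_le (ξ : R3) (l : Fin 3) : |ξ l / ‖ξ‖| ≤ 1 := by
  rw [abs_div, abs_norm]
  exact div_le_one_of_le₀ (PiLp.norm_apply_le ξ l) (norm_nonneg _)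

theorem IsGradient.wnorm_le {j : ℕ} {ρ : R3 → ℝ} {v : R3 → R3} (hg : IsGradient v)
    (hρ : MemLp ρ 2 volume) (hv : ∀ i, MemLp (fun x => v x i) 2 volume) {a : R3 → ℝ} (ha : Measurable a)
    (heven : ∀ ξ, a (-ξ) = a ξ) (l : Fin 3) :
    wnorm a (cl fun x => v x l) ≤ 2 * wnorm a (alpha j ρ v) := by
  refine le_trans ?_ (wnorm_rieszInv_le hρ hv ha heven)
  refine eLpNorm_mono_ae ?_
  filter_upwards [hg l] with ξ h1
  rw [h1, norm_mul, norm_mul, norm_mul, norm_mul, Complex.norm_I, norm_real (ξ l / ‖ξ‖), one_mul]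
  gcongr
  exact mul_le_of_le_one_left (norm_nonneg _) (abs_div_norm_le ξ l)

/-- The norms of `α` are bounded by those of the unknowns; the symbols in `alpha` are bounded by one. -/
theorem wnorm_alpha_le (j : ℕ) (ρ : R3 → ℝ) (v : R3 → R3) {a : R3 → ℝ} (ha : Measurable a) :
    wnorm a (alpha j ρ v) ≤ wnorm a (cl ρ) + ∑ i, wnorm a (cl fun x => v x i) := by
  have hq : Measurable fun ξ => a ξ * (q (freq ξ))⁻¹ := ha.mul measurable_q_freq.inv
  have hm : ∀ i, AEStronglyMeasurable (fun ξ => ((a ξ : ℝ) : ℂ) * (𝓕 (cl fun x => v x i) : L2) ξ) volume :=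
    fun i => aestronglyMeasurable_weight ha _
  calc _ ≤ eLpNorm (fun ξ => ‖((a ξ : ℝ) : ℂ) * (𝓕 (cl ρ) : L2) ξ‖ +
        ∑ i, ‖((a ξ : ℝ) : ℂ) * (𝓕 (cl fun x => v x i) : L2) ξ‖) 2 volume := by
        refine eLpNorm_mono_ae ?_
        filter_upwards [fourier_alpha j ρ v, fourier_rieszInv v] with ξ h1 h2
        rw [h1, mul_add]
        refine (norm_add_le _ _).trans (le_trans ?_ (le_abs_self _))
        refine add_le_add le_rfl ?_
        rw [norm_mul, norm_mul _ (_ * _), norm_phase, one_mul, norm_mul, h2, norm_neg]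
        have h5 : ‖(((q (freq ξ))⁻¹ : ℝ) : ℂ)‖ ≤ 1 := qInv_symbol.2 ξ
        calc _ ≤ ‖((a ξ : ℝ) : ℂ)‖ * (1 * ∑ i, ‖(𝓕 (cl fun x => v x i) : L2) ξ‖) := by
              gcongr
              refine (norm_sum_le _ _).trans (sum_le_sum fun i _ => ?_)
              rw [norm_mul]
              exact mul_le_of_le_one_left (norm_nonneg _) ((riesz_symbol i).2 ξ)
          _ = _ := by rw [one_mul, mul_sum]; simp_rw [norm_mul]
    _ ≤ _ := by
        refine (eLpNorm_add_le (aestronglyMeasurable_weight ha _).norm ?_ (by norm_num)).trans ?_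
        · exact Finset.aestronglyMeasurable_fun_sum _ fun i _ => (hm i).norm
        · refine add_le_add (eLpNorm_norm _).le ?_
          refine (eLpNorm_sum_le' (F := fun i ξ => ‖((a ξ : ℝ) : ℂ) * (𝓕 (cl fun x => v x i) : L2) ξ‖)
            Finset.univ fun i _ => (hm i).norm).trans ?_
          exact sum_le_sum fun i _ => (eLpNorm_norm _).le

/-- The `W^{k,10}` norm is the `L¹⁰` norm of the square-integrable function `(1 - Δ)^{k/2} u`. -/
theorem eLpNorm_le_normW {k : ℝ} {u G : L2}
    (hG : (𝓕 G : L2) =ᵐ[volume] fun ξ => ((jap ξ ^ k : ℝ) : ℂ) * (𝓕 u : L2) ξ) :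
    eLpNorm G 10 volume ≤ normW k 10 u := by
  refine le_iInf fun g => le_iInf fun hg => ?_
  have hloc : LocallyIntegrable (g : R3 → ℂ) volume := (Lp.memLp g).locallyIntegrable (by norm_num)
  have hae : (G : R3 → ℂ) =ᵐ[volume] g := by
    refine L2_ext_schwartz hloc fun ψ => ?_
    have h1 := congrArg (fun Λ : 𝓢'(R3, ℂ) => Λ ψ) hg
    simp only [bessel, TemperedDistribution.fourierMultiplierCLM_apply] at h1
    rw [Lp.fourier_toTemperedDistribution_eq, Lp.toTemperedDistribution_apply] at h1
    have h2 : ∀ Λ : 𝓢'(R3, ℂ), (𝓕⁻ (TemperedDistribution.smulLeftCLM ℂ (fun ξ : R3 => ((jap ξ ^ k : ℝ) : ℂ)) Λ) : 𝓢'(R3, ℂ)) ψ =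
        Λ (SchwartzMap.smulLeftCLM ℂ (fun ξ : R3 => ((jap ξ ^ k : ℝ) : ℂ)) (𝓕⁻ ψ)) := fun Λ => rfl
    rw [h2, Lp.toTemperedDistribution_apply] at h1
    simp only [SchwartzMap.smulLeftCLM_apply_apply (bessel_symbol k), smul_eq_mul] at h1
    rw [h1]
    calc ∫ x, ψ x * G x = ∫ x, (𝓕 (𝓕⁻ ψ) : 𝓢(R3, ℂ)) x * G x := by rw [fourier_fourierInv_eq]
      _ = ∫ ξ, (𝓕⁻ ψ : 𝓢(R3, ℂ)) ξ * (𝓕 G : L2) ξ := integral_fourier_schwartz_mul _ _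
      _ = _ := by
          refine integral_congr_ae ?_
          filter_upwards [hG] with ξ h3
          rw [h3]; ring
  rw [eLpNorm_congr_ae hae, Lp.enorm_def]

/-! ### Pointwise decay from the `W^{k,10}` norm -/

theorem isSymbol_const (c : ℝ) : IsSymbol (fun _ => 1) (fun _ => c) := fun i =>
  ⟨|c|, abs_nonneg c, fun _ => 0, fun _ => 0, fun ξ _ =>
    ⟨hasDerivAt_const _ _, hasDerivAt_const _ _, by simp, by simp, by simp⟩⟩

/-- The symbol of the `l`-th Riesz transform, up to the factor `i`, written with powers. -/
def dirS (l : Fin 3) (ξ : R3) : ℝ := 2 * π * (ξ l * (0 + freq ξ ^ 2) ^ (-(1 / 2) : ℝ))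

/-- The symbol `q(|∇|) (1 - Δ)^{-k/2}`, written with powers. -/
def qJapS (k : ℝ) (ξ : R3) : ℝ :=
  (2 + freq ξ ^ 2) ^ (1 / 2 : ℝ) * (1 + freq ξ ^ 2) ^ (-(1 / 2) : ℝ) * (1 + freq ξ ^ 2) ^ (-k / 2)

theorem jap_rpow_eq (e : ℝ) (ξ : R3) : (1 + freq ξ ^ 2) ^ (e / 2) = jap ξ ^ e := by
  rw [← jap_sq, ← rpow_natCast, ← rpow_mul (jap_pos ξ).le]
  congr 1; push_cast; ring

theorem freq_rpow_eq {ξ : R3} : (0 + freq ξ ^ 2) ^ (-(1 / 2) : ℝ) = (freq ξ)⁻¹ := by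
  rw [zero_add, ← rpow_natCast, ← rpow_mul (freq_nonneg ξ), ← Real.rpow_neg_one]
  congr 1; push_cast; norm_num

theorem dirS_eq (l : Fin 3) (ξ : R3) : dirS l ξ = ξ l / ‖ξ‖ := by
  rw [dirS, freq_rpow_eq, freq, mul_inv]
  have := Real.pi_pos
  field_simp

theorem qJapS_eq (k : ℝ) (ξ : R3) : qJapS k ξ = q (freq ξ) * jap ξ ^ (-k) := by
  rw [qJapS, ← jap_rpow_eq (-k), q, Real.sqrt_eq_rpow, Real.div_rpow (by positivity) (by positivity),
    Real.rpow_neg (by positivity)]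
  ring

theorem isSymbol_dirS (l : Fin 3) : IsSymbol (fun _ => 1) (dirS l) := by
  refine ((isSymbol_const (2 * π)).mul ((isSymbol_coord l).mul
    (isSymbol_rpow le_rfl (-(1 / 2))))).mono fun ξ hξ => ?_
  have h0 := norm_pos_iff.2 hξ
  rw [freq_rpow_eq, freq, mul_inv, one_mul]
  have := Real.pi_gt_three
  calc ‖ξ‖ * ((2 * π)⁻¹ * ‖ξ‖⁻¹) = (2 * π)⁻¹ := by field_simp
    _ ≤ 1 := inv_le_one_of_one_le₀ (by linarith)

theorem isSymbol_japS (k : ℝ) : IsSymbol (fun ξ => jap ξ ^ (-k)) (fun ξ => jap ξ ^ (-k)) := by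
  have := isSymbol_rpow zero_le_one (-k / 2)
  simpa only [jap_rpow_eq] using this

theorem isSymbol_qJapS (k : ℝ) : IsSymbol (fun ξ => 2 * jap ξ ^ (-k)) (qJapS k) := by
  refine (((isSymbol_rpow zero_le_two (1 / 2)).mul (isSymbol_rpow zero_le_one (-(1 / 2)))).mul
    (isSymbol_rpow zero_le_one (-k / 2))).mono fun ξ _ => ?_
  have := qJapS_eq k ξ
  rw [qJapS] at this
  rw [this]
  exact mul_le_mul_of_nonneg_right (q_le_two _) (rpow_nonneg (jap_pos ξ).le _)

theorem isSymbol_dcoord (i : Fin 3) : IsSymbol (fun ξ => (2 : ℝ)⁻¹ * jap ξ) (fun ξ => 2 * π * ξ i) := by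
  refine ((isSymbol_const (2 * π)).mul (isSymbol_coord i)).mono fun ξ _ => ?_
  have h1 := freq_le_jap ξ
  rw [freq] at h1
  have := Real.pi_gt_three
  have := norm_nonneg ξ
  nlinarith

theorem measurable_dirS (l : Fin 3) : Measurable (dirS l) := by
  unfold dirS freq; fun_prop

theorem measurable_qJapS (k : ℝ) : Measurable (qJapS k) := by
  unfold qJapS freq; fun_prop

theorem measurable_japS (k : ℝ) : Measurable fun ξ => jap ξ ^ (-k) := (continuous_jap_rpow _).measurable

theorem jap_rpow_le_neg_four {e : ℝ} (h : e ≤ -4) (ξ : R3) : jap ξ ^ e ≤ jap ξ ^ (-4 : ℝ) :=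
  Real.rpow_le_rpow_of_exponent_le (one_le_jap ξ) h

/-- The four families of symbols that turn the `L¹⁰` bound into pointwise bounds. -/
theorem isSymbol_four {k : ℝ} (hk : 5 ≤ k) (i l : Fin 3) :
    IsSymbol (fun ξ => jap ξ ^ (-4 : ℝ)) (fun ξ => jap ξ ^ (-k)) ∧
    IsSymbol (fun ξ => jap ξ ^ (-4 : ℝ)) (fun ξ => 2 * π * ξ i * jap ξ ^ (-k)) ∧
    IsSymbol (fun ξ => jap ξ ^ (-4 : ℝ)) (fun ξ => 2⁻¹ * (dirS l ξ * qJapS k ξ)) ∧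
    IsSymbol (fun ξ => jap ξ ^ (-4 : ℝ)) (fun ξ => 2 * π * ξ i * (dirS l ξ * qJapS k ξ)) := by
  have hj : ∀ ξ, jap ξ * jap ξ ^ (-k) = jap ξ ^ (1 - k) := fun ξ => by
    rw [sub_eq_add_neg, rpow_add (jap_pos ξ), Real.rpow_one]
  have hp : ∀ ξ e, 0 ≤ jap ξ ^ (e : ℝ) := fun ξ e => rpow_nonneg (jap_pos ξ).le e
  refine ⟨(isSymbol_japS k).mono fun ξ _ => jap_rpow_le_neg_four (by linarith) ξ,
    ((isSymbol_dcoord i).mul (isSymbol_japS k)).mono fun ξ _ => ?_,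
    (?_ : IsSymbol _ _), ((isSymbol_dcoord i).mul ((isSymbol_dirS l).mul (isSymbol_qJapS k))).mono fun ξ _ => ?_⟩
  · rw [mul_assoc, hj]
    have := jap_rpow_le_neg_four (e := 1 - k) (by linarith) ξ
    have := hp ξ (1 - k)
    linarith
  · have h2 : IsSymbol (fun _ => (2 : ℝ)⁻¹) (fun _ => (2 : ℝ)⁻¹) := fun i =>
      ⟨1, zero_le_one, fun _ => 0, fun _ => 0, fun ξ _ =>
        ⟨hasDerivAt_const _ _, hasDerivAt_const _ _, by norm_num, by norm_num, by norm_num⟩⟩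
    refine (h2.mul ((isSymbol_dirS l).mul (isSymbol_qJapS k))).mono fun ξ _ => ?_
    have := jap_rpow_le_neg_four (e := -k) (by linarith) ξ
    linarith
  · have := jap_rpow_le_neg_four (e := 1 - k) (by linarith) ξ
    have e : 2⁻¹ * jap ξ * (1 * (2 * jap ξ ^ (-k))) = jap ξ * jap ξ ^ (-k) := by ring
    rw [e, hj]
    exact this

theorem enorm_le_imp {f : ℝ} {K N : ℝ≥0∞} {a : ℝ} (h : ‖f‖ₑ ≤ K * N) (hK : K < ∞) (ha : 0 ≤ a)
    (hN : N ≤ ofReal a) : |f| ≤ K.toReal * a := by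
  have h1 : ‖f‖ₑ ≤ ofReal (K.toReal * a) := by
    rw [ofReal_mul toReal_nonneg, ofReal_toReal hK.ne]
    exact h.trans (by gcongr)
  rw [Real.enorm_eq_ofReal_abs] at h1
  exact (ofReal_le_ofReal_iff (mul_nonneg toReal_nonneg ha)).1 h1

/-- The `L^{10/9}` norm of the convolution kernel of the multiplier with symbol `m`. -/
def kerC (m : R3 → ℝ) : ℝ≥0∞ := eLpNorm (𝓕 fun ξ => ((m ξ : ℝ) : ℂ)) (10 / 9) volume

theorem abs_le_of_sums {A : ℝ} {B V : Fin 3 → ℝ} {W : Fin 3 → Fin 3 → ℝ} (hA : 0 ≤ A) (hB : ∀ i, 0 ≤ B i)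
    (hV : ∀ i, 0 ≤ V i) (hW : ∀ i j, 0 ≤ W i j) (i l : Fin 3) :
    let S := 1 + A + ∑ i, B i + ∑ l, 2 * V l + ∑ l, ∑ i, W l i
    1 ≤ S ∧ A ≤ S ∧ B i ≤ S ∧ 2 * V l ≤ S ∧ W l i ≤ S := by
  have h1 := single_le_sum (f := B) (fun i _ => hB i) (mem_univ i)
  have h2 := single_le_sum (f := fun l => 2 * V l) (fun i _ => by linarith [hV i]) (mem_univ l)
  have h3 := single_le_sum (f := fun l => ∑ i, W l i)
    (fun l _ => sum_nonneg fun i _ => hW l i) (mem_univ l)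
  have h4 := single_le_sum (f := W l) (fun i _ => hW l i) (mem_univ i)
  have := hB i
  have := hV l
  have := hW l i
  refine ⟨?_, ?_, ?_, ?_, ?_⟩ <;> linarith

/-- The constant in the pointwise bounds by the `W^{k,10}` norm. -/
def decC (k : ℝ) : ℝ :=
  1 + (kerC fun ξ => jap ξ ^ (-k)).toReal +
    ∑ i : Fin 3, (kerC fun ξ => 2 * π * ξ i * jap ξ ^ (-k)).toReal +
    ∑ l : Fin 3, 2 * (kerC fun ξ => 2⁻¹ * (dirS l ξ * qJapS k ξ)).toReal +
    ∑ l : Fin 3, ∑ i : Fin 3, (kerC fun ξ => 2 * π * ξ i * (dirS l ξ * qJapS k ξ)).toReal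

theorem decC_ge (k : ℝ) (i l : Fin 3) : 1 ≤ decC k ∧ (kerC fun ξ => jap ξ ^ (-k)).toReal ≤ decC k ∧
    (kerC fun ξ => 2 * π * ξ i * jap ξ ^ (-k)).toReal ≤ decC k ∧
    2 * (kerC fun ξ => 2⁻¹ * (dirS l ξ * qJapS k ξ)).toReal ≤ decC k ∧
    (kerC fun ξ => 2 * π * ξ i * (dirS l ξ * qJapS k ξ)).toReal ≤ decC k :=
  abs_le_of_sums (A := (kerC fun ξ => jap ξ ^ (-k)).toReal)
    (B := fun i => (kerC fun ξ => 2 * π * ξ i * jap ξ ^ (-k)).toReal)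
    (V := fun l => (kerC fun ξ => 2⁻¹ * (dirS l ξ * qJapS k ξ)).toReal)
    (W := fun l i => (kerC fun ξ => 2 * π * ξ i * (dirS l ξ * qJapS k ξ)).toReal)
    toReal_nonneg (fun _ => toReal_nonneg) (fun _ => toReal_nonneg)
    (fun _ _ => toReal_nonneg) i l

section Decay

variable {k : ℝ} {j : ℕ} {ρ : R3 → ℝ} {v : R3 → R3}

/-- The two parts of `(1 - Δ)^{k/2} α`, with bounds in `L¹⁰`. -/
theorem exists_l10_parts (hρ : MemLp ρ 2 volume) (hv : ∀ i, MemLp (fun x => v x i) 2 volume)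
    (hfin : normHneg (2 * k + 1) (alpha j ρ v) < ∞) (hk : 5 ≤ k) {a : ℝ}
    (ha : normW k 10 (alpha j ρ v) ≤ ofReal a) :
    ∃ G₁ G₂ : L2, ((𝓕 (cl ρ) : L2) =ᵐ[volume] fun ξ => ((jap ξ ^ (-k) : ℝ) : ℂ) * (𝓕 G₁ : L2) ξ) ∧
      ((𝓕 (rieszInv v) : L2) =ᵐ[volume] fun ξ => ((-1 : ℂ) ^ j * I)⁻¹ *
        (((qJapS k ξ : ℝ) : ℂ) * (𝓕 G₂ : L2) ξ)) ∧
      eLpNorm G₁ 10 volume ≤ ofReal a ∧ eLpNorm G₂ 10 volume ≤ ofReal a := by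
  have hw : wnorm (fun ξ => jap ξ ^ k) (alpha j ρ v) < ∞ :=
    (wnorm_mono_ae (fun ξ hξ => rpow_le_freq_inv_mul (by linarith : k ≤ 2 * k) hξ) _).trans_lt hfin
  obtain ⟨G, hG⟩ := exists_fourier_eq (continuous_jap_rpow k).measurable hw
  obtain ⟨G₁, G₂, h1, h2, h3, h4⟩ := exists_parts hρ hv (fun ξ => by rw [jap_neg]) hG
  have h5 := (eLpNorm_le_normW hG).trans ha
  have hcancel : ∀ ξ, ((jap ξ ^ (-k) : ℝ) : ℂ) * ((jap ξ ^ k : ℝ) : ℂ) = 1 := fun ξ => by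
    rw [← Complex.ofReal_mul, ← rpow_add (jap_pos ξ)]; simp
  refine ⟨G₁, G₂, ?_, ?_, (eLpNorm_mono_ae h3).trans h5, (eLpNorm_mono_ae h4).trans h5⟩
  · filter_upwards [h1] with ξ h
    rw [h, ← mul_assoc, hcancel, one_mul]
  · filter_upwards [h2] with ξ h
    have hq : (q (freq ξ) : ℂ) ≠ 0 := by
      have := one_le_q (freq ξ)
      exact_mod_cast (by linarith : (0 : ℝ) < q (freq ξ)).ne'
    have hph : ((-1 : ℂ) ^ j * I) ≠ 0 := norm_ne_zero_iff.1 (by rw [norm_phase]; norm_num)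
    have hc := hcancel ξ
    rw [h, qJapS_eq]
    push_cast
    field_simp
    linear_combination (-(𝓕 (rieszInv v) : L2) ξ) * hc

theorem abs_density_le (hk : 5 ≤ k) (hρ : MemLp ρ 2 volume) (hρc : Continuous ρ)
    (hv : ∀ i, MemLp (fun x => v x i) 2 volume) (hfin : normHneg (2 * k + 1) (alpha j ρ v) < ∞) {a : ℝ}
    (ha0 : 0 ≤ a) (ha : normW k 10 (alpha j ρ v) ≤ ofReal a) (x : R3) : |ρ x| ≤ decC k * a := by
  obtain ⟨G₁, G₂, h1, h2, h3, h4⟩ := exists_l10_parts hρ hv hfin hk ha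
  have hs := (isSymbol_four hk 0 0).1
  have := hs.enorm_le (measurable_japS k) hρc hρ (G := G₁) (c := 1) (by simp)
    (by filter_upwards [h1] with ξ h; rw [h, one_mul]) x
  refine (enorm_le_imp this (hs.kernel_lt_top (measurable_japS k)) ha0 h3).trans ?_
  exact mul_le_mul_of_nonneg_right (decC_ge k 0 0).2.1 ha0

theorem abs_pd_density_le (hk : 5 ≤ k) (hρ : MemLp ρ 2 volume) (hρc : ContDiff ℝ 1 ρ)
    (hv : ∀ i, MemLp (fun x => v x i) 2 volume) (hfin : normHneg (2 * k + 1) (alpha j ρ v) < ∞) {a : ℝ}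
    (ha0 : 0 ≤ a) (ha : normW k 10 (alpha j ρ v) ≤ ofReal a) {i : Fin 3}
    (hd : MemLp (pd i ρ) 2 volume) (x : R3) : |pd i ρ x| ≤ decC k * a := by
  obtain ⟨G₁, G₂, h1, h2, h3, h4⟩ := exists_l10_parts hρ hv hfin hk ha
  have hs := (isSymbol_four hk i 0).2.1
  have hm : Measurable fun ξ : R3 => 2 * π * ξ i * jap ξ ^ (-k) :=
    (by fun_prop : Measurable fun ξ : R3 => 2 * π * ξ i).mul (measurable_japS k)
  have := hs.enorm_le hm (continuous_pd hρc i) hd (G := G₁) (c := I) (by simp)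
    (by
      filter_upwards [h1, fourier_pd (hρc.differentiable (by norm_num)) hρ hd] with ξ h h'
      rw [h', h, dsym]; push_cast; ring) x
  refine (enorm_le_imp this (hs.kernel_lt_top hm) ha0 h3).trans ?_
  exact mul_le_mul_of_nonneg_right (decC_ge k i 0).2.2.1 ha0

theorem norm_phase_inv (j : ℕ) : ‖((-1 : ℂ) ^ j * I)⁻¹‖ = 1 := by
  rw [norm_inv, norm_phase, inv_one]

theorem abs_velocity_le (hk : 5 ≤ k) (hρ : MemLp ρ 2 volume) (hg : IsGradient v)
    (hv : ∀ i, MemLp (fun x => v x i) 2 volume) (hfin : normHneg (2 * k + 1) (alpha j ρ v) < ∞) {a : ℝ}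
    (ha0 : 0 ≤ a) (ha : normW k 10 (alpha j ρ v) ≤ ofReal a) {l : Fin 3}
    (hvc : Continuous fun x => v x l) (x : R3) : |v x l| ≤ decC k * a := by
  obtain ⟨G₁, G₂, h1, h2, h3, h4⟩ := exists_l10_parts hρ hv hfin hk ha
  have hs := (isSymbol_four hk 0 l).2.2.1
  have hm : Measurable fun ξ : R3 => 2⁻¹ * (dirS l ξ * qJapS k ξ) :=
    ((measurable_dirS l).mul (measurable_qJapS k)).const_mul _
  have := hs.enorm_le hm (f := fun x => 2⁻¹ * v x l) (continuous_const.mul hvc) ((hv l).const_mul _)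
    (G := G₂) (c := I * ((-1 : ℂ) ^ j * I)⁻¹)
    (by rw [norm_mul, norm_phase_inv, Complex.norm_I, one_mul])
    (by
      rw [cl_smul _ (hv l), fourier_smul]
      filter_upwards [h2, hg l, Lp.coeFn_smul ((2⁻¹ : ℝ) : ℂ) (𝓕 (cl fun x => v x l) : L2)] with ξ h h' h''
      rw [h'', Pi.smul_apply, h', h, dirS_eq, smul_eq_mul]; push_cast; ring) x
  have h6 := enorm_le_imp this (hs.kernel_lt_top hm) ha0 h4
  rw [abs_mul, abs_of_pos (by norm_num)] at h6
  have h7 := mul_le_mul_of_nonneg_right (decC_ge k 0 l).2.2.2.1 ha0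
  rw [kerC] at h7
  linarith

theorem abs_pd_velocity_le (hk : 5 ≤ k) (hρ : MemLp ρ 2 volume) (hg : IsGradient v)
    (hv : ∀ i, MemLp (fun x => v x i) 2 volume) (hfin : normHneg (2 * k + 1) (alpha j ρ v) < ∞) {a : ℝ}
    (ha0 : 0 ≤ a) (ha : normW k 10 (alpha j ρ v) ≤ ofReal a) {l i : Fin 3}
    (hvc : ContDiff ℝ 1 fun x => v x l) (hd : MemLp (pd i fun x => v x l) 2 volume) (x : R3) :
    |pd i (fun x => v x l) x| ≤ decC k * a := by
  obtain ⟨G₁, G₂, h1, h2, h3, h4⟩ := exists_l10_parts hρ hv hfin hk ha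
  have hs := (isSymbol_four hk i l).2.2.2
  have hm : Measurable fun ξ : R3 => 2 * π * ξ i * (dirS l ξ * qJapS k ξ) :=
    (by fun_prop : Measurable fun ξ : R3 => 2 * π * ξ i).mul
      ((measurable_dirS l).mul (measurable_qJapS k))
  have := hs.enorm_le hm (continuous_pd hvc i) hd (G := G₂)
    (c := I * (I * ((-1 : ℂ) ^ j * I)⁻¹))
    (by rw [norm_mul, norm_mul, norm_phase_inv, Complex.norm_I, one_mul, one_mul])
    (by
      filter_upwards [h2, hg l, fourier_pd (hvc.differentiable (by norm_num)) (hv l) hd] with ξ h h' h''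
      rw [h'', h', h, dirS_eq, dsym]; push_cast; ring) x
  refine (enorm_le_imp this (hs.kernel_lt_top hm) ha0 h4).trans ?_
  exact mul_le_mul_of_nonneg_right (decC_ge k i l).2.2.2.2 ha0

end Decay

/-! ### `L²` as a real Hilbert space, and bounded real multipliers on the Fourier side -/

theorem memLp_mulR {m : R3 → ℝ} (hm : Measurable m) {C : ℝ} (hC : ∀ ξ, |m ξ| ≤ C) (f : L2) :
    MemLp (fun ξ => ((m ξ : ℝ) : ℂ) * f ξ) 2 (volume : Measure R3) :=
  MemLp.of_le_mul (c := C) (Lp.memLp f)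
    ((Complex.continuous_ofReal.measurable.comp hm).aestronglyMeasurable.mul (Lp.aestronglyMeasurable _))
    (.of_forall fun ξ => by
      rw [norm_mul, norm_real]; exact mul_le_mul_of_nonneg_right (hC ξ) (norm_nonneg _))

/-- Multiplication by a bounded measurable real function, on `L²`. -/
def mulR (m : R3 → ℝ) (hm : Measurable m) {C : ℝ} (hC : ∀ ξ, |m ξ| ≤ C) : L2 →L[ℝ] L2 :=
  have hmem := memLp_mulR hm hC
  LinearMap.mkContinuous
    { toFun := fun f => (hmem f).toLp _
      map_add' := fun f g => by
        refine Lp.ext ?_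
        filter_upwards [(hmem (f + g)).coeFn_toLp, Lp.coeFn_add ((hmem f).toLp _) ((hmem g).toLp _),
          (hmem f).coeFn_toLp, (hmem g).coeFn_toLp, Lp.coeFn_add f g] with ξ h1 h2 h3 h4 h5
        rw [h1, h2, Pi.add_apply, h3, h4, h5, Pi.add_apply, mul_add]
      map_smul' := fun c f => by
        refine Lp.ext ?_
        filter_upwards [(hmem (c • f)).coeFn_toLp, Lp.coeFn_smul c ((hmem f).toLp _),
          (hmem f).coeFn_toLp, Lp.coeFn_smul c f] with ξ h1 h2 h3 h5
        rw [h1, RingHom.id_apply, h2, Pi.smul_apply, h3, h5, Pi.smul_apply, mul_smul_comm] } C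
    fun f => by
      refine Lp.norm_le_mul_norm_of_ae_le_mul ?_
      filter_upwards [(hmem f).coeFn_toLp] with ξ h1
      change ‖(hmem f).toLp _ ξ‖ ≤ _
      rw [h1, norm_mul, norm_real]
      exact mul_le_mul_of_nonneg_right (hC ξ) (norm_nonneg _)

theorem coeFn_mulR {m : R3 → ℝ} (hm : Measurable m) {C : ℝ} (hC : ∀ ξ, |m ξ| ≤ C) (f : L2) :
    (mulR m hm hC f : R3 → ℂ) =ᵐ[volume] fun ξ => ((m ξ : ℝ) : ℂ) * f ξ :=
  (memLp_mulR hm hC f).coeFn_toLp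

theorem inner_eq_integral (f g : L2) :
    inner ℝ f g = ∫ x, (conj (f x) * g x).re := by
  rw [L2.inner_def]
  simp only [Complex.inner, mul_comm]

theorem integrable_inner_re (f g : L2) : Integrable fun x => (conj (f x) * g x).re :=
  (MemLp.integrable_mul (memLp_star f) (Lp.memLp g)).re

theorem inner_cl {f g : R3 → ℝ} (hf : MemLp f 2 volume) (hg : MemLp g 2 volume) :
    inner ℝ (cl f) (cl g) = ∫ x, f x * g x := by
  rw [inner_eq_integral]
  refine integral_congr_ae ?_
  filter_upwards [coeFn_cl hf, coeFn_cl hg] with x h1 h2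
  rw [h1, h2, conj_ofReal, ← Complex.ofReal_mul, Complex.ofReal_re]

theorem norm_fourier (f : L2) : ‖(𝓕 f : L2)‖ = ‖f‖ := by
  rw [Lp.norm_def, Lp.norm_def, eLpNorm_fourier]

theorem inner_fourier (f g : L2) : inner ℝ (𝓕 f : L2) (𝓕 g : L2) = inner ℝ f g := by
  rw [real_inner_eq_norm_add_mul_self_sub_norm_mul_self_sub_norm_mul_self_div_two,
    real_inner_eq_norm_add_mul_self_sub_norm_mul_self_sub_norm_mul_self_div_two, ← fourier_add,
    norm_fourier, norm_fourier, norm_fourier]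

theorem inner_mulR {m : R3 → ℝ} (hm : Measurable m) {C : ℝ} (hC : ∀ ξ, |m ξ| ≤ C) (f g : L2) :
    inner ℝ (mulR m hm hC f) g = inner ℝ f (mulR m hm hC g) := by
  rw [inner_eq_integral, inner_eq_integral]
  refine integral_congr_ae ?_
  filter_upwards [coeFn_mulR hm hC f, coeFn_mulR hm hC g] with x h1 h2
  rw [h1, h2, map_mul, conj_ofReal]
  ring_nf

theorem norm_cl {f : R3 → ℝ} (hf : MemLp f 2 volume) : ‖cl f‖ = (eLpNorm f 2 volume).toReal := by
  rw [Lp.norm_def, eLpNorm_coe_cl hf]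

theorem eLpNorm_eq_ofReal_norm {f : R3 → ℝ} (hf : MemLp f 2 volume) :
    eLpNorm f 2 volume = ofReal ‖cl f‖ := by
  rw [norm_cl hf, ofReal_toReal hf.2.ne]

theorem TimeDiff.hasDerivWithinAt_fourier {J : Set ℝ} (hJ : J.OrdConnected) {f g : ℝ → R3 → ℝ}
    (h : TimeDiff J f g) {t : ℝ} (ht : t ∈ J) :
    HasDerivWithinAt (fun t => (𝓕 (cl (f t)) : L2)) (𝓕 (cl (g t))) J t :=
  ((fourierCLM ℂ L2).restrictScalars ℝ : L2 →L[ℝ] L2).hasFDerivAt.comp_hasDerivWithinAt t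
    (h.hasDerivWithinAt hJ ht)

theorem hasDerivWithinAt_half_norm_sq {J : Set ℝ} {u : ℝ → L2} {u' : L2} {t : ℝ}
    (h : HasDerivWithinAt u u' J t) :
    HasDerivWithinAt (fun t => 2⁻¹ * ‖u t‖ ^ 2) (inner ℝ (u t) u') J t := by
  have := (h.norm_sq).const_mul (2⁻¹ : ℝ)
  refine this.congr_deriv ?_
  ring

/-! ### Transport terms -/

theorem memLp_pd_mul {f g : R3 → ℝ} (hf : ContDiff ℝ 1 f) (hg : ContDiff ℝ 1 g) {i : Fin 3} {B B' : ℝ}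
    (hfm : MemLp f 2 volume) (hfm' : MemLp (pd i f) 2 volume)
    (hB : ∀ x, |g x| ≤ B) (hB' : ∀ x, |pd i g x| ≤ B') :
    MemLp (fun x => f x * g x) 2 volume ∧ MemLp (pd i fun x => f x * g x) 2 volume := by
  constructor
  · have := memLp_mul hg.continuous.aestronglyMeasurable hfm hB
    exact (memLp_congr_ae (.of_forall fun x => mul_comm _ _)).1 this
  · have h1 := (memLp_mul hg.continuous.aestronglyMeasurable hfm' hB).add
      (memLp_mul (continuous_pd hg i).aestronglyMeasurable hfm hB')
    refine (memLp_congr_ae (.of_forall fun x => ?_)).1 h1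
    rw [pd_mul (hf.differentiable (by norm_num) x) (hg.differentiable (by norm_num) x)]
    simp only [Pi.add_apply]; ring

/-- Integration by parts in a transport term: the derivative falls on the velocity. -/
theorem integral_transport {S w : R3 → ℝ} (hS : ContDiff ℝ 1 S) (hw : ContDiff ℝ 1 w) {i : Fin 3}
    {B B' : ℝ} (hSm : MemLp S 2 volume) (hSm' : MemLp (pd i S) 2 volume)
    (hB : ∀ x, |w x| ≤ B) (hB' : ∀ x, |pd i w x| ≤ B') :
    ∫ x, S x * (w x * pd i S x) = -(2⁻¹ * ∫ x, pd i w x * S x ^ 2) := by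
  have hSd : Differentiable ℝ S := hS.differentiable (by norm_num)
  have hwd : Differentiable ℝ w := hw.differentiable (by norm_num)
  obtain ⟨h1, h2⟩ := memLp_pd_mul hS hw hSm hSm' hB hB'
  have h3 := integral_mul_pd_of_memLp (f := fun x => S x * w x) (g := S) (hSd.mul hwd) hSd i h1 hSm h2 hSm'
  have i1 : Integrable fun x => S x * (w x * pd i S x) :=
    MemLp.integrable_mul hSm (memLp_mul hw.continuous.aestronglyMeasurable hSm' hB)
  have i2 : Integrable fun x => pd i w x * S x ^ 2 := by
    have := MemLp.integrable_mul hSm (memLp_mul (continuous_pd hw i).aestronglyMeasurable hSm hB')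
    refine this.congr (.of_forall fun x => ?_)
    simp only [Pi.mul_apply]; ring
  have h4 : ∫ x, pd i (fun x => S x * w x) x * S x =
      (∫ x, S x * (w x * pd i S x)) + ∫ x, pd i w x * S x ^ 2 := by
    rw [← integral_add i1 i2]
    refine integral_congr_ae (.of_forall fun x => ?_)
    show pd i (fun x => S x * w x) x * S x = _
    rw [pd_mul (hSd x) (hwd x)]; ring
  have h5 : ∫ x, S x * w x * pd i S x = ∫ x, S x * (w x * pd i S x) := by
    congr 1; ext x; ring
  rw [h4, h5] at h3
  linarith

theorem abs_integral_mul_mul_le {f g w : R3 → ℝ} {B : ℝ} (hf : MemLp f 2 volume) (hg : MemLp g 2 volume)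
    (hw : ∀ x, |w x| ≤ B) : |∫ x, w x * (f x * g x)| ≤ B * (‖cl f‖ * ‖cl g‖) := by
  have hB : 0 ≤ B := (abs_nonneg _).trans (hw 0)
  have h1 : ∫ x, |f x| * |g x| ≤ ‖cl f‖ * ‖cl g‖ := by
    have := real_inner_le_norm (cl fun x => |f x|) (cl fun x => |g x|)
    rw [inner_cl (f := fun x => |f x|) (g := fun x => |g x|) hf.abs hg.abs,
      norm_cl (f := fun x => |f x|) hf.abs, norm_cl (f := fun x => |g x|) hg.abs] at this
    have e : ∀ f : R3 → ℝ, eLpNorm (fun x => |f x|) 2 (volume : Measure R3) = eLpNorm f 2 volume :=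
      fun f => eLpNorm_norm f
    rw [e, e, ← norm_cl hf, ← norm_cl hg] at this
    exact this
  have hi : Integrable fun x => B * (|f x| * |g x|) := (MemLp.integrable_mul hf.abs hg.abs).const_mul B
  calc |∫ x, w x * (f x * g x)| ≤ ∫ x, B * (|f x| * |g x|) := by
        rw [← norm_eq_abs]
        refine norm_integral_le_of_norm_le hi (.of_forall fun x => ?_)
        rw [norm_eq_abs, abs_mul, abs_mul]
        exact mul_le_mul_of_nonneg_right (hw x) (by positivity)
    _ = B * ∫ x, |f x| * |g x| := integral_const_mul _ _
    _ ≤ _ := by gcongr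

/-! ### Propagation of irrotationality -/

theorem measurable_dir (l : Fin 3) : Measurable fun ξ : R3 => ξ l / ‖ξ‖ := by fun_prop

/-- Multiplication by the direction component `ξₗ/|ξ|` on the Fourier side. -/
def dirM (l : Fin 3) : L2 →L[ℝ] L2 := mulR (fun ξ => ξ l / ‖ξ‖) (measurable_dir l) fun ξ => abs_div_norm_le ξ l

theorem coeFn_dirM (l : Fin 3) (f : L2) :
    (dirM l f : R3 → ℂ) =ᵐ[volume] fun ξ => ((ξ l / ‖ξ‖ : ℝ) : ℂ) * f ξ := coeFn_mulR _ _ f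

theorem inner_dirM (l : Fin 3) (f g : L2) : inner ℝ (dirM l f) g = inner ℝ f (dirM l g) := inner_mulR _ _ f g

/-- The radial component of a vector field on the Fourier side. -/
def radial (V : Fin 3 → L2) : L2 := ∑ j, dirM j (V j)

/-- The Leray projection on the Fourier side. -/
def leray (l : Fin 3) (V : Fin 3 → L2) : L2 := V l - dirM l (radial V)

theorem coeFn_radial (V : Fin 3 → L2) :
    (radial V : R3 → ℂ) =ᵐ[volume] fun ξ => ∑ j, ((ξ j / ‖ξ‖ : ℝ) : ℂ) * V j ξ := by
  unfold radial
  rw [Fin.sum_univ_three]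
  filter_upwards [coeFn_dirM 0 (V 0), coeFn_dirM 1 (V 1), coeFn_dirM 2 (V 2),
    Lp.coeFn_add (dirM 0 (V 0)) (dirM 1 (V 1)),
    Lp.coeFn_add (dirM 0 (V 0) + dirM 1 (V 1)) (dirM 2 (V 2))] with ξ h0 h1 h2 h3 h4
  rw [h4, Pi.add_apply, h3, Pi.add_apply, h0, h1, h2, Fin.sum_univ_three]

theorem coeFn_leray (l : Fin 3) (V : Fin 3 → L2) :
    (leray l V : R3 → ℂ) =ᵐ[volume] fun ξ =>
      V l ξ - ((ξ l / ‖ξ‖ : ℝ) : ℂ) * ∑ j, ((ξ j / ‖ξ‖ : ℝ) : ℂ) * V j ξ := by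
  filter_upwards [Lp.coeFn_sub (V l) (dirM l (radial V)), coeFn_dirM l (radial V), coeFn_radial V]
    with ξ h1 h2 h3
  rw [leray, h1, Pi.sub_apply, h2, h3]

theorem sum_div_norm_sq {ξ : R3} (hξ : ξ ≠ 0) : ∑ j, ((ξ j / ‖ξ‖ : ℝ) : ℂ) * ((ξ j / ‖ξ‖ : ℝ) : ℂ) = 1 := by
  have h : ∑ j, ξ j / ‖ξ‖ * (ξ j / ‖ξ‖) = 1 := by
    have e := EuclideanSpace.real_norm_sq_eq ξ
    have hn : ‖ξ‖ ≠ 0 := norm_ne_zero_iff.2 hξ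
    rw [sum_congr rfl fun j _ => show ξ j / ‖ξ‖ * (ξ j / ‖ξ‖) = ξ j ^ 2 / ‖ξ‖ ^ 2 by
      field_simp, ← Finset.sum_div, ← e]
    exact div_self (pow_ne_zero _ hn)
  exact_mod_cast congrArg (fun x : ℝ => (x : ℂ)) h

theorem radial_leray (V : Fin 3 → L2) : radial (fun l => leray l V) = 0 := by
  refine Lp.ext ?_
  filter_upwards [coeFn_radial fun l => leray l V, ae_all_iff.2 fun l => coeFn_leray l V, ae_ne_zero,
    Lp.coeFn_zero ℂ 2 (volume : Measure R3)] with ξ h1 h2 h3 h4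
  rw [h1, h4, sum_congr rfl fun j _ => by rw [h2 j]]
  simp only [mul_sub, Finset.sum_sub_distrib, ← mul_assoc, ← sum_mul]
  rw [sum_div_norm_sq h3]
  simp

/-- The Leray projection is an orthogonal projection. -/
theorem sum_inner_leray (V W : Fin 3 → L2) :
    ∑ l, inner ℝ (leray l V) (leray l W) = ∑ l, inner ℝ (leray l V) (W l) := by
  have h : ∀ l, inner ℝ (leray l V) (leray l W) =
      inner ℝ (leray l V) (W l) - inner ℝ (dirM l (leray l V)) (radial W) := fun l => by
    rw [inner_dirM, ← inner_sub_right]; rfl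
  rw [sum_congr rfl fun l _ => h l, Finset.sum_sub_distrib, ← sum_inner]
  have : ∑ l, dirM l (leray l V) = 0 := radial_leray V
  rw [this, inner_zero_left, sub_zero]

theorem dsym_eq (l : Fin 3) {ξ : R3} (hξ : ξ ≠ 0) :
    dsym l ξ = I * ((freq ξ : ℝ) : ℂ) * ((ξ l / ‖ξ‖ : ℝ) : ℂ) := by
  have hn : (‖ξ‖ : ℂ) ≠ 0 := by exact_mod_cast norm_ne_zero_iff.2 hξ
  unfold dsym freq
  push_cast
  field_simp

/-- The divergence-free part of a regular vector field. -/
theorem exists_leray {v : Fin 3 → R3 → ℝ} (hm : ∀ l, MemLp (v l) 2 volume)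
    (hw : ∀ l, wnorm (fun ξ => jap ξ ^ (3 : ℝ)) (cl (v l)) < ∞) (l : Fin 3) :
    ∃ U : R3 → ℝ, ContDiff ℝ 1 U ∧ MemLp U 2 volume ∧ (∀ i, MemLp (pd i U) 2 volume) ∧
      (𝓕 (cl U) : L2) = leray l fun l => 𝓕 (cl (v l)) := by
  set V : Fin 3 → L2 := fun l => 𝓕 (cl (v l))
  set u : L2 := 𝓕⁻ (leray l V)
  have hu : (𝓕 u : L2) = leray l V := fourier_fourierInv_eq _
  have hae : (𝓕 u : L2) =ᵐ[volume] fun ξ =>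
      V l ξ - ((ξ l / ‖ξ‖ : ℝ) : ℂ) * ∑ j, ((ξ j / ‖ξ‖ : ℝ) : ℂ) * V j ξ := by
    rw [hu]; exact coeFn_leray l V
  have hle : ∀ᵐ ξ : R3, ‖(𝓕 u : L2) ξ‖ ≤ ‖V l ξ‖ + ∑ j, ‖V j ξ‖ := by
    filter_upwards [hae] with ξ h1
    rw [h1]
    have hn : ∀ (l : Fin 3) (z : ℂ), ‖((ξ l / ‖ξ‖ : ℝ) : ℂ) * z‖ ≤ ‖z‖ := fun l z => by
      rw [norm_mul, norm_real]
      exact mul_le_of_le_one_left (norm_nonneg _) (abs_div_norm_le ξ l)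
    refine (norm_sub_le _ _).trans (add_le_add le_rfl ((hn _ _).trans ((norm_sum_le _ _).trans ?_)))
    exact sum_le_sum fun j _ => hn j _
  have hjap : ∀ {a : R3 → ℝ}, Measurable a → (∀ ξ, |a ξ| ≤ jap ξ) → ∀ l,
      Integrable fun ξ => ((a ξ : ℝ) : ℂ) * V l ξ := fun ha hle l => by
    refine integrable_weight ha ((wnorm_mono (fun ξ => ?_) _).trans_lt (hw l))
    have h0 := jap_pos ξ
    rw [abs_mul, abs_of_pos (Real.rpow_pos_of_pos h0 2), abs_of_pos (Real.rpow_pos_of_pos h0 3),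
      show (3 : ℝ) = 2 + 1 by norm_num, rpow_add h0, Real.rpow_one]
    exact mul_le_mul_of_nonneg_left (hle ξ) (rpow_nonneg h0.le _)
  have hj1 : ∀ l, Integrable (V l) := fun l => by
    have := hjap (a := fun _ => 1) measurable_const (fun ξ => by simpa using one_le_jap ξ) l
    simpa using this
  have hj2 : ∀ l, Integrable fun ξ => ‖ξ‖ * ‖V l ξ‖ := fun l => by
    have := (hjap (a := fun ξ => ‖ξ‖) measurable_norm
      (fun ξ => by simpa using (norm_le_freq ξ).trans (freq_le_jap ξ)) l).norm
    refine this.congr (.of_forall fun ξ => ?_)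
    simp
  have h1 : Integrable (𝓕 u : L2) := by
    refine Integrable.mono' ((hj1 l).norm.add (integrable_finsetSum Finset.univ fun (j : Fin 3) _ => (hj1 j).norm))
      (Lp.aestronglyMeasurable _) ?_
    filter_upwards [hle] with ξ h
    simpa using h
  have h2 : Integrable fun ξ => ‖ξ‖ * ‖(𝓕 u : L2) ξ‖ := by
    refine Integrable.mono' ((hj2 l).add (integrable_finsetSum Finset.univ fun j _ => hj2 j))
      (continuous_norm.aestronglyMeasurable.mul (Lp.aestronglyMeasurable _).norm) ?_
    filter_upwards [hle] with ξ h
    rw [norm_of_nonneg (by positivity)]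
    refine (mul_le_mul_of_nonneg_left h (norm_nonneg _)).trans (le_of_eq ?_)
    simp only [Pi.add_apply]
    rw [mul_add, mul_sum]
  have hre : u = cl fun x => (u x).re := by
    refine ae_eq_re_of_fourier ?_
    filter_upwards [hae, ae_neg hae, ae_all_iff.2 fun j => fourier_cl_neg (hm j)] with ξ h1 h2 h3
    rw [h2, h1]
    simp only [V, h3, PiLp.neg_apply, norm_neg, map_sub, map_mul, map_sum, conj_ofReal, neg_div,
      Complex.ofReal_neg]
    simp [mul_sum]
  obtain ⟨U, hU1, hU2, hU3⟩ := exists_contDiff_repr hre h1 h2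
  refine ⟨U, hU1, hU2, fun i => memLp_pd hU1 hU2 ?_, by rw [hU3, hu]⟩
  rw [hU3]
  have hF : ∀ j, MemLp (fun ξ => ((freq ξ : ℝ) : ℂ) * V j ξ) 2 volume := fun j =>
    ⟨aestronglyMeasurable_weight continuous_freq.measurable _, (wnorm_mono (fun ξ => by
      have := rpow_mul_freq_le (a := 0) (s := 3) (by norm_num) ξ
      simpa using this) _).trans_lt (hw j)⟩
  refine MemLp.of_le ((hF l).norm.add (memLp_finsetSum Finset.univ fun j _ => (hF j).norm))
    ((continuous_dsym i).aestronglyMeasurable.mul (Lp.aestronglyMeasurable _)) ?_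
  filter_upwards [hle] with ξ h
  have h0 := freq_nonneg ξ
  simp only [Pi.add_apply, norm_real, norm_mul, norm_of_nonneg h0]
  rw [← mul_sum, ← mul_add, norm_mul (freq ξ), norm_of_nonneg h0,
    norm_of_nonneg (by positivity)]
  exact mul_le_mul (norm_dsym_le i ξ) h (norm_nonneg _) h0

theorem ae_eq_of_cl_eq {f g : R3 → ℝ} (hf : MemLp f 2 volume) (hg : MemLp g 2 volume) (h : cl f = cl g) :
    f =ᵐ[volume] g := by
  filter_upwards [coeFn_cl hf, coeFn_cl hg] with x h1 h2
  rw [h, h2] at h1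
  exact_mod_cast h1.symm

/-- A divergence-free field is orthogonal to gradients. -/
theorem sum_integral_mul_pd_eq_zero {U : Fin 3 → R3 → ℝ} {V : Fin 3 → L2} (hU : ∀ l, ContDiff ℝ 1 (U l))
    (hUm : ∀ l, MemLp (U l) 2 volume) (hUm' : ∀ l i, MemLp (pd i (U l)) 2 volume)
    (hV : ∀ l, (𝓕 (cl (U l)) : L2) = leray l V) {g : R3 → ℝ} (hg : ContDiff ℝ 1 g)
    (hgm : MemLp g 2 volume) (hgm' : ∀ i, MemLp (pd i g) 2 volume) :
    ∑ l, ∫ x, U l x * pd l g x = 0 := by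
  have hd : MemLp (fun x => ∑ l, pd l (U l) x) 2 volume := memLp_finsetSum _ fun l _ => hUm' l l
  have h0 : cl (fun x => ∑ l, pd l (U l) x) = 0 := by
    refine L2_ext_of_fourier ?_
    have hz : (𝓕 (0 : L2) : L2) = 0 := map_zero (fourierCLM ℂ L2)
    rw [hz]
    have hr := coeFn_radial fun l => leray l V
    rw [radial_leray] at hr
    filter_upwards [fourier_div hU hUm hd, hr, ae_ne_zero, Lp.coeFn_zero ℂ 2 (volume : Measure R3)]
      with ξ h1 h2 h3 h4
    rw [h1, h4, sum_congr rfl fun l _ => by rw [dsym_eq l h3, hV l, mul_assoc], ← mul_sum,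
      ← h2, h4]
    simp
  have hz : (fun x => ∑ l, pd l (U l) x) =ᵐ[volume] fun _ => 0 := by
    filter_upwards [coeFn_cl hd, Lp.coeFn_zero ℂ 2 (volume : Measure R3)] with x h1 h2
    rw [h0, h2, Pi.zero_apply] at h1
    exact_mod_cast h1.symm
  have hi : ∀ l, Integrable fun x => pd l (U l) x * g x := fun l => MemLp.integrable_mul (hUm' l l) hgm
  rw [sum_congr rfl fun l _ => integral_mul_pd_of_memLp ((hU l).differentiable (by norm_num))
    (hg.differentiable (by norm_num)) l (hUm l) hgm (hUm' l l) (hgm' l), sum_neg_distrib,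
    ← integral_finsetSum _ fun l _ => hi l, neg_eq_zero]
  refine (integral_congr_ae ?_).trans (integral_zero _ _)
  filter_upwards [hz] with x h
  rw [← sum_mul, h, zero_mul]

/-- Two vector fields with the same gradient part removed have the same curl. -/
theorem curl_leray {v U : Fin 3 → R3 → ℝ} (hv : ∀ l, ContDiff ℝ 1 (v l)) (hvm : ∀ l, MemLp (v l) 2 volume)
    (hvm' : ∀ l i, MemLp (pd i (v l)) 2 volume) (hU : ∀ l, ContDiff ℝ 1 (U l))
    (hUm : ∀ l, MemLp (U l) 2 volume) (hUm' : ∀ l i, MemLp (pd i (U l)) 2 volume)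
    (hV : ∀ l, (𝓕 (cl (U l)) : L2) = leray l fun l => 𝓕 (cl (v l))) (i l : Fin 3) :
    (fun x => pd i (v l) x - pd l (v i) x) =ᵐ[volume] fun x => pd i (U l) x - pd l (U i) x := by
  have m1 : MemLp (fun x => pd i (v l) x - pd l (v i) x) 2 volume := (hvm' l i).sub (hvm' i l)
  have m2 : MemLp (fun x => pd i (U l) x - pd l (U i) x) 2 volume := (hUm' l i).sub (hUm' i l)
  refine ae_eq_of_cl_eq m1 m2 (L2_ext_of_fourier ?_)
  rw [cl_sub (hvm' l i) (hvm' i l), cl_sub (hUm' l i) (hUm' i l), fourier_sub, fourier_sub]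
  have d1 : ∀ l, Differentiable ℝ (v l) := fun l => (hv l).differentiable (by norm_num)
  have d2 : ∀ l, Differentiable ℝ (U l) := fun l => (hU l).differentiable (by norm_num)
  filter_upwards [Lp.coeFn_sub (𝓕 (cl (pd i (v l))) : L2) (𝓕 (cl (pd l (v i)))),
    Lp.coeFn_sub (𝓕 (cl (pd i (U l))) : L2) (𝓕 (cl (pd l (U i)))), fourier_pd (d1 l) (hvm l) (hvm' l i),
    fourier_pd (d1 i) (hvm i) (hvm' i l), fourier_pd (d2 l) (hUm l) (hUm' l i),
    fourier_pd (d2 i) (hUm i) (hUm' i l), coeFn_leray l fun l => 𝓕 (cl (v l)),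
    coeFn_leray i fun l => 𝓕 (cl (v l)), ae_ne_zero] with ξ h1 h2 h3 h4 h5 h6 h7 h8 h9
  rw [h1, h2, Pi.sub_apply, Pi.sub_apply, h3, h4, h5, h6, hV, hV, h7, h8, dsym_eq i h9, dsym_eq l h9]
  ring

/-- The energy estimate for the divergence-free part: pressure gradients drop out, and the transport
term costs one derivative of the velocity in `L^∞`. -/
theorem abs_sum_integral_leray_le {v U : Fin 3 → R3 → ℝ} {σ φ : R3 → ℝ} {B B₀ : ℝ}
    (hv : ∀ l, ContDiff ℝ 1 (v l)) (hvm : ∀ l, MemLp (v l) 2 volume)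
    (hvm' : ∀ l i, MemLp (pd i (v l)) 2 volume) (hB₀ : ∀ l x, |v l x| ≤ B₀)
    (hB : ∀ l i x, |pd i (v l) x| ≤ B) (hU : ∀ l, ContDiff ℝ 1 (U l))
    (hUm : ∀ l, MemLp (U l) 2 volume) (hUm' : ∀ l i, MemLp (pd i (U l)) 2 volume)
    (hV : ∀ l, (𝓕 (cl (U l)) : L2) = leray l fun l => 𝓕 (cl (v l)))
    (hσ : ContDiff ℝ 1 σ) (hσm : MemLp σ 2 volume) (hσm' : ∀ i, MemLp (pd i σ) 2 volume)
    (hφ : ContDiff ℝ 1 φ) (hφm : MemLp φ 2 volume) (hφm' : ∀ i, MemLp (pd i φ) 2 volume) :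
    |∑ l, ∫ x, U l x * (∑ i, v i x * pd i (v l) x + pd l σ x + pd l φ x)| ≤
      5 * B * ∑ l, ‖cl (U l)‖ ^ 2 := by
  have hB0 : 0 ≤ B := (abs_nonneg _).trans (hB 0 0 0)
  have hvU : ∀ i, ContDiff ℝ 1 fun x => v i x * U i x := fun i => (hv i).mul (hU i)
  have hvv : ∀ i, ContDiff ℝ 1 fun x => v i x * v i x := fun i => (hv i).mul (hv i)
  have dv : ∀ l, Differentiable ℝ (v l) := fun l => (hv l).differentiable (by norm_num)
  have dU : ∀ l, Differentiable ℝ (U l) := fun l => (hU l).differentiable (by norm_num)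
  have mvU : ∀ i, MemLp (fun x => v i x * U i x) 2 volume := fun i =>
    memLp_mul (hv i).continuous.aestronglyMeasurable (hUm i) (hB₀ i)
  have mvv : ∀ i, MemLp (fun x => v i x * v i x) 2 volume := fun i =>
    memLp_mul (hv i).continuous.aestronglyMeasurable (hvm i) (hB₀ i)
  have mp : ∀ {w : R3 → ℝ} (i l : Fin 3), MemLp w 2 volume → MemLp (fun x => v i x * w x) 2 volume :=
    fun i l hw => memLp_mul (hv i).continuous.aestronglyMeasurable hw (hB₀ i)
  have mp' : ∀ {w : R3 → ℝ} (i l : Fin 3), MemLp w 2 volume → MemLp (fun x => pd l (v i) x * w x) 2 volume :=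
    fun i l hw => memLp_mul (continuous_pd (hv i) l).aestronglyMeasurable hw (hB i l)
  have mvU' : ∀ i l, MemLp (pd l fun x => v i x * U i x) 2 volume := fun i l => by
    have := (mp' i l (hUm i)).add (mp i l (hUm' i l))
    refine (memLp_congr_ae (.of_forall fun x => ?_)).1 this
    rw [pd_mul (dv i x) (dU i x)]; rfl
  have mvv' : ∀ i l, MemLp (pd l fun x => v i x * v i x) 2 volume := fun i l => by
    have := (mp' i l (hvm i)).add (mp i l (hvm' i l))
    refine (memLp_congr_ae (.of_forall fun x => ?_)).1 this
    rw [pd_mul (dv i x) (dv i x)]; rfl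
  have hT : ∀ l i, ∫ x, U l x * (v i x * pd i (v l) x) =
      -(2⁻¹ * ∫ x, pd i (v i) x * U l x ^ 2) - (∫ x, U l x * pd l (fun y => v i y * U i y) x) +
      (∫ x, pd l (v i) x * (U l x * U i x)) + 2⁻¹ * ∫ x, U l x * pd l (fun y => v i y * v i y) x := by
    intro l i
    rw [← integral_transport (hU l) (hv i) (hUm l) (hUm' l i) (hB₀ i) (hB i i)]
    have i1 : Integrable fun x => U l x * (v i x * pd i (U l) x) :=
      MemLp.integrable_mul (hUm l) (mp i i (hUm' l i))
    have i2 : Integrable fun x => U l x * pd l (fun y => v i y * U i y) x :=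
      MemLp.integrable_mul (hUm l) (mvU' i l)
    have i3 : Integrable fun x => pd l (v i) x * (U l x * U i x) := by
      have := MemLp.integrable_mul (mp' i l (hUm l)) (hUm i)
      refine this.congr (.of_forall fun x => ?_)
      simp only [Pi.mul_apply]; ring
    have i4 : Integrable fun x => 2⁻¹ * (U l x * pd l (fun y => v i y * v i y) x) :=
      (MemLp.integrable_mul (hUm l) (mvv' i l)).const_mul 2⁻¹
    have i5 : Integrable fun x => U l x * (v i x * pd i (U l) x) - U l x * pd l (fun y => v i y * U i y) x :=
      i1.sub i2
    have i6 : Integrable fun x => U l x * (v i x * pd i (U l) x) - U l x * pd l (fun y => v i y * U i y) x +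
      pd l (v i) x * (U l x * U i x) := i5.add i3
    rw [← integral_const_mul, ← integral_sub i1 i2, ← integral_add i5 i3, ← integral_add i6 i4]
    refine integral_congr_ae ?_
    filter_upwards [curl_leray hv hvm hvm' hU hUm hUm' hV i l] with x h
    rw [pd_mul (dv i x) (dU i x), pd_mul (dv i x) (dv i x)]
    linear_combination U l x * v i x * h
  have hS : ∑ l, ∫ x, U l x * (∑ i, v i x * pd i (v l) x + pd l σ x + pd l φ x) =
      ∑ l, ∑ i, (-(2⁻¹ * ∫ x, pd i (v i) x * U l x ^ 2) + ∫ x, pd l (v i) x * (U l x * U i x)) := by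
    have hσ0 := sum_integral_mul_pd_eq_zero hU hUm hUm' hV hσ hσm hσm'
    have hφ0 := sum_integral_mul_pd_eq_zero hU hUm hUm' hV hφ hφm hφm'
    have hg1 : ∑ i, ∑ l, ∫ x, U l x * pd l (fun y => v i y * U i y) x = 0 := Finset.sum_eq_zero fun i _ =>
      sum_integral_mul_pd_eq_zero hU hUm hUm' hV (hvU i) (mvU i) (mvU' i)
    have hg2 : ∑ i, ∑ l, ∫ x, U l x * pd l (fun y => v i y * v i y) x = 0 := Finset.sum_eq_zero fun i _ =>
      sum_integral_mul_pd_eq_zero hU hUm hUm' hV (hvv i) (mvv i) (mvv' i)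
    rw [Finset.sum_comm] at hg1 hg2
    have he : ∀ l, ∫ x, U l x * (∑ i, v i x * pd i (v l) x + pd l σ x + pd l φ x) =
        ∑ i, (∫ x, U l x * (v i x * pd i (v l) x)) + (∫ x, U l x * pd l σ x) + ∫ x, U l x * pd l φ x := by
      intro l
      have j1 : ∀ i, Integrable fun x => U l x * (v i x * pd i (v l) x) := fun i =>
        MemLp.integrable_mul (hUm l) (mp i i (hvm' l i))
      have j2 : Integrable fun x => U l x * pd l σ x := MemLp.integrable_mul (hUm l) (hσm' l)
      have j3 : Integrable fun x => U l x * pd l φ x := MemLp.integrable_mul (hUm l) (hφm' l)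
      have j0 := integrable_finsetSum Finset.univ fun (i : Fin 3) _ => j1 i
      have j4 : Integrable fun x => ∑ i, U l x * (v i x * pd i (v l) x) + U l x * pd l σ x := j0.add j2
      rw [← integral_finsetSum _ fun i _ => j1 i, ← integral_add j0 j2, ← integral_add j4 j3]
      simp only [mul_sum, mul_add]
    rw [sum_congr rfl fun l _ => he l, sum_add_distrib, sum_add_distrib, hσ0, hφ0,
      add_zero, add_zero]
    simp only [hT, sum_add_distrib, Finset.sum_sub_distrib, ← mul_sum] at hg1 hg2 ⊢
    rw [hg1, hg2]; ring
  rw [hS]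
  have hterm : ∀ l i, |-(2⁻¹ * ∫ x, pd i (v i) x * U l x ^ 2) + ∫ x, pd l (v i) x * (U l x * U i x)| ≤
      B * (‖cl (U l)‖ ^ 2 + 2⁻¹ * ‖cl (U i)‖ ^ 2) := by
    intro l i
    have h1 := abs_integral_mul_mul_le (hUm l) (hUm l) (hB i i)
    have h2 := abs_integral_mul_mul_le (hUm l) (hUm i) (hB i l)
    simp only [← sq] at h1
    have h3 : ‖cl (U l)‖ * ‖cl (U i)‖ ≤ 2⁻¹ * ‖cl (U l)‖ ^ 2 + 2⁻¹ * ‖cl (U i)‖ ^ 2 := by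
      nlinarith [sq_nonneg (‖cl (U l)‖ - ‖cl (U i)‖)]
    have h4 := mul_le_mul_of_nonneg_left h3 hB0
    refine (abs_add_le _ _).trans ?_
    rw [abs_neg, abs_mul, abs_of_nonneg (by norm_num : (0 : ℝ) ≤ 2⁻¹)]
    linarith
  refine (abs_sum_le_sum_abs _ _).trans ((sum_le_sum fun l _ =>
    (abs_sum_le_sum_abs _ _).trans (sum_le_sum fun i _ => hterm l i)).trans ?_)
  simp only [Fin.sum_univ_three]
  nlinarith [mul_nonneg hB0 (sq_nonneg ‖cl (U 0)‖), mul_nonneg hB0 (sq_nonneg ‖cl (U 1)‖),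
    mul_nonneg hB0 (sq_nonneg ‖cl (U 2)‖)]

/-- Grönwall's inequality for a function that vanishes initially. -/
theorem eq_zero_of_gronwall {J : Set ℝ} (hJ : J.OrdConnected) (h0 : (0 : ℝ) ∈ J) {E E' : ℝ → ℝ}
    (hE : ∀ t ∈ J, HasDerivWithinAt E (E' t) J t) (hE0 : E 0 = 0) {t : ℝ} (ht : t ∈ J) (ht0 : 0 ≤ t) {K : ℝ}
    (hK : ∀ r ∈ Set.Icc 0 t, |E' r| ≤ K * |E r|) : E t = 0 := by
  have hsub : Set.Icc 0 t ⊆ J := hJ.out h0 ht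
  have := norm_le_gronwallBound_of_norm_deriv_right_le (f := E) (f' := E') (δ := 0) (K := K) (ε := 0)
    (a := 0) (b := t) (fun r hr => ((hE r (hsub hr)).continuousWithinAt).mono hsub)
    (fun r hr => ((hE r (hsub ⟨hr.1, hr.2.le⟩)).mono ((Set.Icc_subset_Icc_left hr.1).trans hsub)).mono_of_mem_nhdsWithin
      (Icc_mem_nhdsGE hr.2)) (by simp [hE0])
    (fun r hr => by simpa using hK r ⟨hr.1, hr.2.le⟩) t ⟨ht0, le_rfl⟩
  simpa [gronwallBound_ε0_δ0] using this

theorem leray_eq_zero_of_curl {v : Fin 3 → R3 → ℝ} (hv : ∀ l, ContDiff ℝ 1 (v l))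
    (hvm : ∀ l, MemLp (v l) 2 volume) (hvm' : ∀ l i, MemLp (pd i (v l)) 2 volume)
    (hc : ∀ i l x, pd i (v l) x = pd l (v i) x) (l : Fin 3) : leray l (fun l => 𝓕 (cl (v l))) = 0 := by
  have d1 : ∀ l, Differentiable ℝ (v l) := fun l => (hv l).differentiable (by norm_num)
  refine Lp.ext ?_
  have hpd : ∀ᵐ ξ : R3, ∀ i, dsym i ξ * (𝓕 (cl (v l)) : L2) ξ =
      dsym l ξ * (𝓕 (cl (v i)) : L2) ξ := ae_all_iff.2 fun i => by
    have e : pd i (v l) = pd l (v i) := funext fun x => hc i l x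
    have h2 := fourier_pd (d1 l) (hvm l) (hvm' l i)
    rw [e] at h2
    filter_upwards [h2, fourier_pd (d1 i) (hvm i) (hvm' i l)] with ξ h3 h4
    rw [← h3, ← h4]
  filter_upwards [coeFn_leray l fun l => (𝓕 (cl (v l)) : L2), hpd, ae_ne_zero,
    Lp.coeFn_zero ℂ 2 (volume : Measure R3)] with ξ h1 h2 h3 h4
  rw [h1, h4, Pi.zero_apply]
  have hf : I * ((freq ξ : ℝ) : ℂ) ≠ 0 :=
    mul_ne_zero Complex.I_ne_zero (by exact_mod_cast (freq_pos h3).ne')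
  have h5 : ∀ i, ((ξ i / ‖ξ‖ : ℝ) : ℂ) * (𝓕 (cl (v l)) : L2) ξ = ((ξ l / ‖ξ‖ : ℝ) : ℂ) * (𝓕 (cl (v i)) : L2) ξ :=
    fun i => mul_left_cancel₀ hf (by have := h2 i; rw [dsym_eq i h3, dsym_eq l h3] at this; linear_combination this)
  rw [mul_sum, sum_congr rfl fun i _ => by
    rw [mul_left_comm, ← h5 i, ← mul_assoc], ← sum_mul, sum_div_norm_sq h3, one_mul, sub_self]

/-- A solution that is irrotational initially has no divergence-free part at any time. -/
theorem Flow.leray_eq_zero {s b : ℝ} (hs : 3 ≤ s) {J : Set ℝ} {ρ : ℝ → R3 → ℝ} {v : Fin 3 → ℝ → R3 → ℝ}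
    {φ : ℝ → R3 → ℝ} (h : Flow s b J ρ v φ) (h0 : ∀ i l x, pd i (v l 0) x = pd l (v i 0) x)
    {t : ℝ} (ht : t ∈ J) (l : Fin 3) : leray l (fun l => 𝓕 (cl (v l t))) = 0 := by
  set g : Fin 3 → ℝ → R3 → ℝ := fun l t x =>
    -(∑ i, v i t x * pd i (v l t) x + pd l (logDen (ρ t)) x + pd l (φ t) x) with hg
  set V : ℝ → Fin 3 → L2 := fun t l => 𝓕 (cl (v l t)) with hV
  set G : ℝ → Fin 3 → L2 := fun t l => 𝓕 (cl (g l t)) with hG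
  have hder : ∀ l, ∀ t ∈ J, HasDerivWithinAt (fun t => V t l) (G t l) J t := fun l t ht =>
    (h.diff_velocity l).hasDerivWithinAt_fourier h.ordConnected ht
  have hder' : ∀ l, ∀ t ∈ J, HasDerivWithinAt (fun t => leray l (V t)) (leray l (G t)) J t := fun l t ht => by
    refine (hder l t ht).sub ((dirM l).hasFDerivAt.comp_hasDerivWithinAt t ?_)
    exact HasDerivWithinAt.fun_sum fun j _ => (dirM j).hasFDerivAt.comp_hasDerivWithinAt t (hder j t ht)
  set E : ℝ → ℝ := fun t => ∑ l, 2⁻¹ * ‖leray l (V t)‖ ^ 2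
  set E' : ℝ → ℝ := fun t => ∑ l, inner ℝ (leray l (V t)) (leray l (G t))
  have hE : ∀ t ∈ J, HasDerivWithinAt E (E' t) J t := fun t ht =>
    HasDerivWithinAt.fun_sum fun l _ => hasDerivWithinAt_half_norm_sq (hder' l t ht)
  have hm : ∀ t ∈ J, ∀ l, MemLp (v l t) 2 volume := fun t ht l => ((h.contH_velocity l).1 t ht).1
  have hm' : ∀ t ∈ J, ∀ l i, MemLp (pd i (v l t)) 2 volume := fun t ht l i =>
    (h.contH_velocity l).memLp_pd (by linarith) (h.contDiff_velocity l) i ht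
  obtain ⟨B, hB⟩ : ∃ B, ∀ r ∈ Set.Icc 0 t, ∀ l i x, |pd i (v l r) x| ≤ B := by
    have := fun l i => ((h.contH_velocity l).supReg_pd hs (h.contDiff_velocity l) i).bdd_on_compact
      isCompact_Icc (h.ordConnected.out h.zero_mem ht)
    choose B hB using this
    refine ⟨∑ l, ∑ i, |B l i|, fun r hr l i x => (hB l i r hr x).trans ((le_abs_self _).trans ?_)⟩
    exact (single_le_sum (f := fun i => |B l i|) (fun _ _ => abs_nonneg _) (mem_univ i)).trans
      (single_le_sum (f := fun l => ∑ i, |B l i|)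
        (fun _ _ => sum_nonneg fun _ _ => abs_nonneg _) (mem_univ l))
  have hE0 : E 0 = 0 := Finset.sum_eq_zero fun l _ => by
    have := leray_eq_zero_of_curl (fun l => h.contDiff_velocity l 0 h.zero_mem) (hm 0 h.zero_mem)
      (hm' 0 h.zero_mem) h0 l
    show 2⁻¹ * ‖leray l fun l => 𝓕 (cl (v l 0))‖ ^ 2 = 0
    rw [this]; simp
  have hK : ∀ r ∈ Set.Icc 0 t, |E' r| ≤ 10 * B * |E r| := by
    intro r hr
    have hrJ : r ∈ J := h.ordConnected.out h.zero_mem ht hr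
    have hw : ∀ l, wnorm (fun ξ => jap ξ ^ (3 : ℝ)) (cl (v l r)) < ∞ := fun l =>
      (wnorm_mono (rpow_weight_le hs) _).trans_lt ((h.contH_velocity l).1 r hrJ).2
    choose U hU hUm hUm' hUV using fun l => exists_leray (hm r hrJ) hw l
    have hb0 : ∀ l, ∃ B₀, ∀ x, |v l r x| ≤ B₀ := fun l =>
      ((h.contH_velocity l).supReg (by linarith) fun t ht => (h.contDiff_velocity l t ht).continuous).bdd r hrJ
    choose B₀ hB₀ using hb0
    have hp := h.potential r hrJ
    have hb : ∀ x, |ρ r x| ≤ 1 / 4 := fun x => (hp.bound x).trans hp.le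
    have hrρ := h.contDiff_density r hrJ
    have hσm' : ∀ i, MemLp (pd i (logDen (ρ r))) 2 volume := fun i => by
      have h1 := h.contH_density.memLp_pd (by linarith) h.contDiff_density i hrJ
      refine memLp_of_abs_le (C := 2) h1
        (continuous_pd (contDiff_logDen hrρ hb) i).aestronglyMeasurable fun x => ?_
      rw [pd_logDen (hrρ.differentiable (by norm_num)) hb, abs_mul]
      have h2 := abs_le.1 (hb x)
      refine mul_le_mul_of_nonneg_right ?_ (abs_nonneg _)
      rw [abs_of_pos (inv_pos.2 (by linarith))]
      exact inv_le_of_inv_le₀ (by norm_num) (by linarith)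
    have hest := abs_sum_integral_leray_le (fun l => h.contDiff_velocity l r hrJ) (hm r hrJ) (hm' r hrJ)
      (B₀ := ∑ l, |B₀ l|) (fun l x => (hB₀ l x).trans ((le_abs_self _).trans
        (single_le_sum (f := fun l => |B₀ l|) (fun _ _ => abs_nonneg _) (mem_univ l))))
      (hB r hr) hU hUm hUm' hUV (contDiff_logDen hrρ hb) (h.diff_log.reg.memLp r hrJ) hσm'
      (hp.contDiff.of_le (by norm_num)) hp.memLp hp.memLp_pd
    have h1 : E' r = -∑ l, ∫ x, U l x * (∑ i, v i r x * pd i (v l r) x + pd l (logDen (ρ r)) x + pd l (φ r) x) := by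
      show ∑ l, inner ℝ (leray l (V r)) (leray l (G r)) = _
      rw [sum_inner_leray, ← sum_neg_distrib]
      refine sum_congr rfl fun l _ => ?_
      rw [← hUV l, inner_fourier, inner_cl (hUm l) ((h.diff_velocity l).reg'.memLp r hrJ), ← integral_neg]
      simp only [mul_neg]
    have h2 : E r = 2⁻¹ * ∑ l, ‖cl (U l)‖ ^ 2 := by
      show ∑ l, 2⁻¹ * ‖leray l (V r)‖ ^ 2 = _
      rw [← mul_sum]
      congr 1
      exact sum_congr rfl fun l _ => by rw [← hUV l, norm_fourier]
    have h3 : 0 ≤ ∑ l, ‖cl (U l)‖ ^ 2 := sum_nonneg fun _ _ => by positivity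
    rw [h1, abs_neg, h2, abs_of_nonneg (mul_nonneg (by norm_num) h3)]
    linarith
  have hEt := eq_zero_of_gronwall h.ordConnected h.zero_mem hE hE0 ht (h.nonneg t ht) hK
  have := (Finset.sum_eq_zero_iff_of_nonneg fun l _ => by positivity).1 hEt l (mem_univ l)
  simpa using this

theorem isGradient_of_leray {v : R3 → R3} (h : ∀ l, leray l (fun l => 𝓕 (cl fun x => v x l)) = 0) :
    IsGradient v := by
  intro l
  have h1 := coeFn_leray l fun l => (𝓕 (cl fun x => v x l) : L2)
  rw [h l] at h1
  filter_upwards [h1, fourier_rieszInv v, Lp.coeFn_zero ℂ 2 (volume : Measure R3)] with ξ h2 h3 h4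
  rw [h4, Pi.zero_apply] at h2
  rw [h3]
  simp only [mul_assoc, ← mul_sum]
  linear_combination -h2 + (((ξ l / ‖ξ‖ : ℝ) : ℂ) * ∑ j, ((ξ j / ‖ξ‖ : ℝ) : ℂ) * (𝓕 (cl fun x => v x j) : L2) ξ) * Complex.I_mul_I

/-- A solution that is irrotational initially stays so. -/
theorem Flow.pd_symm {s b : ℝ} (hs : 3 ≤ s) {J : Set ℝ} {ρ : ℝ → R3 → ℝ} {v : Fin 3 → ℝ → R3 → ℝ}
    {φ : ℝ → R3 → ℝ} (h : Flow s b J ρ v φ) (h0 : ∀ i l x, pd i (v l 0) x = pd l (v i 0) x)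
    {t : ℝ} (ht : t ∈ J) (i l : Fin 3) : pd i (v l t) =ᵐ[volume] pd l (v i t) := by
  have hm : ∀ l, MemLp (v l t) 2 volume := fun l => ((h.contH_velocity l).1 t ht).1
  have hm' : ∀ l i, MemLp (pd i (v l t)) 2 volume := fun l i =>
    (h.contH_velocity l).memLp_pd (by linarith) (h.contDiff_velocity l) i ht
  have hw : ∀ l, wnorm (fun ξ => jap ξ ^ (3 : ℝ)) (cl (v l t)) < ∞ := fun l =>
    (wnorm_mono (rpow_weight_le hs) _).trans_lt ((h.contH_velocity l).1 t ht).2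
  choose U hU hUm hUm' hUV using fun l => exists_leray hm hw l
  have hz : ∀ l, U l = 0 := fun l => by
    have h1 : cl (U l) = 0 := L2_ext_of_fourier (by
      rw [hUV l, h.leray_eq_zero hs h0 ht l, show (𝓕 (0 : L2) : L2) = 0 from map_zero (fourierCLM ℂ L2)])
    have h2 : U l =ᵐ[volume] 0 := by
      filter_upwards [coeFn_cl (hUm l), Lp.coeFn_zero ℂ 2 (volume : Measure R3)] with x h3 h4
      rw [h1, h4, Pi.zero_apply] at h3
      rw [Pi.zero_apply]
      exact_mod_cast h3.symm
    exact Continuous.ae_eq_iff_eq volume (hU l).continuous continuous_zero |>.1 h2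
  filter_upwards [curl_leray (fun l => h.contDiff_velocity l t ht) hm hm' hU hUm hUm' hUV i l] with x hx
  rw [hz, hz] at hx
  have : ∀ i, pd i (0 : R3 → ℝ) x = 0 := fun i => by simp [pd]
  rw [this, this] at hx
  linarith

/-! ### The symmetrized energy identity -/

theorem cl_sum {f : Fin 3 → R3 → ℝ} (hf : ∀ i, MemLp (f i) 2 volume) :
    cl (fun x => ∑ i, f i x) = ∑ i, cl (f i) := by
  simp only [Fin.sum_univ_three]
  rw [cl_add (f := fun x => f 0 x + f 1 x) ((hf 0).add (hf 1)) (hf 2), cl_add (hf 0) (hf 1)]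

theorem abs_integral_le_norm_mul_norm {g : R3 → ℝ} {u w : L2}
    (h : ∀ᵐ ξ : R3, |g ξ| ≤ ‖u ξ‖ * ‖w ξ‖) : |∫ ξ, g ξ| ≤ ‖u‖ * ‖w‖ := by
  have hn : ∀ u : L2, MemLp (fun ξ => ‖u ξ‖) 2 (volume : Measure R3) := fun u => (Lp.memLp u).norm
  have he : ∀ u : L2, ‖cl fun ξ => ‖u ξ‖‖ = ‖u‖ := fun u => by
    rw [norm_cl (hn u), Lp.norm_def]; congr 1; exact eLpNorm_norm _
  have h1 := real_inner_le_norm (cl fun ξ => ‖u ξ‖) (cl fun ξ => ‖w ξ‖)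
  rw [inner_cl (hn u) (hn w), he, he] at h1
  refine le_trans ?_ h1
  rw [← norm_eq_abs]
  exact norm_integral_le_of_norm_le (MemLp.integrable_mul (hn u) (hn w)) h

theorem measurable_jap_inv : Measurable fun ξ => (jap ξ)⁻¹ := continuous_jap.measurable.inv

theorem abs_jap_inv_le (ξ : R3) : |(jap ξ)⁻¹| ≤ 1 := by
  rw [abs_of_pos (inv_pos.2 (jap_pos ξ))]
  exact inv_le_one_of_one_le₀ (one_le_jap ξ)

/-- Multiplication by `(1 + |ξ|²)^{-1/2}` on the Fourier side. -/
def japInvM : L2 →L[ℝ] L2 := mulR (fun ξ => (jap ξ)⁻¹) measurable_jap_inv abs_jap_inv_le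

theorem coeFn_japInvM (f : L2) : (japInvM f : R3 → ℂ) =ᵐ[volume] fun ξ => (((jap ξ)⁻¹ : ℝ) : ℂ) * f ξ :=
  coeFn_mulR _ _ f

theorem norm_dsym_mul_jap_le (l : Fin 3) (ξ : R3) : ‖dsym l ξ‖ * ((jap ξ)⁻¹ * (jap ξ)⁻¹) ≤ 1 := by
  have h1 := (norm_dsym_le l ξ).trans (freq_le_jap ξ)
  have h2 := jap_pos ξ
  have h3 := inv_le_one_of_one_le₀ (one_le_jap ξ)
  calc ‖dsym l ξ‖ * ((jap ξ)⁻¹ * (jap ξ)⁻¹) ≤ jap ξ * ((jap ξ)⁻¹ * (jap ξ)⁻¹) := by gcongr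
    _ = (jap ξ)⁻¹ := by field_simp
    _ ≤ 1 := h3

/-- The electric term and the energy of the density in `H^{-1}` cancel up to the nonlinear part of the
Boltzmann law. -/
theorem abs_inner_electric_le {R N Φ W : R3 → ℝ} (hW : Differentiable ℝ W) (hWm : MemLp W 2 volume)
    (l : Fin 3) (hWm' : MemLp (pd l W) 2 volume) (hΦ : Differentiable ℝ Φ) (hΦm : MemLp Φ 2 volume)
    (hΦm' : MemLp (pd l Φ) 2 volume)
    (he : ∀ᵐ ξ : R3, ((jap ξ ^ 2 : ℝ) : ℂ) * (𝓕 (cl Φ) : L2) ξ =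
      (𝓕 (cl R) : L2) ξ - (𝓕 (cl N) : L2) ξ) :
    |inner ℝ (cl W) (cl (pd l Φ)) + inner ℝ (japInvM (𝓕 (cl R))) (japInvM (𝓕 (cl (pd l W))))| ≤
      ‖cl W‖ * ‖cl N‖ := by
  rw [← inner_fourier, inner_eq_integral, inner_eq_integral,
    ← integral_add (integrable_inner_re _ _) (integrable_inner_re _ _), ← norm_fourier (cl W),
    ← norm_fourier (cl N)]
  refine abs_integral_le_norm_mul_norm ?_
  filter_upwards [he, fourier_pd hW hWm hWm', fourier_pd hΦ hΦm hΦm', coeFn_japInvM (𝓕 (cl R)),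
    coeFn_japInvM (𝓕 (cl (pd l W)))] with ξ h1 h2 h3 h4 h5
  rw [h3, h4, h5, h2]
  have hj : ((jap ξ : ℝ) : ℂ) ≠ 0 := by exact_mod_cast (jap_pos ξ).ne'
  have h6 : (𝓕 (cl Φ) : L2) ξ = (((jap ξ)⁻¹ : ℝ) : ℂ) * (((jap ξ)⁻¹ : ℝ) : ℂ) *
      ((𝓕 (cl R) : L2) ξ - (𝓕 (cl N) : L2) ξ) := by
    rw [← h1]; push_cast; field_simp
  have hd : conj (dsym l ξ) = -dsym l ξ := by
    unfold dsym
    simp only [map_mul, conj_ofReal, Complex.conj_I, map_ofNat]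
    ring
  set w := (𝓕 (cl W) : L2) ξ
  set r := (𝓕 (cl R) : L2) ξ
  set n := (𝓕 (cl N) : L2) ξ
  set J := (jap ξ)⁻¹
  have h7 : (conj w * (dsym l ξ * (𝓕 (cl Φ) : L2) ξ)).re +
      (conj ((J : ℂ) * r) * ((J : ℂ) * (dsym l ξ * w))).re =
      (-(conj w * (dsym l ξ * ((J : ℂ) * (J : ℂ) * n)))).re := by
    have h8 : (conj ((J : ℂ) * r) * ((J : ℂ) * (dsym l ξ * w))).re =
        (conj (conj ((J : ℂ) * r) * ((J : ℂ) * (dsym l ξ * w)))).re :=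
      (Complex.conj_re _).symm
    rw [h8, h6, ← Complex.add_re]
    congr 1
    simp only [map_mul, Complex.conj_conj, conj_ofReal, hd]
    ring
  rw [h7]
  refine (Complex.abs_re_le_norm _).trans ?_
  rw [norm_neg, norm_mul, RCLike.norm_conj, norm_mul, norm_mul, norm_mul, norm_real]
  have hJ : ‖J‖ = J := norm_of_nonneg (inv_nonneg.2 (jap_pos ξ).le)
  rw [hJ]
  have := norm_dsym_mul_jap_le l ξ
  calc ‖w‖ * (‖dsym l ξ‖ * (J * J * ‖n‖)) = ‖w‖ * ‖n‖ * (‖dsym l ξ‖ * (J * J)) := by ring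
    _ ≤ ‖w‖ * ‖n‖ * 1 := by gcongr
    _ = _ := mul_one _

theorem abs_inner_flux_le {R Q : R3 → ℝ} (hQ : Differentiable ℝ Q) (hQm : MemLp Q 2 volume)
    (l : Fin 3) (hQm' : MemLp (pd l Q) 2 volume) :
    |inner ℝ (japInvM (𝓕 (cl R))) (japInvM (𝓕 (cl (pd l Q))))| ≤ ‖cl R‖ * ‖cl Q‖ := by
  rw [inner_eq_integral, ← norm_fourier (cl R), ← norm_fourier (cl Q)]
  refine abs_integral_le_norm_mul_norm ?_
  filter_upwards [fourier_pd hQ hQm hQm', coeFn_japInvM (𝓕 (cl R)), coeFn_japInvM (𝓕 (cl (pd l Q)))]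
    with ξ h2 h4 h5
  rw [h4, h5, h2]
  refine (Complex.abs_re_le_norm _).trans ?_
  rw [norm_mul, RCLike.norm_conj, norm_mul, norm_mul, norm_mul, norm_real,
    norm_of_nonneg (inv_nonneg.2 (jap_pos ξ).le)]
  have := norm_dsym_mul_jap_le l ξ
  calc (jap ξ)⁻¹ * ‖(𝓕 (cl R) : L2) ξ‖ * ((jap ξ)⁻¹ * (‖dsym l ξ‖ * ‖(𝓕 (cl Q) : L2) ξ‖)) =
      ‖(𝓕 (cl R) : L2) ξ‖ * ‖(𝓕 (cl Q) : L2) ξ‖ * (‖dsym l ξ‖ * ((jap ξ)⁻¹ * (jap ξ)⁻¹)) := by ring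
    _ ≤ ‖(𝓕 (cl R) : L2) ξ‖ * ‖(𝓕 (cl Q) : L2) ξ‖ * 1 := by gcongr
    _ = _ := mul_one _

theorem abs_sum_inner_transport_le {S : R3 → ℝ} {v : Fin 3 → R3 → ℝ} {B B₀ : ℝ} (hS : ContDiff ℝ 1 S)
    (hSm : MemLp S 2 volume) (hSm' : ∀ i, MemLp (pd i S) 2 volume) (hv : ∀ i, ContDiff ℝ 1 (v i))
    (hB₀ : ∀ i x, |v i x| ≤ B₀) (hB : ∀ i x, |pd i (v i) x| ≤ B) :
    |∑ i, inner ℝ (cl S) (cl fun x => v i x * pd i S x)| ≤ 3 / 2 * B * ‖cl S‖ ^ 2 := by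
  have h : ∀ i, |inner ℝ (cl S) (cl fun x => v i x * pd i S x)| ≤ 2⁻¹ * (B * ‖cl S‖ ^ 2) := fun i => by
    rw [inner_cl hSm (memLp_mul (hv i).continuous.aestronglyMeasurable (hSm' i) (hB₀ i)),
      integral_transport hS (hv i) hSm (hSm' i) (hB₀ i) (hB i), abs_neg, abs_mul,
      abs_of_pos (by norm_num : (0 : ℝ) < 2⁻¹)]
    have := abs_integral_mul_mul_le hSm hSm (hB i)
    simp only [← sq] at this
    linarith
  refine (abs_sum_le_sum_abs _ _).trans ((sum_le_sum fun i _ => h i).trans (le_of_eq ?_))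
  simp only [Finset.sum_const, Finset.card_univ, Fintype.card_fin, nsmul_eq_mul]
  push_cast; ring

/-- The rate of change of the energy of a solution of the symmetrized system with forcing. The
derivatives of the unknowns cancel: the transport terms and the pressure by integration by parts, the
electric term against the energy of the density. -/
theorem abs_energy_rate_le {S R N Φ : R3 → ℝ} {W Q v : Fin 3 → R3 → ℝ} {cS : L2} {cW : Fin 3 → L2}
    {B B₀ : ℝ} (hS : ContDiff ℝ 1 S) (hSm : MemLp S 2 volume) (hSm' : ∀ i, MemLp (pd i S) 2 volume)
    (hW : ∀ l, ContDiff ℝ 1 (W l)) (hWm : ∀ l, MemLp (W l) 2 volume)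
    (hWm' : ∀ l i, MemLp (pd i (W l)) 2 volume)
    (hΦ : ContDiff ℝ 1 Φ) (hΦm : MemLp Φ 2 volume) (hΦm' : ∀ i, MemLp (pd i Φ) 2 volume)
    (hQ : ∀ l, ContDiff ℝ 1 (Q l)) (hQm : ∀ l, MemLp (Q l) 2 volume)
    (hQm' : ∀ l, MemLp (pd l (Q l)) 2 volume) (hv : ∀ i, ContDiff ℝ 1 (v i))
    (hB₀ : ∀ i x, |v i x| ≤ B₀) (hB : ∀ i x, |pd i (v i) x| ≤ B)
    (he : ∀ᵐ ξ : R3, ((jap ξ ^ 2 : ℝ) : ℂ) * (𝓕 (cl Φ) : L2) ξ =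
      (𝓕 (cl R) : L2) ξ - (𝓕 (cl N) : L2) ξ) :
    |inner ℝ (cl S) (-(∑ i, cl (fun x => v i x * pd i S x) + cS + ∑ i, cl (pd i (W i)))) +
      ∑ l, inner ℝ (cl (W l))
        (-(∑ i, cl (fun x => v i x * pd i (W l) x) + cW l + cl (pd l S) + cl (pd l Φ))) +
      inner ℝ (japInvM (𝓕 (cl R)))
        (japInvM (-(∑ l, (𝓕 (cl (pd l (W l))) : L2) + ∑ l, (𝓕 (cl (pd l (Q l))) : L2))))| ≤
      3 / 2 * B * (‖cl S‖ ^ 2 + ∑ l, ‖cl (W l)‖ ^ 2) + ‖cl S‖ * ‖cS‖ +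
        ∑ l, (‖cl (W l)‖ * ‖cW l‖ + ‖cl (W l)‖ * ‖cl N‖ + ‖cl R‖ * ‖cl (Q l)‖) := by
  have hibp : ∀ l, inner ℝ (cl S) (cl (pd l (W l))) = -inner ℝ (cl (W l)) (cl (pd l S)) := fun l => by
    rw [inner_cl hSm (hWm' l l), inner_cl (hWm l) (hSm' l), integral_mul_pd_of_memLp
      (hS.differentiable (by norm_num)) ((hW l).differentiable (by norm_num)) l hSm (hWm l) (hSm' l) (hWm' l l)]
    congr 2; ext x; ring
  have hT := abs_sum_inner_transport_le hS hSm hSm' hv hB₀ hB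
  have hTW := fun l => abs_sum_inner_transport_le (hW l) (hWm l) (hWm' l) hv hB₀ hB
  have hE := fun l => abs_inner_electric_le (R := R) (N := N) ((hW l).differentiable (by norm_num)) (hWm l) l
    (hWm' l l) (hΦ.differentiable (by norm_num)) hΦm (hΦm' l) he
  have hF := fun l => abs_inner_flux_le (R := R) ((hQ l).differentiable (by norm_num)) (hQm l) l (hQm' l)
  have hS2 := abs_real_inner_le_norm (cl S) cS
  have hW2 := fun l => abs_real_inner_le_norm (cl (W l)) (cW l)
  have key : inner ℝ (cl S) (-(∑ i, cl (fun x => v i x * pd i S x) + cS + ∑ i, cl (pd i (W i)))) +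
      ∑ l, inner ℝ (cl (W l))
        (-(∑ i, cl (fun x => v i x * pd i (W l) x) + cW l + cl (pd l S) + cl (pd l Φ))) +
      inner ℝ (japInvM (𝓕 (cl R)))
        (japInvM (-(∑ l, (𝓕 (cl (pd l (W l))) : L2) + ∑ l, (𝓕 (cl (pd l (Q l))) : L2)))) =
      -(∑ i, inner ℝ (cl S) (cl fun x => v i x * pd i S x)) - inner ℝ (cl S) cS -
      ∑ l, ((∑ i, inner ℝ (cl (W l)) (cl fun x => v i x * pd i (W l) x)) + inner ℝ (cl (W l)) (cW l) +
        (inner ℝ (cl (W l)) (cl (pd l Φ)) + inner ℝ (japInvM (𝓕 (cl R))) (japInvM (𝓕 (cl (pd l (W l)))))) +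
        inner ℝ (japInvM (𝓕 (cl R))) (japInvM (𝓕 (cl (pd l (Q l)))))) := by
    simp only [map_neg, map_add, map_sum, inner_neg_right, inner_add_right, inner_sum, hibp,
      sum_add_distrib, sum_neg_distrib]
    ring
  rw [key]
  have hl : ∀ l, |(∑ i, inner ℝ (cl (W l)) (cl fun x => v i x * pd i (W l) x)) + inner ℝ (cl (W l)) (cW l) +
        (inner ℝ (cl (W l)) (cl (pd l Φ)) + inner ℝ (japInvM (𝓕 (cl R))) (japInvM (𝓕 (cl (pd l (W l)))))) +
        inner ℝ (japInvM (𝓕 (cl R))) (japInvM (𝓕 (cl (pd l (Q l)))))| ≤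
      3 / 2 * B * ‖cl (W l)‖ ^ 2 + (‖cl (W l)‖ * ‖cW l‖ + ‖cl (W l)‖ * ‖cl N‖ + ‖cl R‖ * ‖cl (Q l)‖) := fun l => by
    refine (abs_add_le _ _).trans ((add_le_add ((abs_add_le _ _).trans (add_le_add (abs_add_le _ _) le_rfl))
      le_rfl).trans ?_)
    linarith [hTW l, hE l, hF l, hW2 l]
  have hsum := (abs_sum_le_sum_abs (fun l => (∑ i, inner ℝ (cl (W l)) (cl fun x => v i x * pd i (W l) x)) +
        inner ℝ (cl (W l)) (cW l) +
        (inner ℝ (cl (W l)) (cl (pd l Φ)) + inner ℝ (japInvM (𝓕 (cl R))) (japInvM (𝓕 (cl (pd l (W l)))))) +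
        inner ℝ (japInvM (𝓕 (cl R))) (japInvM (𝓕 (cl (pd l (Q l)))))) Finset.univ).trans
    (sum_le_sum fun l _ => hl l)
  have e : ∑ l, (3 / 2 * B * ‖cl (W l)‖ ^ 2 +
      (‖cl (W l)‖ * ‖cW l‖ + ‖cl (W l)‖ * ‖cl N‖ + ‖cl R‖ * ‖cl (Q l)‖)) = 3 / 2 * B * ∑ l, ‖cl (W l)‖ ^ 2 +
      ∑ l, (‖cl (W l)‖ * ‖cW l‖ + ‖cl (W l)‖ * ‖cl N‖ + ‖cl R‖ * ‖cl (Q l)‖) := by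
    rw [sum_add_distrib, ← mul_sum]
  rw [e] at hsum
  refine (abs_sub _ _).trans ((add_le_add (abs_sub _ _) hsum).trans ?_)
  rw [abs_neg]
  linarith

/-! ### Differences of derivatives -/

theorem contDiff_fwdDiff_iter {f : R3 → ℝ} (hf : ContDiff ℝ 1 f) (h : R3) (n : ℕ) :
    ContDiff ℝ 1 ((fwdDiff h)^[n] f) := by
  induction n generalizing f with
  | zero => exact hf
  | succ n ih => exact ih ((hf.comp (contDiff_id.add contDiff_const)).sub hf)

theorem pd_fwdDiff_iter {f : R3 → ℝ} (hf : ContDiff ℝ 1 f) (h : R3) (n : ℕ) (i : Fin 3) :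
    pd i ((fwdDiff h)^[n] f) = (fwdDiff h)^[n] (pd i f) := by
  induction n generalizing f with
  | zero => rfl
  | succ n ih =>
    rw [Function.iterate_succ_apply, Function.iterate_succ_apply,
      ih (f := fwdDiff h f) ((hf.comp (contDiff_id.add contDiff_const)).sub hf)]
    congr 1
    ext x
    have hd : Differentiable ℝ f := hf.differentiable (by norm_num)
    show pd i (fun y => f (y + h) - f y) x = pd i f (x + h) - pd i f x
    rw [pd_sub (f := fun y => f (y + h)) ((hd.comp (differentiable_id.add_const h)) x) (hd x)]
    congr 1
    show fderiv ℝ (fun y => f (y + h)) x _ = _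
    rw [fderiv_comp_add_right]; rfl

theorem fwdDiff_iter_sum (h : R3) (n : ℕ) (f : Fin 3 → R3 → ℝ) (x : R3) :
    (fwdDiff h)^[n] (fun y => ∑ i, f i y) x = ∑ i, (fwdDiff h)^[n] (f i) x := by
  simp only [fwdDiff_iter_eq_sum_shift, Finset.smul_sum]
  rw [Finset.sum_comm]

theorem fwdDiff_iter_add' (h : R3) (n : ℕ) (f g : R3 → ℝ) (x : R3) :
    (fwdDiff h)^[n] (fun y => f y + g y) x = (fwdDiff h)^[n] f x + (fwdDiff h)^[n] g x := by
  simp only [fwdDiff_iter_eq_sum_shift, smul_add, sum_add_distrib]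

theorem fwdDiff_iter_neg (h : R3) (n : ℕ) (f : R3 → ℝ) (x : R3) :
    (fwdDiff h)^[n] (fun y => -f y) x = -(fwdDiff h)^[n] f x := by
  simp only [fwdDiff_iter_eq_sum_shift, smul_neg, sum_neg_distrib]

/-! ### The energy of differences at a fixed time -/

/-- The commutator of an iterated difference with multiplication by `a`, applied to `g`. -/
def comm (h : R3) (n : ℕ) (a g : R3 → ℝ) (x : R3) : ℝ :=
  (fwdDiff h)^[n] (fun y => a y * g y) x - a x * (fwdDiff h)^[n] g x

theorem memLp_comm {a g : R3 → ℝ} {B : ℝ} (ha : Continuous a) (hB : ∀ x, |a x| ≤ B) (hg : MemLp g 2 volume)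
    (h : R3) (n : ℕ) : MemLp (comm h n a g) 2 volume :=
  (memLp_fwdDiff_iter (memLp_mul ha.aestronglyMeasurable hg hB) h n).sub
    (memLp_mul ha.aestronglyMeasurable (memLp_fwdDiff_iter hg h n) hB)

/-- What the energy estimate uses about a solution at a fixed time: the unknowns and their first
derivatives are bounded by `A`, their Sobolev norms of order `s` by `X`, and that of the nonlinear part
`e^φ - 1 - φ` of the Boltzmann law by `A * X`. -/
structure Slice (s A X : ℝ) (ρ φ : R3 → ℝ) (v : Fin 3 → R3 → ℝ) : Prop where
  one_lt : 1 < s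
  nonneg : 0 ≤ A
  nonneg' : 0 ≤ X
  contDiff_density : ContDiff ℝ 1 ρ
  contDiff_log : ContDiff ℝ 1 (logDen ρ)
  contDiff_potential : ContDiff ℝ 1 φ
  contDiff_velocity : ∀ l, ContDiff ℝ 1 (v l)
  memLp_density : MemLp ρ 2 volume
  memLp_log : MemLp (logDen ρ) 2 volume
  memLp_potential : MemLp φ 2 volume
  memLp_rem : MemLp (fun x => expRem (φ x)) 2 volume
  memLp_velocity : ∀ l, MemLp (v l) 2 volume
  memLp_pd_density : ∀ i, MemLp (pd i ρ) 2 volume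
  memLp_pd_log : ∀ i, MemLp (pd i (logDen ρ)) 2 volume
  memLp_pd_potential : ∀ i, MemLp (pd i φ) 2 volume
  memLp_pd_velocity : ∀ l i, MemLp (pd i (v l)) 2 volume
  abs_density : ∀ x, |ρ x| ≤ A
  abs_velocity : ∀ l x, |v l x| ≤ A
  abs_pd_log : ∀ i x, |pd i (logDen ρ) x| ≤ A
  abs_pd_velocity : ∀ l i x, |pd i (v l) x| ≤ A
  hs_density : hs s ρ ≤ ofReal X
  hs_log : hs s (logDen ρ) ≤ ofReal X
  hs_velocity : ∀ l, hs s (v l) ≤ ofReal X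
  hs_rem : hs s (fun x => expRem (φ x)) ≤ ofReal (A * X)
  fourier : (fun ξ => ((jap ξ ^ 2 : ℝ) : ℂ) * (𝓕 (cl φ) : L2) ξ) =ᵐ[volume]
    (𝓕 (cl fun x => ρ x - expRem (φ x)) : L2)

/-- The time derivative of `log (1 + ρ)`. -/
def rateLog (ρ : R3 → ℝ) (v : Fin 3 → R3 → ℝ) (x : R3) : ℝ :=
  -(∑ i, v i x * pd i (logDen ρ) x + ∑ i, pd i (v i) x)

/-- The time derivative of `ρ`. -/
def rateDensity (ρ : R3 → ℝ) (v : Fin 3 → R3 → ℝ) (x : R3) : ℝ :=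
  -(∑ i, pd i (v i) x + ∑ i, pd i (fun y => ρ y * v i y) x)

/-- The time derivative of the velocity. -/
def rateVelocity (ρ φ : R3 → ℝ) (v : Fin 3 → R3 → ℝ) (l : Fin 3) (x : R3) : ℝ :=
  -(∑ i, v i x * pd i (v l) x + pd l (logDen ρ) x + pd l φ x)

/-- The energy of the differences of order `n` with step `h`. -/
def stepEnergy (h : R3) (n : ℕ) (ρ : R3 → ℝ) (v : Fin 3 → R3 → ℝ) : ℝ :=
  2⁻¹ * ‖cl ((fwdDiff h)^[n] (logDen ρ))‖ ^ 2 + ∑ l, 2⁻¹ * ‖cl ((fwdDiff h)^[n] (v l))‖ ^ 2 +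
    2⁻¹ * ‖japInvM (𝓕 (cl ((fwdDiff h)^[n] ρ)))‖ ^ 2

/-- The time derivative of `stepEnergy`. -/
def stepRate (h : R3) (n : ℕ) (ρ φ : R3 → ℝ) (v : Fin 3 → R3 → ℝ) : ℝ :=
  inner ℝ (cl ((fwdDiff h)^[n] (logDen ρ))) (cl ((fwdDiff h)^[n] (rateLog ρ v))) +
    ∑ l, inner ℝ (cl ((fwdDiff h)^[n] (v l))) (cl ((fwdDiff h)^[n] (rateVelocity ρ φ v l))) +
    inner ℝ (japInvM (𝓕 (cl ((fwdDiff h)^[n] ρ)))) (japInvM (𝓕 (cl ((fwdDiff h)^[n] (rateDensity ρ v)))))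

theorem cl_fwdDiff_transport {v : Fin 3 → R3 → ℝ} {f g : R3 → ℝ} {B : ℝ} (hv : ∀ i, Continuous (v i))
    (hB : ∀ i x, |v i x| ≤ B) (hf : ContDiff ℝ 1 f) (hf' : ∀ i, MemLp (pd i f) 2 volume)
    (hg : MemLp g 2 volume) (h : R3) (n : ℕ) :
    cl ((fwdDiff h)^[n] fun x => -(∑ i, v i x * pd i f x + g x)) =
      -(∑ i, cl (fun x => v i x * pd i ((fwdDiff h)^[n] f) x) + ∑ i, cl (comm h n (v i) (pd i f)) +
        cl ((fwdDiff h)^[n] g)) := by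
  have m1 : ∀ i, MemLp (fun x => v i x * (fwdDiff h)^[n] (pd i f) x) 2 volume := fun i =>
    memLp_mul (hv i).aestronglyMeasurable (memLp_fwdDiff_iter (hf' i) h n) (hB i)
  have m2 : ∀ i, MemLp (comm h n (v i) (pd i f)) 2 volume := fun i => memLp_comm (hv i) (hB i) (hf' i) h n
  have m3 : MemLp ((fwdDiff h)^[n] g) 2 volume := memLp_fwdDiff_iter hg h n
  have s1 : MemLp (fun x => ∑ i, v i x * (fwdDiff h)^[n] (pd i f) x) 2 volume :=
    memLp_finsetSum _ fun i _ => m1 i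
  have s2 : MemLp (fun x => ∑ i, comm h n (v i) (pd i f) x) 2 volume := memLp_finsetSum _ fun i _ => m2 i
  have s12 : MemLp (fun x => ∑ i, v i x * (fwdDiff h)^[n] (pd i f) x + ∑ i, comm h n (v i) (pd i f) x) 2 volume :=
    s1.add s2
  have s123 : MemLp (fun x => ∑ i, v i x * (fwdDiff h)^[n] (pd i f) x + ∑ i, comm h n (v i) (pd i f) x +
    (fwdDiff h)^[n] g x) 2 volume := s12.add m3
  have e : ((fwdDiff h)^[n] fun x => -(∑ i, v i x * pd i f x + g x)) = fun x =>
      -(∑ i, v i x * (fwdDiff h)^[n] (pd i f) x + ∑ i, comm h n (v i) (pd i f) x + (fwdDiff h)^[n] g x) := by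
    ext x
    rw [fwdDiff_iter_neg h n (fun x => ∑ i, v i x * pd i f x + g x),
      fwdDiff_iter_add' h n (fun x => ∑ i, v i x * pd i f x), fwdDiff_iter_sum h n fun i x => v i x * pd i f x,
      ← sum_add_distrib]
    congr 3
    ext i
    rw [comm]; ring
  rw [e, cl_neg s123, cl_add s12 m3, cl_add s1 s2, cl_sum m1, cl_sum m2]
  simp only [pd_fwdDiff_iter hf]

namespace Slice

variable {s A X : ℝ} {ρ φ : R3 → ℝ} {v : Fin 3 → R3 → ℝ}

theorem memLp_flux (hS : Slice s A X ρ φ v) (l : Fin 3) : MemLp (fun x => ρ x * v l x) 2 volume :=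
  memLp_mul hS.contDiff_density.continuous.aestronglyMeasurable (hS.memLp_velocity l) hS.abs_density

theorem memLp_pd_flux (hS : Slice s A X ρ φ v) (l i : Fin 3) :
    MemLp (pd i fun x => ρ x * v l x) 2 volume :=
  (memLp_pd_mul hS.contDiff_density (hS.contDiff_velocity l) hS.memLp_density (hS.memLp_pd_density i)
    (hS.abs_velocity l) (hS.abs_pd_velocity l i)).2

theorem fourier_fwdDiff (hS : Slice s A X ρ φ v) (h : R3) (n : ℕ) :
    ∀ᵐ ξ : R3, ((jap ξ ^ 2 : ℝ) : ℂ) * (𝓕 (cl ((fwdDiff h)^[n] φ)) : L2) ξ =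
      (𝓕 (cl ((fwdDiff h)^[n] ρ)) : L2) ξ - (𝓕 (cl ((fwdDiff h)^[n] fun x => expRem (φ x))) : L2) ξ := by
  have h0 := hS.fourier
  rw [cl_sub hS.memLp_density hS.memLp_rem, fourier_sub] at h0
  filter_upwards [h0, Lp.coeFn_sub (𝓕 (cl ρ) : L2) (𝓕 (cl fun x => expRem (φ x))),
    fourier_fwdDiff_iter hS.memLp_density h n, fourier_fwdDiff_iter hS.memLp_rem h n,
    fourier_fwdDiff_iter hS.memLp_potential h n] with ξ h1 h2 h3 h4 h5
  rw [h2, Pi.sub_apply] at h1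
  rw [h3, h4, h5]
  linear_combination (chr h ξ - 1) ^ n * h1

theorem abs_stepRate_le (hS : Slice s A X ρ φ v) (h : R3) (n : ℕ) :
    |stepRate h n ρ φ v| ≤
      3 / 2 * A * (‖cl ((fwdDiff h)^[n] (logDen ρ))‖ ^ 2 + ∑ l, ‖cl ((fwdDiff h)^[n] (v l))‖ ^ 2) +
      ∑ i, ‖cl ((fwdDiff h)^[n] (logDen ρ))‖ * ‖cl (comm h n (v i) (pd i (logDen ρ)))‖ +
      ∑ l, (∑ i, ‖cl ((fwdDiff h)^[n] (v l))‖ * ‖cl (comm h n (v i) (pd i (v l)))‖ +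
        ‖cl ((fwdDiff h)^[n] (v l))‖ * ‖cl ((fwdDiff h)^[n] fun x => expRem (φ x))‖ +
        ‖cl ((fwdDiff h)^[n] ρ)‖ * ‖cl ((fwdDiff h)^[n] fun x => ρ x * v l x)‖) := by
  have hvc := fun i => (hS.contDiff_velocity i).continuous
  have hD : ∀ {f : R3 → ℝ}, ContDiff ℝ 1 f → (∀ i, MemLp (pd i f) 2 volume) → ∀ i,
      MemLp (pd i ((fwdDiff h)^[n] f)) 2 volume := fun hf hf' i => by
    rw [pd_fwdDiff_iter hf]; exact memLp_fwdDiff_iter (hf' i) h n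
  have hQ : ∀ l, ContDiff ℝ 1 fun x => ρ x * v l x := fun l =>
    hS.contDiff_density.mul (hS.contDiff_velocity l)
  have md : MemLp (fun x => ∑ i, pd i (v i) x) 2 volume :=
    memLp_finsetSum _ fun i _ => hS.memLp_pd_velocity i i
  have mp : ∀ l, MemLp (fun x => pd l (logDen ρ) x + pd l φ x) 2 volume := fun l =>
    (hS.memLp_pd_log l).add (hS.memLp_pd_potential l)
  have mq : MemLp (fun x => ∑ i, pd i (fun y => ρ y * v i y) x) 2 volume :=
    memLp_finsetSum _ fun i _ => hS.memLp_pd_flux i i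
  have r1 : cl ((fwdDiff h)^[n] (rateLog ρ v)) =
      -(∑ i, cl (fun x => v i x * pd i ((fwdDiff h)^[n] (logDen ρ)) x) +
        ∑ i, cl (comm h n (v i) (pd i (logDen ρ))) + ∑ i, cl (pd i ((fwdDiff h)^[n] (v i)))) := by
    have := cl_fwdDiff_transport (f := logDen ρ) (g := fun x => ∑ i, pd i (v i) x) hvc hS.abs_velocity
      hS.contDiff_log hS.memLp_pd_log md h n
    unfold rateLog
    rw [this, show ((fwdDiff h)^[n] fun x => ∑ i, pd i (v i) x) = fun x => ∑ i, (fwdDiff h)^[n] (pd i (v i)) x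
      from funext fun x => fwdDiff_iter_sum h n _ x,
      cl_sum fun i => memLp_fwdDiff_iter (hS.memLp_pd_velocity i i) h n]
    simp only [pd_fwdDiff_iter (hS.contDiff_velocity _)]
  have r2 : ∀ l, cl ((fwdDiff h)^[n] (rateVelocity ρ φ v l)) =
      -(∑ i, cl (fun x => v i x * pd i ((fwdDiff h)^[n] (v l)) x) +
        ∑ i, cl (comm h n (v i) (pd i (v l))) + cl (pd l ((fwdDiff h)^[n] (logDen ρ))) +
        cl (pd l ((fwdDiff h)^[n] φ))) := fun l => by
    have := cl_fwdDiff_transport (f := v l) (g := fun x => pd l (logDen ρ) x + pd l φ x) hvc hS.abs_velocity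
      (hS.contDiff_velocity l) (hS.memLp_pd_velocity l) (mp l) h n
    have e : rateVelocity ρ φ v l = fun x =>
        -(∑ i, v i x * pd i (v l) x + (pd l (logDen ρ) x + pd l φ x)) := by
      ext x; rw [rateVelocity]; ring
    rw [e, this, show ((fwdDiff h)^[n] fun x => pd l (logDen ρ) x + pd l φ x) =
      fun x => (fwdDiff h)^[n] (pd l (logDen ρ)) x + (fwdDiff h)^[n] (pd l φ) x
      from funext fun x => fwdDiff_iter_add' h n _ _ x,
      cl_add (memLp_fwdDiff_iter (hS.memLp_pd_log l) h n) (memLp_fwdDiff_iter (hS.memLp_pd_potential l) h n),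
      pd_fwdDiff_iter hS.contDiff_log, pd_fwdDiff_iter hS.contDiff_potential]
    abel
  have r3 : (𝓕 (cl ((fwdDiff h)^[n] (rateDensity ρ v))) : L2) =
      -(∑ l, (𝓕 (cl (pd l ((fwdDiff h)^[n] (v l)))) : L2) +
        ∑ l, (𝓕 (cl (pd l ((fwdDiff h)^[n] fun x => ρ x * v l x))) : L2)) := by
    have e : ((fwdDiff h)^[n] (rateDensity ρ v)) = fun x => -(∑ i, (fwdDiff h)^[n] (pd i (v i)) x +
        ∑ i, (fwdDiff h)^[n] (pd i fun y => ρ y * v i y) x) := by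
      ext x
      unfold rateDensity
      rw [fwdDiff_iter_neg h n (fun x => ∑ i, pd i (v i) x + ∑ i, pd i (fun y => ρ y * v i y) x),
        fwdDiff_iter_add' h n (fun x => ∑ i, pd i (v i) x), fwdDiff_iter_sum h n fun i => pd i (v i),
        fwdDiff_iter_sum h n fun i => pd i fun y => ρ y * v i y]
    have n1 : ∀ i, MemLp ((fwdDiff h)^[n] (pd i (v i))) 2 volume := fun i =>
      memLp_fwdDiff_iter (hS.memLp_pd_velocity i i) h n
    have n2 : ∀ i, MemLp ((fwdDiff h)^[n] (pd i fun y => ρ y * v i y)) 2 volume := fun i =>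
      memLp_fwdDiff_iter (hS.memLp_pd_flux i i) h n
    have n3 : MemLp (fun x => ∑ i, (fwdDiff h)^[n] (pd i (v i)) x) 2 volume := memLp_finsetSum _ fun i _ => n1 i
    have n4 : MemLp (fun x => ∑ i, (fwdDiff h)^[n] (pd i fun y => ρ y * v i y) x) 2 volume :=
      memLp_finsetSum _ fun i _ => n2 i
    have hsum : ∀ f : Fin 3 → L2, (𝓕 (∑ i, f i) : L2) = ∑ i, (𝓕 (f i) : L2) := fun f =>
      map_sum (fourierCLM ℂ L2) _ _
    rw [e, cl_neg (f := fun x => ∑ i, (fwdDiff h)^[n] (pd i (v i)) x +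
      ∑ i, (fwdDiff h)^[n] (pd i fun y => ρ y * v i y) x) (n3.add n4), cl_add n3 n4, cl_sum n1, cl_sum n2,
      fourier_neg, fourier_add, hsum, hsum]
    simp only [pd_fwdDiff_iter (hS.contDiff_velocity _), pd_fwdDiff_iter (hQ _)]
  have key := abs_energy_rate_le (S := (fwdDiff h)^[n] (logDen ρ)) (R := (fwdDiff h)^[n] ρ)
    (N := (fwdDiff h)^[n] fun x => expRem (φ x)) (Φ := (fwdDiff h)^[n] φ) (W := fun l => (fwdDiff h)^[n] (v l))
    (Q := fun l => (fwdDiff h)^[n] fun x => ρ x * v l x) (v := v)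
    (cS := ∑ i, cl (comm h n (v i) (pd i (logDen ρ)))) (cW := fun l => ∑ i, cl (comm h n (v i) (pd i (v l))))
    (contDiff_fwdDiff_iter hS.contDiff_log h n) (memLp_fwdDiff_iter hS.memLp_log h n)
    (hD hS.contDiff_log hS.memLp_pd_log) (fun l => contDiff_fwdDiff_iter (hS.contDiff_velocity l) h n)
    (fun l => memLp_fwdDiff_iter (hS.memLp_velocity l) h n)
    (fun l => hD (hS.contDiff_velocity l) (hS.memLp_pd_velocity l))
    (contDiff_fwdDiff_iter hS.contDiff_potential h n) (memLp_fwdDiff_iter hS.memLp_potential h n)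
    (hD hS.contDiff_potential hS.memLp_pd_potential) (fun l => contDiff_fwdDiff_iter (hQ l) h n)
    (fun l => memLp_fwdDiff_iter (hS.memLp_flux l) h n) (fun l => hD (hQ l) (hS.memLp_pd_flux l) l)
    hS.contDiff_velocity hS.abs_velocity (fun i x => hS.abs_pd_velocity i i x) (hS.fourier_fwdDiff h n)
  unfold stepRate
  rw [r1, r3]
  simp only [r2]
  refine key.trans (add_le_add (add_le_add le_rfl ?_) (sum_le_sum fun l _ =>
    add_le_add (add_le_add ?_ le_rfl) le_rfl))
  · rw [← mul_sum]
    exact mul_le_mul_of_nonneg_left (norm_sum_le _ _) (norm_nonneg _)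
  · rw [← mul_sum]
    exact mul_le_mul_of_nonneg_left (norm_sum_le _ _) (norm_nonneg _)

end Slice

/-! ### Weighted sums over the steps -/

theorem sum_weight_mul_le {ι : Type*} {F : Finset ι} {w x y : ι → ℝ} {a b : ℝ} (hw : ∀ i, 0 ≤ w i) (ha : 0 ≤ a)
    (hb : 0 ≤ b) (hx : ∑ i ∈ F, w i * x i ^ 2 ≤ a ^ 2) (hy : ∑ i ∈ F, w i * y i ^ 2 ≤ b ^ 2) :
    ∑ i ∈ F, w i * (x i * y i) ≤ a * b := by
  have h := Finset.sum_mul_sq_le_sq_mul_sq F (fun i => Real.sqrt (w i) * x i) fun i => Real.sqrt (w i) * y i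
  simp only [mul_pow, Real.sq_sqrt (hw _)] at h
  have e : ∀ i, Real.sqrt (w i) * x i * (Real.sqrt (w i) * y i) = w i * (x i * y i) := fun i => by
    rw [mul_mul_mul_comm, Real.mul_self_sqrt (hw i)]
  simp only [e] at h
  refine le_of_abs_le (abs_le_of_sq_le_sq ?_ (mul_nonneg ha hb))
  rw [mul_pow]
  exact h.trans (mul_le_mul hx hy (sum_nonneg fun i _ => mul_nonneg (hw i) (sq_nonneg _)) (sq_nonneg _))

/-- The weight `wt` as a real number. -/
def wtR (s : ℝ) (p : ℤ × Fin 3) : ℝ := (2 : ℝ) ^ (2 * s * p.1)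

theorem wtR_nonneg (s : ℝ) (p : ℤ × Fin 3) : 0 ≤ wtR s p := by unfold wtR; positivity

theorem ofReal_wtR_mul (s : ℝ) {G : ℤ × Fin 3 → R3 → ℝ} (hG : ∀ p, MemLp (G p) 2 volume) (p : ℤ × Fin 3) :
    ofReal (wtR s p * ‖cl (G p)‖ ^ 2) = wt s p * eLpNorm (G p) 2 volume ^ 2 := by
  rw [ofReal_mul (wtR_nonneg s p), eLpNorm_eq_ofReal_norm (hG p), ofReal_pow (norm_nonneg _)]
  rfl

theorem sum_wtR_le {s : ℝ} {G : ℤ × Fin 3 → R3 → ℝ} (hG : ∀ p, MemLp (G p) 2 volume) {c : ℝ} (hc : 0 ≤ c)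
    (h : wsum s G ≤ ofReal c) (F : Finset (ℤ × Fin 3)) :
    ∑ p ∈ F, wtR s p * ‖cl (G p)‖ ^ 2 ≤ c := by
  rw [← ofReal_le_ofReal_iff hc, ENNReal.ofReal_sum_of_nonneg fun p _ =>
    mul_nonneg (wtR_nonneg s p) (sq_nonneg _), sum_congr rfl fun p _ => ofReal_wtR_mul s hG p]
  exact (ENNReal.sum_le_tsum F).trans h

theorem wsum_le_of_sum_le {s : ℝ} {G : ℤ × Fin 3 → R3 → ℝ} (hG : ∀ p, MemLp (G p) 2 volume) {c : ℝ}
    (h : ∀ F : Finset (ℤ × Fin 3), ∑ p ∈ F, wtR s p * ‖cl (G p)‖ ^ 2 ≤ c) : wsum s G ≤ ofReal c := by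
  rw [wsum, ENNReal.tsum_eq_iSup_sum]
  refine iSup_le fun F => ?_
  rw [← sum_congr rfl fun p _ => ofReal_wtR_mul s hG p, ← ENNReal.ofReal_sum_of_nonneg fun p _ =>
    mul_nonneg (wtR_nonneg s p) (sq_nonneg _)]
  exact ofReal_le_ofReal (h F)

theorem abs_sub_le_of_abs_pd_le {f : R3 → ℝ} (hf : Differentiable ℝ f) {A : ℝ} (hA : ∀ i x, |pd i f x| ≤ A)
    (x h : R3) : |f (x + h) - f x| ≤ ‖h‖ * (3 * A) := by
  have hA0 : 0 ≤ A := (abs_nonneg _).trans (hA 0 0)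
  have hb : ∀ x, ‖fderiv ℝ f x‖ ≤ 3 * A := fun x => by
    refine ContinuousLinearMap.opNorm_le_bound _ (by positivity) fun y => ?_
    have h3 : y = ∑ j, y j • ee j := by
      ext l
      simp [Finset.sum_apply, Pi.single_apply]
    conv_lhs => rw [h3, map_sum]
    refine (norm_sum_le _ _).trans ((sum_le_sum (g := fun _ => A * ‖y‖) fun j _ => ?_).trans
      (le_of_eq (by simp; ring)))
    rw [map_smul, norm_smul, mul_comm]
    exact mul_le_mul (hA j x) (PiLp.norm_apply_le y j) (norm_nonneg _) hA0
  have := convex_univ.norm_image_sub_le_of_norm_fderiv_le (𝕜 := ℝ) (fun x _ => hf x) (fun x _ => hb x)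
    (Set.mem_univ x) (Set.mem_univ (x + h))
  rw [add_sub_cancel_left, norm_eq_abs] at this
  linarith

theorem hs_sub_one_pd_le {s : ℝ} {f : R3 → ℝ} (hs0 : 0 < s) (hf : Differentiable ℝ f) (hm : MemLp f 2 volume)
    {i : Fin 3} (hm' : MemLp (pd i f) 2 volume) : hs (s - 1) (pd i f) ≤ hs s f := by
  refine (wnorm_pd_le hf hm hm' _).trans (wnorm_mono (fun ξ => le_of_eq ?_) _)
  congr 1
  rcases (freq_nonneg ξ).eq_or_lt with h | h
  · rw [← h, mul_zero, Real.zero_rpow hs0.ne']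
  · rw [Real.rpow_sub_one h.ne', div_mul_cancel₀ _ h.ne']

/-! ### The weighted energy -/

/-- A constant in the energy estimate of order `s`, above the constants in the bounds of the differences of
the unknowns, of their products and of the commutators. -/
def enC (s : ℝ) : ℝ :=
  1 + (3 * dyC s (ord s)).toReal * (1 + (2 * (prodC s).toReal) ^ 2) + 10 * (commC s).toReal

theorem one_le_enC (s : ℝ) : 1 ≤ enC s := by
  unfold enC
  have h1 := (3 * dyC s (ord s)).toReal_nonneg
  have h2 := (commC s).toReal_nonneg
  nlinarith [sq_nonneg (2 * (prodC s).toReal)]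

theorem enC_le_sq (s : ℝ) : enC s ≤ enC s ^ 2 := by nlinarith [one_le_enC s]

theorem lt_ord {s : ℝ} (hs0 : 0 < s) : s < ord s := by linarith [two_mul_lt_ord s]

theorem sum_fwdDiff_le {s : ℝ} (hs0 : 0 < s) {f : R3 → ℝ} (hf : MemLp f 2 volume) {Z : ℝ} (hZ : 0 ≤ Z)
    (h : hs s f ≤ ofReal Z) (F : Finset (ℤ × Fin 3)) :
    ∑ p ∈ F, wtR s p * ‖cl ((fwdDiff (stp p))^[ord s] f)‖ ^ 2 ≤ (3 * dyC s (ord s)).toReal * Z ^ 2 := by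
  have hord : 0 < ord s := by unfold ord; omega
  have hfin : 3 * dyC s (ord s) ≠ ∞ := ENNReal.mul_ne_top (by simp) (dyC_lt_top hs0 (lt_ord hs0)).ne
  refine sum_wtR_le (G := fun p => (fwdDiff (stp p))^[ord s] f) (fun p => memLp_fwdDiff_iter hf _ _)
    (by positivity) ((wsum_diff_le hs0 hord hf).trans ?_) F
  rw [ofReal_mul toReal_nonneg, ofReal_toReal hfin, ofReal_pow hZ]
  gcongr

theorem sum_fwdDiff_le' {s : ℝ} (hs0 : 0 < s) {f : R3 → ℝ} (hf : MemLp f 2 volume) {Z : ℝ} (hZ : 0 ≤ Z)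
    (h : hs s f ≤ ofReal Z) (F : Finset (ℤ × Fin 3)) :
    ∑ p ∈ F, wtR s p * ‖cl ((fwdDiff (stp p))^[ord s] f)‖ ^ 2 ≤ (enC s * Z) ^ 2 := by
  refine (sum_fwdDiff_le hs0 hf hZ h F).trans ?_
  rw [mul_pow]
  refine mul_le_mul_of_nonneg_right (le_trans ?_ (enC_le_sq s)) (sq_nonneg Z)
  unfold enC
  have h1 := (3 * dyC s (ord s)).toReal_nonneg
  have h2 := (commC s).toReal_nonneg
  nlinarith [mul_nonneg h1 (sq_nonneg (2 * (prodC s).toReal))]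

theorem sum_comm_le {s : ℝ} (hs1 : 1 < s) {a f : R3 → ℝ} {A X : ℝ} (hA : 0 ≤ A) (hX : 0 ≤ X)
    (ha : ContDiff ℝ 1 a) (ham : MemLp a 2 volume) (haA : ∀ x, |a x| ≤ A) (hA' : ∀ i x, |pd i a x| ≤ A)
    (hax : hs s a ≤ ofReal X)
    (hf : ContDiff ℝ 1 f) (hfm : MemLp f 2 volume) {i : Fin 3} (hfm' : MemLp (pd i f) 2 volume)
    (hfA : ∀ x, |pd i f x| ≤ A) (hfx : hs s f ≤ ofReal X) (F : Finset (ℤ × Fin 3)) :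
    ∑ p ∈ F, wtR s p * ‖cl (comm (stp p) (ord s) a (pd i f))‖ ^ 2 ≤ (enC s * (A * X)) ^ 2 := by
  have h1 : wsum s (fun p => comm (stp p) (ord s) a (pd i f)) ≤
      ofReal ((commC s).toReal * (10 * (A * X) ^ 2)) := by
    refine (wsum_comm_le hs1 ham hfm' (abs_sub_le_of_abs_pd_le (ha.differentiable (by norm_num)) hA') hfA).trans ?_
    rw [ofReal_mul toReal_nonneg, ofReal_toReal (commC_lt_top hs1).ne]
    have e : ofReal (10 * (A * X) ^ 2) =
        ofReal (3 * A) ^ 2 * ofReal X ^ 2 + ofReal A ^ 2 * ofReal X ^ 2 := by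
      rw [← ofReal_pow (by positivity), ← ofReal_pow hX, ← ofReal_pow hA,
        ← ofReal_mul (by positivity), ← ofReal_mul (by positivity),
        ← ofReal_add (by positivity) (by positivity)]
      congr 1; ring
    rw [e]
    have h2 := (hs_sub_one_pd_le (by linarith) (hf.differentiable (by norm_num)) hfm hfm').trans hfx
    gcongr
  refine (sum_wtR_le (fun p => memLp_comm ha.continuous haA hfm' _ _) (by positivity) h1 F).trans ?_
  rw [← mul_assoc, mul_pow (enC s)]
  refine mul_le_mul_of_nonneg_right (le_trans ?_ (enC_le_sq s)) (sq_nonneg _)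
  unfold enC
  have h1 := (3 * dyC s (ord s)).toReal_nonneg
  nlinarith [mul_nonneg h1 (sq_nonneg (2 * (prodC s).toReal))]

/-- The Cauchy–Schwarz inequality for all terms in `Slice.abs_stepRate_le`. -/
theorem weighted_energy_bound {ι : Type*} {F : Finset ι} {w : ι → ℝ} (hw : ∀ p, 0 ≤ w p) {A Z : ℝ}
    (hA : 0 ≤ A) (hZ : 0 ≤ Z) {x r n : ι → ℝ} {b y q : Fin 3 → ι → ℝ} {u : Fin 3 → Fin 3 → ι → ℝ}
    (hx : ∑ p ∈ F, w p * x p ^ 2 ≤ Z ^ 2) (hr : ∑ p ∈ F, w p * r p ^ 2 ≤ Z ^ 2)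
    (hb : ∀ l, ∑ p ∈ F, w p * b l p ^ 2 ≤ Z ^ 2) (hn : ∑ p ∈ F, w p * n p ^ 2 ≤ (A * Z) ^ 2)
    (hy : ∀ l, ∑ p ∈ F, w p * y l p ^ 2 ≤ (A * Z) ^ 2) (hq : ∀ l, ∑ p ∈ F, w p * q l p ^ 2 ≤ (A * Z) ^ 2)
    (hu : ∀ l i, ∑ p ∈ F, w p * u l i p ^ 2 ≤ (A * Z) ^ 2) :
    ∑ p ∈ F, w p * (3 / 2 * A * (x p ^ 2 + ∑ l, b l p ^ 2) + ∑ i, x p * y i p +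
      ∑ l, (∑ i, b l p * u l i p + b l p * n p + r p * q l p)) ≤ 24 * (A * Z ^ 2) := by
  have hAZ : 0 ≤ A * Z := mul_nonneg hA hZ
  have e : ∑ p ∈ F, w p * (3 / 2 * A * (x p ^ 2 + ∑ l, b l p ^ 2) + ∑ i, x p * y i p +
      ∑ l, (∑ i, b l p * u l i p + b l p * n p + r p * q l p)) =
      3 / 2 * A * (∑ p ∈ F, w p * x p ^ 2 + ∑ l, ∑ p ∈ F, w p * b l p ^ 2) +
      ∑ i, ∑ p ∈ F, w p * (x p * y i p) + ∑ l, (∑ i, ∑ p ∈ F, w p * (b l p * u l i p) +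
        ∑ p ∈ F, w p * (b l p * n p) + ∑ p ∈ F, w p * (r p * q l p)) := by
    simp only [Fin.sum_univ_three, mul_add, sum_add_distrib, mul_sum]
    simp only [mul_left_comm (3 / 2 * A)]
  rw [e]
  have h1 := mul_le_mul_of_nonneg_left (add_le_add hx (sum_le_sum fun l (_ : l ∈ Finset.univ) => hb l))
    (show 0 ≤ 3 / 2 * A by positivity)
  have h2 := sum_le_sum fun i (_ : i ∈ Finset.univ) => sum_weight_mul_le hw hZ hAZ hx (hy i)
  have h3 := sum_le_sum fun l (_ : l ∈ Finset.univ) => add_le_add (add_le_add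
    (sum_le_sum fun i (_ : i ∈ Finset.univ) => sum_weight_mul_le hw hZ hAZ (hb l) (hu l i))
    (sum_weight_mul_le hw hZ hAZ (hb l) hn)) (sum_weight_mul_le hw hZ hAZ hr (hq l))
  refine (add_le_add (add_le_add h1 h2) h3).trans (le_of_eq ?_)
  simp only [Fin.sum_univ_three]
  ring

/-- The rate of change of the energy of order `s` is at most `A` times the square of the norm, uniformly in the set
of steps. -/
theorem Slice.abs_sum_stepRate_le {s A X : ℝ} {ρ φ : R3 → ℝ} {v : Fin 3 → R3 → ℝ} (hS : Slice s A X ρ φ v)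
    (F : Finset (ℤ × Fin 3)) :
    |∑ p ∈ F, wtR s p * stepRate (stp p) (ord s) ρ φ v| ≤ 24 * (A * (enC s * X) ^ 2) := by
  have hs0 : 0 < s := by linarith [hS.one_lt]
  have hA := hS.nonneg
  have hX := hS.nonneg'
  have hC := one_le_enC s
  have hw : ∀ p, 0 ≤ wtR s p := wtR_nonneg s
  have hflux : ∀ l, hs s (fun x => ρ x * v l x) ≤ ofReal (2 * (prodC s).toReal * (A * X)) := fun l => by
    refine (hs_mul_le hs0 hS.memLp_density (hS.memLp_velocity l) hS.abs_density (hS.abs_velocity l)).trans ?_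
    have h1 := add_le_add (mul_le_mul_right (hS.hs_velocity l) (ofReal A))
      (mul_le_mul_right hS.hs_density (ofReal A))
    refine (mul_le_mul_right h1 _).trans (le_of_eq ?_)
    rw [← two_mul, ← ofReal_mul hA, ← ofReal_toReal (prodC_lt_top hs0).ne]
    rw [show (2 : ℝ≥0∞) = ofReal 2 by simp, ← ofReal_mul (by norm_num),
      ← ofReal_mul toReal_nonneg, ENNReal.toReal_ofReal toReal_nonneg]
    congr 1; ring
  have hq : ∀ l, ∑ p ∈ F, wtR s p * ‖cl ((fwdDiff (stp p))^[ord s] fun x => ρ x * v l x)‖ ^ 2 ≤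
      (A * (enC s * X)) ^ 2 := fun l => by
    refine (sum_fwdDiff_le hs0 (hS.memLp_flux l) (by positivity) (hflux l) F).trans ?_
    have e1 : (3 * dyC s (ord s)).toReal * (2 * (prodC s).toReal * (A * X)) ^ 2 =
        (3 * dyC s (ord s)).toReal * (2 * (prodC s).toReal) ^ 2 * (A * X) ^ 2 := by ring
    have e2 : (A * (enC s * X)) ^ 2 = enC s ^ 2 * (A * X) ^ 2 := by ring
    rw [e1, e2]
    refine mul_le_mul_of_nonneg_right (le_trans ?_ (enC_le_sq s)) (sq_nonneg _)
    unfold enC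
    have h1 := (3 * dyC s (ord s)).toReal_nonneg
    have h2 := (commC s).toReal_nonneg
    linarith
  have e2 : enC s * (A * X) = A * (enC s * X) := by ring
  have hn := sum_fwdDiff_le' hs0 hS.memLp_rem (by positivity) hS.hs_rem F
  rw [e2] at hn
  refine (abs_sum_le_sum_abs _ _).trans ((sum_le_sum fun p _ => ?_).trans
    (weighted_energy_bound (F := F) hw hA (Z := enC s * X) (by positivity)
    (sum_fwdDiff_le' hs0 hS.memLp_log hX hS.hs_log F) (sum_fwdDiff_le' hs0 hS.memLp_density hX hS.hs_density F)
    (b := fun l p => ‖cl ((fwdDiff (stp p))^[ord s] (v l))‖)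
    (fun l => sum_fwdDiff_le' hs0 (hS.memLp_velocity l) hX (hS.hs_velocity l) F) hn
    (y := fun i p => ‖cl (comm (stp p) (ord s) (v i) (pd i (logDen ρ)))‖)
    (fun i => by
      have := sum_comm_le hS.one_lt hA hX (hS.contDiff_velocity i) (hS.memLp_velocity i) (hS.abs_velocity i)
        (hS.abs_pd_velocity i) (hS.hs_velocity i) hS.contDiff_log hS.memLp_log (hS.memLp_pd_log i)
        (hS.abs_pd_log i) hS.hs_log F
      rwa [e2] at this)
    hq (u := fun l i p => ‖cl (comm (stp p) (ord s) (v i) (pd i (v l)))‖)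
    (fun l i => by
      have := sum_comm_le hS.one_lt hA hX (hS.contDiff_velocity i) (hS.memLp_velocity i) (hS.abs_velocity i)
        (hS.abs_pd_velocity i) (hS.hs_velocity i) (hS.contDiff_velocity l) (hS.memLp_velocity l)
        (hS.memLp_pd_velocity l i) (hS.abs_pd_velocity l i) (hS.hs_velocity l) F
      rwa [e2] at this)))
  rw [abs_mul, abs_of_nonneg (hw p)]
  exact mul_le_mul_of_nonneg_left (hS.abs_stepRate_le _ _) (hw p)

/-- The energy of a finite family of differences. -/
def diffEnergy (s : ℝ) (F : Finset (ℤ × Fin 3)) (ρ : R3 → ℝ) (v : Fin 3 → R3 → ℝ) : ℝ :=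
  ∑ p ∈ F, wtR s p * stepEnergy (stp p) (ord s) ρ v

theorem norm_japInvM_le (f : L2) : ‖japInvM f‖ ≤ ‖f‖ := by
  refine (Lp.norm_le_mul_norm_of_ae_le_mul (c := 1) ?_).trans (le_of_eq (one_mul _))
  filter_upwards [coeFn_japInvM f] with ξ h
  rw [h, norm_mul, norm_real]
  exact mul_le_mul_of_nonneg_right (abs_jap_inv_le ξ) (norm_nonneg _)

theorem diffEnergy_le {s : ℝ} (hs0 : 0 < s) {ρ : R3 → ℝ} {v : Fin 3 → R3 → ℝ} (hρ : MemLp ρ 2 volume)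
    (hσ : MemLp (logDen ρ) 2 volume) (hv : ∀ l, MemLp (v l) 2 volume) {Y : ℝ} (hY : 0 ≤ Y)
    (h1 : hs s ρ ≤ ofReal Y) (h2 : hs s (logDen ρ) ≤ ofReal Y)
    (h3 : ∀ l, hs s (v l) ≤ ofReal Y) (F : Finset (ℤ × Fin 3)) :
    diffEnergy s F ρ v ≤ 5 / 2 * (enC s * Y) ^ 2 := by
  have k1 := sum_fwdDiff_le' hs0 hρ hY h1 F
  have k2 := sum_fwdDiff_le' hs0 hσ hY h2 F
  have k3 := fun l => sum_fwdDiff_le' hs0 (hv l) hY (h3 l) F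
  have hle : diffEnergy s F ρ v ≤ ∑ p ∈ F, wtR s p *
      (2⁻¹ * ‖cl ((fwdDiff (stp p))^[ord s] (logDen ρ))‖ ^ 2 +
        ∑ l, 2⁻¹ * ‖cl ((fwdDiff (stp p))^[ord s] (v l))‖ ^ 2 +
        2⁻¹ * ‖cl ((fwdDiff (stp p))^[ord s] ρ)‖ ^ 2) := by
    refine sum_le_sum fun p _ => mul_le_mul_of_nonneg_left ?_ (wtR_nonneg s p)
    unfold stepEnergy
    have := norm_japInvM_le (𝓕 (cl ((fwdDiff (stp p))^[ord s] ρ)))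
    rw [norm_fourier] at this
    gcongr
  refine hle.trans ?_
  simp only [Fin.sum_univ_three, mul_add, sum_add_distrib, mul_left_comm _ (2⁻¹ : ℝ), ← mul_sum]
  linarith [k3 0, k3 1, k3 2]

theorem sum_le_diffEnergy (s : ℝ) (F : Finset (ℤ × Fin 3)) (ρ : R3 → ℝ) (v : Fin 3 → R3 → ℝ) (l : Fin 3) :
    ∑ p ∈ F, wtR s p * ‖cl ((fwdDiff (stp p))^[ord s] (logDen ρ))‖ ^ 2 ≤ 2 * diffEnergy s F ρ v ∧
    ∑ p ∈ F, wtR s p * ‖cl ((fwdDiff (stp p))^[ord s] (v l))‖ ^ 2 ≤ 2 * diffEnergy s F ρ v := by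
  unfold diffEnergy stepEnergy
  simp only [mul_sum]
  constructor
  · refine sum_le_sum fun p _ => ?_
    rw [mul_left_comm]
    refine mul_le_mul_of_nonneg_left ?_ (wtR_nonneg s p)
    have : 0 ≤ ∑ l, 2⁻¹ * ‖cl ((fwdDiff (stp p))^[ord s] (v l))‖ ^ 2 :=
      sum_nonneg fun _ _ => by positivity
    nlinarith [sq_nonneg ‖japInvM (𝓕 (cl ((fwdDiff (stp p))^[ord s] ρ)))‖]
  · refine sum_le_sum fun p _ => ?_
    rw [mul_left_comm]
    refine mul_le_mul_of_nonneg_left ?_ (wtR_nonneg s p)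
    have := single_le_sum (f := fun l => 2⁻¹ * ‖cl ((fwdDiff (stp p))^[ord s] (v l))‖ ^ 2)
      (fun _ _ => by positivity) (mem_univ l)
    nlinarith [sq_nonneg ‖japInvM (𝓕 (cl ((fwdDiff (stp p))^[ord s] ρ)))‖,
      sq_nonneg ‖cl ((fwdDiff (stp p))^[ord s] (logDen ρ))‖]

theorem Flow.hasDerivWithinAt_diffEnergy {s b : ℝ} {J : Set ℝ} {ρ : ℝ → R3 → ℝ} {v : Fin 3 → ℝ → R3 → ℝ}
    {φ : ℝ → R3 → ℝ} (h : Flow s b J ρ v φ) (r : ℝ) (F : Finset (ℤ × Fin 3)) {t : ℝ} (ht : t ∈ J) :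
    HasDerivWithinAt (fun t => diffEnergy r F (ρ t) fun l => v l t)
      (∑ p ∈ F, wtR r p * stepRate (stp p) (ord r) (ρ t) (φ t) fun l => v l t) J t := by
  have hJ := h.ordConnected
  refine HasDerivWithinAt.fun_sum fun p _ => HasDerivWithinAt.const_mul _ ?_
  unfold stepEnergy stepRate
  refine (HasDerivWithinAt.add ?_ (HasDerivWithinAt.fun_sum fun l _ => ?_)).add ?_
  · exact hasDerivWithinAt_half_norm_sq ((h.diff_log.fwdDiff_iter (stp p) (ord r)).hasDerivWithinAt hJ ht)
  · exact hasDerivWithinAt_half_norm_sq (((h.diff_velocity l).fwdDiff_iter (stp p) (ord r)).hasDerivWithinAt hJ ht)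
  · exact hasDerivWithinAt_half_norm_sq (japInvM.hasFDerivAt.comp_hasDerivWithinAt t
      ((h.diff_density.fwdDiff_iter (stp p) (ord r)).hasDerivWithinAt_fourier hJ ht))

/-- The decay rate `(1 + t)^{-16/15}` is integrable in time. -/
theorem growth_le {J : Set ℝ} (hJ : J.OrdConnected) (h0 : (0 : ℝ) ∈ J) {E E' : ℝ → ℝ} {C : ℝ} (hC : 0 ≤ C)
    (hE : ∀ t ∈ J, HasDerivWithinAt E (E' t) J t)
    (hb : ∀ t ∈ J, |E' t| ≤ C * (1 + t) ^ (-(16 / 15) : ℝ)) {t : ℝ} (ht : t ∈ J) (ht0 : 0 ≤ t) :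
    E t ≤ E 0 + 15 * C := by
  have hsub : Set.Icc 0 t ⊆ J := hJ.out h0 ht
  have hd : ∀ r ∈ Set.Icc 0 t, HasDerivWithinAt (fun r => E r + 15 * C * (1 + r) ^ (-(1 / 15) : ℝ))
      (E' r + 15 * C * (1 * (-(1 / 15)) * (1 + r) ^ (-(1 / 15) - 1 : ℝ))) (Set.Icc 0 t) r := fun r hr => by
    have h1 : HasDerivAt (fun r : ℝ => (1 + r) ^ (-(1 / 15) : ℝ))
        (1 * (-(1 / 15)) * (1 + r) ^ (-(1 / 15) - 1 : ℝ)) r :=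
      ((hasDerivAt_id r).const_add 1).rpow_const (Or.inl (by have := hr.1; simp only [id]; linarith))
    exact ((hE r (hsub hr)).mono hsub).add (h1.const_mul _).hasDerivWithinAt
  have hanti := antitoneOn_of_hasDerivWithinAt_nonpos (convex_Icc (0 : ℝ) t)
    (fun r hr => (hd r hr).continuousWithinAt)
    (fun r hr => (hd r (interior_subset hr)).mono interior_subset) fun r hr => by
      have h2 := hb r (hsub (interior_subset hr))
      have h3 := le_abs_self (E' r)
      rw [show (-(1 / 15) - 1 : ℝ) = -(16 / 15) by norm_num]
      nlinarith
  have h4 := hanti ⟨le_rfl, ht0⟩ ⟨ht0, le_rfl⟩ ht0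
  simp only [add_zero, Real.one_rpow, mul_one] at h4
  have h5 : 0 ≤ 15 * C * (1 + t) ^ (-(1 / 15) : ℝ) := by positivity
  linarith

/-! ### The energy in the homogeneous space `H⁻¹` -/

/-- The symbol of `|∇|⁻¹`, cut off to frequencies at least `δ`. -/
def lowP (δ : ℝ) (ξ : R3) : ℝ := if δ ≤ freq ξ then (freq ξ)⁻¹ else 0

theorem measurable_lowP (δ : ℝ) : Measurable (lowP δ) :=
  Measurable.ite (measurableSet_le measurable_const continuous_freq.measurable)
    continuous_freq.measurable.inv measurable_const

theorem lowP_nonneg (δ : ℝ) (ξ : R3) : 0 ≤ lowP δ ξ := by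
  unfold lowP; split_ifs
  · exact inv_nonneg.2 (freq_nonneg ξ)
  · exact le_rfl

theorem lowP_le (δ : ℝ) (ξ : R3) : lowP δ ξ ≤ (freq ξ)⁻¹ := by
  unfold lowP; split_ifs
  · exact le_rfl
  · exact inv_nonneg.2 (freq_nonneg ξ)

theorem lowP_mul_freq_le (δ : ℝ) (ξ : R3) : lowP δ ξ * freq ξ ≤ 1 :=
  (mul_le_mul_of_nonneg_right (lowP_le δ ξ) (freq_nonneg ξ)).trans inv_mul_le_one

theorem abs_lowP_le {δ : ℝ} (hδ : 0 < δ) (ξ : R3) : |lowP δ ξ| ≤ δ⁻¹ := by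
  rw [abs_of_nonneg (lowP_nonneg δ ξ)]
  unfold lowP; split_ifs with h
  · exact inv_anti₀ hδ h
  · exact (inv_pos.2 hδ).le

theorem abs_lowP_mul_q_le {δ : ℝ} (hδ : 0 < δ) (ξ : R3) : |lowP δ ξ * q (freq ξ)| ≤ δ⁻¹ * 2 := by
  rw [abs_mul]
  refine mul_le_mul (abs_lowP_le hδ ξ) ?_ (abs_nonneg _) (inv_pos.2 hδ).le
  rw [abs_of_nonneg (zero_le_one.trans (one_le_q _))]
  exact q_le_two _

/-- The truncation of `|∇|⁻¹` on the Fourier side. -/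
def lowM {δ : ℝ} (hδ : 0 < δ) : L2 →L[ℝ] L2 := mulR (lowP δ) (measurable_lowP δ) (abs_lowP_le hδ)

/-- The truncation of `q(|∇|)|∇|⁻¹` on the Fourier side. -/
def lowQM {δ : ℝ} (hδ : 0 < δ) : L2 →L[ℝ] L2 :=
  mulR (fun ξ => lowP δ ξ * q (freq ξ)) ((measurable_lowP δ).mul measurable_q_freq) (abs_lowP_mul_q_le hδ)

theorem coeFn_lowM {δ : ℝ} (hδ : 0 < δ) (f : L2) :
    (lowM hδ f : R3 → ℂ) =ᵐ[volume] fun ξ => ((lowP δ ξ : ℝ) : ℂ) * f ξ := coeFn_mulR _ _ f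

theorem coeFn_lowQM {δ : ℝ} (hδ : 0 < δ) (f : L2) :
    (lowQM hδ f : R3 → ℂ) =ᵐ[volume] fun ξ => ((lowP δ ξ * q (freq ξ) : ℝ) : ℂ) * f ξ := coeFn_mulR _ _ f

theorem wnorm_eq_ofReal_norm_mulR {m : R3 → ℝ} (hm : Measurable m) {C : ℝ} (hC : ∀ ξ, |m ξ| ≤ C) (f : L2) :
    wnorm m f = ofReal ‖mulR m hm hC (𝓕 f)‖ := by
  rw [Lp.norm_def, ofReal_toReal (Lp.eLpNorm_ne_top _), wnorm]
  exact (eLpNorm_congr_ae (coeFn_mulR hm hC _)).symm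

theorem norm_lowM_le {δ : ℝ} (hδ : 0 < δ) {f : L2} {X : ℝ} (hX : 0 ≤ X)
    (h : wnorm (fun ξ => (freq ξ)⁻¹) f ≤ ofReal X) : ‖lowM hδ (𝓕 f)‖ ≤ X := by
  rw [← ofReal_le_ofReal_iff hX, lowM, ← wnorm_eq_ofReal_norm_mulR]
  refine (wnorm_mono (fun ξ => ?_) f).trans h
  rw [abs_of_nonneg (lowP_nonneg δ ξ), abs_of_nonneg (inv_nonneg.2 (freq_nonneg ξ))]
  exact lowP_le δ ξ

theorem norm_lowM_le_lowQM {δ : ℝ} (hδ : 0 < δ) (f : L2) : ‖lowM hδ f‖ ≤ ‖lowQM hδ f‖ := by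
  refine (Lp.norm_le_mul_norm_of_ae_le_mul (c := 1) ?_).trans (le_of_eq (one_mul _))
  filter_upwards [coeFn_lowM hδ f, coeFn_lowQM hδ f] with ξ h1 h2
  rw [h1, one_mul, h2, norm_mul, norm_mul, norm_real, norm_real, norm_mul]
  refine mul_le_mul_of_nonneg_right (le_mul_of_one_le_right (norm_nonneg _) ?_) (norm_nonneg _)
  exact (one_le_q _).trans (le_abs_self _)

theorem norm_lowQM_le {δ : ℝ} (hδ : 0 < δ) (f : L2) : ‖lowQM hδ f‖ ≤ 2 * ‖lowM hδ f‖ := by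
  refine Lp.norm_le_mul_norm_of_ae_le_mul ?_
  filter_upwards [coeFn_lowM hδ f, coeFn_lowQM hδ f] with ξ h1 h2
  rw [h1, h2, norm_mul, norm_mul, norm_real, norm_real, norm_mul]
  have h3 : ‖q (freq ξ)‖ ≤ 2 := by
    rw [norm_of_nonneg (zero_le_one.trans (one_le_q _))]; exact q_le_two _
  calc ‖lowP δ ξ‖ * ‖q (freq ξ)‖ * ‖f ξ‖ ≤ ‖lowP δ ξ‖ * 2 * ‖f ξ‖ := by gcongr
    _ = _ := by ring

theorem lowP_mul_norm_dsym_le (δ : ℝ) (l : Fin 3) (ξ : R3) : lowP δ ξ * ‖dsym l ξ‖ ≤ 1 :=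
  (mul_le_mul_of_nonneg_left (norm_dsym_le l ξ) (lowP_nonneg δ ξ)).trans (lowP_mul_freq_le δ ξ)

theorem norm_lowQM_pd_le {δ : ℝ} (hδ : 0 < δ) {Q : R3 → ℝ} (hQ : Differentiable ℝ Q) (hQm : MemLp Q 2 volume)
    {l : Fin 3} (hQm' : MemLp (pd l Q) 2 volume) : ‖lowQM hδ (𝓕 (cl (pd l Q)))‖ ≤ 2 * ‖cl Q‖ := by
  rw [← norm_fourier (cl Q)]
  refine Lp.norm_le_mul_norm_of_ae_le_mul ?_
  filter_upwards [coeFn_lowQM hδ (𝓕 (cl (pd l Q))), fourier_pd hQ hQm hQm'] with ξ h1 h2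
  rw [h1, h2, norm_mul, norm_real, norm_mul, norm_mul, norm_of_nonneg (lowP_nonneg δ ξ),
    norm_of_nonneg (zero_le_one.trans (one_le_q _))]
  have h3 := q_le_two (freq ξ)
  have h4 := lowP_mul_norm_dsym_le δ l ξ
  have h5 := zero_le_one.trans (one_le_q (freq ξ))
  calc lowP δ ξ * q (freq ξ) * (‖dsym l ξ‖ * ‖(𝓕 (cl Q) : L2) ξ‖) =
      lowP δ ξ * ‖dsym l ξ‖ * (q (freq ξ) * ‖(𝓕 (cl Q) : L2) ξ‖) := by ring
    _ ≤ 1 * (2 * ‖(𝓕 (cl Q) : L2) ξ‖) := by gcongr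
    _ = _ := one_mul _

/-- The linear terms of the system cancel in the energy of order `-1`. -/
theorem abs_inner_low_le {δ : ℝ} (hδ : 0 < δ) {R W H : R3 → ℝ} {G : L2} (hW : Differentiable ℝ W)
    (hWm : MemLp W 2 volume) (l : Fin 3) (hWm' : MemLp (pd l W) 2 volume) (hH : Differentiable ℝ H)
    (hHm : MemLp H 2 volume) (hHm' : MemLp (pd l H) 2 volume)
    (he : ∀ᵐ ξ : R3, (𝓕 (cl H) : L2) ξ =
      ((q (freq ξ) ^ 2 : ℝ) : ℂ) * (𝓕 (cl R) : L2) ξ + G ξ) :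
    |inner ℝ (lowQM hδ (𝓕 (cl R))) (lowQM hδ (𝓕 (cl (pd l W)))) +
      inner ℝ (lowM hδ (𝓕 (cl W))) (lowM hδ (𝓕 (cl (pd l H))))| ≤ ‖lowM hδ (𝓕 (cl W))‖ * ‖G‖ := by
  rw [inner_eq_integral, inner_eq_integral,
    ← integral_add (integrable_inner_re _ _) (integrable_inner_re _ _)]
  refine abs_integral_le_norm_mul_norm ?_
  filter_upwards [he, fourier_pd hW hWm hWm', fourier_pd hH hHm hHm',
    coeFn_lowQM hδ (𝓕 (cl R)), coeFn_lowQM hδ (𝓕 (cl (pd l W))), coeFn_lowM hδ (𝓕 (cl W)),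
    coeFn_lowM hδ (𝓕 (cl (pd l H)))] with ξ h1 h2 h3 h4 h5 h6 h7
  rw [h4, h5, h6, h7, h3, h2, h1]
  have hd : conj (dsym l ξ) = -dsym l ξ := by
    unfold dsym
    simp only [map_mul, conj_ofReal, Complex.conj_I, map_ofNat]
    ring
  set w := (𝓕 (cl W) : L2) ξ
  set r := (𝓕 (cl R) : L2) ξ
  set P := lowP δ ξ with hP
  set Q := q (freq ξ)
  have h8 : (conj (((P * Q : ℝ) : ℂ) * r) * (((P * Q : ℝ) : ℂ) * (dsym l ξ * w))).re +
      (conj ((P : ℂ) * w) * ((P : ℂ) * (dsym l ξ * (((Q ^ 2 : ℝ) : ℂ) * r + G ξ)))).re =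
      (conj ((P : ℂ) * w) * ((P : ℂ) * (dsym l ξ * G ξ))).re := by
    rw [← Complex.conj_re (conj (((P * Q : ℝ) : ℂ) * r) * (((P * Q : ℝ) : ℂ) * (dsym l ξ * w))),
      ← Complex.add_re]
    congr 1
    simp only [map_mul, Complex.conj_conj, conj_ofReal, hd]
    push_cast
    ring
  rw [h8]
  refine (Complex.abs_re_le_norm _).trans ?_
  rw [norm_mul, RCLike.norm_conj]
  refine mul_le_mul_of_nonneg_left ?_ (norm_nonneg _)
  rw [norm_mul, norm_mul, ← mul_assoc, norm_real, norm_of_nonneg (lowP_nonneg δ ξ)]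
  exact mul_le_of_le_one_left (norm_nonneg _) (lowP_mul_norm_dsym_le δ l ξ)

/-- What the energy estimate of order `-1` uses in addition: the low frequencies and the quadratic
remainders in `L²`, and that the velocity is irrotational. -/
structure LowSlice (s A X : ℝ) (ρ φ : R3 → ℝ) (v : Fin 3 → R3 → ℝ) : Prop extends Slice s A X ρ φ v where
  norm_velocity : ∀ l, ‖cl (v l)‖ ≤ X
  norm_rem : ‖cl fun x => expRem (φ x)‖ ≤ A * X
  norm_logRem : ‖cl fun x => logDen ρ x - ρ x‖ ≤ A * X
  low_density : wnorm (fun ξ => (freq ξ)⁻¹) (cl ρ) ≤ ofReal X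
  low_velocity : ∀ l, wnorm (fun ξ => (freq ξ)⁻¹) (cl (v l)) ≤ ofReal X
  pd_symm : ∀ i l, pd i (v l) =ᵐ[volume] pd l (v i)

/-- The energy of order `-1`, for frequencies at least `δ`. -/
def lowEnergy {δ : ℝ} (hδ : 0 < δ) (ρ : R3 → ℝ) (v : Fin 3 → R3 → ℝ) : ℝ :=
  2⁻¹ * ‖lowQM hδ (𝓕 (cl ρ))‖ ^ 2 + ∑ l, 2⁻¹ * ‖lowM hδ (𝓕 (cl (v l)))‖ ^ 2

/-- The time derivative of `lowEnergy`. -/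
def lowRate {δ : ℝ} (hδ : 0 < δ) (ρ φ : R3 → ℝ) (v : Fin 3 → R3 → ℝ) : ℝ :=
  inner ℝ (lowQM hδ (𝓕 (cl ρ))) (lowQM hδ (𝓕 (cl (rateDensity ρ v)))) +
    ∑ l, inner ℝ (lowM hδ (𝓕 (cl (v l)))) (lowM hδ (𝓕 (cl (rateVelocity ρ φ v l))))

theorem norm_cl_mul_le {f g : R3 → ℝ} {B : ℝ} (hf : AEStronglyMeasurable f volume) (hg : MemLp g 2 volume)
    (hB : ∀ x, |f x| ≤ B) : ‖cl fun x => f x * g x‖ ≤ B * ‖cl g‖ := by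
  refine Lp.norm_le_mul_norm_of_ae_le_mul ?_
  filter_upwards [coeFn_cl (memLp_mul hf hg hB), coeFn_cl hg] with x h1 h2
  rw [h1, h2, norm_real, norm_real, norm_mul]
  exact mul_le_mul_of_nonneg_right (hB x) (norm_nonneg _)

/-- The kinetic energy density `|v|²/2`. -/
def kin (v : Fin 3 → R3 → ℝ) (x : R3) : ℝ := ∑ i, 2⁻¹ * (v i x * v i x)

namespace LowSlice

variable {s A X : ℝ} {ρ φ : R3 → ℝ} {v : Fin 3 → R3 → ℝ}

theorem memLp_sq (hS : LowSlice s A X ρ φ v) (i : Fin 3) : MemLp (fun x => v i x * v i x) 2 volume :=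
  memLp_mul (hS.contDiff_velocity i).continuous.aestronglyMeasurable (hS.memLp_velocity i) (hS.abs_velocity i)

theorem contDiff_kin (hS : LowSlice s A X ρ φ v) : ContDiff ℝ 1 (kin v) :=
  ContDiff.sum fun i _ => contDiff_const.mul ((hS.contDiff_velocity i).mul (hS.contDiff_velocity i))

theorem memLp_kin (hS : LowSlice s A X ρ φ v) : MemLp (kin v) 2 volume :=
  memLp_finsetSum _ fun i _ => (hS.memLp_sq i).const_mul 2⁻¹

theorem pd_kin (hS : LowSlice s A X ρ φ v) (l : Fin 3) (x : R3) :
    pd l (kin v) x = ∑ i, v i x * pd l (v i) x := by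
  have hd : ∀ i, Differentiable ℝ (v i) := fun i => (hS.contDiff_velocity i).differentiable (by norm_num)
  have h2 : ∀ i, DifferentiableAt ℝ (fun x => 2⁻¹ * (v i x * v i x)) x := fun i =>
    (((hd i).mul (hd i)).const_mul 2⁻¹) x
  have h1 : kin v = fun x => 2⁻¹ * (v 0 x * v 0 x) + 2⁻¹ * (v 1 x * v 1 x) + 2⁻¹ * (v 2 x * v 2 x) := by
    ext x; rw [kin, Fin.sum_univ_three]
  have h3 : ∀ i, pd l (fun x => 2⁻¹ * (v i x * v i x)) x = v i x * pd l (v i) x := fun i => by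
    rw [pd_mul (f := fun _ => 2⁻¹) (g := fun x => v i x * v i x) (differentiableAt_const _)
      (((hd i).mul (hd i)) x), pd_mul (hd i x) (hd i x)]
    have : pd l (fun _ : R3 => (2⁻¹ : ℝ)) x = 0 := by simp [pd]
    rw [this]; ring
  rw [h1, pd_add (f := fun x => 2⁻¹ * (v 0 x * v 0 x) + 2⁻¹ * (v 1 x * v 1 x)) ((h2 0).add (h2 1)) (h2 2),
    pd_add (h2 0) (h2 1), h3, h3, h3, Fin.sum_univ_three]

theorem memLp_pd_kin (hS : LowSlice s A X ρ φ v) (l : Fin 3) : MemLp (pd l (kin v)) 2 volume := by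
  rw [show pd l (kin v) = fun x => ∑ i, v i x * pd l (v i) x from funext fun x => hS.pd_kin l x]
  exact memLp_finsetSum _ fun i _ => memLp_mul (hS.contDiff_velocity i).continuous.aestronglyMeasurable
    (hS.memLp_pd_velocity i l) (hS.abs_velocity i)

theorem norm_kin_le (hS : LowSlice s A X ρ φ v) : ‖cl (kin v)‖ ≤ 3 / 2 * (A * X) := by
  have h1 : cl (kin v) = ∑ i, cl (fun x => 2⁻¹ * (v i x * v i x)) :=
    cl_sum fun i => (hS.memLp_sq i).const_mul 2⁻¹
  rw [h1]
  refine (norm_sum_le _ _).trans ((sum_le_sum (g := fun _ => 2⁻¹ * (A * X)) fun i _ => ?_).trans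
    (le_of_eq (by simp; ring)))
  rw [cl_smul 2⁻¹ (hS.memLp_sq i), norm_smul, norm_real, norm_of_nonneg (by norm_num)]
  refine mul_le_mul_of_nonneg_left ?_ (by norm_num)
  refine (norm_cl_mul_le (hS.contDiff_velocity i).continuous.aestronglyMeasurable (hS.memLp_velocity i)
    (hS.abs_velocity i)).trans ?_
  exact mul_le_mul_of_nonneg_left (hS.norm_velocity i) hS.nonneg

/-- `∇(|v|²/2 + σ + φ)` is the whole of `-∂ₜv`. Its linear part
`ρ + (1 - Δ)^{-1} ρ = q(|∇|)² ρ` cancels against the density equation, and the rest is quadratic. -/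
theorem abs_lowRate_le (hS : LowSlice s A X ρ φ v) {δ : ℝ} (hδ : 0 < δ) :
    |lowRate hδ ρ φ v| ≤ 24 * (A * X ^ 2) := by
  have hA := hS.nonneg
  have hX := hS.nonneg'
  set H : R3 → ℝ := fun x => kin v x + logDen ρ x + φ x with hH
  have hHc : ContDiff ℝ 1 H := (hS.contDiff_kin.add hS.contDiff_log).add hS.contDiff_potential
  have m1 : MemLp (fun x => kin v x + logDen ρ x) 2 volume := hS.memLp_kin.add hS.memLp_log
  have hHm : MemLp H 2 volume := m1.add hS.memLp_potential
  have dk := hS.contDiff_kin.differentiable (by norm_num)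
  have dl := hS.contDiff_log.differentiable (by norm_num)
  have dp := hS.contDiff_potential.differentiable (by norm_num)
  have hpd : ∀ l, pd l H = fun x => pd l (kin v) x + pd l (logDen ρ) x + pd l φ x := fun l => by
    ext x
    rw [hH, pd_add (f := fun x => kin v x + logDen ρ x) ((dk.add dl) x) (dp x), pd_add (dk x) (dl x)]
  have hHm' : ∀ l, MemLp (pd l H) 2 volume := fun l => by
    rw [hpd]; exact ((hS.memLp_pd_kin l).add (hS.memLp_pd_log l)).add (hS.memLp_pd_potential l)
  have hrate : ∀ l, cl (rateVelocity ρ φ v l) = -cl (pd l H) := fun l => by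
    rw [← cl_neg (hHm' l)]
    refine cl_congr ?_
    filter_upwards [ae_all_iff.2 fun i => hS.pd_symm i l] with x hx
    rw [hpd]
    show rateVelocity ρ φ v l x = -(pd l (kin v) x + pd l (logDen ρ) x + pd l φ x)
    rw [rateVelocity, hS.pd_kin, sum_congr rfl fun i _ => by rw [hx i]]
  set G : L2 := 𝓕 (cl (kin v)) + 𝓕 (cl fun x => logDen ρ x - ρ x) -
    japInvM (japInvM (𝓕 (cl fun x => expRem (φ x)))) with hG
  have hGn : ‖G‖ ≤ 7 / 2 * (A * X) := by
    refine (norm_sub_le _ _).trans ?_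
    have h1 := norm_add_le (𝓕 (cl (kin v)) : L2) (𝓕 (cl fun x => logDen ρ x - ρ x))
    have h2 := (norm_japInvM_le (japInvM (𝓕 (cl fun x => expRem (φ x))))).trans (norm_japInvM_le _)
    rw [norm_fourier] at h2
    rw [norm_fourier, norm_fourier] at h1
    linarith [hS.norm_kin_le, hS.norm_rem, hS.norm_logRem]
  have he : ∀ᵐ ξ : R3, (𝓕 (cl H) : L2) ξ =
      ((q (freq ξ) ^ 2 : ℝ) : ℂ) * (𝓕 (cl ρ) : L2) ξ + G ξ := by
    have hHf : (𝓕 (cl H) : L2) = 𝓕 (cl (kin v)) + 𝓕 (cl (logDen ρ)) + 𝓕 (cl φ) := by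
      rw [hH, cl_add m1 hS.memLp_potential, cl_add hS.memLp_kin hS.memLp_log, fourier_add, fourier_add]
    have hσ : (𝓕 (cl fun x => logDen ρ x - ρ x) : L2) = 𝓕 (cl (logDen ρ)) - 𝓕 (cl ρ) := by
      rw [cl_sub hS.memLp_log hS.memLp_density, fourier_sub]
    have hp := hS.fourier
    rw [cl_sub hS.memLp_density hS.memLp_rem, fourier_sub] at hp
    rw [hHf, hG, hσ]
    filter_upwards [hp, Lp.coeFn_sub (𝓕 (cl ρ) : L2) (𝓕 (cl fun x => expRem (φ x))),
      Lp.coeFn_add (𝓕 (cl (kin v)) + 𝓕 (cl (logDen ρ)) : L2) (𝓕 (cl φ)),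
      Lp.coeFn_add (𝓕 (cl (kin v)) : L2) (𝓕 (cl (logDen ρ))),
      Lp.coeFn_sub (𝓕 (cl (kin v)) + (𝓕 (cl (logDen ρ)) - 𝓕 (cl ρ)) : L2)
        (japInvM (japInvM (𝓕 (cl fun x => expRem (φ x))))),
      Lp.coeFn_add (𝓕 (cl (kin v)) : L2) (𝓕 (cl (logDen ρ)) - 𝓕 (cl ρ)),
      Lp.coeFn_sub (𝓕 (cl (logDen ρ)) : L2) (𝓕 (cl ρ)),
      coeFn_japInvM (japInvM (𝓕 (cl fun x => expRem (φ x)))),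
      coeFn_japInvM (𝓕 (cl fun x => expRem (φ x)))] with ξ h1 h2 h3 h4 h5 h6 h7 h8 h9
    rw [h2, Pi.sub_apply] at h1
    rw [h3, Pi.add_apply, h4, Pi.add_apply, h5, Pi.sub_apply, h6, Pi.add_apply, h7, Pi.sub_apply, h8, h9]
    have hj : ((jap ξ : ℝ) : ℂ) ≠ 0 := by exact_mod_cast (jap_pos ξ).ne'
    have hq : q (freq ξ) ^ 2 = 1 + (jap ξ)⁻¹ * (jap ξ)⁻¹ := by
      have h0 := jap_sq ξ
      have h0' := (jap_pos ξ).ne'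
      rw [q_sq, ← h0, show 2 + freq ξ ^ 2 = 1 + jap ξ ^ 2 by rw [h0]; ring]
      field_simp
      ring
    have h10 : (𝓕 (cl φ) : L2) ξ = (((jap ξ)⁻¹ : ℝ) : ℂ) * (((jap ξ)⁻¹ : ℝ) : ℂ) *
        ((𝓕 (cl ρ) : L2) ξ - (𝓕 (cl fun x => expRem (φ x)) : L2) ξ) := by
      rw [← h1]; push_cast; field_simp
    rw [hq, h10]
    push_cast
    ring
  have hQc : ∀ l, Differentiable ℝ fun x => ρ x * v l x := fun l =>
    (hS.contDiff_density.mul (hS.contDiff_velocity l)).differentiable (by norm_num)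
  have hdens : (𝓕 (cl (rateDensity ρ v)) : L2) = -(∑ l, (𝓕 (cl (pd l (v l))) : L2) +
      ∑ l, (𝓕 (cl (pd l fun x => ρ x * v l x)) : L2)) := by
    have n3 : MemLp (fun x => ∑ i, pd i (v i) x) 2 volume := memLp_finsetSum _ fun i _ => hS.memLp_pd_velocity i i
    have n4 : MemLp (fun x => ∑ i, pd i (fun y => ρ y * v i y) x) 2 volume :=
      memLp_finsetSum _ fun i _ => hS.memLp_pd_flux i i
    have hsum : ∀ f : Fin 3 → L2, (𝓕 (∑ i, f i) : L2) = ∑ i, (𝓕 (f i) : L2) := fun f =>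
      map_sum (fourierCLM ℂ L2) _ _
    have e : rateDensity ρ v = fun x => -(∑ i, pd i (v i) x + ∑ i, pd i (fun y => ρ y * v i y) x) := rfl
    rw [e, cl_neg (f := fun x => ∑ i, pd i (v i) x + ∑ i, pd i (fun y => ρ y * v i y) x) (n3.add n4),
      cl_add n3 n4, cl_sum fun i => hS.memLp_pd_velocity i i, cl_sum fun i => hS.memLp_pd_flux i i,
      fourier_neg, fourier_add, hsum, hsum]
  have key : lowRate hδ ρ φ v = -∑ l, ((inner ℝ (lowQM hδ (𝓕 (cl ρ))) (lowQM hδ (𝓕 (cl (pd l (v l))))) +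
      inner ℝ (lowM hδ (𝓕 (cl (v l)))) (lowM hδ (𝓕 (cl (pd l H))))) +
      inner ℝ (lowQM hδ (𝓕 (cl ρ))) (lowQM hδ (𝓕 (cl (pd l fun x => ρ x * v l x))))) := by
    unfold lowRate
    rw [hdens]
    simp only [hrate, fourier_neg, map_neg, map_add, map_sum, inner_neg_right, inner_add_right, inner_sum,
      sum_add_distrib, sum_neg_distrib]
    ring
  rw [key, abs_neg]
  have hl : ∀ l, |(inner ℝ (lowQM hδ (𝓕 (cl ρ))) (lowQM hδ (𝓕 (cl (pd l (v l))))) +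
      inner ℝ (lowM hδ (𝓕 (cl (v l)))) (lowM hδ (𝓕 (cl (pd l H))))) +
      inner ℝ (lowQM hδ (𝓕 (cl ρ))) (lowQM hδ (𝓕 (cl (pd l fun x => ρ x * v l x))))| ≤ 8 * (A * X ^ 2) := by
    intro l
    have h1 := abs_inner_low_le hδ (R := ρ) (G := G) ((hS.contDiff_velocity l).differentiable (by norm_num))
      (hS.memLp_velocity l) l (hS.memLp_pd_velocity l l) (hHc.differentiable (by norm_num)) hHm (hHm' l) he
    have h2 := norm_lowM_le hδ hX (hS.low_velocity l)
    have h3 := norm_lowM_le hδ hX hS.low_density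
    have h4 : ‖lowM hδ (𝓕 (cl (v l)))‖ * ‖G‖ ≤ X * (7 / 2 * (A * X)) :=
      mul_le_mul h2 hGn (norm_nonneg _) hX
    have h5 := abs_real_inner_le_norm (lowQM hδ (𝓕 (cl ρ))) (lowQM hδ (𝓕 (cl (pd l fun x => ρ x * v l x))))
    have h6 : ‖lowQM hδ (𝓕 (cl (pd l fun x => ρ x * v l x)))‖ ≤ 2 * (A * X) := by
      refine (norm_lowQM_pd_le hδ (hQc l) (hS.memLp_flux l) (hS.memLp_pd_flux l l)).trans ?_
      refine mul_le_mul_of_nonneg_left ?_ (by norm_num)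
      exact (norm_cl_mul_le hS.contDiff_density.continuous.aestronglyMeasurable (hS.memLp_velocity l)
        hS.abs_density).trans (mul_le_mul_of_nonneg_left (hS.norm_velocity l) hA)
    have h7 : ‖lowQM hδ (𝓕 (cl ρ))‖ ≤ 2 * X := (norm_lowQM_le hδ _).trans (by linarith)
    have h8 := mul_le_mul h7 h6 (norm_nonneg _) (by positivity)
    have h9 : 0 ≤ A * X ^ 2 := by positivity
    refine (abs_add_le _ _).trans ?_
    nlinarith
  refine (abs_sum_le_sum_abs _ _).trans ((sum_le_sum fun l _ => hl l).trans (le_of_eq ?_))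
  simp only [Finset.sum_const, Finset.card_univ, Fintype.card_fin, nsmul_eq_mul]
  push_cast; ring

end LowSlice

theorem Flow.hasDerivWithinAt_lowEnergy {s b : ℝ} {J : Set ℝ} {ρ : ℝ → R3 → ℝ} {v : Fin 3 → ℝ → R3 → ℝ}
    {φ : ℝ → R3 → ℝ} (h : Flow s b J ρ v φ) {δ : ℝ} (hδ : 0 < δ) {t : ℝ} (ht : t ∈ J) :
    HasDerivWithinAt (fun t => lowEnergy hδ (ρ t) fun l => v l t)
      (lowRate hδ (ρ t) (φ t) fun l => v l t) J t := by
  have hJ := h.ordConnected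
  unfold lowEnergy lowRate
  refine HasDerivWithinAt.add ?_ (HasDerivWithinAt.fun_sum fun l _ => ?_)
  · exact hasDerivWithinAt_half_norm_sq ((lowQM hδ).hasFDerivAt.comp_hasDerivWithinAt t
      (h.diff_density.hasDerivWithinAt_fourier hJ ht))
  · exact hasDerivWithinAt_half_norm_sq ((lowM hδ).hasFDerivAt.comp_hasDerivWithinAt t
      ((h.diff_velocity l).hasDerivWithinAt_fourier hJ ht))

theorem lowEnergy_le {δ : ℝ} (hδ : 0 < δ) {ρ : R3 → ℝ} {v : Fin 3 → R3 → ℝ} {Y : ℝ} (hY : 0 ≤ Y)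
    (h1 : wnorm (fun ξ => (freq ξ)⁻¹) (cl ρ) ≤ ofReal Y)
    (h2 : ∀ l, wnorm (fun ξ => (freq ξ)⁻¹) (cl (v l)) ≤ ofReal Y) :
    lowEnergy hδ ρ v ≤ 7 / 2 * Y ^ 2 := by
  have k1 := (norm_lowQM_le hδ (𝓕 (cl ρ))).trans (mul_le_mul_of_nonneg_left (norm_lowM_le hδ hY h1) two_pos.le)
  have k2 := fun l => pow_le_pow_left₀ (norm_nonneg _) (norm_lowM_le hδ hY (h2 l)) 2
  have k3 := pow_le_pow_left₀ (norm_nonneg _) k1 2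
  unfold lowEnergy
  rw [Fin.sum_univ_three]
  linarith [k2 0, k2 1, k2 2]

/-- The truncation of the low frequencies can be removed, by Fatou's lemma. -/
theorem wnorm_freq_inv_le {f : L2} {c : ℝ≥0∞} (h : ∀ δ : ℝ, 0 < δ → wnorm (lowP δ) f ≤ c) :
    wnorm (fun ξ => (freq ξ)⁻¹) f ≤ c := by
  refine (Lp.eLpNorm_lim_le_liminf_eLpNorm
    (f := fun (n : ℕ) ξ => ((lowP (1 / ((n : ℝ) + 1)) ξ : ℝ) : ℂ) * (𝓕 f : L2) ξ)
    (fun n => aestronglyMeasurable_weight (measurable_lowP _) _) _ ?_).trans ?_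
  · filter_upwards [ae_ne_zero] with ξ hξ
    refine tendsto_const_nhds.congr' ?_
    have h0 : Tendsto (fun n : ℕ => 1 / ((n : ℝ) + 1)) atTop (𝓝 0) := tendsto_one_div_add_atTop_nhds_zero_nat
    filter_upwards [h0.eventually (eventually_le_nhds (freq_pos hξ))] with n hn
    rw [lowP, if_pos hn]
  · refine (liminf_le_liminf (v := fun _ => c) (.of_forall fun n => h _ (by positivity))).trans ?_
    simp

/-! ### From the norms of `α` to the energy estimate -/

theorem freq_rpow_le {s : ℝ} (hs0 : 0 ≤ s) {ξ : R3} (hξ : ξ ≠ 0) :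
    |freq ξ ^ s| ≤ |(freq ξ)⁻¹ * jap ξ ^ (s + 1)| := by
  refine le_trans ?_ (rpow_le_freq_inv_mul le_rfl hξ)
  rw [abs_of_nonneg (rpow_nonneg (freq_nonneg ξ) _), abs_of_nonneg (rpow_nonneg (jap_pos ξ).le _)]
  exact Real.rpow_le_rpow (freq_nonneg ξ) (freq_le_jap ξ) hs0

theorem freq_inv_le {s : ℝ} (hs0 : 0 ≤ s) {ξ : R3} :
    |(freq ξ)⁻¹| ≤ |(freq ξ)⁻¹ * jap ξ ^ s| := by
  rw [abs_mul]
  refine le_mul_of_one_le_right (abs_nonneg _) ?_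
  rw [abs_of_nonneg (rpow_nonneg (jap_pos ξ).le _)]
  exact Real.one_le_rpow (one_le_jap ξ) hs0

/-- The norms of the unknowns that `‖|∇|⁻¹ α‖_{H^{s+1}}` controls. -/
theorem norms_le_of_normHneg {s : ℝ} {j : ℕ} {ρ : R3 → ℝ} {v : R3 → R3} (hρ : MemLp ρ 2 volume)
    (hv : ∀ i, MemLp (fun x => v x i) 2 volume) (hg : IsGradient v) {Y : ℝ}
    (hY : normHneg (s + 1) (alpha j ρ v) ≤ ofReal Y) {w : R3 → ℝ} (hw : Measurable w)
    (heven : ∀ ξ, w (-ξ) = w ξ) (hle : ∀ ξ ≠ 0, |w ξ| ≤ |(freq ξ)⁻¹ * jap ξ ^ (s + 1)|) :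
    wnorm w (cl ρ) ≤ ofReal Y ∧ ∀ l, wnorm w (cl fun x => v x l) ≤ ofReal (2 * Y) := by
  have h1 : wnorm w (alpha j ρ v) ≤ ofReal Y := (wnorm_mono_ae hle _).trans hY
  refine ⟨(wnorm_density_le hρ hv hw heven).1.trans h1, fun l => (hg.wnorm_le (j := j) hρ hv hw heven l).trans ?_⟩
  rw [ofReal_mul (by norm_num), show ofReal 2 = 2 by simp]
  gcongr

theorem abs_logRem_le {x : ℝ} (hx : |x| ≤ 1 / 2) : |Real.log (1 + x) - x| ≤ 2 * |x| * |x| := by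
  have h := Real.abs_log_sub_add_sum_range_le (x := -x) (by rw [abs_neg]; linarith) 1
  simp only [Finset.range_one, Finset.sum_singleton, zero_add, pow_one, Nat.cast_zero, div_one, abs_neg,
    sub_neg_eq_add] at h
  rw [show -x + Real.log (1 + x) = Real.log (1 + x) - x by ring] at h
  refine h.trans ?_
  rw [div_le_iff₀ (by linarith)]
  rw [show (1 : ℕ) + 1 = 2 by rfl]
  nlinarith [mul_nonneg (sq_nonneg |x|) (by linarith : 0 ≤ 1 - 2 * |x|)]

/-- The factor between the decay of `α` and the pointwise bounds in `Slice`; its inverse is the threshold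
for the size of the solution. -/
def slC (k : ℝ) : ℝ := 16 * ((prodC (2 * k)).toReal + 1) * decC k

theorem one_le_decC (k : ℝ) : 1 ≤ decC k := (decC_ge k 0 0).1

theorem le_slC (k : ℝ) : 16 * decC k ≤ slC k := by
  have h1 := one_le_decC k
  have h2 := (prodC (2 * k)).toReal_nonneg
  unfold slC
  nlinarith

theorem prodC_le_slC (k : ℝ) : 16 * (prodC (2 * k)).toReal * decC k ≤ slC k := by
  have h1 := one_le_decC k
  unfold slC
  nlinarith

theorem one_le_slC (k : ℝ) : 1 ≤ slC k := by linarith [le_slC k, one_le_decC k]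

theorem mul_prodC_le {k : ℝ} (hk : 0 < k) {c a : ℝ} (hc : 0 ≤ c) (ha : 0 ≤ a)
    (hsmall : slC k * a ≤ 1) :
    ofReal c * prodC (2 * k) * ofReal (decC k * a) ≤ ofReal (c / 16) := by
  have hP := (prodC (2 * k)).toReal_nonneg
  have hD := zero_le_one.trans (one_le_decC k)
  rw [← ofReal_toReal (prodC_lt_top (by linarith : 0 < 2 * k)).ne, ← ofReal_mul hc,
    ← ofReal_mul (by positivity)]
  refine ofReal_le_ofReal ?_
  have h1 := mul_le_mul_of_nonneg_right (prodC_le_slC k) ha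
  nlinarith

variable {k a X : ℝ} {j : ℕ} {ρ φ : R3 → ℝ} {v : R3 → R3}

/-- `log (1 + ρ)` and `ρ` have comparable Sobolev norms. -/
theorem hs_log_sub_le (hk : 5 ≤ k) (ha : 0 ≤ a) (hsmall : slC k * a ≤ 1) (hρ : MemLp ρ 2 volume)
    (hb : ∀ x, |ρ x| ≤ decC k * a) (hσ : MemLp (logDen ρ) 2 volume) :
    hs (2 * k) (fun x => logDen ρ x - ρ x) ≤ ofReal (1 / 2) * hs (2 * k) ρ := by
  have h1 := mul_le_mul_of_nonneg_right (le_slC k) ha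
  have h2 := mul_prodC_le (by linarith : 0 < k) (c := 4) (by norm_num) ha hsmall
  rw [show ofReal 4 = 4 by simp] at h2
  refine (hs_logRem_le (by linarith) hρ hb (by linarith) (h2.trans ?_) (hσ.sub hρ)).trans ?_
  · rw [ENNReal.ofReal_le_one]; norm_num
  · refine mul_le_mul_left (h2.trans (ofReal_le_ofReal (by norm_num))) _

/-- The assumptions of the energy estimates at a fixed time, from the size `X` of the first part of the `X` norm of
`α` and the size `a` of its norm in `W^{k,10}`. -/
theorem lowSlice_of_alpha (hk : 5 ≤ k) (ha : 0 ≤ a) (hX : 0 ≤ X) (hsmall : slC k * a ≤ 1)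
    (hρc : ContDiff ℝ 1 ρ) (hvc : ∀ l, ContDiff ℝ 1 fun x => v x l)
    (hv : ∀ l, MemLp (fun x => v x l) 2 volume) (hρ' : ∀ i, MemLp (pd i ρ) 2 volume)
    (hv' : ∀ l i, MemLp (pd i fun x => v x l) 2 volume) (hσ : MemLp (logDen ρ) 2 volume)
    (hp : IsPotential (decC k * a) ρ φ) (hg : IsGradient v)
    (hsymm : ∀ i l, pd i (fun x => v x l) =ᵐ[volume] pd l fun x => v x i)
    (hN : normHneg (2 * k + 1) (alpha j ρ v) ≤ ofReal X)
    (hW : normW k 10 (alpha j ρ v) ≤ ofReal a) :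
    LowSlice (2 * k) (slC k * a) (2 * X) ρ φ fun l x => v x l := by
  have hρ := hp.memLp_density
  have hD := one_le_decC k
  have hDa : 0 ≤ decC k * a := by positivity
  have h16 := mul_le_mul_of_nonneg_right (le_slC k) ha
  have hle : decC k * a ≤ slC k * a := by linarith
  have hb : ∀ x, |ρ x| ≤ 1 / 4 := fun x => (hp.bound x).trans hp.le
  have hfin : normHneg (2 * k + 1) (alpha j ρ v) < ∞ := hN.trans_lt ofReal_lt_top
  have hk0 : 0 ≤ 2 * k := by linarith
  obtain ⟨s1, s2⟩ := norms_le_of_normHneg hρ hv hg hN (measurable_freq_rpow (2 * k))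
    (fun ξ => by rw [freq_neg]) fun ξ hξ => freq_rpow_le hk0 hξ
  obtain ⟨l1, l2⟩ := norms_le_of_normHneg hρ hv hg hN continuous_freq.measurable.inv
    (fun ξ => by rw [Pi.inv_apply, Pi.inv_apply, freq_neg]) fun ξ _ => freq_inv_le (by linarith)
  obtain ⟨n1, n2⟩ := norms_le_of_normHneg hρ hv hg hN (w := fun _ => 1) measurable_const
    (fun ξ => rfl) fun ξ hξ => by simpa using rpow_le_freq_inv_mul (a := 0) hk0 hξ
  have hn : ∀ {f : R3 → ℝ}, MemLp f 2 volume → ∀ {Z : ℝ}, 0 ≤ Z →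
      wnorm (fun _ => 1) (cl f) ≤ ofReal Z → ‖cl f‖ ≤ Z := fun hf Z hZ h => by
    rw [wnorm_one, eLpNorm_coe_cl hf, eLpNorm_eq_ofReal_norm hf] at h
    exact (ofReal_le_ofReal_iff hZ).1 h
  have hX2 : ofReal X ≤ ofReal (2 * X) := ofReal_le_ofReal (by linarith)
  have hpdlog : ∀ i x, |pd i (logDen ρ) x| ≤ 2 * |pd i ρ x| := fun i x => by
    rw [pd_logDen (hρc.differentiable (by norm_num)) hb, abs_mul]
    have h2 := abs_le.1 (hb x)
    refine mul_le_mul_of_nonneg_right ?_ (abs_nonneg _)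
    rw [abs_of_pos (inv_pos.2 (by linarith))]
    exact inv_le_of_inv_le₀ (by norm_num) (by linarith)
  have hφ : ‖cl φ‖ ≤ 4 * X := by
    have h0 : IsPotential (1 / 4) (fun _ => 0) fun _ => 0 :=
      ⟨contDiff_const, tendsto_const_nhds, fun x => by
        have h0 : ∀ i, pd i (fun _ => (0 : ℝ)) = fun _ => 0 := fun i => by ext y; simp [pd]
        rw [laplacian_eq_sum_pd contDiff_const]; simp [h0], le_rfl, fun x => by norm_num, continuous_const,
        MemLp.zero'⟩
    have h1 := hp.eLpNorm_sub_le h0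
    simp only [sub_zero] at h1
    rw [eLpNorm_eq_ofReal_norm hp.memLp, eLpNorm_eq_ofReal_norm hρ, show (4 : ℝ≥0∞) = ofReal 4 by simp,
      ← ofReal_mul (by norm_num), ofReal_le_ofReal_iff (by positivity)] at h1
    linarith [hn hρ hX n1]
  have hrem : ‖cl fun x => expRem (φ x)‖ ≤ 2 * (decC k * a) * ‖cl φ‖ := by
    refine Lp.norm_le_mul_norm_of_ae_le_mul ?_
    filter_upwards [coeFn_cl hp.memLp_rem, coeFn_cl hp.memLp] with x h1 h2
    rw [h1, h2, norm_real, norm_real]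
    exact (abs_expRem_le ((hp.abs_le_half x).trans (by norm_num))).trans
      (mul_le_mul_of_nonneg_right (hp.abs_le x) (abs_nonneg _))
  have hlrem : ‖cl fun x => logDen ρ x - ρ x‖ ≤ 2 * (decC k * a) * ‖cl ρ‖ := by
    refine Lp.norm_le_mul_norm_of_ae_le_mul ?_
    filter_upwards [coeFn_cl (f := fun x => logDen ρ x - ρ x) (hσ.sub hρ), coeFn_cl hρ] with x h1 h2
    rw [h1, h2, norm_real, norm_real]
    refine (abs_logRem_le ((hb x).trans (by norm_num))).trans (mul_le_mul_of_nonneg_right ?_ (abs_nonneg _))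
    linarith [hp.bound x]
  have hsrem : hs (2 * k) (fun x => expRem (φ x)) ≤ ofReal (slC k * a * (2 * X)) := by
    have e : ofReal (2 * (decC k * a)) = 2 * ofReal (decC k * a) := by
      rw [ofReal_mul (by norm_num)]; simp
    have h2 := mul_prodC_le (by linarith : 0 < k) (c := 16) (by norm_num) ha hsmall
    rw [show ofReal 16 = 8 * 2 by rw [← ENNReal.ofReal_ofNat 8, ← ENNReal.ofReal_ofNat 2,
      ← ofReal_mul (by norm_num)]; norm_num, show (16 / 16 : ℝ) = 1 by norm_num, ENNReal.ofReal_one] at h2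
    refine (hp.hs_rem_le (by linarith) (s1.trans_lt ofReal_lt_top) ?_).trans ?_
    · rw [e]; convert h2 using 1; ring
    · refine (mul_le_mul_right s1 _).trans ?_
      rw [show (8 : ℝ≥0∞) = ofReal 8 by simp,
        ← ofReal_toReal (prodC_lt_top (by linarith : 0 < 2 * k)).ne, ← ofReal_mul (by norm_num),
        ← ofReal_mul (by positivity), ← ofReal_mul (by positivity)]
      refine ofReal_le_ofReal ?_
      have h3 := mul_le_mul_of_nonneg_right (mul_le_mul_of_nonneg_right (prodC_le_slC k) ha) hX
      have h4 : 0 ≤ slC k * a * X := mul_nonneg (hDa.trans hle) hX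
      linarith
  exact {
    one_lt := by linarith
    nonneg := hDa.trans hle
    nonneg' := by linarith
    contDiff_density := hρc
    contDiff_log := contDiff_logDen hρc hb
    contDiff_potential := hp.contDiff.of_le (by norm_num)
    contDiff_velocity := hvc
    memLp_density := hρ
    memLp_log := hσ
    memLp_potential := hp.memLp
    memLp_rem := hp.memLp_rem
    memLp_velocity := hv
    memLp_pd_density := hρ'
    memLp_pd_log := fun i => memLp_of_abs_le (hρ' i)
      (continuous_pd (contDiff_logDen hρc hb) i).aestronglyMeasurable (hpdlog i)
    memLp_pd_potential := hp.memLp_pd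
    memLp_pd_velocity := hv'
    abs_density := fun x => (hp.bound x).trans hle
    abs_velocity := fun l x => (abs_velocity_le hk hρ hg hv hfin ha hW (hvc l).continuous x).trans hle
    abs_pd_log := fun i x => by
      have := abs_pd_density_le hk hρ hρc hv hfin ha hW (hρ' i) x
      linarith [hpdlog i x]
    abs_pd_velocity := fun l i x => (abs_pd_velocity_le hk hρ hg hv hfin ha hW (hvc l) (hv' l i) x).trans hle
    hs_density := le_trans s1 hX2
    hs_log := by
      have e : logDen ρ = fun x => (logDen ρ x - ρ x) + ρ x := by ext x; ring
      rw [e]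
      refine (hs_add_le (2 * k) (f := fun x => logDen ρ x - ρ x) (hσ.sub hρ) hρ).trans
        ((add_le_add_left (hs_log_sub_le hk ha hsmall hρ hp.bound hσ) _).trans ?_)
      refine (add_le_add (mul_le_mul_right s1 _) s1).trans ?_
      rw [← ofReal_mul (by norm_num), ← ofReal_add (by positivity) hX]
      exact ofReal_le_ofReal (by linarith)
    hs_velocity := s2
    hs_rem := hsrem
    fourier := hp.fourier
    norm_velocity := fun l => hn (hv l) (by linarith) (n2 l)
    norm_rem := by
      have h1 := mul_le_mul_of_nonneg_left hφ (by positivity : 0 ≤ 2 * (decC k * a))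
      have h2 := mul_le_mul_of_nonneg_right h16 hX
      have h3 : 0 ≤ slC k * a * X := mul_nonneg (hDa.trans hle) hX
      linarith
    norm_logRem := by
      have h1 := mul_le_mul_of_nonneg_left (hn hρ hX n1) (by positivity : 0 ≤ 2 * (decC k * a))
      have h2 := mul_le_mul_of_nonneg_right h16 hX
      have h3 : 0 ≤ decC k * a * X := mul_nonneg hDa hX
      linarith
    low_density := le_trans l1 hX2
    low_velocity := l2
    pd_symm := hsymm }

theorem hs_le_two_mul_hs_log (hk : 5 ≤ k) (ha : 0 ≤ a) (hsmall : slC k * a ≤ 1) (hρ : MemLp ρ 2 volume)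
    (hb : ∀ x, |ρ x| ≤ decC k * a) (hσ : MemLp (logDen ρ) 2 volume) {Z X : ℝ} (hZ : 0 ≤ Z)
    (hfin : hs (2 * k) ρ ≤ ofReal X) (h : hs (2 * k) (logDen ρ) ≤ ofReal Z) :
    hs (2 * k) ρ ≤ ofReal (2 * Z) := by
  have e : ρ = fun x => logDen ρ x - (logDen ρ x - ρ x) := by ext x; ring
  have h1 : hs (2 * k) ρ ≤ hs (2 * k) (logDen ρ) + ofReal (1 / 2) * hs (2 * k) ρ := by
    conv_lhs => rw [e]
    exact (hs_sub_le (2 * k) (g := fun x => logDen ρ x - ρ x) hσ (hσ.sub hρ)).trans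
      (add_le_add_right (hs_log_sub_le hk ha hsmall hρ hb hσ) _)
  have hne : hs (2 * k) ρ ≠ ∞ := (hfin.trans_lt ofReal_lt_top).ne
  have h2 := h1.trans (add_le_add_left h _)
  rw [← ofReal_toReal hne, ← ofReal_mul (by norm_num), ← ofReal_add hZ (by positivity),
    ofReal_le_ofReal_iff (by positivity)] at h2
  rw [← ofReal_toReal hne]
  exact ofReal_le_ofReal (by linarith)

theorem jap_rpow_le {s : ℝ} (hs0 : 0 ≤ s) {ξ : R3} (hξ : ξ ≠ 0) :
    |jap ξ ^ s| ≤ 2 ^ s * |(freq ξ)⁻¹ + freq ξ ^ s| := by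
  have h0 := freq_pos hξ
  have hj := (jap_pos ξ).le
  have h1 : 0 ≤ freq ξ ^ s := rpow_nonneg h0.le s
  have h2 : 0 < (freq ξ)⁻¹ := inv_pos.2 h0
  have hsq := jap_sq ξ
  rw [abs_of_nonneg (rpow_nonneg hj s), abs_of_nonneg (by positivity)]
  rcases le_total (freq ξ) 1 with h | h
  · have h3 : jap ξ ≤ 2 := by nlinarith
    have h4 : 1 ≤ (freq ξ)⁻¹ := (one_le_inv₀ h0).2 h
    calc jap ξ ^ s ≤ 2 ^ s := Real.rpow_le_rpow hj h3 hs0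
      _ ≤ 2 ^ s * ((freq ξ)⁻¹ + freq ξ ^ s) := le_mul_of_one_le_right (by positivity) (by linarith)
  · have h3 : jap ξ ≤ 2 * freq ξ := by nlinarith
    calc jap ξ ^ s ≤ (2 * freq ξ) ^ s := Real.rpow_le_rpow hj h3 hs0
      _ = 2 ^ s * freq ξ ^ s := Real.mul_rpow (by norm_num) h0.le
      _ ≤ 2 ^ s * ((freq ξ)⁻¹ + freq ξ ^ s) := mul_le_mul_of_nonneg_left (by linarith) (by positivity)

/-- The norm of `α` in `H⁻¹ ∩ H^s` is bounded by the homogeneous norms of the unknowns. -/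
theorem normHinter_slice_le {s : ℝ} (hs0 : 0 ≤ s) (j : ℕ) (ρ : R3 → ℝ) (v : R3 → R3) {Z : ℝ} (hZ : 0 ≤ Z)
    (h1 : wnorm (fun ξ => (freq ξ)⁻¹) (cl ρ) ≤ ofReal Z)
    (h2 : ∀ l, wnorm (fun ξ => (freq ξ)⁻¹) (cl fun x => v x l) ≤ ofReal Z)
    (h3 : hs s ρ ≤ ofReal (2 * Z)) (h4 : ∀ l, hs s (fun x => v x l) ≤ ofReal Z) :
    normHneg 0 (alpha j ρ v) + normH s (alpha j ρ v) ≤ ofReal ((4 + 9 * 2 ^ s) * Z) := by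
  have hm : Measurable fun ξ : R3 => (freq ξ)⁻¹ := continuous_freq.measurable.inv
  have k1 : wnorm (fun ξ => (freq ξ)⁻¹) (alpha j ρ v) ≤ ofReal (4 * Z) := by
    refine (wnorm_alpha_le j ρ v hm).trans ((add_le_add h1 (sum_le_sum fun i _ => h2 i)).trans ?_)
    rw [← ENNReal.ofReal_sum_of_nonneg fun _ _ => hZ, ← ofReal_add hZ (sum_nonneg fun _ _ => hZ)]
    exact ofReal_le_ofReal (by simp; linarith)
  have k2 : wnorm (fun ξ => freq ξ ^ s) (alpha j ρ v) ≤ ofReal (5 * Z) := by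
    refine (wnorm_alpha_le j ρ v (measurable_freq_rpow s)).trans
      ((add_le_add h3 (sum_le_sum fun i _ => h4 i)).trans ?_)
    rw [← ENNReal.ofReal_sum_of_nonneg fun _ _ => hZ,
      ← ofReal_add (by linarith) (sum_nonneg fun _ _ => hZ)]
    exact ofReal_le_ofReal (by simp; linarith)
  have k3 : normHneg 0 (alpha j ρ v) ≤ ofReal (4 * Z) := by
    refine (wnorm_mono (fun ξ => ?_) _).trans k1
    rw [Real.rpow_zero, mul_one]
  have k4 : normH s (alpha j ρ v) ≤ ofReal (2 ^ s * (9 * Z)) := by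
    refine (wnorm_le_ae (fun ξ hξ => jap_rpow_le hs0 hξ) _).trans ?_
    rw [ofReal_mul (by positivity)]
    refine mul_le_mul_right ((wnorm_add_weight_le hm (measurable_freq_rpow s) _).trans
      ((add_le_add k1 k2).trans (le_of_eq ?_))) _
    rw [← ofReal_add (by positivity) (by positivity)]
    congr 1; ring
  refine (add_le_add k3 k4).trans (le_of_eq ?_)
  rw [← ofReal_add (by positivity) (by positivity)]
  congr 1; ring

theorem normX_apply_le {J : Set ℝ} {u : ℝ → L2} {X : ℝ} (hX : normX k J u ≤ ofReal X)
    {t : ℝ} (ht : t ∈ J) (ht0 : 0 ≤ t) : normHneg (2 * k + 1) (u t) ≤ ofReal X ∧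
      normW k 10 (u t) ≤ ofReal (X * (1 + t) ^ (-(16 / 15) : ℝ)) := by
  have h := (le_iSup₂_of_le (f := fun t _ => normHneg (2 * k + 1) (u t) +
    ofReal ((1 + t) ^ (16 / 15 : ℝ)) * normW k 10 (u t)) t ht le_rfl).trans hX
  refine ⟨le_self_add.trans h, ?_⟩
  have h2 := le_add_self.trans h
  have hp : 0 < (1 + t) ^ (16 / 15 : ℝ) := by positivity
  have h3 := mul_le_mul_right h2 (ofReal ((1 + t) ^ (-(16 / 15) : ℝ)))
  rw [← mul_assoc, ← ofReal_mul (by positivity), ← rpow_add (by linarith)] at h3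
  simp only [neg_add_cancel, Real.rpow_zero, ENNReal.ofReal_one, one_mul] at h3
  rw [mul_comm X, ofReal_mul (by positivity)]
  exact h3

/-- The constant in the final bound for the energies. -/
def finC (k : ℝ) : ℝ :=
  1 + 2 * ((14 + 1440 * slC k) * enC (2 * k) ^ 2) * ((2 * π) ^ (2 * (2 * k)) * 3 ^ (2 * k) + 1)

theorem le_finC (k : ℝ) : 0 ≤ finC k ∧
    2 * ((14 + 1440 * slC k) * enC (2 * k) ^ 2) * ((2 * π) ^ (2 * (2 * k)) * 3 ^ (2 * k)) ≤ finC k ^ 2 ∧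
    2 * ((14 + 1440 * slC k) * enC (2 * k) ^ 2) ≤ finC k ^ 2 := by
  have h1 := one_le_slC k
  have h2 : 0 ≤ 2 * ((14 + 1440 * slC k) * enC (2 * k) ^ 2) := by positivity
  have h3 : 0 ≤ (2 * π) ^ (2 * (2 * k)) * (3 : ℝ) ^ (2 * k) := by positivity
  set c := 2 * ((14 + 1440 * slC k) * enC (2 * k) ^ 2)
  set l := (2 * π) ^ (2 * (2 * k)) * (3 : ℝ) ^ (2 * k)
  have h4 : finC k = 1 + c * (l + 1) := rfl
  have h5 : 0 ≤ c * l := mul_nonneg h2 h3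
  have h6 : 1 ≤ finC k := by rw [h4]; nlinarith
  have h7 : finC k ≤ finC k ^ 2 := by nlinarith
  refine ⟨by linarith, ?_, ?_⟩ <;> refine le_trans ?_ h7 <;> rw [h4] <;> nlinarith

/-! ### The energy estimate on the time interval -/

theorem pd_comm_of_curl_eq_zero {v : R3 → R3} (h : ∀ x, curl v x = 0) (i l : Fin 3) (x : R3) :
    pd i (fun y => v y l) x = pd l (fun y => v y i) x := by
  have h0 := congrArg (fun w : R3 => w 0) (h x)
  have h1 := congrArg (fun w : R3 => w 1) (h x)
  have h2 := congrArg (fun w : R3 => w 2) (h x)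
  simp [curl, sub_eq_zero] at h0 h1 h2
  fin_cases i <;> fin_cases l <;> simp [h0, h1, h2]

theorem hs_le_of_sum_le {s : ℝ} (hs0 : 0 < s) {f : R3 → ℝ} (hf : MemLp f 2 volume) {c Z : ℝ} (hZ : 0 ≤ Z)
    (h : ∀ F : Finset (ℤ × Fin 3), ∑ p ∈ F, wtR s p * ‖cl ((fwdDiff (stp p))^[ord s] f)‖ ^ 2 ≤ c)
    (hc : (2 * π) ^ (2 * s) * 3 ^ s * c ≤ Z ^ 2) : hs s f ≤ ofReal Z := by
  rw [← ENNReal.pow_le_pow_left_iff (n := 2) (by norm_num)]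
  refine (hs_sq_le_wsum hs0 (ord s) hf).trans ?_
  refine (mul_le_mul_right (wsum_le_of_sum_le (fun p => memLp_fwdDiff_iter hf (stp p) (ord s)) h) _).trans ?_
  rw [lowC, ← ofReal_mul (by positivity), ← ofReal_pow hZ]
  exact ofReal_le_ofReal hc

theorem wnorm_freq_inv_le_of_lowM {f : L2} {Z : ℝ} (hZ : 0 ≤ Z)
    (h : ∀ {δ : ℝ} (hδ : 0 < δ), ‖lowM hδ (𝓕 f)‖ ^ 2 ≤ Z ^ 2) :
    wnorm (fun ξ => (freq ξ)⁻¹) f ≤ ofReal Z :=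
  wnorm_freq_inv_le fun δ hδ => by
    rw [wnorm_eq_ofReal_norm_mulR (measurable_lowP δ) (abs_lowP_le hδ)]
    exact ofReal_le_ofReal ((sq_le_sq₀ (norm_nonneg _) hZ).1 (h hδ))

theorem sq_add_cube_le {X Y : ℝ} (hX : 0 ≤ X) (hY : 0 ≤ Y) : Y ^ 2 + X ^ 3 ≤ (Y + X ^ (3 / 2 : ℝ)) ^ 2 := by
  have h1 : (X ^ (3 / 2 : ℝ)) ^ 2 = X ^ 3 := by
    rw [← rpow_natCast, ← rpow_mul hX, ← rpow_natCast]; norm_num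
  have h2 : 0 ≤ X ^ (3 / 2 : ℝ) := rpow_nonneg hX _
  nlinarith [mul_nonneg hY h2]

/-- The energy estimate, with the size `X` of the solution and the size `Y` of the data. -/
theorem IsSolution.normHinter_le {k : ℝ} (hk : 5 ≤ k) {T : EReal} (hT : 0 < T) {ρ : ℝ → R3 → ℝ}
    {v : ℝ → R3 → R3} {φ : ℝ → R3 → ℝ} (h : IsSolution k (timeInterval T) ρ v φ) {j : ℕ} {X Y : ℝ}
    (hX0 : 0 ≤ X) (hsmall : slC k * X ≤ 1) (hY0 : 0 ≤ Y)
    (hX : normX k (timeInterval T) (fun t => alpha j (ρ t) (v t)) ≤ ofReal X)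
    (hY : normHneg (2 * k + 1) (alpha j (ρ 0) (v 0)) ≤ ofReal Y) :
    normHinter k (timeInterval T) (fun t => alpha j (ρ t) (v t)) ≤
      ofReal ((4 + 9 * 2 ^ (2 * k)) * (finC k * (Y + X ^ (3 / 2 : ℝ)))) := by
  set J := timeInterval T with hJdef
  have hk2 : 0 < 2 * k := by linarith
  have hD := one_le_decC k
  have hS1 := one_le_slC k
  have hE1 := one_le_enC (2 * k)
  set a : ℝ → ℝ := fun t => X * (1 + t) ^ (-(16 / 15) : ℝ) with ha
  have ha0 : ∀ t ∈ J, 0 ≤ a t := fun t ht => mul_nonneg hX0 (rpow_nonneg (by linarith [ht.1]) _)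
  have haX : ∀ t ∈ J, a t ≤ X := fun t ht =>
    mul_le_of_le_one_right hX0 (Real.rpow_le_one_of_one_le_of_nonpos (by linarith [ht.1]) (by norm_num))
  have hX' := fun t ht => normX_apply_le hX (t := t) ht ht.1
  have hcρ : ∀ t ∈ J, ContDiff ℝ 1 (ρ t) := fun t ht => contDiff_slice h.contDiff_density ht
  have hbt : ∀ t ∈ J, ∀ x, |ρ t x| ≤ decC k * a t := fun t ht x =>
    abs_density_le hk (h.regular_density.1 t ht).1 (hcρ t ht).continuous
      (fun i => ((h.regular_velocity i).1 t ht).1) ((hX' t ht).1.trans_lt ofReal_lt_top)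
      (ha0 t ht) (hX' t ht).2 x
  have h16 := mul_le_mul_of_nonneg_right (le_slC k) hX0
  have hDX : 0 ≤ decC k * X := by positivity
  have hflow : Flow (2 * k) (decC k * X) J ρ (fun i t x => v t x i) φ :=
    h.flow hk hT (by linarith) fun t ht x => (hbt t ht x).trans (mul_le_mul_of_nonneg_left (haX t ht) (by linarith))
  have hcurl : ∀ i l x, pd i ((fun i t x => v t x i : Fin 3 → ℝ → R3 → ℝ) l 0) x =
      pd l ((fun i t x => v t x i : Fin 3 → ℝ → R3 → ℝ) i 0) x := fun i l x =>
    pd_comm_of_curl_eq_zero h.irrotational i l x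
  have h3 : (3 : ℝ) ≤ 2 * k := by linarith
  have hg : ∀ t ∈ J, IsGradient (v t) := fun t ht => isGradient_of_leray (hflow.leray_eq_zero h3 hcurl ht)
  have hat : ∀ t ∈ J, slC k * a t ≤ 1 := fun t ht =>
    (mul_le_mul_of_nonneg_left (haX t ht) (by linarith)).trans hsmall
  have hρm : ∀ t ∈ J, MemLp (ρ t) 2 volume := fun t ht => (h.regular_density.1 t ht).1
  have hvm : ∀ t ∈ J, ∀ l, MemLp (fun x => v t x l) 2 volume := fun t ht l => ((h.regular_velocity l).1 t ht).1
  have hσm : ∀ t ∈ J, MemLp (logDen (ρ t)) 2 volume := fun t ht => hflow.diff_log.reg.memLp t ht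
  have hslice : ∀ t ∈ J, LowSlice (2 * k) (slC k * a t) (2 * X) (ρ t) (φ t) fun l x => v t x l := fun t ht => by
    have hp := hflow.potential t ht
    have h16 := mul_le_mul_of_nonneg_right (le_slC k) (ha0 t ht)
    exact lowSlice_of_alpha hk (ha0 t ht) hX0 (hat t ht) (hcρ t ht) (fun l => hflow.contDiff_velocity l t ht)
      (hvm t ht) (fun i => hflow.contH_density.memLp_pd (by linarith) hflow.contDiff_density i ht)
      (fun l i => (hflow.contH_velocity l).memLp_pd (by linarith) (hflow.contDiff_velocity l) i ht) (hσm t ht)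
      { hp with le := by linarith [hat t ht], bound := hbt t ht } (hg t ht)
      (fun i l => hflow.pd_symm h3 hcurl ht i l) (hX' t ht).1 (hX' t ht).2
  -- the energies at the initial time
  have z := hflow.zero_mem
  obtain ⟨s1, s2⟩ := norms_le_of_normHneg (hρm 0 z) (hvm 0 z) (hg 0 z) hY
    (measurable_freq_rpow (2 * k)) (fun ξ => by rw [freq_neg]) fun ξ hξ => freq_rpow_le hk2.le hξ
  obtain ⟨l1, l2⟩ := norms_le_of_normHneg (hρm 0 z) (hvm 0 z) (hg 0 z) hY
    continuous_freq.measurable.inv (fun ξ => by rw [Pi.inv_apply, Pi.inv_apply, freq_neg])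
    fun ξ _ => freq_inv_le (by linarith)
  have hY2 : ofReal Y ≤ ofReal (2 * Y) := ofReal_le_ofReal (by linarith)
  have slog : hs (2 * k) (logDen (ρ 0)) ≤ ofReal (2 * Y) := by
    have e : logDen (ρ 0) = fun x => (logDen (ρ 0) x - ρ 0 x) + ρ 0 x := by ext x; ring
    rw [e]
    refine (hs_add_le (2 * k) (f := fun x => logDen (ρ 0) x - ρ 0 x) ((hσm 0 z).sub (hρm 0 z)) (hρm 0 z)).trans
      ((add_le_add_left (hs_log_sub_le hk (ha0 0 z) (hat 0 z) (hρm 0 z) (hbt 0 z) (hσm 0 z)) _).trans ?_)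
    refine (add_le_add (mul_le_mul_right s1 _) s1).trans ?_
    rw [← ofReal_mul (by norm_num), ← ofReal_add (by positivity) hY0]
    exact ofReal_le_ofReal (by linarith)
  set R := Y + X ^ (3 / 2 : ℝ) with hR
  have hR0 : 0 ≤ R := by positivity
  have hR2 : Y ^ 2 + X ^ 3 ≤ R ^ 2 := sq_add_cube_le hX0 hY0
  set K := (14 + 1440 * slC k) * enC (2 * k) ^ 2 with hK
  have hK0 : 0 ≤ K := by positivity
  have hXc : 0 ≤ X ^ 3 := by positivity
  have hYc : 0 ≤ Y ^ 2 := by positivity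
  have hKR : ∀ {c d : ℝ}, 0 ≤ c → 0 ≤ d → c ≤ 14 → d ≤ 1440 * slC k →
      (c * Y ^ 2 + d * X ^ 3) * enC (2 * k) ^ 2 ≤ K * R ^ 2 := fun {c d} hc hd hc' hd' => by
    rw [hK, mul_right_comm]
    refine mul_le_mul_of_nonneg_right ?_ (by positivity)
    have i1 := mul_le_mul_of_nonneg_right hc' hYc
    have i2 := mul_le_mul_of_nonneg_right hd' hXc
    have i3 := mul_le_mul_of_nonneg_left hR2 (by linarith : 0 ≤ 14 + 1440 * slC k)
    have i4 : 0 ≤ slC k * Y ^ 2 := by positivity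
    linarith
  have hhigh : ∀ t ∈ J, ∀ F, diffEnergy (2 * k) F (ρ t) (fun l x => v t x l) ≤ K * R ^ 2 := fun t ht F => by
    have g := growth_le hflow.ordConnected z (C := 24 * (slC k * X * (enC (2 * k) * (2 * X)) ^ 2)) (by positivity)
      (fun t ht => hflow.hasDerivWithinAt_diffEnergy (2 * k) F ht)
      (fun t ht => ((hslice t ht).toSlice.abs_sum_stepRate_le F).trans (le_of_eq (by ring))) ht ht.1
    have g0 := diffEnergy_le hk2 (hρm 0 z) (hσm 0 z) (hvm 0 z) (by positivity : 0 ≤ 2 * Y) (s1.trans hY2) slog s2 F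
    refine g.trans ((add_le_add_left g0 _).trans (le_trans (le_of_eq ?_)
      (hKR (c := 10) (d := 1440 * slC k) (by norm_num) (by positivity) (by norm_num) le_rfl)))
    ring
  have hlow : ∀ t ∈ J, ∀ {δ : ℝ} (hδ : 0 < δ), lowEnergy hδ (ρ t) (fun l x => v t x l) ≤ K * R ^ 2 :=
    fun t ht δ hδ => by
    have g := growth_le hflow.ordConnected z (C := 24 * (slC k * X * (2 * X) ^ 2)) (by positivity)
      (fun t ht => hflow.hasDerivWithinAt_lowEnergy hδ ht)
      (fun t ht => ((hslice t ht).abs_lowRate_le hδ).trans (le_of_eq (by ring))) ht ht.1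
    have g0 := lowEnergy_le hδ (by positivity : 0 ≤ 2 * Y) (l1.trans hY2) l2
    refine g.trans ((add_le_add_left g0 _).trans (le_trans (le_of_eq ?_) ((le_mul_of_one_le_right ?_
      (one_le_pow₀ hE1 : 1 ≤ enC (2 * k) ^ 2)).trans
      (hKR (c := 14) (d := 1440 * slC k) (by norm_num) (by positivity) le_rfl le_rfl))))
    · ring
    · positivity
  obtain ⟨c0, c1, c2⟩ := le_finC k
  have hZ : 0 ≤ finC k * R := mul_nonneg c0 hR0
  have hZ1 : (2 * π) ^ (2 * (2 * k)) * 3 ^ (2 * k) * (2 * (K * R ^ 2)) ≤ (finC k * R) ^ 2 := by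
    have := mul_le_mul_of_nonneg_right c1 (sq_nonneg R)
    rw [mul_pow]
    exact le_trans (le_of_eq (by ring)) this
  have hZ2 : 2 * (K * R ^ 2) ≤ (finC k * R) ^ 2 := by
    have := mul_le_mul_of_nonneg_right c2 (sq_nonneg R)
    rw [mul_pow]
    exact le_trans (le_of_eq (by ring)) this
  refine iSup₂_le fun t ht => ?_
  have b1 : hs (2 * k) (logDen (ρ t)) ≤ ofReal (finC k * R) :=
    hs_le_of_sum_le hk2 (hσm t ht) hZ (fun F => (sum_le_diffEnergy (2 * k) F (ρ t) (fun l x => v t x l) 0).1.trans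
      (mul_le_mul_of_nonneg_left (hhigh t ht F) two_pos.le)) hZ1
  have b2 : ∀ l, hs (2 * k) (fun x => v t x l) ≤ ofReal (finC k * R) := fun l =>
    hs_le_of_sum_le hk2 (hvm t ht l) hZ (fun F => (sum_le_diffEnergy (2 * k) F (ρ t) (fun l x => v t x l) l).2.trans
      (mul_le_mul_of_nonneg_left (hhigh t ht F) two_pos.le)) hZ1
  have b3 : wnorm (fun ξ => (freq ξ)⁻¹) (cl (ρ t)) ≤ ofReal (finC k * R) :=
    wnorm_freq_inv_le_of_lowM hZ fun {δ} hδ => by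
      have i1 := pow_le_pow_left₀ (norm_nonneg _) (norm_lowM_le_lowQM hδ (𝓕 (cl (ρ t)))) 2
      have i2 : 0 ≤ ∑ l, 2⁻¹ * ‖lowM hδ (𝓕 (cl fun x => v t x l))‖ ^ 2 :=
        sum_nonneg fun l _ => by positivity
      have i3 := hlow t ht hδ
      unfold lowEnergy at i3
      linarith
  have b4 : ∀ l, wnorm (fun ξ => (freq ξ)⁻¹) (cl fun x => v t x l) ≤ ofReal (finC k * R) := fun l =>
    wnorm_freq_inv_le_of_lowM hZ fun {δ} hδ => by
      have i1 := sq_nonneg ‖lowQM hδ (𝓕 (cl (ρ t)))‖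
      have i2 := single_le_sum (f := fun l => 2⁻¹ * ‖lowM hδ (𝓕 (cl fun x => v t x l))‖ ^ 2)
        (fun l _ => by positivity) (mem_univ l)
      have i3 := hlow t ht hδ
      unfold lowEnergy at i3
      linarith
  refine normHinter_slice_le hk2.le j (ρ t) (v t) hZ b3 b4 ?_ b2
  exact hs_le_two_mul_hs_log hk (ha0 t ht) (hat t ht) (hρm t ht) (hbt t ht) (hσm t ht) hZ (hslice t ht).hs_density b1

theorem one_le_finC (k : ℝ) : 1 ≤ finC k := by
  have h1 := one_le_slC k
  have h2 : 0 ≤ 2 * ((14 + 1440 * slC k) * enC (2 * k) ^ 2) := by positivity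
  have h3 : 0 ≤ (2 * π) ^ (2 * (2 * k)) * (3 : ℝ) ^ (2 * k) := by positivity
  unfold finC
  nlinarith

end IonEP

end

theorem mainTheorem4 (k : ℝ) (hk : 5 ≤ k) :
    ∃ ε : ℝ, 0 < ε ∧ ∃ C : ℝ, 0 < C ∧
      ∀ (T : EReal), 0 < T →
      ∀ (ρ : ℝ → IonEP.R3 → ℝ) (v : ℝ → IonEP.R3 → IonEP.R3) (φ : ℝ → IonEP.R3 → ℝ),
        IonEP.IsSolution k (IonEP.timeInterval T) ρ v φ →
      ∀ j : ℕ, j = 1 ∨ j = 2 →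
        IonEP.normX k (IonEP.timeInterval T) (fun t => IonEP.alpha j (ρ t) (v t)) ≤
            ENNReal.ofReal ε →
        IonEP.normHinter k (IonEP.timeInterval T) (fun t => IonEP.alpha j (ρ t) (v t)) ≤
          ENNReal.ofReal C *
            (IonEP.normY k (IonEP.alpha j (ρ 0) (v 0)) +
              IonEP.normX k (IonEP.timeInterval T) (fun t => IonEP.alpha j (ρ t) (v t)) ^
                (3 / 2 : ℝ)) := by
  have hS := IonEP.one_le_slC k
  have hF := IonEP.one_le_finC k
  have hS0 : 0 < IonEP.slC k := by linarith
  refine ⟨(IonEP.slC k)⁻¹, inv_pos.2 hS0, (4 + 9 * 2 ^ (2 * k)) * IonEP.finC k, by positivity, ?_⟩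
  intro T hT ρ v φ h j _ hX
  set X := IonEP.normX k (IonEP.timeInterval T) (fun t => IonEP.alpha j (ρ t) (v t)) with hXdef
  have hXe : ENNReal.ofReal X.toReal = X := ENNReal.ofReal_toReal (hX.trans_lt ENNReal.ofReal_lt_top).ne
  have hXs : IonEP.slC k * X.toReal ≤ 1 := by
    have h1 := ENNReal.toReal_le_of_le_ofReal (inv_pos.2 hS0).le hX
    calc IonEP.slC k * X.toReal ≤ IonEP.slC k * (IonEP.slC k)⁻¹ := mul_le_mul_of_nonneg_left h1 hS0.le
      _ = 1 := mul_inv_cancel₀ hS0.ne'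
  set Y := IonEP.normHneg (2 * k + 1) (IonEP.alpha j (ρ 0) (v 0)) with hYdef
  have hYX : Y ≤ ENNReal.ofReal X.toReal :=
    (IonEP.normX_apply_le hXe.ge (IonEP.zero_mem_timeInterval hT) le_rfl).1
  have hYe : ENNReal.ofReal Y.toReal = Y := ENNReal.ofReal_toReal (hYX.trans_lt ENNReal.ofReal_lt_top).ne
  refine (h.normHinter_le hk hT ENNReal.toReal_nonneg hXs ENNReal.toReal_nonneg hXe.ge hYe.ge).trans ?_
  rw [← mul_assoc, ENNReal.ofReal_mul (by positivity),
    ENNReal.ofReal_add ENNReal.toReal_nonneg (Real.rpow_nonneg ENNReal.toReal_nonneg _), hYe,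
    ← ENNReal.ofReal_rpow_of_nonneg ENNReal.toReal_nonneg (by norm_num), hXe]
  exact mul_le_mul_right (add_le_add_left le_self_add _) _
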